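/- A \emph{semioval} in $\mathrm{PG}(2,9)$ is a non-empty point set $\mathcal S$ such that through every point $P\in\mathcal S$ there is exactly one line $t$ with $\mathcal S\cap t=\{P\}$. It is a \emph{blocking semioval} if, moreover, every line contains a point of $\mathcal S$ and a point not in $\mathcal S$. Two semiovals are \emph{equivalent} if a collineation in $P\Gamma L(3,9)$ (a collineation induced by a bijective semilinear map) maps one to the other; the \emph{stabilizer} of $\mathcal S$ is taken in $P\Gamma L(3,9)$; and $\ell_i$ denotes the number of lines meeting $\mathcal S$ in exactly $i$ points. Then the following hold. \begin{enumerate} \item A semioval in $\mathrm{PG}(2,9)$ of size at most $16$ has size $10,12,13,14,15$ or $16$, and the numbers of equivalence classes of semiovals of these sizes are $1,1,1,3,26$ and $113$, respectively. \item No semioval in $\mathrm{PG}(2,9)$ of size at most $16$ is a blocking semioval. \item For every semioval of size at most $16$ the vector $(\ell_0,\ell_1,\dots,\ell_8)$ is one of the following, and the number of equivalence classes with the given size and vector is the number after the colon: \begin{itemize} \item size $10$: $(36,10,45,0,0,0,0,0,0):1$; \item size $12$: $(28,12,48,0,3,0,0,0,0):1$; \item size $13$: $(25,13,44,8,0,1,0,0,0):1$;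 \item size $14$: $(23,14,37,16,1,0,0,0,0):3$; \item size $15$: $(21,15,30,25,0,0,0,0,0):4$; $(20,15,36,17,3,0,0,0,0):18$; $(19,15,42,9,6,0,0,0,0):4$; \item size $16$: $(19,16,24,32,0,0,0,0,0):2$; $(18,16,30,24,3,0,0,0,0):39$; $(17,16,36,16,6,0,0,0,0):51$; $(17,16,35,19,3,1,0,0,0):8$; $(16,16,42,8,9,0,0,0,0):3$; $(16,16,41,11,6,1,0,0,0):2$; $(16,16,40,14,3,2,0,0,0):4$; $(15,16,48,0,12,0,0,0,0):2$; $(15,16,45,8,6,0,1,0,0):1$; $(9,16,64,0,0,0,0,0,2):1$. \end{itemize} \item The stabilizers are as follows, where $\mathbb Z_n$ is the cyclic group of order $n$, $\mathcal S_3$ the symmetric group of degree $3$, $\mathcal D_4$ the dihedral group of order $8$, $\mathcal Q_6$ the dicyclic group of order $12$, an entry $G_n$ means a group of order $n$, and the number after the colon is the number of equivalence classes of semiovals of the given size with such a stabilizer: \begin{itemize} \item size $10$: $G_{1440}:1$; \item size $12$: $G_{192}:1$; \item size $13$: $G_{16}:1$; \item size $14$: $\mathbb Z_2:2$; $\mathbb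 Z_2\times\mathbb Z_2:1$; \item size $15$: $\mathbb Z_1:6$; $\mathbb Z_2:11$; $\mathbb Z_3:2$; $\mathbb Z_6:2$; $\mathcal S_3:2$; $\mathcal D_4:1$; $\mathcal Q_6:1$; $G_{24}:1$; \item size $16$: $\mathbb Z_1:81$; $\mathbb Z_2:22$; $\mathbb Z_2\times\mathbb Z_2:2$; $\mathbb Z_4:1$; $\mathbb Z_6:1$; $\mathbb Z_2\times\mathbb Z_4:1$; $\mathcal D_4:1$; $G_{32}:1$; $G_{48}:1$; $G_{192}:1$; $G_{256}:1$. \end{itemize} \end{enumerate} -/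

import Mathlib

open scoped LinearAlgebra.Projectivization Pointwise

namespace PG2

/-- The points of `PG(2, K)`: the one-dimensional subspaces of `K³`. -/
abbrev Point (K : Type*) [Field K] : Type _ := ℙ K (Fin 3 → K)

/-- The lines of `PG(2, K)` in Mathlib's coordinates (`Configuration.ofField`): the line with
homogeneous coordinates `a` consists of the points `x` with `a₀ x₀ + a₁ x₁ + a₂ x₂ = 0`, and
`p ∈ ℓ` is the incidence relation. -/
abbrev Line (K : Type*) [Field K] : Type _ := ℙ K (Fin 3 → K)

/-- The set of those points of `S` that lie on the line `ℓ`. -/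
def trace {K : Type*} [Field K] (S : Set (Point K)) (ℓ : Line K) : Set (Point K) :=
  {p : Point K | p ∈ S ∧ p ∈ ℓ}

/-- A semioval: a non-empty set of points with exactly one tangent line at each of its points. -/
def IsSemioval {K : Type*} [Field K] (S : Set (Point K)) : Prop :=
  S.Nonempty ∧ ∀ p ∈ S, ∃! ℓ : Line K, trace S ℓ = {p}

/-- A blocking semioval: a semioval such that every line contains a point of `S` and a point
outside `S`. -/
def IsBlockingSemioval {K : Type*} [Field K] (S : Set (Point K)) : Prop :=
  IsSemioval S ∧ ∀ ℓ : Line K, (∃ p : Point K, p ∈ ℓ ∧ p ∈ S) ∧ ∃ p : Point K, p ∈ ℓ ∧ p ∉ S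

/-- The number of `i`-secants of `S`, that is, of lines that meet `S` in exactly `i` points. -/
noncomputable def secantCount {K : Type*} [Field K] (S : Set (Point K)) (i : ℕ) : ℕ :=
  {ℓ : Line K | (trace S ℓ).ncard = i}.ncard

/-- The list of the numbers of `0`-, `1`-, …, `8`-secants of `S`. -/
noncomputable def secantCounts {K : Type*} [Field K] (S : Set (Point K)) : List ℕ :=
  (List.range 9).map (secantCount S)

/-- The group `PΓL(3, K)` of collineations of `PG(2, K)`, as a group of permutations of the points:
those that are induced by a bijective map `f : K³ → K³` which is semilinear with respect to some
automorphism `σ` of `K`. -/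
def PGammaL (K : Type*) [Field K] : Subgroup (Equiv.Perm (Point K)) where
  carrier := {g | ∃ (σ : K ≃+* K) (f : (Fin 3 → K) →ₛₗ[(σ : K →+* K)] (Fin 3 → K))
    (hf : Function.Bijective f), ⇑g = Projectivization.map f hf.injective}
  one_mem' := by
    refine ⟨RingEquiv.refl K, ⟨⟨id, fun _ _ => rfl⟩, fun _ _ => rfl⟩, Function.bijective_id, ?_⟩
    funext p
    induction p using Projectivization.ind with | h v hv => rfl
  mul_mem' := by
    rintro g₁ g₂ ⟨σ₁, f₁, hf₁, h₁⟩ ⟨σ₂, f₂, hf₂, h₂⟩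
    refine ⟨σ₂.trans σ₁, ⟨⟨fun v => f₁ (f₂ v), fun v w => by simp⟩, fun c v => by simp⟩,
      hf₁.comp hf₂, ?_⟩
    funext p
    rw [Equiv.Perm.mul_apply, h₁, h₂]
    induction p using Projectivization.ind with | h v hv => rfl
  inv_mem' := by
    rintro g ⟨σ, f, hf, h⟩
    let e := Equiv.ofBijective f hf
    have he : ∀ v, f (e.symm v) = v := e.apply_symm_apply
    refine ⟨σ.symm, ⟨⟨fun v => e.symm v, fun v w => hf.injective (by simp [he])⟩,
      fun c v => hf.injective (by simp [he])⟩, e.symm.bijective, ?_⟩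
    funext p
    rw [Equiv.Perm.inv_eq_iff_eq, h]
    induction p using Projectivization.ind with | h v hv => ?_
    rw [Projectivization.map_mk, Projectivization.map_mk]
    congr 1
    exact (he v).symm

/-- The number of inequivalent semiovals `S` in `PG(2, K)` with the property `Q`, that is, the
number of orbits of the collineation group `PΓL(3, K)` that contain such a semioval. -/
noncomputable def numClasses (K : Type*) [Field K] (Q : Set (Point K) → Prop) : ℕ :=
  {O : Set (Set (Point K)) | ∃ S : Set (Point K),
    IsSemioval S ∧ Q S ∧ O = MulAction.orbit (PGammaL K) S}.ncard

/-- The number of inequivalent semiovals of size `k`. -/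
noncomputable def numOfSize (K : Type*) [Field K] (k : ℕ) : ℕ :=
  numClasses K fun S => S.ncard = k

/-- The number of inequivalent semiovals of size `k` whose numbers of `0`-, `1`-, …, `8`-secants
form the list `d`. -/
noncomputable def numWithSecants (K : Type*) [Field K] (k : ℕ) (d : List ℕ) : ℕ :=
  numClasses K fun S => S.ncard = k ∧ secantCounts S = d

/-- The number of inequivalent semiovals of size `k` whose stabilizer in `PΓL(3, K)` is isomorphic
to `G`. -/
noncomputable def numWithStabilizer (K : Type*) [Field K] (k : ℕ) (G : Type) [Group G] : ℕ :=
  numClasses K fun S => S.ncard = k ∧ Nonempty (MulAction.stabilizer (PGammaL K) S ≃* G)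

/-- The number of inequivalent semiovals of size `k` whose stabilizer in `PΓL(3, K)` has order
`n`. -/
noncomputable def numWithStabilizerOrder (K : Type*) [Field K] (k n : ℕ) : ℕ :=
  numClasses K fun S => S.ncard = k ∧ Nat.card (MulAction.stabilizer (PGammaL K) S) = n

/-- The cyclic group of order `n`, written multiplicatively. -/
abbrev Z (n : ℕ) : Type := Multiplicative (ZMod n)

/-- The intersection numbers with lines: an entry `(k, [ℓ₀, …, ℓ₈], n)` says that there are `n`
inequivalent semiovals of size `k` with `ℓ_i` lines meeting them in `i` points, `0 ≤ i ≤ 8`. -/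
def secantTable : List (ℕ × List ℕ × ℕ) :=
  [(10, [36, 10, 45,  0,  0, 0, 0, 0, 0],  1),
   (12, [28, 12, 48,  0,  3, 0, 0, 0, 0],  1),
   (13, [25, 13, 44,  8,  0, 1, 0, 0, 0],  1),
   (14, [23, 14, 37, 16,  1, 0, 0, 0, 0],  3),
   (15, [21, 15, 30, 25,  0, 0, 0, 0, 0],  4),
   (15, [20, 15, 36, 17,  3, 0, 0, 0, 0], 18),
   (15, [19, 15, 42,  9,  6, 0, 0, 0, 0],  4),
   (16, [19, 16, 24, 32,  0, 0, 0, 0, 0],  2),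
   (16, [18, 16, 30, 24,  3, 0, 0, 0, 0], 39),
   (16, [17, 16, 36, 16,  6, 0, 0, 0, 0], 51),
   (16, [17, 16, 35, 19,  3, 1, 0, 0, 0],  8),
   (16, [16, 16, 42,  8,  9, 0, 0, 0, 0],  3),
   (16, [16, 16, 41, 11,  6, 1, 0, 0, 0],  2),
   (16, [16, 16, 40, 14,  3, 2, 0, 0, 0],  4),
   (16, [15, 16, 48,  0, 12, 0, 0, 0, 0],  2),
   (16, [15, 16, 45,  8,  6, 0, 1, 0, 0],  1),
   (16, [ 9, 16, 64,  0,  0, 0, 0, 0, 2],  1)]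

end PG2

/-! A field with nine elements is F₃(i) with i² = -1, so every plane PG(2,9) can be replaced by one
concrete plane. Its points and lines are numbered modulo 91 along a Singer cycle: the point p lies
on the line l exactly if p - l belongs to a perfect difference set of ten residues. `Model.mem_ln`
identifies this incidence with the one of the theorem. PΓL(3,9) becomes the group `Model.coll` of
permutations of the 91 numbers. Every regular matrix, with or without the Frobenius automorphism,
gives an element of it (`Model.exists_coll`); an element that fixes a frame is the identity or the
Frobenius collineation (`Model.rigid`); and every element also permutes the lines
(`Model.exists_linePerm`).

Completeness of the list. Let s be a semioval with at most 16 points. If some line contains four of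
its points, that line can be moved to the line `89`, and up to collineations only two quadruples on
it have to be treated. If the longest secants have three points, one triple on that line suffices.
If no line has three points, then s has at most ten points and a small search from a single point is
enough. The tangents at the chosen points are then normalised by collineations, and the orbits of
possible further points are treated one after the other, where the points of the earlier orbits are
excluded. What remains is left to a search.

The search rests on one inequality. For a set A of chosen points and p in A, call a line through p
free if p is its only point in A. The tangent at p is free, and each other free line must receive a
new point of s; these new points are different (`free_card_add_le`). Hence the number of free lines
at p is between one and one more than the number of points that may still be added. When a bound is
attained, further points are excluded, and two free lines at p that cannot receive points any more
are a contradiction (`blocked_unique`).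

To make this feasible inside the kernel, thousands of states are packed into one natural number,
with 104 bits for each. As all lines are translates of one set, the numbers of points on all lines
in all states are obtained at once by adding ten rotated copies of the packed sets. `round_spec`,
`proc_spec` and `search_spec` show that no semioval is lost, whatever the heuristics do; the
compaction of the states and the reductions by symmetry use unproved data, which are checked when
they are used. Every semioval that is found is mapped into `repT` by a collineation given as a hint.
The bookkeeping is done with the predicate `Cov` and with certificates for `check`.

The list itself. The 145 representatives are verified directly: the tangency condition, the size and
the secant numbers. Each of them contains the points X, Y, U of the standard frame, and its tangents
at X and Y meet in Z. So a collineation from one representative to another is determined, up to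
Frobenius, by the images of X, Y and U, and all such collineations can be listed
(`Model.exists_isos`). Together with the invariant `key` this separates the classes, and it gives
the orders of the stabilizers (`Model.card_stab`). Where several groups have the same order, or a
composite order calls for a named group, an explicit injective homomorphism identifies the group
(`Model.nonempty_mulEquiv`). By `Model.numClasses_eq` all numbers in the theorem become counts over
the list. No semioval is blocking, since each representative has an external line. -/

namespace PG2

/-! ### The field with nine elements on codes -/

/-- Addition table of the field with 9 elements, 4 bits for each entry. -/
def addT : ℕ :=
  8986690708024339884259668388453865091868182506470258411551265922896781674643265104972283578167824

/-- Multiplication table of the field with 9 elements, 4 bits for each entry. -/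
def mulT : ℕ :=
  12992295474418726299168584010125499800446975643965808714274855111902658395364003326119775607717888

/-- Coordinate vectors of the 91 points, 10 bits for each. -/
def ptT : ℕ :=
  9059807325883132239495657677024505240282948627928730521083626699795568604623411587479987062680831684949030860103026451951892879594904309578853397705014963642911880787748571238134283931802840662841632053394757642721847131117786031819330201732412295327376361475524970685521

/-- Coordinate vectors of the 91 lines, 10 bits for each. -/
def lnT : ℕ :=
  76743409321776049481092590951201638950256167929219266690006970257284810655309492925396322963501515970317614589447014423818094820656212442722304139648559924573471662435091976085433404510671249805573618881251543747996391678881388663478424503630012228385317063499444133202945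

/-- The point spanned by each of the 729 coordinate vectors, 7 bits for each. -/
def nrmT : ℕ :=
  923523328052761336664294832159037279389571915664701491173133408017538339627165839170734228218605966283121604622768772328500083330049697519736820229765588102716888938382825809921214018221282806903769194196936777618818660739658916128375401550266197429207672144320183861778445704293247595633897178500799094055747217833585244744505033145073569444195000293155057102672721269474483787249789764097293632632512016857512073112163984768017625342191987926967740627778368211465814220830993339438951355124244313491890158800948881419162857276716136963984444285657119499651004321013559508559040510269089062421636735169852123102513147551977747314657301289069454022799675207681634384396980002188443102603427821072037993584277857068712736968521471403675450280757044109613441058835958447803404799696325278373343956899753864396039096212829197669943488471248334076098549082475458104305389289819812467638566827224852923393136872898045879473068527186095402339890476847597079081227132234718052794075320281256425048639811924563849164314864513141836520599182708514947919741931240373545457229434756941084647850868248865900074762964569412624637031794584638848755526232570470414009722612367090143517634647117824640949038945387592140882334555031679333564141524270774746083242351651973910490602695259951271449305160326413708731159374176249107785952695860875706848920366662618708349645156341715542521998329760521850616760488818211700267965939435263736213232005093072360609972747255952246491357992747451407935075683132757714293110218606342467441956745549064655315840256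

/-- Sum of two field codes; `n` stands for `n % 3 + (n / 3) i` with `i ^ 2 = -1`. -/
def fa (a b : ℕ) : ℕ := 
  Nat.land (Nat.shiftRight addT (Nat.mul 4 (Nat.add (Nat.mul 9 a) b))) 15

/-- Product of two field codes. -/
def fm (a b : ℕ) : ℕ := 
  Nat.land (Nat.shiftRight mulT (Nat.mul 4 (Nat.add (Nat.mul 9 a) b))) 15

/-- The code of the vector with coordinate codes `a`, `b`, `c`. -/
def vc (a b c : ℕ) : ℕ := Nat.add (Nat.add a (Nat.mul 9 b)) (Nat.mul 81 c)

/-- The coordinate vector of a point. -/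
def pv (p : ℕ) : ℕ := Nat.land (Nat.shiftRight ptT (Nat.mul 10 p)) 1023

/-- The coordinate vector of a line. -/
def lv (l : ℕ) : ℕ := Nat.land (Nat.shiftRight lnT (Nat.mul 10 l)) 1023

/-- The point spanned by a vector. -/
def nrm (v : ℕ) : ℕ := Nat.land (Nat.shiftRight nrmT (Nat.mul 7 v)) 127

/-- The points on line `0`. -/
def diffSet : List ℕ := [0, 1, 3, 9, 27, 49, 56, 61, 77, 81]

/-- The set of points on line `0`. -/
def diffMask : ℕ := 2568969745144640335512075

/-- The coordinates of a vector. -/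
def vx (v : ℕ) : ℕ := Nat.mod v 9

/-- The coordinates of a vector. -/
def vy (v : ℕ) : ℕ := Nat.mod (Nat.div v 9) 9

/-- The coordinates of a vector. -/
def vz (v : ℕ) : ℕ := Nat.mod (Nat.div v 81) 9

/-- Incidence of the line `l` and the point `p`. -/
def inc (l p : Fin 91) : Bool := 
  Nat.beq (Nat.land (Nat.shiftRight diffMask
    (Nat.mod (Nat.sub (Nat.add p.val 91) l.val) 91)) 1) 1

/-- An embedding of the codes into the field `K`. -/
structure Model (K : Type*) [Field K] where
  i : K
  sq : i * i = -1
  three : (3 : K) = 0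
  card : Nat.card K = 9

/-- The order 9 forces characteristic three, and -1 is a square because 9 is not 3 modulo 4. -/
theorem exists_model {K : Type*} [Field K] (hK : Nat.card K = 9) : Nonempty (Model K) := by
  have hfin : Finite K := Nat.finite_of_card_ne_zero (by omega)
  have : Fintype K := Fintype.ofFinite K
  have hc : Fintype.card K = 9 := by rw [← Nat.card_eq_fintype_card, hK]
  have hp : CharP K 3 := charP_of_card_eq_prime_pow (f := 2) (by rw [hc]; norm_num)
  obtain ⟨i, hi⟩ := (FiniteField.isSquare_neg_one_iff (F := K)).2 (by rw [hc]; norm_num)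
  exact ⟨⟨i, hi.symm, by exact_mod_cast CharP.cast_eq_zero K 3, hK⟩⟩

theorem vc_eq (a b c : ℕ) : vc a b c = a + 9 * b + 81 * c := rfl

theorem vx_lt (v : ℕ) : vx v < 9 := Nat.mod_lt _ (by norm_num)

theorem vy_lt (v : ℕ) : vy v < 9 := Nat.mod_lt _ (by norm_num)

theorem vz_lt (v : ℕ) : vz v < 9 := Nat.mod_lt _ (by norm_num)

theorem vx_eq (v : ℕ) : vx v = v % 9 := rfl

theorem vy_eq (v : ℕ) : vy v = v / 9 % 9 := rfl

theorem vz_eq (v : ℕ) : vz v = v / 81 % 9 := rfl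

namespace Model

variable {K : Type*} [Field K] (M : Model K)

/-- The field element with a given code. -/
def dec (n : ℕ) : K := ((n % 3 : ℕ) : K) + ((n / 3 : ℕ) : K) * M.i

theorem cast_mod {K : Type*} [Field K] (M : Model K) (n : ℕ) : ((n % 3 : ℕ) : K) = n := by
  conv_rhs => rw [← Nat.mod_add_div n 3]
  push_cast
  rw [M.three]; ring

theorem fa_eq : ∀ a < 9, ∀ b < 9,
    fa a b = (a % 3 + b % 3) % 3 + 3 * ((a / 3 + b / 3) % 3) := by decide +kernel

/-- The factor `2` stands for i² = -1 modulo three. With `fa_eq` this replaces the packed tables by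
arithmetic that `dec` visibly respects. -/
theorem fm_eq : ∀ a < 9, ∀ b < 9, fm a b = ((a % 3) * (b % 3) + 2 * ((a / 3) * (b / 3))) % 3 +
    3 * (((a % 3) * (b / 3) + (a / 3) * (b % 3)) % 3) := by decide +kernel

theorem fa_lt {a b : ℕ} (ha : a < 9) (hb : b < 9) : fa a b < 9 := by
  rw [fa_eq a ha b hb]; omega

theorem fm_lt {a b : ℕ} (ha : a < 9) (hb : b < 9) : fm a b < 9 := by
  rw [fm_eq a ha b hb]; omega

theorem dec_mix (x y : ℕ) : M.dec (x % 3 + 3 * (y % 3)) = x + y * M.i := by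
  have h1 : (x % 3 + 3 * (y % 3)) % 3 = x % 3 := by omega
  have h2 : (x % 3 + 3 * (y % 3)) / 3 = y % 3 := by omega
  rw [dec, h1, h2, M.cast_mod, M.cast_mod]

theorem dec_fa {a b : ℕ} (ha : a < 9) (hb : b < 9) : M.dec (fa a b) = M.dec a + M.dec b := by
  rw [fa_eq a ha b hb, dec_mix, dec, dec]
  push_cast; ring

theorem dec_fm {a b : ℕ} (ha : a < 9) (hb : b < 9) : M.dec (fm a b) = M.dec a * M.dec b := by
  rw [fm_eq a ha b hb, dec_mix, dec, dec]
  push_cast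
  linear_combination (-((a / 3 : ℕ) : K) * ((b / 3 : ℕ) : K)) * M.sq +
    ((a / 3 : ℕ) : K) * ((b / 3 : ℕ) : K) * M.three

@[simp] theorem dec_zero : M.dec 0 = 0 := by simp [dec]

@[simp] theorem dec_one : M.dec 1 = 1 := by simp [dec]

theorem dec_eq_zero_iff {a : ℕ} (ha : a < 9) : M.dec a = 0 ↔ a = 0 := by
  refine ⟨fun h => ?_, fun h => by rw [h, dec_zero]⟩
  by_contra h0
  obtain ⟨b, hb, hab⟩ := (by decide +kernel : ∀ a < 9, a ≠ 0 → ∃ b < 9, fm a b = 1) a ha h0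
  have := M.dec_fm ha hb
  rw [hab, h, dec_one, zero_mul] at this
  exact one_ne_zero this

theorem dec_inj {a b : ℕ} (ha : a < 9) (hb : b < 9) (h : M.dec a = M.dec b) : a = b := by
  obtain ⟨c, hc, hbc, huniq⟩ := (by decide +kernel : ∀ b < 9, ∃ c < 9, fa b c = 0 ∧
    ∀ a < 9, fa a c = 0 → a = b) b hb
  refine huniq a ha ((M.dec_eq_zero_iff (fa_lt ha hc)).1 ?_)
  rw [M.dec_fa ha hc, h, ← M.dec_fa hb hc, hbc, dec_zero]

theorem dec_surj (x : K) : ∃ a < 9, M.dec a = x := by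
  have hfin : Finite K := Nat.finite_of_card_ne_zero (by rw [M.card]; omega)
  have : Fintype K := Fintype.ofFinite K
  have hinj : Function.Injective (fun a : Fin 9 => M.dec a) :=
    fun a b h => Fin.ext (M.dec_inj a.2 b.2 h)
  have hb := (Fintype.bijective_iff_injective_and_card _).2
    ⟨hinj, by rw [← Nat.card_eq_fintype_card, ← Nat.card_eq_fintype_card, M.card]; simp⟩
  obtain ⟨a, ha⟩ := hb.2 x
  exact ⟨a, a.2, ha⟩

/-- The vector with a given code. -/
def vdec (v : ℕ) : Fin 3 → K := ![M.dec (vx v), M.dec (vy v), M.dec (vz v)]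

theorem vdec_vc {a b c : ℕ} (ha : a < 9) (hb : b < 9) (hc : c < 9) :
    M.vdec (vc a b c) = ![M.dec a, M.dec b, M.dec c] := by
  have h1 : vx (vc a b c) = a := by rw [vx_eq, vc_eq]; omega
  have h2 : vy (vc a b c) = b := by rw [vy_eq, vc_eq]; omega
  have h3 : vz (vc a b c) = c := by rw [vz_eq, vc_eq]; omega
  rw [vdec, h1, h2, h3]

theorem vdec_ne_zero {v : ℕ} (hv : v < 729) (h0 : v ≠ 0) : M.vdec v ≠ 0 := by
  intro h
  have e0 := congrFun h 0
  have e1 := congrFun h 1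
  have e2 := congrFun h 2
  simp only [vdec, Matrix.cons_val_zero, Matrix.cons_val_one, Matrix.cons_val, Pi.zero_apply]
    at e0 e1 e2
  rw [M.dec_eq_zero_iff (vx_lt v)] at e0
  rw [M.dec_eq_zero_iff (vy_lt v)] at e1
  rw [M.dec_eq_zero_iff (vz_lt v)] at e2
  rw [vx_eq] at e0
  rw [vy_eq] at e1
  rw [vz_eq] at e2
  omega

theorem vdec_surj (x : Fin 3 → K) : ∃ v < 729, M.vdec v = x := by
  obtain ⟨a, ha, ha'⟩ := M.dec_surj (x 0)
  obtain ⟨b, hb, hb'⟩ := M.dec_surj (x 1)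
  obtain ⟨c, hc, hc'⟩ := M.dec_surj (x 2)
  refine ⟨vc a b c, by rw [vc_eq]; omega, ?_⟩
  rw [M.vdec_vc ha hb hc, ha', hb', hc']
  ext j; fin_cases j <;> rfl

/-- Multiplication of a vector by a scalar. -/
def _root_.PG2.vs (s v : ℕ) : ℕ := vc (fm s (vx v)) (fm s (vy v)) (fm s (vz v))

theorem vdec_vs {s : ℕ} (hs : s < 9) (v : ℕ) : M.vdec (vs s v) = M.dec s • M.vdec v := by
  rw [vs, M.vdec_vc (fm_lt hs (vx_lt v)) (fm_lt hs (vy_lt v)) (fm_lt hs (vz_lt v)),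
    M.dec_fm hs (vx_lt v), M.dec_fm hs (vy_lt v), M.dec_fm hs (vz_lt v), vdec]
  simp

theorem pv_spec : ∀ p < 91, pv p < 729 ∧ pv p ≠ 0 ∧ lv p < 729 ∧ lv p ≠ 0 := by decide +kernel

/-- Every nonzero vector is a multiple of the vector of its point, and by `nrm_vs` the multiples of
that vector lead back to the same number. These two finite checks make the numbering of the points
bijective. -/
theorem nrm_spec : ∀ v < 729, v ≠ 0 → nrm v < 91 ∧
    ∃ s < 9, s ≠ 0 ∧ vs s (pv (nrm v)) = v := by decide +kernel

theorem nrm_vs : ∀ p < 91, ∀ s < 9, s ≠ 0 → nrm (vs s (pv p)) = p := by decide +kernel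

/-- The point with a given number. -/
def pt (p : Fin 91) : Point K :=
  Projectivization.mk K (M.vdec (pv p)) (M.vdec_ne_zero (pv_spec p p.2).1 (pv_spec p p.2).2.1)

theorem mk_vdec {v : ℕ} (hv : v < 729) (h0 : v ≠ 0) (h : M.vdec v ≠ 0) :
    Projectivization.mk K (M.vdec v) h = M.pt ⟨nrm v, (nrm_spec v hv h0).1⟩ := by
  obtain ⟨-, s, hs, hs0, hv'⟩ := nrm_spec v hv h0
  rw [pt, Projectivization.mk_eq_mk_iff']
  exact ⟨M.dec s, by rw [← M.vdec_vs hs, hv']⟩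

theorem vdec_inj {v w : ℕ} (hv : v < 729) (hw : w < 729) (h : M.vdec v = M.vdec w) : v = w := by
  have e0 := congrFun h 0
  have e1 := congrFun h 1
  have e2 := congrFun h 2
  simp only [vdec, Matrix.cons_val_zero, Matrix.cons_val_one, Matrix.cons_val] at e0 e1 e2
  have e0 := M.dec_inj (vx_lt v) (vx_lt w) e0
  have e1 := M.dec_inj (vy_lt v) (vy_lt w) e1
  have e2 := M.dec_inj (vz_lt v) (vz_lt w) e2
  rw [vx_eq, vx_eq] at e0
  rw [vy_eq, vy_eq] at e1
  rw [vz_eq, vz_eq] at e2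
  omega

theorem vs_lt {s : ℕ} (hs : s < 9) (v : ℕ) : vs s v < 729 := by
  have h1 : fm s (vx v) < 9 := fm_lt hs (vx_lt v)
  have h2 : fm s (vy v) < 9 := fm_lt hs (vy_lt v)
  have h3 : fm s (vz v) < 9 := fm_lt hs (vz_lt v)
  rw [vs, vc_eq]; omega

theorem pt_bijective : Function.Bijective M.pt := by
  constructor
  · intro p q h
    rw [pt, pt, Projectivization.mk_eq_mk_iff'] at h
    obtain ⟨a, ha⟩ := h
    obtain ⟨s, hs, rfl⟩ := M.dec_surj a
    rw [← M.vdec_vs hs] at ha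
    have h1 := M.vdec_inj (vs_lt hs _) (pv_spec p p.2).1 ha
    have hs0 : s ≠ 0 := by
      rintro rfl
      rw [M.vdec_vs hs, dec_zero, zero_smul] at ha
      exact M.vdec_ne_zero (pv_spec p p.2).1 (pv_spec p p.2).2.1 ha.symm
    have h2 := nrm_vs q q.2 s hs hs0
    have h3 := nrm_vs p p.2 1 (by omega) (by omega)
    have h4 : vs 1 (pv p) = pv p := M.vdec_inj (vs_lt (by omega) _) (pv_spec p p.2).1
      (by rw [M.vdec_vs (by omega), dec_one, one_smul])
    rw [h1] at h2
    rw [h4] at h3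
    exact Fin.ext (h3.symm.trans h2)
  · intro x
    induction x using Projectivization.ind with | h v hv => ?_
    obtain ⟨c, hc, rfl⟩ := M.vdec_surj v
    have hc0 : c ≠ 0 := by rintro rfl; exact hv (by ext j; fin_cases j <;> exact M.dec_zero)
    exact ⟨_, (M.mk_vdec hc hc0 hv).symm⟩

/-- The numbering of the points. -/
noncomputable def ptE : Fin 91 ≃ Point K := Equiv.ofBijective M.pt M.pt_bijective

/-- The line with a given number. -/
def ln (l : Fin 91) : Line K :=
  Projectivization.mk K (M.vdec (lv l)) (M.vdec_ne_zero (pv_spec l l.2).2.2.1 (pv_spec l l.2).2.2.2)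

theorem lv_eq : ∀ l < 91, ∃ s < 9, vs s (pv (nrm (lv l))) = lv l ∧ nrm (lv l) < 91 ∧
    ∃ k < 91, nrm (lv k) = l := by decide +kernel

theorem ln_eq (l : Fin 91) : M.ln l = M.pt ⟨nrm (lv l), (nrm_spec _ (pv_spec l l.2).2.2.1
    (pv_spec l l.2).2.2.2).1⟩ := M.mk_vdec (pv_spec l l.2).2.2.1 (pv_spec l l.2).2.2.2 _

theorem ln_bijective : Function.Bijective M.ln := by
  have hs : Function.Surjective M.ln := by
    intro x
    obtain ⟨p, rfl⟩ := M.pt_bijective.2 x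
    obtain ⟨-, -, -, -, k, hk, hkp⟩ := lv_eq p p.2
    refine ⟨⟨k, hk⟩, ?_⟩
    rw [ln_eq]
    congr 1
    exact Fin.ext hkp
  have : Finite (Line K) := Finite.of_equiv _ M.ptE
  have : Fintype (Line K) := Fintype.ofFinite _
  refine (Fintype.bijective_iff_surjective_and_card _).2 ⟨hs, ?_⟩
  exact Fintype.card_congr M.ptE

/-- The numbering of the lines. -/
noncomputable def lnE : Fin 91 ≃ Line K := Equiv.ofBijective M.ln M.ln_bijective

/-- The dot product of two vector codes. -/
def _root_.PG2.vdot (v w : ℕ) : ℕ := fa (fa (fm (vx v) (vx w)) (fm (vy v) (vy w)))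
  (fm (vz v) (vz w))

theorem vdot_lt (v w : ℕ) : vdot v w < 9 :=
  fa_lt (fa_lt (fm_lt (vx_lt v) (vx_lt w)) (fm_lt (vy_lt v) (vy_lt w)))
    (fm_lt (vz_lt v) (vz_lt w))

theorem dec_vdot (v w : ℕ) : M.dec (vdot v w) = M.vdec v ⬝ᵥ M.vdec w := by
  rw [vdot, M.dec_fa (fa_lt (fm_lt (vx_lt v) (vx_lt w)) (fm_lt (vy_lt v) (vy_lt w)))
    (fm_lt (vz_lt v) (vz_lt w)), M.dec_fa (fm_lt (vx_lt v) (vx_lt w))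
    (fm_lt (vy_lt v) (vy_lt w)), M.dec_fm (vx_lt v) (vx_lt w), M.dec_fm (vy_lt v) (vy_lt w),
    M.dec_fm (vz_lt v) (vz_lt w)]
  simp [vdec, dotProduct, Fin.sum_univ_three]

/-- The coordinates of points and lines were listed along a Singer cycle, so that the dot product
vanishes exactly if p - l modulo 91 lies in the difference set. From here on incidence is cyclic,
and coordinates are needed only for collineations. -/
theorem inc_vdot : ∀ l p : Fin 91, inc l p = Nat.beq (vdot (pv p) (lv l)) 0 := by decide +kernel

theorem mem_ln (l p : Fin 91) : M.ptE p ∈ M.lnE l ↔ inc l p = true := by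
  rw [Configuration.ofField.mem_iff]
  change Projectivization.orthogonal (M.pt p) (M.ln l) ↔ _
  rw [pt, ln, Projectivization.orthogonal_mk, ← dec_vdot, M.dec_eq_zero_iff (vdot_lt _ _),
    inc_vdot, Nat.beq_eq]

end Model

end PG2

namespace PG2

/-! ### Collineations given by matrices -/

/-- The Frobenius automorphism on codes. -/
def fr (a : ℕ) : ℕ := Nat.add (Nat.mod a 3) (Nat.mul 3 (Nat.mod (Nat.mul 2 (Nat.div a 3)) 3))

/-- The entries of a `3 × 3` matrix over the field with nine elements, and a flag that tells
whether the Frobenius automorphism is to be applied first. -/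
structure Col where
  a : ℕ
  b : ℕ
  c : ℕ
  d : ℕ
  e : ℕ
  f : ℕ
  g : ℕ
  h : ℕ
  i : ℕ
  s : Bool

namespace Col

/-- All entries are field codes. -/
def Valid (m : Col) : Prop := (m.a < 9 ∧ m.b < 9 ∧ m.c < 9) ∧ (m.d < 9 ∧ m.e < 9 ∧ m.f < 9) ∧
  (m.g < 9 ∧ m.h < 9 ∧ m.i < 9)

/-- The difference `a b - c d`. -/
def minor (a b c d : ℕ) : ℕ := fa (fm a b) (fm 2 (fm c d))

/-- The determinant. -/
def det (m : Col) : ℕ :=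
  fa (fa (fm m.a (minor m.e m.i m.f m.h)) (fm m.b (minor m.f m.g m.d m.i)))
    (fm m.c (minor m.d m.h m.e m.g))

/-- A row of a matrix times a vector. -/
def row (a b c x y z : ℕ) : ℕ := fa (fa (fm a x) (fm b y)) (fm c z)

/-- The image of a vector with coordinates `x`, `y`, `z` under the matrix. -/
def app (m : Col) (x y z : ℕ) : ℕ :=
  vc (row m.a m.b m.c x y z) (row m.d m.e m.f x y z) (row m.g m.h m.i x y z)

/-- The image of a point. -/
def img (m : Col) (p : ℕ) : ℕ :=
  let v := pv p
  nrm (cond m.s (m.app (fr (vx v)) (fr (vy v)) (fr (vz v))) (m.app (vx v) (vy v) (vz v)))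

/-- The Frobenius collineation. -/
def frob : Col := ⟨1, 0, 0, 0, 1, 0, 0, 0, 1, true⟩

end Col

theorem fr_lt {a : ℕ} (ha : a < 9) : fr a < 9 :=
  (by decide : ∀ a < 9, fr a < 9) a ha

namespace Model

variable {K : Type*} [Field K] (M : Model K)

theorem dec_fr {a : ℕ} (ha : a < 9) : M.dec (fr a) = M.dec a ^ 3 := by
  have h : fr a = fm a (fm a a) := (by decide +kernel : ∀ a < 9, fr a = fm a (fm a a)) a ha
  rw [h, M.dec_fm ha (fm_lt ha ha), M.dec_fm ha ha]
  ring

theorem frobenius_add {K : Type*} [Field K] (M : Model K) (x y : K) : (x + y) ^ 3 = x ^ 3 + y ^ 3 := by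
  linear_combination (x ^ 2 * y + x * y ^ 2) * M.three

/-- The Frobenius automorphism. -/
noncomputable def frobE : K ≃+* K :=
  RingEquiv.ofBijective
    ({ toFun := fun x => x ^ 3
       map_one' := one_pow 3
       map_mul' := fun x y => mul_pow x y 3
       map_zero' := zero_pow (by norm_num)
       map_add' := M.frobenius_add } : K →+* K)
    (by
      have : Finite K := Nat.finite_of_card_ne_zero (by rw [M.card]; omega)
      exact Finite.injective_iff_bijective.1 (RingHom.injective _))

/-- The field automorphism of a collineation. -/
noncomputable def autE (s : Bool) : K ≃+* K := cond s M.frobE (RingEquiv.refl K)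

/-- The matrix of a collineation. -/
def mat (m : Col) : Matrix (Fin 3) (Fin 3) K :=
  !![M.dec m.a, M.dec m.b, M.dec m.c; M.dec m.d, M.dec m.e, M.dec m.f;
    M.dec m.g, M.dec m.h, M.dec m.i]

theorem minor_lt {a b c d : ℕ} (ha : a < 9) (hb : b < 9) (hc : c < 9) (hd : d < 9) :
    Col.minor a b c d < 9 := fa_lt (fm_lt ha hb) (fm_lt (by omega) (fm_lt hc hd))

theorem dec_two : M.dec 2 = -1 := by
  have h : M.dec 2 = 2 := by simp [dec]
  linear_combination h + M.three

theorem dec_minor {a b c d : ℕ} (ha : a < 9) (hb : b < 9) (hc : c < 9) (hd : d < 9) :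
    M.dec (Col.minor a b c d) = M.dec a * M.dec b - M.dec c * M.dec d := by
  rw [Col.minor, M.dec_fa (fm_lt ha hb) (fm_lt (by omega) (fm_lt hc hd)), M.dec_fm ha hb,
    M.dec_fm (by omega) (fm_lt hc hd), M.dec_fm hc hd, dec_two]
  ring

theorem det_spec {m : Col} (hm : m.Valid) : m.det < 9 ∧ M.dec m.det = (M.mat m).det := by
  obtain ⟨⟨ha, hb, hc⟩, ⟨hd, he, hf⟩, hg, hh, hi⟩ := hm
  have h1 := minor_lt he hi hf hh
  have h2 := minor_lt hf hg hd hi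
  have h3 := minor_lt hd hh he hg
  refine ⟨fa_lt (fa_lt (fm_lt ha h1) (fm_lt hb h2)) (fm_lt hc h3), ?_⟩
  rw [Col.det, M.dec_fa (fa_lt (fm_lt ha h1) (fm_lt hb h2)) (fm_lt hc h3),
    M.dec_fa (fm_lt ha h1) (fm_lt hb h2), M.dec_fm ha h1, M.dec_fm hb h2, M.dec_fm hc h3,
    M.dec_minor he hi hf hh, M.dec_minor hf hg hd hi, M.dec_minor hd hh he hg, mat,
    Matrix.det_fin_three]
  simp only [Matrix.of_apply, Matrix.cons_val', Matrix.cons_val_zero, Matrix.cons_val_one,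
    Matrix.cons_val, Matrix.cons_val_fin_one]
  ring

theorem row_spec {a b c x y z : ℕ} (ha : a < 9) (hb : b < 9) (hc : c < 9) (hx : x < 9)
    (hy : y < 9) (hz : z < 9) : Col.row a b c x y z < 9 ∧
      M.dec (Col.row a b c x y z) = M.dec a * M.dec x + M.dec b * M.dec y + M.dec c * M.dec z := by
  have h1 := fm_lt ha hx
  have h2 := fm_lt hb hy
  have h3 := fm_lt hc hz
  refine ⟨fa_lt (fa_lt h1 h2) h3, ?_⟩
  rw [Col.row, M.dec_fa (fa_lt h1 h2) h3, M.dec_fa h1 h2, M.dec_fm ha hx, M.dec_fm hb hy,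
    M.dec_fm hc hz]

theorem app_spec {m : Col} (hm : m.Valid) {x y z : ℕ} (hx : x < 9) (hy : y < 9) (hz : z < 9) :
    m.app x y z < 729 ∧ M.vdec (m.app x y z) = (M.mat m).mulVec ![M.dec x, M.dec y, M.dec z] := by
  obtain ⟨⟨ha, hb, hc⟩, ⟨hd, he, hf⟩, hg, hh, hi⟩ := hm
  obtain ⟨l1, e1⟩ := M.row_spec ha hb hc hx hy hz
  obtain ⟨l2, e2⟩ := M.row_spec hd he hf hx hy hz
  obtain ⟨l3, e3⟩ := M.row_spec hg hh hi hx hy hz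
  refine ⟨by rw [Col.app, vc_eq]; omega, ?_⟩
  rw [Col.app, M.vdec_vc l1 l2 l3, e1, e2, e3, mat]
  ext j
  fin_cases j <;> simp [Matrix.mulVec, dotProduct, Fin.sum_univ_three]

/-- The group `PΓL(3, 9)` as a group of permutations of the numbers of the points. -/
noncomputable def coll : Subgroup (Equiv.Perm (Fin 91)) :=
  (PGammaL K).comap M.ptE.permCongrHom.toMonoidHom

theorem mem_coll (π : Equiv.Perm (Fin 91)) :
    π ∈ M.coll ↔ ∃ γ ∈ PGammaL K, ∀ p, γ (M.pt p) = M.pt (π p) := by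
  constructor
  · intro h
    refine ⟨_, h, fun p => ?_⟩
    change M.ptE (π (M.ptE.symm (M.ptE p))) = _
    rw [Equiv.symm_apply_apply]; rfl
  · rintro ⟨γ, hγ, h⟩
    have : γ = M.ptE.permCongrHom.toMonoidHom π := by
      ext x
      obtain ⟨p, rfl⟩ := M.pt_bijective.2 x
      rw [h]
      change _ = M.ptE (π (M.ptE.symm (M.ptE p)))
      rw [Equiv.symm_apply_apply]; rfl
    rw [this] at hγ
    exact hγ

/-- The semilinear map of a collineation. -/
noncomputable def slin (m : Col) :
    (Fin 3 → K) →ₛₗ[(M.autE m.s : K →+* K)] (Fin 3 → K) where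
  toFun v := (M.mat m).mulVec fun j => M.autE m.s (v j)
  map_add' v w := by
    rw [← Matrix.mulVec_add]; congr 1; ext j; simp
  map_smul' c v := by
    rw [← Matrix.mulVec_smul]; congr 1; ext j; simp

theorem slin_bijective {m : Col} (hm : m.Valid) (h : m.det ≠ 0) :
    Function.Bijective (M.slin m) := by
  have : Finite K := Nat.finite_of_card_ne_zero (by rw [M.card]; omega)
  refine Finite.injective_iff_bijective.1 ?_
  have hu : IsUnit (M.mat m) := by
    rw [Matrix.isUnit_iff_isUnit_det, isUnit_iff_ne_zero, ← (M.det_spec hm).2, ne_eq,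
      M.dec_eq_zero_iff (M.det_spec hm).1]
    exact h
  intro v w hvw
  have := Matrix.mulVec_injective_of_isUnit hu (a₁ := fun j => M.autE m.s (v j))
    (a₂ := fun j => M.autE m.s (w j)) hvw
  ext j
  exact (M.autE m.s).injective (congrFun this j)

/-- A collineation that occurs in a certificate needs no proof of its own: a nonzero determinant
makes the semilinear map injective, hence bijective, and `img` computes its action on the numbers.
-/
theorem exists_coll {m : Col} (hm : m.Valid) (h : m.det ≠ 0) :
    ∃ π ∈ M.coll, ∀ p : Fin 91, (π p).val = m.img p := by
  have hb := M.slin_bijective hm h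
  let γf := Projectivization.map (M.slin m) hb.injective
  have hfin : Finite (Point K) := Finite.of_equiv _ M.ptE
  have hγ : Function.Bijective γf :=
    Finite.injective_iff_bijective.1 (by
      intro x y hxy
      induction x using Projectivization.ind with | h v hv => ?_
      induction y using Projectivization.ind with | h w hw => ?_
      simp only [γf] at hxy
      rw [Projectivization.map_mk, Projectivization.map_mk, Projectivization.mk_eq_mk_iff'] at hxy
      obtain ⟨a, ha⟩ := hxy
      rw [Projectivization.mk_eq_mk_iff']
      refine ⟨(M.autE m.s).symm a, hb.injective ?_⟩
      rw [map_smulₛₗ, ← ha]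
      simp)
  let γ : Equiv.Perm (Point K) := Equiv.ofBijective γf hγ
  have hγm : γ ∈ PGammaL K := ⟨M.autE m.s, M.slin m, hb, rfl⟩
  refine ⟨M.ptE.permCongrHom.symm γ, ?_, ?_⟩
  · change M.ptE.permCongrHom (M.ptE.permCongrHom.symm γ) ∈ PGammaL K
    rw [MulEquiv.apply_symm_apply]; exact hγm
  · intro p
    change (M.ptE.symm (γ (M.ptE p))).val = _
    -- The flag only decides which codes represent the coordinates after the field automorphism; the
    -- rest of the computation is the same in both cases.
    have key : ∀ x y z : ℕ, x < 9 → y < 9 → z < 9 →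
        (fun j => M.autE m.s (M.vdec (pv p) j)) = ![M.dec x, M.dec y, M.dec z] →
        (M.ptE.symm (γ (M.ptE p))).val = nrm (m.app x y z) := by
      intro x y z hx hy hz hxyz
      obtain ⟨h1, h2⟩ := M.app_spec hm hx hy hz
      have h3 : M.slin m (M.vdec (pv p)) = M.vdec (m.app x y z) := by
        rw [h2, ← hxyz]; rfl
      have hne : M.vdec (pv p) ≠ 0 := M.vdec_ne_zero (pv_spec p p.2).1 (pv_spec p p.2).2.1
      have h0 : m.app x y z ≠ 0 := by
        intro h0
        apply hne
        apply hb.injective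
        rw [h3, h0, map_zero]
        ext j; fin_cases j <;> exact M.dec_zero
      have : γ (M.ptE p) = M.ptE ⟨nrm (m.app x y z), (nrm_spec _ h1 h0).1⟩ := by
        have h4 := M.mk_vdec h1 h0 (M.vdec_ne_zero h1 h0)
        change _ = M.pt _
        rw [← h4]
        change Projectivization.map (M.slin m) hb.injective (Projectivization.mk K _ _) = _
        rw [Projectivization.map_mk]
        congr 1
      rw [this, Equiv.symm_apply_apply]
    unfold Col.img
    cases hs : m.s with
    | false =>
      refine key _ _ _ (vx_lt _) (vy_lt _) (vz_lt _) ?_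
      rw [hs]; ext j; fin_cases j <;> rfl
    | true =>
      refine key _ _ _ (fr_lt (vx_lt _)) (fr_lt (vy_lt _)) (fr_lt (vz_lt _)) ?_
      rw [hs, M.dec_fr (vx_lt _), M.dec_fr (vy_lt _), M.dec_fr (vz_lt _)]
      ext j; fin_cases j <;> rfl

/-- The differences 0 and 1 put the points `l` and `l + 1` on the line `l`, and these two points
determine it. -/
theorem line_ext (l l' : Fin 91) (h : ∀ p, inc l p = inc l' p) : l = l' := by
  have h1 : ∀ l : Fin 91, inc l l = true ∧ inc l (l + 1) = true := by decide +kernel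
  have h2 : ∀ l l' : Fin 91, inc l' l = true → inc l' (l + 1) = true → l = l' := by decide +kernel
  exact h2 l l' (by rw [← h, (h1 l).1]) (by rw [← h, (h1 l).2])

/-- The preimages of the unit vectors under f form a basis; the coordinates of v in it are those of
f v, twisted by the inverse of σ. Expanding v in this basis gives the image of the linear form
without an inverse matrix. -/
theorem exists_dual {σ : K ≃+* K} {f : (Fin 3 → K) →ₛₗ[(σ : K →+* K)] (Fin 3 → K)}
    (hf : Function.Bijective f) (w : Fin 3 → K) :
    ∃ w' : Fin 3 → K, ∀ v, f v ⬝ᵥ w' = σ (v ⬝ᵥ w) := by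
  choose b hb using fun k : Fin 3 => hf.surjective (Pi.single k 1)
  refine ⟨fun k => σ (b k ⬝ᵥ w), fun v => ?_⟩
  have hv : v = ∑ k, σ.symm (f v k) • b k := by
    apply hf.injective
    rw [map_sum]
    simp only [map_smulₛₗ, hb]
    ext j
    simp [Finset.sum_apply, Pi.single_apply]
  conv_rhs => rw [hv]
  rw [sum_dotProduct, map_sum, dotProduct]
  refine Finset.sum_congr rfl fun k _ => ?_
  rw [smul_dotProduct, smul_eq_mul, map_mul, RingEquiv.apply_symm_apply]

/-- `PGammaL` acts on points only. The companion action on lines is what makes tangents, secant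
numbers and the colors below invariant. -/
theorem exists_linePerm {π : Equiv.Perm (Fin 91)} (hπ : π ∈ M.coll) :
    ∃ τ : Equiv.Perm (Fin 91), ∀ l p, inc (τ l) (π p) = inc l p := by
  obtain ⟨γ, ⟨σ, f, hf, hγ⟩, h⟩ := (M.mem_coll π).1 hπ
  have key : ∀ l : Fin 91, ∃ l' : Fin 91, ∀ p, inc l' (π p) = inc l p := by
    intro l
    obtain ⟨w', hw'⟩ := exists_dual hf (M.vdec (lv l))
    have hl := pv_spec l l.2
    have hw0 : w' ≠ 0 := by
      rintro rfl
      apply M.vdec_ne_zero hl.2.2.1 hl.2.2.2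
      refine (dotProduct_eq_zero_iff).1 fun v => ?_
      have := hw' v
      rw [dotProduct_zero, eq_comm, EmbeddingLike.map_eq_zero_iff] at this
      rw [dotProduct_comm]; exact this
    obtain ⟨l', hl'⟩ := M.ln_bijective.2 (Projectivization.mk K w' hw0)
    refine ⟨l', fun p => Bool.eq_iff_iff.2 ?_⟩
    rw [← M.mem_ln, ← M.mem_ln, Configuration.ofField.mem_iff, Configuration.ofField.mem_iff]
    change Projectivization.orthogonal (M.pt (π p)) (M.ln l') ↔
      Projectivization.orthogonal (M.pt p) (M.ln l)
    rw [hl', ← h, hγ, pt, Projectivization.map_mk, ln, Projectivization.orthogonal_mk,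
      Projectivization.orthogonal_mk, hw', EmbeddingLike.map_eq_zero_iff]
  choose τ hτ using key
  have hinj : Function.Injective τ := fun l l' hll =>
    line_ext l l' fun p => by rw [← hτ l p, ← hτ l' p, hll]
  exact ⟨Equiv.ofBijective τ (Finite.injective_iff_bijective.1 hinj), hτ⟩

/-- The prime field is fixed, and the image of i is again a root of -1, thus i or -i. In the second
case σ is the cubing map, because i³ = -i. -/
theorem aut_cases (σ : K ≃+* K) : (∀ a < 9, σ (M.dec a) = M.dec a) ∨
    (∀ a < 9, σ (M.dec a) = M.dec (fr a)) := by
  have h1 : (σ M.i - M.i) * (σ M.i + M.i) = 0 := by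
    have : σ M.i * σ M.i = -1 := by rw [← map_mul, M.sq, map_neg, map_one]
    linear_combination this - M.sq
  rcases mul_eq_zero.1 h1 with h | h
  · left
    intro a _
    rw [dec, map_add, map_mul, map_natCast, map_natCast, sub_eq_zero.1 h]
  · right
    intro a ha
    have hi3 : M.i ^ 3 = -M.i := by linear_combination M.i * M.sq
    have : ∀ n : ℕ, (n : K) ^ 3 = n := fun n => by
      induction n with
      | zero => simp
      | succ k ih => push_cast; rw [M.frobenius_add, ih, one_pow]
    rw [M.dec_fr ha, dec, M.frobenius_add, mul_pow, this, this, hi3, map_add, map_mul, map_natCast,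
      map_natCast, eq_neg_of_add_eq_zero_left h]

/-- The four points of the standard frame. -/
def _root_.PG2.fX : Fin 91 := ⟨nrm 1, by decide +kernel⟩

/-- The four points of the standard frame. -/
def _root_.PG2.fY : Fin 91 := ⟨nrm 9, by decide +kernel⟩

/-- The four points of the standard frame. -/
def _root_.PG2.fZ : Fin 91 := ⟨nrm 81, by decide +kernel⟩

/-- The four points of the standard frame. -/
def _root_.PG2.fU : Fin 91 := ⟨nrm 91, by decide +kernel⟩

/-- Fixing the three base points makes the semilinear map diagonal up to its automorphism, and
fixing the unit point makes it scalar. Only the automorphism is left, and it is one of two. -/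
theorem rigid {π : Equiv.Perm (Fin 91)} (hπ : π ∈ M.coll) (hX : π fX = fX) (hY : π fY = fY)
    (hZ : π fZ = fZ) (hU : π fU = fU) :
    (∀ p, π p = p) ∨ ∀ p, (π p).val = Col.frob.img p := by
  obtain ⟨γ, ⟨σ, f, hf, hγ⟩, h⟩ := (M.mem_coll π).1 hπ
  have fix : ∀ (v : ℕ) (hv : v < 729) (h0 : v ≠ 0),
      π ⟨nrm v, (nrm_spec v hv h0).1⟩ = ⟨nrm v, (nrm_spec v hv h0).1⟩ →
      ∃ c : K, f (M.vdec v) = c • M.vdec v := by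
    intro v hv h0 hp
    have h1 := h ⟨nrm v, (nrm_spec v hv h0).1⟩
    rw [hp, ← M.mk_vdec hv h0 (M.vdec_ne_zero hv h0), hγ, Projectivization.map_mk,
      Projectivization.mk_eq_mk_iff'] at h1
    obtain ⟨a, ha⟩ := h1
    exact ⟨a, ha.symm⟩
  obtain ⟨a, ha⟩ := fix 1 (by omega) (by omega) hX
  obtain ⟨b, hb⟩ := fix 9 (by omega) (by omega) hY
  obtain ⟨c, hc⟩ := fix 81 (by omega) (by omega) hZ
  obtain ⟨d, hd⟩ := fix 91 (by omega) (by omega) hU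
  have v1 : M.vdec 1 = ![1, 0, 0] := by
    rw [← M.dec_zero, ← M.dec_one]; rfl
  have v9 : M.vdec 9 = ![0, 1, 0] := by
    rw [← M.dec_zero, ← M.dec_one]; rfl
  have v81 : M.vdec 81 = ![0, 0, 1] := by
    rw [← M.dec_zero, ← M.dec_one]; rfl
  have v91 : M.vdec 91 = ![1, 1, 1] := by
    rw [← M.dec_one]; rfl
  rw [v1] at ha
  rw [v9] at hb
  rw [v81] at hc
  rw [v91] at hd
  have expand : ∀ v : Fin 3 → K, f v = ![σ (v 0) * a, σ (v 1) * b, σ (v 2) * c] := by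
    intro v
    have : v = v 0 • ![1, 0, 0] + v 1 • ![0, 1, 0] + v 2 • ![0, 0, 1] := by
      ext j; fin_cases j <;> simp
    conv_lhs => rw [this]
    rw [map_add, map_add, map_smulₛₗ, map_smulₛₗ, map_smulₛₗ, ha, hb, hc]
    ext j; fin_cases j <;> simp
  rw [expand] at hd
  have e0 := congrFun hd 0
  have e1 := congrFun hd 1
  have e2 := congrFun hd 2
  simp at e0 e1 e2
  -- The image of the unit vector is a multiple of it, so the three diagonal entries coincide.
  subst e0 e1 e2
  have img : ∀ p : Fin 91, ∀ v < 729, v ≠ 0 → M.vdec v = (fun j => σ (M.vdec (pv p) j)) →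
      (π p).val = nrm v := by
    intro p v hv h0 hvp
    have h1 := h p
    rw [hγ, pt, Projectivization.map_mk] at h1
    have h2 : M.pt (π p) = M.pt ⟨nrm v, (nrm_spec v hv h0).1⟩ := by
      rw [← h1, ← M.mk_vdec hv h0 (M.vdec_ne_zero hv h0), Projectivization.mk_eq_mk_iff']
      refine ⟨c, ?_⟩
      rw [expand, hvp]
      ext j; fin_cases j <;> simp [mul_comm]
    rw [M.pt_bijective.1 h2]
  rcases M.aut_cases σ with hσ | hσ
  · left
    intro p
    have hp := pv_spec p p.2
    refine Fin.ext ((img p (pv p) hp.1 hp.2.1 ?_).trans ?_)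
    · ext j; fin_cases j
      · exact (hσ _ (vx_lt _)).symm
      · exact (hσ _ (vy_lt _)).symm
      · exact (hσ _ (vz_lt _)).symm
    · exact (by decide +kernel : ∀ p < 91, nrm (pv p) = p) p p.2
  · right
    intro p
    have hq := (by decide +kernel : ∀ p < 91, vc (fr (vx (pv p))) (fr (vy (pv p)))
      (fr (vz (pv p))) ≠ 0 ∧ Col.frob.img p = nrm (vc (fr (vx (pv p))) (fr (vy (pv p)))
      (fr (vz (pv p))))) p p.2
    have l1 := fr_lt (vx_lt (pv p))
    have l2 := fr_lt (vy_lt (pv p))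
    have l3 := fr_lt (vz_lt (pv p))
    rw [hq.2]
    refine img p _ (by rw [vc_eq]; omega) hq.1 ?_
    rw [M.vdec_vc l1 l2 l3]
    ext j; fin_cases j
    · exact (hσ _ (vx_lt _)).symm
    · exact (hσ _ (vy_lt _)).symm
    · exact (hσ _ (vz_lt _)).symm

end Model

end PG2

namespace PG2

/-! ### Bits of packed numbers: fields of 104 bits -/

/-- Bit `p` of field `j`. -/
def bt (X j p : ℕ) : Bool := X.testBit (104 * j + p)

/-- The number with `f j` in field `j`, for `j < N`. -/
def pack (N : ℕ) (f : ℕ → ℕ) : ℕ :=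
  match N with
  | 0 => 0
  | N + 1 => f 0 + 2 ^ 104 * pack N fun j => f (j + 1)

/-- The number `1` in each of `N` fields. -/
def ones (N : ℕ) : ℕ :=
  Nat.div (Nat.sub (Nat.pow 2 (Nat.mul 104 N)) 1) 20282409603651670423947251286015

/-- The number with the lowest `k` bits set. -/
def pm (k : ℕ) : ℕ := Nat.sub (Nat.pow 2 k) 1

theorem bt_land (X Y j p : ℕ) : bt (Nat.land X Y) j p = (bt X j p && bt Y j p) :=
  Nat.testBit_and ..

theorem bt_lor (X Y j p : ℕ) : bt (Nat.lor X Y) j p = (bt X j p || bt Y j p) :=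
  Nat.testBit_or ..

theorem bt_xor (X Y j p : ℕ) : bt (Nat.xor X Y) j p = (bt X j p ^^ bt Y j p) :=
  Nat.testBit_xor ..

theorem bt_zero (j p : ℕ) : bt 0 j p = false := Nat.zero_testBit _

theorem eq_of_bt {X Y : ℕ} (h : ∀ j, ∀ p < 104, bt X j p = bt Y j p) : X = Y := by
  refine Nat.eq_of_testBit_eq fun m => ?_
  have := h (m / 104) (m % 104) (Nat.mod_lt _ (by norm_num))
  rwa [bt, bt, Nat.div_add_mod] at this

theorem bt_pack {N : ℕ} {f : ℕ → ℕ} (hf : ∀ j < N, f j < 2 ^ 104) (j : ℕ) {p : ℕ} (hp : p < 104) :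
    bt (pack N f) j p = (decide (j < N) && (f j).testBit p) := by
  induction N generalizing f j with
  | zero => simp [pack, bt]
  | succ N ih =>
    rw [pack, bt, add_comm (f 0), Nat.testBit_two_pow_mul_add _ (hf 0 (by omega))]
    cases j with
    | zero => simp [hp]
    | succ j =>
      have h1 : ¬ 104 * (j + 1) + p < 104 := by omega
      have h2 : 104 * (j + 1) + p - 104 = 104 * j + p := by omega
      rw [if_neg h1, h2]
      have := ih (f := fun j => f (j + 1)) (fun j hj => hf (j + 1) (by omega)) j
      rw [bt] at this
      rw [this]; simp

/-- An identity of numbers that holds even if entries exceed 104 bits; it becomes a statement about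
fields as soon as the sums are bounded and `bt_pack` applies. -/
theorem pack_add (N : ℕ) (f g : ℕ → ℕ) : pack N f + pack N g = pack N fun j => f j + g j := by
  induction N generalizing f g with
  | zero => rfl
  | succ N ih => simp only [pack]; rw [← ih]; ring

theorem mul_pack (N c : ℕ) (f : ℕ → ℕ) : c * pack N f = pack N fun j => c * f j := by
  induction N generalizing f with
  | zero => rfl
  | succ N ih => simp only [pack]; rw [← ih]; ring

theorem pack_congr {N : ℕ} {f g : ℕ → ℕ} (h : ∀ j < N, f j = g j) : pack N f = pack N g := by
  induction N generalizing f g with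
  | zero => rfl
  | succ N ih => simp only [pack]; rw [h 0 (by omega), ih fun j hj => h (j + 1) (by omega)]

/-- A geometric series with ratio 2^104; the divisor in the definition is 2^104 - 1. -/
theorem ones_eq (N : ℕ) : ones N = pack N fun _ => 1 := by
  have h : ∀ N, pack N (fun _ => 1) * 20282409603651670423947251286015 + 1 = 2 ^ (104 * N) := by
    intro N
    induction N with
    | zero => rfl
    | succ N ih =>
      simp only [pack]
      rw [mul_add, pow_add, ← ih]; ring
  change (2 ^ (104 * N) - 1) / _ = _
  rw [← h, Nat.add_sub_cancel, Nat.mul_div_cancel _ (by norm_num)]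

/-- The content of a field. -/
def field (X j : ℕ) : ℕ := X / 2 ^ (104 * j) % 2 ^ 104

theorem field_lt (X j : ℕ) : field X j < 2 ^ 104 := Nat.mod_lt _ (by positivity)

theorem testBit_field (X j p : ℕ) : (field X j).testBit p = (decide (p < 104) && bt X j p) := by
  rw [field, Nat.testBit_mod_two_pow, Nat.testBit_div_two_pow, bt, Nat.add_comm]

theorem eq_pack {N X : ℕ} (h : ∀ j ≥ N, ∀ p < 104, bt X j p = false) : X = pack N (field X) := by
  refine eq_of_bt fun j p hp => ?_
  rw [bt_pack (fun j _ => field_lt X j) j hp, testBit_field]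
  by_cases hj : j < N
  · simp [hp, hj]
  · simp [hj, h j (by omega) p hp]

/-- One multiplication copies `c` into all fields, and the bound on `c` rules out carries. This is
how masks are broadcast; `bt_mul_flags` does the same for selected fields. -/
theorem bt_mul_ones {c : ℕ} (hc : c < 2 ^ 104) (N j : ℕ) {p : ℕ} (hp : p < 104) :
    bt (Nat.mul c (ones N)) j p = (decide (j < N) && c.testBit p) := by
  change bt (c * ones N) j p = _
  rw [ones_eq, mul_pack, bt_pack (fun _ _ => by simpa using hc) j hp, mul_one]

theorem testBit_one (p : ℕ) : Nat.testBit 1 p = decide (p = 0) := by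
  cases p with
  | zero => rfl
  | succ p => simp [Nat.testBit_succ]

theorem bt_ones (N j : ℕ) {p : ℕ} (hp : p < 104) :
    bt (ones N) j p = (decide (j < N) && decide (p = 0)) := by
  have := bt_mul_ones (c := 1) (by norm_num) N j hp
  rw [show Nat.mul 1 (ones N) = ones N from one_mul _] at this
  rw [this, testBit_one]

/-- A number all of whose fields among the first `N` ones are `0` or `1`, the others being `0`. -/
def Flags (N V : ℕ) : Prop := ∀ j, ∀ p < 104, bt V j p = true → j < N ∧ p = 0

theorem bt_mul_flags {c : ℕ} (hc : c < 2 ^ 104) {N V : ℕ} (hV : Flags N V) (j : ℕ) {p : ℕ}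
    (hp : p < 104) : bt (Nat.mul c V) j p = (bt V j 0 && c.testBit p) := by
  have h1 : V = pack N (field V) := eq_pack fun j hj p hp => by
    by_contra h
    have := hV j p hp (by simpa using h)
    omega
  have h2 : ∀ j, field V j = if bt V j 0 then 1 else 0 := by
    intro j
    refine Nat.eq_of_testBit_eq fun p => ?_
    rw [testBit_field]
    by_cases hp : p < 104
    · by_cases h0 : p = 0
      · subst h0; cases bt V j 0 <;> simp
      · have : bt V j p = false := by
          by_contra h
          exact h0 (hV j p hp (by simpa using h)).2
        cases bt V j 0 <;> simp [this, testBit_one, h0]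
    · have : p ≠ 0 := by omega
      cases bt V j 0 <;> simp [hp, testBit_one, this]
  change bt (c * V) j p = _
  rw [h1, mul_pack, bt_pack (fun j _ => ?_) j hp, ← h1, h2]
  · by_cases hj : j < N
    · cases bt V j 0 <;> simp [hj]
    · have : bt V j 0 = false := by
        by_contra h
        exact hj (hV j 0 (by norm_num) (by simpa using h)).1
      simp [this]
  · rw [h2]; split <;> simp <;> exact hc

/-- The number with the lowest 91 bits set. -/
def b91 : ℕ := 2475880078570760549798248447

theorem testBit_pm (k p : ℕ) : (pm k).testBit p = decide (p < k) :=
  Nat.testBit_two_pow_sub_one k p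

theorem b91_eq : b91 = pm 91 := by decide +kernel

theorem testBit_b91 (p : ℕ) : b91.testBit p = decide (p < 91) := by rw [b91_eq, testBit_pm]

theorem pm_lt {k : ℕ} (hk : k ≤ 104) : pm k < 2 ^ 104 :=
  lt_of_lt_of_le (Nat.sub_lt (Nat.two_pow_pos k) (by norm_num)) (Nat.pow_le_pow_right (by norm_num) hk)

/-- The mask of the fields. -/
def mask (N : ℕ) : ℕ := Nat.mul b91 (ones N)

theorem bt_mask (N j : ℕ) {p : ℕ} (hp : p < 104) :
    bt (mask N) j p = (decide (j < N) && decide (p < 91)) := by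
  rw [mask, bt_mul_ones (b91_eq ▸ pm_lt (by norm_num)) N j hp, testBit_b91]

/-- Rotation of the lowest 91 bits of each field by `d` places to the right. -/
def rot (E d X : ℕ) : ℕ :=
  Nat.lor (Nat.shiftRight (Nat.land X (Nat.mul (Nat.xor b91 (pm d)) E)) d)
    (Nat.shiftLeft (Nat.land X (Nat.mul (pm d) E)) (Nat.sub 91 d))

/-- The upper 91 - d bits of a field move down and the lower d bits move up. The masks are applied
before the shifts and remove just those bits that would leave their field or land on the wrong
place. -/
theorem bt_rot {N d : ℕ} (hd0 : 0 < d) (hd : d < 91) (X j : ℕ) {p : ℕ} (hp : p < 91) :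
    bt (rot (ones N) d X) j p = (decide (j < N) && bt X j ((p + d) % 91)) := by
  have hc : Nat.xor b91 (pm d) < 2 ^ 104 :=
    Nat.xor_lt_two_pow (b91_eq ▸ pm_lt (by norm_num)) (pm_lt (by omega))
  have h1 : ∀ j q, q < 104 → bt (Nat.mul (Nat.xor b91 (pm d)) (ones N)) j q =
      (decide (j < N) && decide (d ≤ q ∧ q < 91)) := by
    intro j q hq
    rw [bt_mul_ones hc N j hq]
    have : (Nat.xor b91 (pm d)).testBit q = (b91.testBit q ^^ (pm d).testBit q) :=
      Nat.testBit_xor ..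
    rw [this, testBit_b91, testBit_pm]
    congr 1
    by_cases h1 : q < 91 <;> by_cases h2 : q < d <;> simp [h1, h2] <;> omega
  have h2 : ∀ j q, q < 104 → bt (Nat.mul (pm d) (ones N)) j q =
      (decide (j < N) && decide (q < d)) := by
    intro j q hq
    rw [bt_mul_ones (pm_lt (by omega)) N j hq, testBit_pm]
  rw [rot, bt_lor]
  have e1 : bt (Nat.shiftRight (Nat.land X (Nat.mul (Nat.xor b91 (pm d)) (ones N))) d) j p =
      (decide (j < N) && decide (p + d < 91) && bt X j (p + d)) := by
    change ((Nat.land X _) >>> d).testBit _ = _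
    rw [Nat.testBit_shiftRight]
    by_cases h : p + d < 104
    · have : d + (104 * j + p) = 104 * j + (p + d) := by omega
      rw [this]
      change bt _ j (p + d) = _
      rw [bt_land, h1 _ _ h]
      by_cases hj : j < N <;> by_cases h3 : p + d < 91 <;> simp [hj, h3]
    · have : d + (104 * j + p) = 104 * (j + 1) + (p + d - 104) := by omega
      rw [this]
      change bt _ (j + 1) (p + d - 104) = _
      rw [bt_land, h1 _ _ (by omega)]
      have h3 : ¬ (d ≤ p + d - 104 ∧ p + d - 104 < 91) := by omega
      have h4 : ¬ p + d < 91 := by omega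
      simp [h3, h4]
  have e2 : bt (Nat.shiftLeft (Nat.land X (Nat.mul (pm d) (ones N))) (Nat.sub 91 d)) j p =
      (decide (j < N) && decide (91 ≤ p + d) && bt X j (p + d - 91)) := by
    change ((Nat.land X _) <<< (91 - d)).testBit _ = _
    rw [Nat.testBit_shiftLeft]
    by_cases h : 91 ≤ p + d
    · have h3 : 104 * j + p ≥ 91 - d := by omega
      have h4 : 104 * j + p - (91 - d) = 104 * j + (p + d - 91) := by omega
      rw [h4]
      change (_ && bt _ j (p + d - 91)) = _
      rw [bt_land, h2 _ _ (by omega)]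
      have h5 : p + d - 91 < d := by omega
      simp [h, h3, h5, Bool.and_comm]
    · cases j with
      | zero =>
        simp [h]
      | succ j =>
        have h4 : 104 * (j + 1) + p - (91 - d) = 104 * j + (p + d + 13) := by omega
        rw [h4]
        change (_ && bt _ j (p + d + 13)) = _
        rw [bt_land, h2 _ _ (by omega)]
        have h5 : ¬ p + d + 13 < d := by omega
        simp [h, h5]
  rw [e1, e2]
  by_cases h : p + d < 91
  · have h3 : ¬ 91 ≤ p + d := by omega
    rw [Nat.mod_eq_of_lt h]
    simp [h, h3]
  · have h3 : (p + d) % 91 = p + d - 91 := by omega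
    have h4 : 91 ≤ p + d := by omega
    rw [h3]
    simp [h, h4]

/-- All bits lie in the mask. -/
def Clean (N X : ℕ) : Prop := ∀ j, ∀ p < 104, bt X j p = true → j < N ∧ p < 91

theorem Clean.land {N X : ℕ} (h : Clean N X) (Y : ℕ) : Clean N (Nat.land X Y) :=
  fun j p hp hb => h j p hp (by rw [bt_land, Bool.and_eq_true] at hb; exact hb.1)

theorem clean_land_mask (N X : ℕ) : Clean N (Nat.land X (mask N)) := by
  intro j p hp hb
  rw [bt_land, bt_mask N j hp] at hb
  simp only [Bool.and_eq_true, decide_eq_true_eq] at hb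
  exact hb.2

theorem Clean.field_lt {N X : ℕ} (h : Clean N X) (j : ℕ) : field X j < 2 ^ 91 := by
  refine Nat.lt_pow_two_of_testBit _ fun p hp => ?_
  rw [testBit_field]
  by_cases h4 : p < 104
  · have : bt X j p = false := by
      by_contra hb
      have := h j p h4 (by simpa using hb)
      omega
    simp [this]
  · simp [h4]

theorem Clean.eq_pack {N X : ℕ} (h : Clean N X) : X = pack N (field X) :=
  PG2.eq_pack fun j hj p hp => by
    by_contra hb
    have := h j p hp (by simpa using hb)
    omega

/-- The flags of the fields that are not zero. -/
def nonzero (E F X : ℕ) : ℕ := Nat.land (Nat.shiftRight (Nat.add X F) 91) E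

theorem b91_add_one : b91 + 1 = 2 ^ 91 := by decide +kernel

theorem two_pow_104 : 2 ^ 104 = 8192 * 2 ^ 91 := by decide +kernel

theorem two_pow_95 : 2 ^ 95 = 16 * 2 ^ 91 := by decide +kernel

/-- Adding 2^91 - 1 to a number below 2^91 sets bit 91 exactly if the number is not zero, and the
sum still fits into its field. -/
theorem bt_nonzero {N X : ℕ} (hX : Clean N X) (j : ℕ) {p : ℕ} (hp : p < 104) :
    bt (nonzero (ones N) (mask N) X) j p = true ↔ p = 0 ∧ j < N ∧ ∃ q < 91, bt X j q = true := by
  rw [nonzero, bt_land, bt_ones N j hp]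
  by_cases h0 : p = 0
  swap
  · simp [h0]
  subst h0
  have e : bt (Nat.shiftRight (Nat.add X (mask N)) 91) j 0 = bt (X + b91 * ones N) j 91 := by
    change ((X + b91 * ones N) >>> 91).testBit _ = _
    rw [Nat.testBit_shiftRight, bt]
    congr 1; omega
  have h2 : (∃ q < 91, bt X j q = true) ↔ field X j ≠ 0 := by
    rw [← not_iff_not, not_not]
    constructor
    · intro h
      refine Nat.eq_of_testBit_eq fun q => ?_
      rw [testBit_field, Nat.zero_testBit]
      by_contra hb
      simp only [Bool.not_eq_false, Bool.and_eq_true, decide_eq_true_eq] at hb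
      exact h ⟨q, (hX j q hb.1 hb.2).2, hb.2⟩
    · rintro h ⟨q, hq, hb⟩
      have := testBit_field X j q
      rw [h, Nat.zero_testBit, hb] at this
      simp at this; omega
  have hb := b91_add_one
  have h104 := two_pow_104
  have hlt := hX.field_lt
  have hsum : bt (X + b91 * ones N) j 91 = (decide (j < N) && (field X j + b91 * 1).testBit 91) := by
    conv_lhs => rw [hX.eq_pack, ones_eq, mul_pack, pack_add]
    exact bt_pack (fun j _ => by have := hlt j; omega) j (by norm_num)
  rw [e, hsum]
  by_cases hj : j < N
  swap
  · simp [hj]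
  have h3 : (field X j + b91 * 1).testBit 91 = true ↔ field X j ≠ 0 := by
    have := hlt j
    rw [Nat.testBit_eq_decide_div_mod_eq, decide_eq_true_eq]
    by_cases h : field X j = 0
    · rw [Nat.div_eq_of_lt (by omega)]; simp [h]
    · have : (field X j + b91 * 1) / 2 ^ 91 = 1 :=
        Nat.div_eq_of_lt_le (by omega) (by omega)
      rw [this]; simp [h]
  rw [h2, ← h3]
  simp [hj]

/-- The lowest bit of each field. -/
def low (E F X : ℕ) : ℕ :=
  let Y := Nat.land X F
  Nat.land Y (Nat.xor F (Nat.land F (Nat.sub (Nat.add Y (Nat.shiftLeft E 91)) E)))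

/-- The usual trick: Y without the bits of Y - 1. Bit 91 is set in every field before the
subtraction, so no borrow crosses a field. Uniqueness is all that has to be proved; that a bit is
present is tested by `proc` during the search. -/
theorem low_unique (N X : ℕ) {j p q : ℕ} (hpq : p < q) (hq : q < 104)
    (h1 : bt (low (ones N) (mask N) X) j p = true) (h2 : bt (low (ones N) (mask N) X) j q = true) :
    False := by
  simp only [low, bt_land, bt_xor, Bool.and_eq_true] at h1 h2
  obtain ⟨⟨hq0, hF⟩, h2⟩ := h2
  have hY := clean_land_mask N X
  have hp1 : bt (Nat.land X (mask N)) j p = true := by rw [bt_land, h1.1.1, h1.1.2]; rfl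
  have hq1 : bt (Nat.land X (mask N)) j q = true := by
    rw [bt_land, hF, Bool.and_true]; exact hq0
  set Y := Nat.land X (mask N) with hYdef
  rw [hF] at h2
  have h3 : bt (Nat.sub (Nat.add Y (Nat.shiftLeft (ones N) 91)) (ones N)) j q = false := by
    cases h : bt (Nat.sub (Nat.add Y (Nat.shiftLeft (ones N) 91)) (ones N)) j q
    · rfl
    · rw [h] at h2; simp at h2
  have hj := (hY j p (by omega) hp1).1
  have hB : 0 < 2 ^ 91 := Nat.two_pow_pos 91
  have e : Nat.sub (Nat.add Y (Nat.shiftLeft (ones N) 91)) (ones N) =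
      pack N fun j => field Y j + 2 ^ 91 - 1 := by
    change Y + (ones N) <<< 91 - ones N = _
    rw [Nat.shiftLeft_eq, mul_comm]
    refine Nat.sub_eq_of_eq_add ?_
    conv_lhs => rw [hY.eq_pack]
    rw [ones_eq, mul_pack, pack_add, pack_add]
    refine pack_congr fun j _ => ?_
    generalize 2 ^ 91 = B at hB
    omega
  have h104 := two_pow_104
  rw [e, bt_pack (fun j _ => by
    have := hY.field_lt j
    generalize 2 ^ 91 = B at *
    generalize 2 ^ 104 = C at *
    omega) j hq] at h3
  simp only [hj, decide_true, Bool.true_and] at h3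
  have hlt := hY.field_lt j
  have tq : (field Y j).testBit q = true := by rw [testBit_field, hq1]; simp [hq]
  have tp : (field Y j).testBit p = true := by rw [testBit_field, hp1]; simp; omega
  have hq91 : q < 91 := by
    by_contra h
    rw [Nat.testBit_lt_two_pow (lt_of_lt_of_le hlt (Nat.pow_le_pow_right (by norm_num)
      (by omega)))] at tq
    simp at tq
  have hmod : 2 ^ p ≤ field Y j % 2 ^ q := by
    refine Nat.ge_two_pow_of_testBit ?_
    rw [Nat.testBit_mod_two_pow, tp]; simp [hpq]
  -- Because of bit p the remainder modulo 2^q is positive, so subtracting 1 borrows nothing from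
  -- bit q. The added quotient 2^(91 - q) is even; hence bit q survives in the difference and is
  -- removed from the result.
  have hdiv : (field Y j + 2 ^ 91 - 1) / 2 ^ q = field Y j / 2 ^ q + 2 ^ (91 - q) := by
    have hpos : 0 < 2 ^ p := by positivity
    have e1 := Nat.div_add_mod (field Y j) (2 ^ q)
    have e2 : 2 ^ 91 = 2 ^ q * 2 ^ (91 - q) := by rw [← pow_add]; congr 1; omega
    have hm := Nat.mod_lt (field Y j) (show 0 < 2 ^ q by positivity)
    refine Nat.div_eq_of_lt_le ?_ ?_
    · rw [add_mul, mul_comm, mul_comm (2 ^ (91 - q)), ← e2]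
      generalize 2 ^ 91 = B at *
      omega
    · rw [add_mul, add_mul, mul_comm, mul_comm (2 ^ (91 - q)), ← e2, one_mul]
      generalize 2 ^ 91 = B at *
      omega
  rw [Nat.testBit_eq_decide_div_mod_eq, hdiv] at h3
  rw [Nat.testBit_eq_decide_div_mod_eq] at tq
  have h4 : 2 ^ (91 - q) % 2 = 0 := by
    rw [show 91 - q = (91 - q - 1) + 1 by omega, pow_succ]; simp
  simp only [decide_eq_true_eq, decide_eq_false_iff_not] at h3 tq
  omega

/-- The number in bits 91 to 94 of a field. -/
def cap (X j : ℕ) : ℕ := field X j / 2 ^ 91 % 16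

/-- Decrement the numbers in bits 91 to 94 of the fields with a flag in `V`. -/
def bump (E V X : ℕ) : ℕ :=
  Nat.land (Nat.sub (Nat.add X (Nat.shiftLeft E 95)) (Nat.shiftLeft V 91)) (Nat.mul (pm 95) E)

/-- Adding 2^95 to each field pays for any borrow of the subtraction of 2^91, and the last mask
removes this bit again. Bits below 91 are not affected. A counter that is zero would wrap around to
15, hence the assumption that it is positive. -/
theorem bump_spec {N X V : ℕ} (hX : ∀ j, ∀ p < 104, bt X j p = true → j < N ∧ p < 95)
    (hV : Flags N V) (j : ℕ) :
    (∀ p < 91, bt (bump (ones N) V X) j p = bt X j p) ∧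
      (bt V j 0 = true → 1 ≤ cap X j → cap (bump (ones N) V X) j + 1 = cap X j) ∧
      (bt V j 0 = false → cap (bump (ones N) V X) j = cap X j) ∧
      (∀ p < 104, bt (bump (ones N) V X) j p = true → j < N) := by
  have hX1 : X = pack N (field X) := eq_pack fun j hj p hp => by
    by_contra hb
    have := hX j p hp (by simpa using hb)
    omega
  have hV1 : V = pack N (field V) := eq_pack fun j hj p hp => by
    by_contra h
    have := hV j p hp (by simpa using h)
    omega
  have hV2 : ∀ j, field V j = (bt V j 0).toNat := by
    intro j
    refine Nat.eq_of_testBit_eq fun p => ?_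
    rw [testBit_field]
    by_cases hp : p < 104
    · by_cases h0 : p = 0
      · subst h0; cases bt V j 0 <;> simp
      · have : bt V j p = false := by
          by_contra h
          exact h0 (hV j p hp (by simpa using h)).2
        cases bt V j 0 <;> simp [this, testBit_one, h0]
    · have : p ≠ 0 := by omega
      cases bt V j 0 <;> simp [hp, testBit_one, this]
  have hlt : ∀ j, field X j < 2 ^ 95 := by
    intro j
    refine Nat.lt_pow_two_of_testBit _ fun p hp => ?_
    rw [testBit_field]
    by_cases h4 : p < 104
    · have : bt X j p = false := by
        by_contra hb
        have := hX j p h4 (by simpa using hb)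
        omega
      simp [this]
    · simp [h4]
  have e : Nat.sub (Nat.add X (Nat.shiftLeft (ones N) 95)) (Nat.shiftLeft V 91) =
      pack N fun j => field X j + 2 ^ 95 - 2 ^ 91 * (bt V j 0).toNat := by
    change X + (ones N) <<< 95 - V <<< 91 = _
    rw [Nat.shiftLeft_eq, Nat.shiftLeft_eq, mul_comm, mul_comm _ (2 ^ 91)]
    refine Nat.sub_eq_of_eq_add ?_
    have hv : 2 ^ 91 * V = pack N fun j => 2 ^ 91 * field V j := by
      conv_lhs => rw [hV1, mul_pack]
    conv_lhs => rw [hX1]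
    rw [ones_eq, mul_pack, hv, pack_add, pack_add]
    refine pack_congr fun j _ => ?_
    have := two_pow_95
    rw [hV2]
    generalize 2 ^ 91 = B at *
    generalize 2 ^ 95 = C at *
    cases bt V j 0
    · simp
    · simp only [Bool.toNat_true]; omega
  have hb : ∀ p < 104, bt (bump (ones N) V X) j p = (decide (j < N) &&
      ((field X j + 2 ^ 95 - 2 ^ 91 * (bt V j 0).toNat) % 2 ^ 95).testBit p) := by
    intro p hp
    rw [bump, bt_land, e, bt_pack (fun j _ => by
      have := hlt j
      have h104 := two_pow_104
      have h95 := two_pow_95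
      have h1 := Nat.sub_le (field X j + 2 ^ 95) (2 ^ 91 * (bt V j 0).toNat)
      generalize 2 ^ 91 = B at *
      generalize 2 ^ 95 = C at *
      generalize 2 ^ 104 = D at *
      omega) j hp,
      bt_mul_ones (pm_lt (by norm_num)) N j hp, testBit_pm, Nat.testBit_mod_two_pow]
    by_cases hj : j < N <;> simp [hj, Bool.and_comm]
  have e3 : field X j + 2 ^ 95 - 2 ^ 91 * (bt V j 0).toNat =
      field X j + (16 - (bt V j 0).toNat) * 2 ^ 91 := by
    have h95 := two_pow_95
    generalize 2 ^ 91 = B at *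
    generalize 2 ^ 95 = C at *
    cases bt V j 0 <;> simp only [Bool.toNat_true, Bool.toNat_false] <;> omega
  by_cases hj : j < N
  · have hf : field (bump (ones N) V X) j =
        (field X j + 2 ^ 95 - 2 ^ 91 * (bt V j 0).toNat) % 2 ^ 95 := by
      refine Nat.eq_of_testBit_eq fun p => ?_
      rw [testBit_field]
      by_cases hp : p < 104
      · rw [hb p hp]; simp [hp, hj]
      · rw [Nat.testBit_mod_two_pow]
        have : ¬ p < 95 := by omega
        simp [hp, this]
    have h95 := two_pow_95
    have hc : cap (bump (ones N) V X) j = (field X j / 2 ^ 91 + (16 - (bt V j 0).toNat)) % 16 := by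
      rw [cap, hf, e3, h95, mul_comm 16, Nat.mod_mul_right_div_self,
        Nat.add_mul_div_right _ _ (Nat.two_pow_pos 91), Nat.mod_mod]
    refine ⟨fun p hp => ?_, fun hv h1 => ?_, fun hv => ?_, fun p hp hbt => hj⟩
    · have h3 : (field X j + 2 ^ 95 - 2 ^ 91 * (bt V j 0).toNat) % 2 ^ 91 = field X j % 2 ^ 91 := by
        rw [e3, Nat.add_mul_mod_self_right]
      have h4 := congrArg (fun n => Nat.testBit n p) h3
      simp only [Nat.testBit_mod_two_pow, hp, decide_true, Bool.true_and] at h4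
      rw [hb p (by omega), Nat.testBit_mod_two_pow, h4, testBit_field]
      have h5 : p < 95 := by omega
      have h6 : p < 104 := by omega
      simp [hj, h5, h6]
    · rw [hc, hv]
      unfold cap at h1 ⊢
      simp only [Bool.toNat_true]
      omega
    · rw [hc, hv]
      unfold cap
      simp only [Bool.toNat_false]
      omega
  · have h0 : ∀ p < 104, bt X j p = false := fun p hp => by
      by_contra hb
      exact hj (hX j p hp (by simpa using hb)).1
    have hf : field X j = 0 := Nat.eq_of_testBit_eq fun p => by
      rw [testBit_field, Nat.zero_testBit]
      by_cases hp : p < 104 <;> simp [hp, h0]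
    have hf' : field (bump (ones N) V X) j = 0 := Nat.eq_of_testBit_eq fun p => by
      rw [testBit_field, Nat.zero_testBit]
      by_cases hp : p < 104
      · rw [hb p hp]; simp [hj]
      · simp [hp]
    refine ⟨fun p hp => ?_, fun _ h1 => ?_, fun _ => ?_, fun p hp hbt => ?_⟩
    · rw [hb p (by omega), h0 p (by omega)]; simp [hj]
    · simp [cap, hf] at h1
    · rw [cap, cap, hf, hf']
    · rw [hb p hp] at hbt; simp [hj] at hbt

end PG2

namespace PG2

/-! ### Semiovals as sets of numbers -/

/-- For each non-zero difference the point of line `0` with which a pair of points of line `0` with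
this difference starts, 7 bits for each. -/
def startT : ℕ :=
  4560923324510686657279951061623131121041881888015283854319605484087502762321586982047600740788400251138911946533501082467641901306870713209528868872976466537343815874763383483210186941808640

/-- The line through two different points. -/
def join (p q : Fin 91) : Fin 91 :=
  ⟨Nat.mod (Nat.sub (Nat.add p.val 91) (Nat.land (Nat.shiftRight startT
    (Nat.mul 7 (Nat.mod (Nat.sub (Nat.add q.val 91) p.val) 91))) 127)) 91,
    Nat.mod_lt _ (by norm_num)⟩

/-- The points of a line. -/
def pointsOn (l : Fin 91) : List (Fin 91) := [0, 1, 3, 9, 27, 49, 56, 61, 77, 81].map (l + ·)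

/-- The lines through a point. -/
def linesOn (p : Fin 91) : List (Fin 91) := [0, 90, 88, 82, 64, 42, 35, 30, 14, 10].map (p + ·)

theorem inc_iff (l p : Fin 91) : inc l p = true ↔ (p.val + 91 - l.val) % 91 ∈ diffSet := by
  have h : ∀ k < 91, (Nat.beq (Nat.land (Nat.shiftRight diffMask k) 1) 1 = true ↔ k ∈ diffSet) := by
    decide +kernel
  exact h _ (Nat.mod_lt _ (by norm_num))

theorem inc_iff_pointsOn (l p : Fin 91) : inc l p = true ↔ p ∈ pointsOn l := by
  rw [inc_iff]
  simp only [pointsOn, diffSet, List.map_cons, List.map_nil, List.mem_cons, List.not_mem_nil,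
    or_false, Fin.ext_iff, Fin.val_add]
  change _ ↔ p.val = (l.val + 0) % 91 ∨ p.val = (l.val + 1) % 91 ∨ p.val = (l.val + 3) % 91 ∨
    p.val = (l.val + 9) % 91 ∨ p.val = (l.val + 27) % 91 ∨ p.val = (l.val + 49) % 91 ∨
    p.val = (l.val + 56) % 91 ∨ p.val = (l.val + 61) % 91 ∨ p.val = (l.val + 77) % 91 ∨
    p.val = (l.val + 81) % 91
  have key : ∀ d < 91, (p.val = (l.val + d) % 91 ↔ (p.val + 91 - l.val) % 91 = d) := by omega
  rw [key 0 (by norm_num), key 1 (by norm_num), key 3 (by norm_num), key 9 (by norm_num),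
    key 27 (by norm_num), key 49 (by norm_num), key 56 (by norm_num), key 61 (by norm_num),
    key 77 (by norm_num), key 81 (by norm_num)]

theorem inc_iff_linesOn (p l : Fin 91) : inc l p = true ↔ l ∈ linesOn p := by
  rw [inc_iff]
  simp only [linesOn, diffSet, List.map_cons, List.map_nil, List.mem_cons, List.not_mem_nil,
    or_false, Fin.ext_iff, Fin.val_add]
  change _ ↔ l.val = (p.val + 0) % 91 ∨ l.val = (p.val + 90) % 91 ∨ l.val = (p.val + 88) % 91 ∨
    l.val = (p.val + 82) % 91 ∨ l.val = (p.val + 64) % 91 ∨ l.val = (p.val + 42) % 91 ∨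
    l.val = (p.val + 35) % 91 ∨ l.val = (p.val + 30) % 91 ∨ l.val = (p.val + 14) % 91 ∨
    l.val = (p.val + 10) % 91
  have key : ∀ d < 91, (l.val = (p.val + (91 - d)) % 91 ↔ (p.val + 91 - l.val) % 91 = d) := by
    omega
  rw [show (l.val = (p.val + 0) % 91 ↔ (p.val + 91 - l.val) % 91 = 0) by omega,
    key 1 (by norm_num), key 3 (by norm_num), key 9 (by norm_num), key 27 (by norm_num),
    key 49 (by norm_num), key 56 (by norm_num), key 61 (by norm_num), key 77 (by norm_num),
    key 81 (by norm_num)]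

theorem pointsOn_nodup (l : Fin 91) : (pointsOn l).Nodup :=
  List.Nodup.map (add_right_injective l) (by decide)

theorem linesOn_nodup (p : Fin 91) : (linesOn p).Nodup :=
  List.Nodup.map (add_right_injective p) (by decide)

/-- In a perfect difference set a nonzero difference e - d determines d. The table `startT` stores
d, and the line is found by going back from `p` by d. -/
theorem join_eq {l p q : Fin 91} (hp : inc l p = true) (hq : inc l q = true) (h : p ≠ q) :
    join p q = l := by
  rw [inc_iff] at hp hq
  have h1 : ∀ d ∈ diffSet, ∀ e ∈ diffSet, d ≠ e → Nat.land (Nat.shiftRight startT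
      (Nat.mul 7 ((e + 91 - d) % 91))) 127 = d := by decide +kernel
  have h2 : p.val ≠ q.val := fun h' => h (Fin.ext h')
  have h3 := h1 _ hp _ hq (by omega)
  have h4 : ((q.val + 91 - l.val) % 91 + 91 - (p.val + 91 - l.val) % 91) % 91 =
      (q.val + 91 - p.val) % 91 := by omega
  rw [h4] at h3
  refine Fin.ext ?_
  change (p.val + 91 - Nat.land (Nat.shiftRight startT
      (Nat.mul 7 ((q.val + 91 - p.val) % 91))) 127) % 91 = l.val
  rw [h3]
  omega

theorem line_unique {l m p q : Fin 91} (h : p ≠ q) (hp : inc l p = true) (hq : inc l q = true)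
    (hp' : inc m p = true) (hq' : inc m q = true) : l = m :=
  (join_eq hp hq h).symm.trans (join_eq hp' hq' h)

/-- The points of `s` on the line `l`. -/
def trc (s : Finset (Fin 91)) (l : Fin 91) : Finset (Fin 91) := s.filter fun p => inc l p = true

theorem mem_trc {s : Finset (Fin 91)} {l p : Fin 91} : p ∈ trc s l ↔ p ∈ s ∧ inc l p = true :=
  Finset.mem_filter

/-- Semiovals, as sets of numbers of points. -/
def SO (s : Finset (Fin 91)) : Prop := s.Nonempty ∧ ∀ p ∈ s, ∃! l, trc s l = {p}

/-- The lines through `p` that contain exactly one point of `A`. -/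
def free (A : Finset (Fin 91)) (p : Fin 91) : Finset (Fin 91) :=
  Finset.univ.filter fun l => inc l p = true ∧ (trc A l).card = 1

/-! ### Free lines at a chosen point: the bounds behind the search -/

section state

variable {A s : Finset (Fin 91)} {p q l : Fin 91}

theorem trc_eq_singleton (hp : p ∈ A) (hl : inc l p = true) (h : (trc A l).card = 1) :
    trc A l = {p} := by
  obtain ⟨q, hq⟩ := Finset.card_eq_one.1 h
  have : p ∈ trc A l := mem_trc.2 ⟨hp, hl⟩
  rw [hq, Finset.mem_singleton] at this
  rw [hq, this]

theorem tangent_mem_free (hA : A ⊆ s) (hp : p ∈ A) (h : trc s l = {p}) : l ∈ free A p := by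
  have hpl : p ∈ trc s l := by rw [h]; exact Finset.mem_singleton_self p
  have hl := (mem_trc.1 hpl).2
  refine Finset.mem_filter.2 ⟨Finset.mem_univ l, hl, Finset.card_eq_one.2 ⟨p, ?_⟩⟩
  refine Finset.eq_singleton_iff_unique_mem.2 ⟨mem_trc.2 ⟨hp, hl⟩, fun q hq => ?_⟩
  have : q ∈ trc s l := mem_trc.2 ⟨hA (mem_trc.1 hq).1, (mem_trc.1 hq).2⟩
  rw [h] at this
  exact Finset.mem_singleton.1 this

/-- Among the free lines at p exactly one is the tangent of s. Every other one contains a point of s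
outside A, and these points differ, as two of the lines meet only in p. Points of `Q` lie on no free
line at p, so they come on top. -/
theorem free_card_add_le (hs : SO s) (hA : A ⊆ s) (hp : p ∈ A) {Q : Finset (Fin 91)}
    (hQ : Q ⊆ s \ A) (hQl : ∀ q ∈ Q, ∀ l ∈ free A p, inc l q = false) :
    (free A p).card + Q.card ≤ (s \ A).card + 1 := by
  obtain ⟨t, ht, htu⟩ := hs.2 p (hA hp)
  have htf := tangent_mem_free hA hp ht
  have key : ∀ l ∈ (free A p).erase t, ∃ x ∈ s \ A, inc l x = true := by
    intro l hl
    obtain ⟨hlt, hl⟩ := Finset.mem_erase.1 hl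
    obtain ⟨-, hlp, hlA⟩ := Finset.mem_filter.1 hl
    have h1 : trc s l ≠ {p} := fun h => hlt (htu l h)
    have h2 : p ∈ trc s l := mem_trc.2 ⟨hA hp, hlp⟩
    obtain ⟨x, hx, hxp⟩ : ∃ x ∈ trc s l, x ≠ p := by
      by_contra hcon
      push Not at hcon
      exact h1 (Finset.eq_singleton_iff_unique_mem.2 ⟨h2, hcon⟩)
    refine ⟨x, Finset.mem_sdiff.2 ⟨(mem_trc.1 hx).1, fun hxA => hxp ?_⟩, (mem_trc.1 hx).2⟩
    have : x ∈ trc A l := mem_trc.2 ⟨hxA, (mem_trc.1 hx).2⟩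
    rw [trc_eq_singleton hp hlp hlA] at this
    exact Finset.mem_singleton.1 this
  choose! x hx1 hx2 using key
  have hinj : Set.InjOn x ((free A p).erase t : Finset (Fin 91)) := by
    intro l hl m hm hlm
    have hl' := (Finset.mem_filter.1 (Finset.mem_erase.1 hl).2).2.1
    have hm' := (Finset.mem_filter.1 (Finset.mem_erase.1 hm).2).2.1
    refine line_unique (p := p) (q := x l) ?_ hl' (hx2 l hl) hm' (hlm ▸ hx2 m hm)
    rintro h
    have := hx1 l hl
    rw [← h] at this
    exact (Finset.mem_sdiff.1 this).2 hp
  have hdis : Disjoint (((free A p).erase t).image x) Q := by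
    rw [Finset.disjoint_left]
    intro y hy hyQ
    obtain ⟨l, hl, rfl⟩ := Finset.mem_image.1 hy
    have h1 := hQl _ hyQ l (Finset.mem_erase.1 hl).2
    rw [hx2 l hl] at h1
    simp at h1
  have hsub : ((free A p).erase t).image x ∪ Q ⊆ s \ A := by
    refine Finset.union_subset (fun y hy => ?_) hQ
    obtain ⟨l, hl, rfl⟩ := Finset.mem_image.1 hy
    exact hx1 l hl
  have := Finset.card_le_card hsub
  rw [Finset.card_union_of_disjoint hdis, Finset.card_image_of_injOn hinj,
    Finset.card_erase_of_mem htf] at this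
  have := Finset.card_pos.2 ⟨t, htf⟩
  omega

theorem free_pos (hs : SO s) (hA : A ⊆ s) (hp : p ∈ A) : 0 < (free A p).card := by
  obtain ⟨t, ht, -⟩ := hs.2 p (hA hp)
  exact Finset.card_pos.2 ⟨t, tangent_mem_free hA hp ht⟩

/-- The number `b` exceeds the number of points still allowed by one; the extra line is the tangent.
In this form the bound is stored with each state and can be compared directly with the number of
free lines. -/
theorem free_le {b : ℕ} (hs : SO s) (hA : A ⊆ s) (hp : p ∈ A) (hb : s.card + 1 ≤ A.card + b) :
    (free A p).card ≤ b := by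
  have h := free_card_add_le hs hA hp (Q := ∅) (Finset.empty_subset _) (by simp)
  rw [Finset.card_sdiff_of_subset hA, Finset.card_empty] at h
  have := Finset.card_le_card hA
  omega

/-- All points that may still be added are needed on the free lines at p, so none is left for a line
through p that is a secant already. -/
theorem notMem_of_tight {b : ℕ} (hs : SO s) (hA : A ⊆ s) (hp : p ∈ A)
    (hb : s.card + 1 ≤ A.card + b) (hf : (free A p).card = b) (hl : inc l p = true)
    (h2 : 2 ≤ (trc A l).card) (hq : inc l q = true) (hqA : q ∉ A) : q ∉ s := by
  intro hqs
  have h := free_card_add_le hs hA hp (Q := {q})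
    (Finset.singleton_subset_iff.2 (Finset.mem_sdiff.2 ⟨hqs, hqA⟩)) (by
      intro q' hq' m hm
      rw [Finset.mem_singleton] at hq'
      subst hq'
      obtain ⟨-, hmp, hmc⟩ := Finset.mem_filter.1 hm
      by_contra hmq
      rw [Bool.not_eq_false] at hmq
      have : l = m := line_unique (p := p) (q := q') (fun h => hqA (h ▸ hp)) hl hq hmp hmq
      subst this
      omega)
  rw [Finset.card_sdiff_of_subset hA, Finset.card_singleton] at h
  have := Finset.card_le_card hA
  omega

/-- The only free line at p has to be the tangent, so its other points are excluded. -/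
theorem notMem_of_free_one (hs : SO s) (hA : A ⊆ s) (hp : p ∈ A) (hf : (free A p).card = 1)
    (hl : inc l p = true) (h1 : (trc A l).card = 1) (hq : inc l q = true) (hqA : q ∉ A) :
    q ∉ s := by
  intro hqs
  obtain ⟨t, ht, -⟩ := hs.2 p (hA hp)
  have h3 := tangent_mem_free hA hp ht
  have h4 : l ∈ free A p := Finset.mem_filter.2 ⟨Finset.mem_univ l, hl, h1⟩
  have : l = t := Finset.card_le_one.1 hf.le l h4 t h3
  subst this
  have : q ∈ trc s l := mem_trc.2 ⟨hqs, hq⟩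
  rw [ht, Finset.mem_singleton] at this
  exact hqA (this ▸ hp)

theorem notMem_of_cap (hA : A ⊆ s) (hcap : ∀ l, (trc s l).card ≤ 3) (h3 : 3 ≤ (trc A l).card)
    (hq : inc l q = true) (hqA : q ∉ A) : q ∉ s := by
  intro hqs
  have : insert q (trc A l) ⊆ trc s l := by
    intro x hx
    rcases Finset.mem_insert.1 hx with rfl | hx
    · exact mem_trc.2 ⟨hqs, hq⟩
    · exact mem_trc.2 ⟨hA (mem_trc.1 hx).1, (mem_trc.1 hx).2⟩
  have h1 := Finset.card_le_card this
  rw [Finset.card_insert_of_notMem (fun h => hqA (mem_trc.1 h).1)] at h1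
  have := hcap l
  omega

/-- A free line at p that can receive no further point is the tangent at p, and there is just one
tangent. -/
theorem blocked_unique (hs : SO s) (hA : A ⊆ s) (hp : p ∈ A) {l m : Fin 91}
    (hl : inc l p = true) (hl1 : (trc A l).card = 1) (hlb : ∀ q, inc l q = true → q ∉ A → q ∉ s)
    (hm : inc m p = true) (hm1 : (trc A m).card = 1) (hmb : ∀ q, inc m q = true → q ∉ A → q ∉ s) :
    l = m := by
  have key : ∀ l, inc l p = true → (trc A l).card = 1 →
      (∀ q, inc l q = true → q ∉ A → q ∉ s) → trc s l = {p} := by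
    intro l hl hl1 hlb
    rw [← trc_eq_singleton hp hl hl1]
    ext q
    rw [mem_trc, mem_trc]
    refine ⟨fun h => ⟨?_, h.2⟩, fun h => ⟨hA h.1, h.2⟩⟩
    by_contra hq
    exact hlb q h.2 hq h.1
  obtain ⟨t, -, htu⟩ := hs.2 p (hA hp)
  rw [htu l (key l hl hl1 hlb), htu m (key m hm hm1 hmb)]

end state

end PG2

namespace PG2

/-! ### One round of the packed search -/

/-- The differences of line `0`, without `0`. -/
def dl : List ℕ := [1, 3, 9, 27, 49, 56, 61, 77, 81]

/-- The negatives of the differences of line `0`, without `0`. -/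
def dp : List ℕ := [90, 88, 82, 64, 42, 35, 30, 14, 10]

/-- The bits of a number that runs over `0`, `1`, `2` and `3`, in unary notation. -/
structure Un where
  a : ℕ
  b : ℕ
  c : ℕ

/-- Increment, saturating at `2`. -/
def Un.inc2 (t : ℕ) (q : Un) : Un := ⟨Nat.lor q.a t, Nat.lor q.b (Nat.land q.a t), 0⟩

/-- Increment, saturating at `3`. -/
def Un.inc3 (t : ℕ) (q : Un) : Un :=
  ⟨Nat.lor q.a t, Nat.lor q.b (Nat.land q.a t), Nat.lor q.c (Nat.land q.b t)⟩

/-- The bits of a number below `16`. -/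
structure Bi where
  a : ℕ
  b : ℕ
  c : ℕ
  d : ℕ

/-- Increment. -/
def Bi.inc (t : ℕ) (q : Bi) : Bi :=
  let u := Nat.land q.a t
  let v := Nat.land q.b u
  ⟨Nat.xor q.a t, Nat.xor q.b u, Nat.xor q.c v, Nat.lor q.d (Nat.land q.c v)⟩

/-- The rotations of `X` that contain a given bit, counted up to `2`. -/
def thr2 (E X : ℕ) (ds : List ℕ) : Un := ds.foldl (fun q d => q.inc2 (rot E d X)) ⟨X, 0, 0⟩

/-- The rotations of `X` that contain a given bit, counted up to `3`. -/
def thr3 (E X : ℕ) (ds : List ℕ) : Un := ds.foldl (fun q d => q.inc3 (rot E d X)) ⟨X, 0, 0⟩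

/-- The number of rotations of `X` that contain a given bit. -/
def cnt (E X : ℕ) (ds : List ℕ) : Bi := ds.foldl (fun q d => q.inc (rot E d X)) ⟨X, 0, 0, 0⟩

/-- The union of the rotations of `X`. -/
def orG (E X : ℕ) (ds : List ℕ) : ℕ := ds.foldl (fun a d => Nat.lor a (rot E d X)) X

/-- The bits of `X` outside `Y`. -/
def diff (X Y : ℕ) : ℕ := Nat.xor X (Nat.land X Y)

/-- The fields with a non-zero bit, as full fields. -/
def full (E F X : ℕ) : ℕ := Nat.mul b91 (nonzero E F X)

/-- The bits of `Z` outside `s`, in the fields where there are any, and else all bits. -/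
def minSel (E F Z s : ℕ) : ℕ :=
  let Zi := diff Z s
  Nat.lor Zi (diff Z (full E F Zi))

/-- The bits of `Z` inside `s`, in the fields where there are any, and else all bits. -/
def maxSel (E F Z s : ℕ) : ℕ :=
  let Zi := Nat.land Z s
  Nat.lor Zi (diff Z (full E F Zi))

/-- Points to branch on in each field: one of the undecided points `und` on a line from `BR` with
few such points, and a further one, if there are exactly two such points and the line contains a
point from `bp`; `any` are the lines with undecided points, `c` the numbers of these points, and `h`
the numbers of lines from `sgl` through the points. -/
def pick (BR E F und sgl any bp : ℕ) (c h : Bi) : ℕ :=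
  let Z := Nat.land (Nat.land sgl (Nat.mul BR E)) any
  let Z3 := minSel E F (minSel E F (minSel E F (minSel E F Z c.d) c.c) c.b) c.a
  let m := orG E (low E F Z3) dp
  let C := Nat.land m und
  let cand := Nat.lor C (diff und (full E F Z))
  let x := Nat.land
    (low E F (maxSel E F (maxSel E F (maxSel E F (maxSel E F cand h.d) h.c) h.b) h.a)) und
  let Y := diff C x
  let Yl := low E F Y
  Nat.lor x (Nat.land Yl
    (Nat.mul b91 (diff (nonzero E F (Nat.land m bp)) (nonzero E F (diff Y Yl)))))

/-- Broadcast of bit `k`. -/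
def spread (E X k : ℕ) : ℕ := Nat.mul b91 (Nat.land (Nat.shiftRight X k) E)

/-- The result of a round: dead fields, undecided points, the points to branch on, excluded points. -/
structure Round where
  dead : ℕ
  und : ℕ
  x : ℕ
  O : ℕ

/-- One round: `I` are the chosen points, `O` the excluded ones. -/
def round (cap3 : Bool) (BR E F I O : ℕ) : Round :=
  let It := Nat.land I F
  let ts := cond cap3 (thr3 E It dl) (thr2 E It dl)
  let two := ts.b
  let sgl := Nat.xor ts.a two
  let s := cnt E sgl dp
  let x0 := Nat.xor s.a (spread E I 91)
  let x1 := Nat.xor s.b (spread E I 92)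
  let x2 := Nat.xor s.c (spread E I 93)
  let x3 := Nat.xor s.d (spread E I 94)
  let tight := Nat.xor It (Nat.land It (Nat.lor (Nat.lor x0 x1) (Nat.lor x2 x3)))
  let hi := Nat.lor s.b (Nat.lor s.c s.d)
  let e1 := Nat.xor It (Nat.land It (Nat.lor hi (Nat.xor s.a F)))
  let g0 := Nat.land x0 s.a
  let g1 := Nat.lor (Nat.land x1 s.b) (Nat.xor g0 (Nat.land g0 x1))
  let g2 := Nat.lor (Nat.land x2 s.c) (Nat.xor g1 (Nat.land g1 x2))
  let g3 := Nat.lor (Nat.land x3 s.d) (Nat.xor g2 (Nat.land g2 x3))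
  let z := Nat.xor F (Nat.lor hi s.a)
  let lo := Nat.lor (Nat.lor (Nat.land (orG E tight dl) two) (Nat.land (orG E e1 dl) sgl)) ts.c
  let no := orG E lo dp
  let O' := Nat.lor O (Nat.xor no (Nat.land no It))
  let und := Nat.xor F (Nat.land F (Nat.lor It O'))
  let c := cnt E und dl
  let any := Nat.lor (Nat.lor c.a c.b) (Nat.lor c.c c.d)
  let bl := Nat.xor sgl (Nat.land sgl any)
  let tb := thr2 E bl dp
  ⟨nonzero E F (Nat.land It (Nat.lor (Nat.lor tb.b g3) z)), und,
    pick BR E F und sgl any (Nat.land It tb.a) c s, O'⟩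

/-- The points in a field. -/
def fld (X j : ℕ) : Finset (Fin 91) := Finset.univ.filter fun p => bt X j p.val = true

theorem mem_fld {X j : ℕ} {p : Fin 91} : p ∈ fld X j ↔ bt X j p.val = true := by simp [fld]

/-- The number of the bits at `p` and at `p + d` for `d` in the list. -/
def num (X j p : ℕ) (ds : List ℕ) : ℕ :=
  (bt X j p).toNat + ds.countP fun d => bt X j ((p + d) % 91)

theorem card_filter_list {L : List (Fin 91)} (hL : L.Nodup) (f : Fin 91 → Bool) :
    (Finset.univ.filter fun p => p ∈ L ∧ f p = true).card = L.countP f := by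
  rw [List.countP_eq_length_filter, ← List.toFinset_card_of_nodup (hL.filter f)]
  congr 1
  ext p
  simp

theorem countP_add (X j : ℕ) (l : Fin 91) (L : List (Fin 91)) :
    ((0 :: L).map (l + ·)).countP (fun p => bt X j p.val) = num X j l.val (L.map Fin.val) := by
  rw [num, List.countP_map, List.countP_map, List.countP_cons, add_comm]
  congr 1
  simp only [Function.comp_apply, add_zero]
  cases bt X j l.val <;> rfl

/-- The points of `l` are its translates by the difference set. So the number of points on `l` is a
sum over rotated copies, read off at position `l`. The list `dp` of negatives serves in the same way
for the lines through a point. -/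
theorem card_points (X j : ℕ) (l : Fin 91) :
    (Finset.univ.filter fun p => inc l p = true ∧ bt X j p.val = true).card = num X j l.val dl := by
  simp only [inc_iff_pointsOn]
  rw [card_filter_list (pointsOn_nodup l) (fun p => bt X j p.val)]
  exact countP_add X j l [1, 3, 9, 27, 49, 56, 61, 77, 81]

theorem card_lines (X j : ℕ) (p : Fin 91) :
    (Finset.univ.filter fun l => inc l p = true ∧ bt X j l.val = true).card = num X j p.val dp := by
  simp only [inc_iff_linesOn]
  rw [card_filter_list (linesOn_nodup p) (fun p => bt X j p.val)]
  exact countP_add X j p [90, 88, 82, 64, 42, 35, 30, 14, 10]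

theorem card_trc_fld (X j : ℕ) (l : Fin 91) : (trc (fld X j) l).card = num X j l.val dl := by
  rw [← card_points]
  congr 1
  ext p
  simp [trc, mem_fld, and_comm]

/-- All entries are possible arguments of rotations. -/
def Good (ds : List ℕ) : Prop := ∀ d ∈ ds, 0 < d ∧ d < 91

theorem good_dl : Good dl := by unfold Good; decide

theorem good_dp : Good dp := by unfold Good; decide

/-! ### Counting with rotated copies -/

section counts

theorem bt_orG {N j : ℕ} (hj : j < N) {p : ℕ} (hp : p < 91) (X : ℕ) {ds : List ℕ} (h : Good ds) :
    bt (orG (ones N) X ds) j p = decide (1 ≤ num X j p ds) := by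
  have key : ∀ (ds : List ℕ), Good ds → ∀ (a k : ℕ), bt a j p = decide (1 ≤ k) →
      bt (ds.foldl (fun a d => Nat.lor a (rot (ones N) d X)) a) j p =
        decide (1 ≤ k + ds.countP fun d => bt X j ((p + d) % 91)) := by
    intro ds
    induction ds with
    | nil => intro _ a k h; simpa using h
    | cons d ds ih =>
      intro hg a k h
      obtain ⟨h0, h1⟩ := hg d List.mem_cons_self
      rw [List.foldl_cons, ih (fun e he => hg e (List.mem_cons_of_mem d he)) _
        (k + (bt X j ((p + d) % 91)).toNat), List.countP_cons]
      · cases bt X j ((p + d) % 91) <;> simp <;> omega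
      · rw [bt_lor, h, bt_rot h0 h1 X j hp]
        cases bt X j ((p + d) % 91) <;> simp [hj]
  exact key ds h X _ (by cases bt X j p <;> simp)

/-- The two bits form a unary counter that saturates at two; the induction carries the number k of
copies counted so far. `bt_thr3` differs only by one more bit. -/
theorem bt_thr2 {N j : ℕ} (hj : j < N) {p : ℕ} (hp : p < 91) (X : ℕ) {ds : List ℕ} (h : Good ds) :
    bt (thr2 (ones N) X ds).a j p = decide (1 ≤ num X j p ds) ∧
    bt (thr2 (ones N) X ds).b j p = decide (2 ≤ num X j p ds) ∧
    bt (thr2 (ones N) X ds).c j p = false := by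
  have key : ∀ (ds : List ℕ), Good ds → ∀ (q : Un) (k : ℕ), bt q.a j p = decide (1 ≤ k) →
      bt q.b j p = decide (2 ≤ k) → bt q.c j p = false →
      let r := ds.foldl (fun q d => q.inc2 (rot (ones N) d X)) q
      let n := k + ds.countP fun d => bt X j ((p + d) % 91)
      bt r.a j p = decide (1 ≤ n) ∧ bt r.b j p = decide (2 ≤ n) ∧ bt r.c j p = false := by
    intro ds
    induction ds with
    | nil => intro _ q k ha hb hc; exact ⟨ha, hb, hc⟩
    | cons d ds ih =>
      intro hg q k ha hb hc
      obtain ⟨h0, h1⟩ := hg d List.mem_cons_self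
      have := ih (fun e he => hg e (List.mem_cons_of_mem d he)) (q.inc2 (rot (ones N) d X))
        (k + (bt X j ((p + d) % 91)).toNat) ?_ ?_ (bt_zero j p)
      · have e : k + (bt X j ((p + d) % 91)).toNat + ds.countP (fun d => bt X j ((p + d) % 91)) =
            k + (d :: ds).countP (fun d => bt X j ((p + d) % 91)) := by
          rw [List.countP_cons]; cases bt X j ((p + d) % 91) <;> simp; omega
        rw [e] at this
        exact this
      · rw [Un.inc2, bt_lor, ha, bt_rot h0 h1 X j hp]
        cases bt X j ((p + d) % 91) <;> simp [hj]
      · rw [Un.inc2, bt_lor, bt_land, ha, hb, bt_rot h0 h1 X j hp]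
        cases bt X j ((p + d) % 91) <;> simp [hj]
        grind
  exact key ds h ⟨X, 0, 0⟩ _ (by cases bt X j p <;> simp)
    (by cases bt X j p <;> simp [bt_zero]) (bt_zero j p)

theorem bt_thr3 {N j : ℕ} (hj : j < N) {p : ℕ} (hp : p < 91) (X : ℕ) {ds : List ℕ} (h : Good ds) :
    bt (thr3 (ones N) X ds).a j p = decide (1 ≤ num X j p ds) ∧
    bt (thr3 (ones N) X ds).b j p = decide (2 ≤ num X j p ds) ∧
    bt (thr3 (ones N) X ds).c j p = decide (3 ≤ num X j p ds) := by
  have key : ∀ (ds : List ℕ), Good ds → ∀ (q : Un) (k : ℕ), bt q.a j p = decide (1 ≤ k) →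
      bt q.b j p = decide (2 ≤ k) → bt q.c j p = decide (3 ≤ k) →
      let r := ds.foldl (fun q d => q.inc3 (rot (ones N) d X)) q
      let n := k + ds.countP fun d => bt X j ((p + d) % 91)
      bt r.a j p = decide (1 ≤ n) ∧ bt r.b j p = decide (2 ≤ n) ∧
        bt r.c j p = decide (3 ≤ n) := by
    intro ds
    induction ds with
    | nil => intro _ q k ha hb hc; exact ⟨ha, hb, hc⟩
    | cons d ds ih =>
      intro hg q k ha hb hc
      obtain ⟨h0, h1⟩ := hg d List.mem_cons_self
      have := ih (fun e he => hg e (List.mem_cons_of_mem d he)) (q.inc3 (rot (ones N) d X))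
        (k + (bt X j ((p + d) % 91)).toNat) ?_ ?_ ?_
      · have e : k + (bt X j ((p + d) % 91)).toNat + ds.countP (fun d => bt X j ((p + d) % 91)) =
            k + (d :: ds).countP (fun d => bt X j ((p + d) % 91)) := by
          rw [List.countP_cons]; cases bt X j ((p + d) % 91) <;> simp; omega
        rw [e] at this
        exact this
      · rw [Un.inc3, bt_lor, ha, bt_rot h0 h1 X j hp]
        cases bt X j ((p + d) % 91) <;> simp [hj]
      · rw [Un.inc3, bt_lor, bt_land, ha, hb, bt_rot h0 h1 X j hp]
        cases bt X j ((p + d) % 91) <;> simp [hj]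
        grind
      · rw [Un.inc3, bt_lor, bt_land, hb, hc, bt_rot h0 h1 X j hp]
        cases bt X j ((p + d) % 91) <;> simp [hj]
        grind
  exact key ds h ⟨X, 0, 0⟩ _ (by cases bt X j p <;> simp)
    (by cases bt X j p <;> simp [bt_zero]) (by cases bt X j p <;> simp [bt_zero])

/-- The number with the given binary digits. -/
def bval (a b c d : Bool) : ℕ := a.toNat + 2 * b.toNat + 4 * c.toNat + 8 * d.toNat

theorem bval_inc : ∀ a b c d t : Bool, bval a b c d + t.toNat < 16 →
    bval (a ^^ t) (b ^^ (a && t)) (c ^^ (b && (a && t))) (d || (c && (b && (a && t)))) =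
      bval a b c d + t.toNat := by decide

/-- A ripple carry counter, worked in parallel at all positions of all fields. Fewer than 15
rotations and the unrotated copy keep it below 16, so four digits suffice. -/
theorem bt_cnt {N j : ℕ} (hj : j < N) {p : ℕ} (hp : p < 91) (X : ℕ) {ds : List ℕ} (h : Good ds)
    (hl : ds.length < 15) : bval (bt (cnt (ones N) X ds).a j p) (bt (cnt (ones N) X ds).b j p)
      (bt (cnt (ones N) X ds).c j p) (bt (cnt (ones N) X ds).d j p) = num X j p ds := by
  have key : ∀ (ds : List ℕ), Good ds → ∀ q : Bi,
      bval (bt q.a j p) (bt q.b j p) (bt q.c j p) (bt q.d j p) + ds.length < 16 →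
      let r := ds.foldl (fun q d => q.inc (rot (ones N) d X)) q
      bval (bt r.a j p) (bt r.b j p) (bt r.c j p) (bt r.d j p) =
        bval (bt q.a j p) (bt q.b j p) (bt q.c j p) (bt q.d j p) +
          ds.countP fun d => bt X j ((p + d) % 91) := by
    intro ds
    induction ds with
    | nil => intro _ q _; rfl
    | cons d ds ih =>
      intro hg q hq
      obtain ⟨h0, h1⟩ := hg d List.mem_cons_self
      have e : bval (bt (q.inc (rot (ones N) d X)).a j p) (bt (q.inc (rot (ones N) d X)).b j p)
          (bt (q.inc (rot (ones N) d X)).c j p) (bt (q.inc (rot (ones N) d X)).d j p) =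
          bval (bt q.a j p) (bt q.b j p) (bt q.c j p) (bt q.d j p) +
            (bt X j ((p + d) % 91)).toNat := by
        simp only [Bi.inc, bt_lor, bt_xor, bt_land, bt_rot h0 h1 X j hp, hj, decide_true,
          Bool.true_and]
        rw [bval_inc]
        have : (bt X j ((p + d) % 91)).toNat ≤ 1 := Bool.toNat_le _
        simp only [List.length_cons] at hq
        omega
      have h3 : (bt X j ((p + d) % 91)).toNat ≤ 1 := Bool.toNat_le _
      have := ih (fun e he => hg e (List.mem_cons_of_mem d he)) (q.inc (rot (ones N) d X)) (by
        rw [e]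
        simp only [List.length_cons] at hq
        omega)
      simp only at this ⊢
      rw [List.foldl_cons, this, e, List.countP_cons]
      cases bt X j ((p + d) % 91) <;> simp <;> omega
  have h3 : (bt X j p).toNat ≤ 1 := Bool.toNat_le _
  have h4 : bval (bt X j p) false false false = (bt X j p).toNat := by simp [bval]
  have := key ds h ⟨X, 0, 0, 0⟩ (by simp only [bt_zero]; omega)
  simp only [bt_zero, h4] at this
  exact this

end counts

theorem bt_spread {N j : ℕ} (hj : j < N) {p : ℕ} (hp : p < 91) (X k : ℕ) :
    bt (spread (ones N) X k) j p = bt X j k := by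
  have hV : Flags N (Nat.land (Nat.shiftRight X k) (ones N)) := by
    intro j p hp h
    rw [bt_land, bt_ones N j hp] at h
    simp only [Bool.and_eq_true, decide_eq_true_eq] at h
    exact h.2
  rw [spread, bt_mul_flags (b91_eq ▸ pm_lt (by norm_num)) hV j (by omega), bt_land,
    bt_ones N j (by norm_num), testBit_b91]
  simp only [hj, hp, decide_true, Bool.and_true]
  change (X >>> k).testBit _ = _
  rw [Nat.testBit_shiftRight, bt]
  congr 1; omega

theorem cap_eq (X j : ℕ) : cap X j = bval (bt X j 91) (bt X j 92) (bt X j 93) (bt X j 94) := by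
  have h : ∀ k < 13, bt X j (91 + k) = decide (field X j / 2 ^ 91 / 2 ^ k % 2 = 1) := by
    intro k hk
    have := testBit_field X j (91 + k)
    rw [Nat.testBit_eq_decide_div_mod_eq, pow_add, ← Nat.div_div_eq_div_mul] at this
    rw [this]
    have : 91 + k < 104 := by omega
    simp [this]
  have h0 := h 0 (by norm_num)
  have h1 := h 1 (by norm_num)
  have h2 := h 2 (by norm_num)
  have h3 := h 3 (by norm_num)
  simp only [Nat.add_zero, Nat.reduceAdd] at h0 h1 h2 h3
  rw [cap, h0, h1, h2, h3]
  generalize field X j / 2 ^ 91 = m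
  simp only [bval, Bool.toNat]
  norm_num
  simp only [Bool.cond_decide]
  split_ifs <;> omega

end PG2

namespace PG2

/-- The set `s` contains the points of field `j` of `I`, no point of field `j` of `O`, and
its number of further points is less than the number in field `j` of `I`. -/
structure Fits (s : Finset (Fin 91)) (I O j : ℕ) : Prop where
  sub : fld I j ⊆ s
  out : ∀ p ∈ fld O j, p ∉ s
  card : s.card + 1 ≤ (fld I j).card + cap I j

/-- The Boolean expressions of `round` written out for single bits: equality with the capacity,
excess over the capacity by a comparison that starts at the lowest digit, value zero, and value one.
-/
theorem compare_digits : ∀ a b c d a' b' c' d' : Bool,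
    (((((a ^^ a') || (b ^^ b')) || ((c ^^ c') || (d ^^ d'))) = false) →
      bval a b c d = bval a' b' c' d') ∧
    (((d ^^ d') && d || ((((c ^^ c') && c || ((((b ^^ b') && b || (((a ^^ a') && a) ^^
      (((a ^^ a') && a) && (b ^^ b')))) ^^ (((b ^^ b') && b || (((a ^^ a') && a) ^^
      (((a ^^ a') && a) && (b ^^ b')))) && (c ^^ c'))))) ^^ (((c ^^ c') && c ||
      ((((b ^^ b') && b || (((a ^^ a') && a) ^^ (((a ^^ a') && a) && (b ^^ b')))) ^^
      (((b ^^ b') && b || (((a ^^ a') && a) ^^ (((a ^^ a') && a) && (b ^^ b')))) &&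
      (c ^^ c'))))) && (d ^^ d'))))) = true →
      bval a' b' c' d' < bval a b c d) ∧
    (((b || (c || d)) || a) = false → bval a b c d = 0) ∧
    (((b || (c || d)) || (a ^^ true)) = false → bval a b c d = 1) := by decide +kernel

theorem one_le_num_dl {X j : ℕ} {l : Fin 91} :
    1 ≤ num X j l.val dl ↔ ∃ p : Fin 91, inc l p = true ∧ bt X j p.val = true := by
  rw [← card_points, Nat.succ_le_iff, Finset.card_pos]
  simp [Finset.Nonempty]

theorem one_le_num_dp {X j : ℕ} {p : Fin 91} :
    1 ≤ num X j p.val dp ↔ ∃ l : Fin 91, inc l p = true ∧ bt X j l.val = true := by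
  rw [← card_lines, Nat.succ_le_iff, Finset.card_pos]
  simp [Finset.Nonempty]

theorem bt_diff (X Y j p : ℕ) : bt (diff X Y) j p = (bt X j p && !bt Y j p) := by
  rw [diff, bt_xor, bt_land]
  cases bt X j p <;> cases bt Y j p <;> rfl

theorem bt_of_low {E F X j p : ℕ} (h : bt (low E F X) j p = true) : bt X j p = true := by
  simp only [low, bt_land, Bool.and_eq_true] at h
  exact h.1.1

theorem low_inj {N X j p q : ℕ} (hp : p < 104) (hq : q < 104)
    (h1 : bt (low (ones N) (mask N) X) j p = true) (h2 : bt (low (ones N) (mask N) X) j q = true) :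
    p = q := by
  rcases lt_trichotomy p q with h | h | h
  · exact (low_unique N X h hq h1 h2).elim
  · exact h
  · exact (low_unique N X h hp h2 h1).elim

theorem bt_of_minSel {E F Z s j p : ℕ} (h : bt (minSel E F Z s) j p = true) : bt Z j p = true := by
  simp only [minSel, bt_lor, bt_diff, Bool.or_eq_true, Bool.and_eq_true] at h
  exact h.elim And.left And.left

theorem flags_nonzero {N X : ℕ} (hX : Clean N X) : Flags N (nonzero (ones N) (mask N) X) :=
  fun j _ hp h => by
    rw [bt_nonzero hX j hp] at h
    exact ⟨h.2.1, h.1⟩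

theorem Clean.diff {N X : ℕ} (h : Clean N X) (Y : ℕ) : Clean N (diff X Y) :=
  fun j p hp hb => h j p hp (by rw [bt_diff, Bool.and_eq_true] at hb; exact hb.1)

theorem Flags.diff {N X : ℕ} (h : Flags N X) (Y : ℕ) : Flags N (PG2.diff X Y) :=
  fun j p hp hb => h j p hp (by rw [bt_diff, Bool.and_eq_true] at hb; exact hb.1)

/-- The points chosen by `pick`. -/
theorem pick_cases {BR N und sgl any bp : ℕ} (c h : Bi) (hund : Clean N und) (hbp : Clean N bp) :
    ∃ x y : ℕ, pick BR (ones N) (mask N) und sgl any bp c h = Nat.lor x y ∧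
      (∀ j p, bt x j p = true → bt und j p = true) ∧
      (∀ j p, bt y j p = true → bt und j p = true) ∧
      (∀ j, ∀ p < 104, ∀ q < 104, bt x j p = true → bt x j q = true → p = q) ∧
      (∀ j, ∀ p < 104, ∀ q < 104, bt y j p = true → bt y j q = true → p = q) ∧
      ∀ j < N, ∀ q : Fin 91, bt y j q.val = true → ∃ l t : Fin 91, bt sgl j l.val = true ∧
        bt any j l.val = true ∧ inc l t = true ∧ bt bp j t.val = true ∧
        ∀ u : Fin 91, inc l u = true → bt und j u.val = true → bt x j u.val = true ∨ u = q := by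
  set Z := Nat.land (Nat.land sgl (Nat.mul BR (ones N))) any with hZ
  set Z3 := low (ones N) (mask N) (minSel (ones N) (mask N) (minSel (ones N) (mask N)
    (minSel (ones N) (mask N) (minSel (ones N) (mask N) Z c.d) c.c) c.b) c.a) with hZ3
  set m := orG (ones N) Z3 dp with hm
  set C := Nat.land m und with hC
  set x := Nat.land (low (ones N) (mask N) (maxSel (ones N) (mask N) (maxSel (ones N) (mask N)
    (maxSel (ones N) (mask N) (maxSel (ones N) (mask N)
      (Nat.lor C (diff und (full (ones N) (mask N) Z))) h.d) h.c) h.b) h.a)) und with hx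
  set Y := diff C x with hY
  set Yl := low (ones N) (mask N) Y with hYl
  set w := nonzero (ones N) (mask N) (Nat.land m bp) with hw
  set v := nonzero (ones N) (mask N) (diff Y Yl) with hv
  have hCc : Clean N C := fun j p hp hb => hund j p hp (by
    rw [hC, bt_land, Bool.and_eq_true] at hb; exact hb.2)
  have hmc : Clean N (Nat.land m bp) := fun j p hp hb => hbp j p hp (by
    rw [bt_land, Bool.and_eq_true] at hb; exact hb.2)
  have hYu : ∀ j p, bt Yl j p = true → bt C j p = true ∧ bt x j p = false := by
    intro j p hb
    have := bt_of_low hb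
    rw [hY, bt_diff] at this
    simpa using this
  refine ⟨x, Nat.land Yl (Nat.mul b91 (diff w v)), rfl, fun j p hb => ?_, fun j p hb => ?_,
    fun j p hp q hq h1 h2 => ?_, fun j p hp q hq h1 h2 => ?_, fun j hj q hq => ?_⟩
  · rw [hx, bt_land, Bool.and_eq_true] at hb; exact hb.2
  · rw [bt_land, Bool.and_eq_true] at hb
    have := (hYu j p hb.1).1
    rw [hC, bt_land, Bool.and_eq_true] at this
    exact this.2
  · rw [hx, bt_land, Bool.and_eq_true] at h1 h2
    exact low_inj hp hq h1.1 h2.1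
  · rw [bt_land, Bool.and_eq_true] at h1 h2
    exact low_inj hp hq h1.1 h2.1
  · rw [bt_land, Bool.and_eq_true,
      bt_mul_flags (b91_eq ▸ pm_lt (by norm_num)) ((flags_nonzero hmc).diff v) j (by omega),
      Bool.and_eq_true, bt_diff, Bool.and_eq_true, bt_nonzero hmc j (by norm_num),
      Bool.not_eq_true'] at hq
    obtain ⟨hqY, ⟨⟨-, -, t, ht, htm⟩, hvj⟩, -⟩ := hq
    rw [bt_land, Bool.and_eq_true] at htm
    obtain ⟨hqC, hqx⟩ := hYu j _ hqY
    have hmem : ∀ u : Fin 91, bt m j u.val = true ↔ ∃ l : Fin 91, inc l u = true ∧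
        bt Z3 j l.val = true := by
      intro u
      rw [hm, bt_orG hj u.2 _ good_dp, decide_eq_true_eq, one_le_num_dp]
    obtain ⟨l, hlt, hlZ⟩ := (hmem ⟨t, ht⟩).1 htm.1
    have hZl : bt Z j l.val = true :=
      bt_of_minSel (bt_of_minSel (bt_of_minSel (bt_of_minSel (bt_of_low hlZ))))
    rw [hZ, bt_land, bt_land, Bool.and_eq_true, Bool.and_eq_true] at hZl
    refine ⟨l, ⟨t, ht⟩, hZl.1.1, hZl.2, hlt, htm.2, fun u hlu huu => ?_⟩
    have huC : bt C j u.val = true := by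
      rw [hC, bt_land, (hmem u).2 ⟨l, hlu, hlZ⟩, huu]; rfl
    cases hux : bt x j u.val
    · right
      have huY : bt Y j u.val = true := by rw [hY, bt_diff, huC, hux]; rfl
      -- If `u` were not the lowest point of `Y`, then `Y` would have a second point and the flag
      -- `v` would have suppressed the second branching point.
      have huYl : bt Yl j u.val = true := by
        by_contra hcon
        have : bt v j 0 = true := by
          rw [hv, bt_nonzero ((hCc.diff x).diff Yl) j (by norm_num)]
          refine ⟨rfl, hj, u.val, u.2, ?_⟩
          rw [bt_diff, huY]
          simpa using hcon
        rw [this] at hvj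
        simp at hvj
      exact Fin.ext (low_inj (by omega) (by omega) huYl hqY)
    · exact Or.inl rfl

theorem clean_round_und (N X Y : ℕ) :
    Clean N (Nat.xor (mask N) (Nat.land (mask N) (Nat.lor X Y))) := by
  intro j p hp hb
  rw [bt_xor, bt_land] at hb
  cases hF : bt (mask N) j p
  · simp [hF] at hb
  · rw [bt_mask N j hp, Bool.and_eq_true] at hF
    simpa using hF

section round

variable {N j : ℕ} {s : Finset (Fin 91)} {cap3 : Bool} {I O : ℕ}

/-- Each mask of `round` matches one of the facts on free lines, and the proof only translates bits.
For the second branching point, consider a chosen point with a blocked free line, which is its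
tangent. If both undecided points on another free line at it were outside `s`, this line would be a
second tangent. Nothing depends on `BR`, which merely steers the choice of the points. -/
theorem round_spec (BR : ℕ) (hj : j < N) (hs : SO s)
    (hcap : cap3 = true → ∀ l, (trc s l).card ≤ 3) (h : Fits s I O j) :
    let r := round cap3 BR (ones N) (mask N) I O
    bt r.dead j 0 = false ∧ (∀ p ∈ fld r.O j, p ∉ s) ∧
      (∀ p < 91, bt r.und j p = !(bt I j p || bt r.O j p)) ∧
      ∀ p q : Fin 91, bt r.x j p.val = true → bt r.x j q.val = true → p ≠ q → p ∉ s → q ∈ s := by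
  intro r
  set It := Nat.land I (mask N) with hIt
  have hF : ∀ p : Fin 91, bt (mask N) j p.val = true := fun p => by
    rw [bt_mask N j (by omega)]; simp [hj]
  have bIt : ∀ p : Fin 91, bt It j p.val = bt I j p.val := fun p => by
    rw [hIt, bt_land, hF, Bool.and_true]
  set A := fld I j with hA
  have hAt : fld It j = A := by ext p; rw [mem_fld, hA, mem_fld, bIt]
  have mA : ∀ p : Fin 91, bt It j p.val = true ↔ p ∈ A := fun p => by rw [bIt, hA, mem_fld]
  have hnum : ∀ l : Fin 91, num It j l.val dl = (trc A l).card := fun l => by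
    rw [← card_trc_fld, hAt]
  set ts := cond cap3 (thr3 (ones N) It dl) (thr2 (ones N) It dl) with hts
  have hts1 : ∀ l : Fin 91, bt ts.a j l.val = decide (1 ≤ (trc A l).card) ∧
      bt ts.b j l.val = decide (2 ≤ (trc A l).card) ∧
      (bt ts.c j l.val = true → cap3 = true ∧ 3 ≤ (trc A l).card) := by
    intro l
    rw [← hnum, hts]
    cases cap3 with
    | true =>
      obtain ⟨h1, h2, h3⟩ := bt_thr3 hj l.2 It good_dl
      exact ⟨h1, h2, fun h => ⟨rfl, by simpa [h3] using h⟩⟩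
    | false =>
      obtain ⟨h1, h2, h3⟩ := bt_thr2 hj l.2 It good_dl
      exact ⟨h1, h2, fun h => by simp [h3] at h⟩
  set sgl := Nat.xor ts.a ts.b with hsgl
  have bsgl : ∀ l : Fin 91, bt sgl j l.val = true ↔ (trc A l).card = 1 := by
    intro l
    rw [hsgl, bt_xor, (hts1 l).1, (hts1 l).2.1]
    by_cases h1 : 1 ≤ (trc A l).card <;> by_cases h2 : 2 ≤ (trc A l).card <;> simp [h1, h2] <;>
      omega
  set c := cnt (ones N) sgl dp with hc
  have hcnt : ∀ p : Fin 91, bval (bt c.a j p.val) (bt c.b j p.val) (bt c.c j p.val)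
      (bt c.d j p.val) = (free A p).card := by
    intro p
    rw [hc, bt_cnt hj p.2 sgl good_dp (by decide), ← card_lines]
    congr 1
    ext l
    simp only [free, Finset.mem_filter, bsgl]
  have hcap1 := cap_eq I j
  have hsp : ∀ p : Fin 91, ∀ k, bt (spread (ones N) I k) j p.val = bt I j k :=
    fun p k => bt_spread hj p.2 I k
  set x0 := Nat.xor c.a (spread (ones N) I 91) with hx0
  set x1 := Nat.xor c.b (spread (ones N) I 92) with hx1
  set x2 := Nat.xor c.c (spread (ones N) I 93) with hx2
  set x3 := Nat.xor c.d (spread (ones N) I 94) with hx3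
  set tight := Nat.xor It (Nat.land It (Nat.lor (Nat.lor x0 x1) (Nat.lor x2 x3))) with htight
  -- No binary digit of the number of free lines differs from that of the capacity.
  have btight : ∀ p : Fin 91, bt tight j p.val = true → p ∈ A ∧ (free A p).card = cap I j := by
    intro p hp
    simp only [htight, hx0, hx1, hx2, hx3, bt_xor, bt_land, bt_lor, hsp] at hp
    cases hb : bt It j p.val
    · simp [hb] at hp
    · rw [hb] at hp
      refine ⟨(mA p).1 hb, ?_⟩
      rw [← hcnt, hcap1]
      refine (compare_digits _ _ _ _ _ _ _ _).1 ?_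
      simpa using hp
  set hi := Nat.lor c.b (Nat.lor c.c c.d) with hhi
  set e1 := Nat.xor It (Nat.land It (Nat.lor hi (Nat.xor c.a (mask N)))) with he1
  have be1 : ∀ p : Fin 91, bt e1 j p.val = true → p ∈ A ∧ (free A p).card = 1 := by
    intro p hp
    simp only [he1, hhi, bt_xor, bt_land, bt_lor, hF] at hp
    cases hb : bt It j p.val
    · simp [hb] at hp
    · rw [hb] at hp
      refine ⟨(mA p).1 hb, ?_⟩
      rw [← hcnt]
      refine (compare_digits _ _ _ _ false false false false).2.2.2 ?_
      simpa using hp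
  set g0 := Nat.land x0 c.a with hg0
  set g1 := Nat.lor (Nat.land x1 c.b) (Nat.xor g0 (Nat.land g0 x1)) with hg1
  set g2 := Nat.lor (Nat.land x2 c.c) (Nat.xor g1 (Nat.land g1 x2)) with hg2
  set g3 := Nat.lor (Nat.land x3 c.d) (Nat.xor g2 (Nat.land g2 x3)) with hg3
  -- The comparator would report more free lines than the capacity permits.
  have bg3 : ∀ p : Fin 91, p ∈ A → bt g3 j p.val = false := by
    intro p hp
    by_contra hb
    rw [Bool.not_eq_false] at hb
    simp only [hg3, hg2, hg1, hg0, hx0, hx1, hx2, hx3, bt_xor, bt_land, bt_lor, hsp] at hb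
    have h1 := (compare_digits _ _ _ _ _ _ _ _).2.1 hb
    rw [hcnt, ← hcap1] at h1
    have : (free A p).card ≤ cap I j := free_le hs h.sub hp h.card
    omega
  set z := Nat.xor (mask N) (Nat.lor hi c.a) with hz
  have bz : ∀ p : Fin 91, p ∈ A → bt z j p.val = false := by
    intro p hp
    by_contra hb
    rw [Bool.not_eq_false] at hb
    simp only [hz, hhi, bt_xor, bt_lor, hF] at hb
    have h1 := (compare_digits (bt c.a j p.val) (bt c.b j p.val) (bt c.c j p.val) (bt c.d j p.val)
      false false false false).2.2.1 (by simpa using hb)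
    rw [hcnt] at h1
    have : 0 < (free A p).card := free_pos hs h.sub hp
    omega
  set lo := Nat.lor (Nat.lor (Nat.land (orG (ones N) tight dl) ts.b)
    (Nat.land (orG (ones N) e1 dl) sgl)) ts.c with hlo
  have blo : ∀ l : Fin 91, bt lo j l.val = true → ∀ q, inc l q = true → q ∉ A → q ∉ s := by
    intro l hl q hq hqA
    rw [hlo, bt_lor, bt_lor, bt_land, bt_land, bt_orG hj l.2 _ good_dl, bt_orG hj l.2 _ good_dl,
      (hts1 l).2.1, Bool.or_eq_true, Bool.or_eq_true, Bool.and_eq_true, Bool.and_eq_true,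
      decide_eq_true_eq, decide_eq_true_eq, decide_eq_true_eq, one_le_num_dl, one_le_num_dl,
      bsgl] at hl
    rcases hl with (⟨⟨p, hpl, hp⟩, h2⟩ | ⟨⟨p, hpl, hp⟩, h1⟩) | h3
    · exact notMem_of_tight hs h.sub (btight p hp).1 h.card (btight p hp).2 hpl h2 hq hqA
    · exact notMem_of_free_one hs h.sub (be1 p hp).1 (be1 p hp).2 hpl h1 hq hqA
    · exact notMem_of_cap h.sub (hcap ((hts1 l).2.2 h3).1) ((hts1 l).2.2 h3).2 hq hqA
  set no := orG (ones N) lo dp with hno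
  set O' := Nat.lor O (Nat.xor no (Nat.land no It)) with hO'
  have bO' : ∀ p ∈ fld O' j, p ∉ s := by
    intro p hp
    rw [mem_fld, hO', bt_lor, bt_xor, bt_land, Bool.or_eq_true] at hp
    rcases hp with hp | hp
    · exact h.out p (mem_fld.2 hp)
    · cases hb : bt It j p.val
      · rw [hb, hno, bt_orG hj p.2 _ good_dp, Bool.and_false, Bool.xor_false, decide_eq_true_eq,
          one_le_num_dp] at hp
        obtain ⟨l, hl, hlb⟩ := hp
        exact blo l hlb p hl fun hpA => by rw [(mA p).2 hpA] at hb; simp at hb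
      · simp [hb] at hp
  set und := Nat.xor (mask N) (Nat.land (mask N) (Nat.lor It O')) with hund
  have bund : ∀ p : Fin 91, bt und j p.val = !(bt I j p.val || bt O' j p.val) := by
    intro p
    rw [hund, bt_xor, bt_land, bt_lor, hF, bIt]
    simp
  set w := cnt (ones N) und dl with hw
  set any := Nat.lor (Nat.lor w.a w.b) (Nat.lor w.c w.d) with hany
  have bany : ∀ l : Fin 91, bt any j l.val = false →
      ∀ q : Fin 91, inc l q = true → bt und j q.val = false := by
    intro l hl q hq
    have h1 := bt_cnt hj l.2 und good_dl (by decide)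
    rw [← hw] at h1
    rw [hany, bt_lor, bt_lor, bt_lor] at hl
    simp only [Bool.or_eq_false_iff] at hl
    rw [hl.1.1, hl.1.2, hl.2.1, hl.2.2] at h1
    by_contra hcon
    rw [Bool.not_eq_false] at hcon
    have := one_le_num_dl.2 ⟨q, hq, hcon⟩
    rw [← h1] at this
    simp [bval] at this
  set bl := Nat.xor sgl (Nat.land sgl any) with hbl
  -- A line with one chosen point and no undecided ones: its remaining points are all excluded.
  have bbl : ∀ l : Fin 91, bt bl j l.val = true → (trc A l).card = 1 ∧
      ∀ q, inc l q = true → q ∉ A → q ∉ s := by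
    intro l hl
    rw [hbl, bt_xor, bt_land] at hl
    cases hb : bt sgl j l.val
    · simp [hb] at hl
    · simp only [hb, Bool.true_and, Bool.true_xor, Bool.not_eq_true'] at hl
      refine ⟨(bsgl l).1 hb, fun q hq hqA => ?_⟩
      have h1 := bany l hl q hq
      rw [bund] at h1
      have h2 : bt I j q.val = false := by
        by_contra hcon
        exact hqA (mem_fld.2 (by simpa using hcon))
      simp only [h2, Bool.false_or, Bool.not_eq_false'] at h1
      exact bO' q (mem_fld.2 h1)
  set tb := thr2 (ones N) bl dp with htb
  have btb : ∀ p : Fin 91, p ∈ A → bt tb.b j p.val = false := by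
    intro p hp
    rw [htb, (bt_thr2 hj p.2 bl good_dp).2.1, decide_eq_false_iff_not, ← card_lines]
    intro hcon
    obtain ⟨l, hl, m, hm, hlm⟩ := Finset.one_lt_card.1 hcon
    simp only [Finset.mem_filter, Finset.mem_univ, true_and] at hl hm
    obtain ⟨hl1, hlb⟩ := bbl l hl.2
    obtain ⟨hm1, hmb⟩ := bbl m hm.2
    exact hlm (blocked_unique hs h.sub hp hl.1 hl1 hlb hm.1 hm1 hmb)
  refine ⟨?_, bO', fun p hp => bund ⟨p, hp⟩, ?_⟩
  · change bt (nonzero (ones N) (mask N) (Nat.land It (Nat.lor (Nat.lor tb.b g3) z))) j 0 = false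
    by_contra hcon
    rw [Bool.not_eq_false, bt_nonzero ((clean_land_mask N I).land _) j (by norm_num)] at hcon
    obtain ⟨-, -, q, hq, hb⟩ := hcon
    have hqA : bt It j (⟨q, hq⟩ : Fin 91).val = true := by
      rw [bt_land, Bool.and_eq_true] at hb; exact hb.1
    have h1 := (mA _).1 hqA
    rw [bt_land, bt_lor, bt_lor, btb ⟨q, hq⟩ h1, bg3 ⟨q, hq⟩ h1, bz ⟨q, hq⟩ h1] at hb
    simp at hb
  · obtain ⟨x, y, hxy, -, -, hx, hy, hline⟩ := pick_cases (BR := BR) (sgl := sgl) (any := any)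
      w c (clean_round_und N It O') ((clean_land_mask N I).land tb.a)
    change ∀ p q : Fin 91, bt (pick BR (ones N) (mask N) und sgl any (Nat.land It tb.a) w c) j p = true
      → bt (pick BR (ones N) (mask N) und sgl any (Nat.land It tb.a) w c) j q = true → _
    rw [hxy]
    -- With both points outside `s`, the line `l` through the chosen point `t` is blocked. It then
    -- equals the line `m` at `t` that is blocked already, but `l` still has undecided points.
    have key : ∀ p q : Fin 91, bt x j p.val = true → bt y j q.val = true → p ∉ s → q ∉ s → False := by
      intro p q hp hq hps hqs
      obtain ⟨l, t, hls, hla, hlt, htb', hu⟩ := hline j hj q hq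
      rw [bt_land, Bool.and_eq_true, mA, htb, (bt_thr2 hj t.2 bl good_dp).1, decide_eq_true_eq,
        one_le_num_dp] at htb'
      obtain ⟨htA, m, hmt, hm⟩ := htb'
      have hlb : ∀ u, inc l u = true → u ∉ A → u ∉ s := by
        intro u hlu huA
        cases hb : bt und j u.val
        · rw [bund] at hb
          have h2 : bt I j u.val = false := by
            by_contra hcon
            exact huA (mem_fld.2 (by simpa using hcon))
          simp only [h2, Bool.false_or, Bool.not_eq_false'] at hb
          exact bO' u (mem_fld.2 hb)
        · rcases hu u hlu hb with h1 | rfl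
          · rwa [Fin.ext (hx j _ (by omega) _ (by omega) h1 hp)]
          · exact hqs
      obtain ⟨hm1, hmb⟩ := bbl m hm
      have := blocked_unique hs h.sub htA hlt ((bsgl l).1 hls) hlb hmt hm1 hmb
      subst this
      rw [hbl, bt_xor, bt_land, hls, hla] at hm
      simp at hm
    intro p q hp hq hpq hps
    by_contra hqs
    rw [bt_lor, Bool.or_eq_true] at hp hq
    rcases hp with hp | hp <;> rcases hq with hq | hq
    · exact hpq (Fin.ext (hx j _ (by omega) _ (by omega) hp hq))
    · exact key p q hp hq hps hqs
    · exact key q p hq hp hqs hps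
    · exact hpq (Fin.ext (hy j _ (by omega) _ (by omega) hp hq))

/-- The two parts of `pick` contribute at most one bit each to a field, so among three branching
points two coincide. -/
theorem round_x {BR N I O : ℕ} {cap3 : Bool} {j p : ℕ} (hp : p < 104) :
    let r := round cap3 BR (ones N) (mask N) I O
    bt r.x j p = true → bt r.und j p = true ∧ ∀ q < 104, ∀ t < 104, bt r.x j q = true →
      bt r.x j t = true → p = q ∨ q = t ∨ p = t := by
  intro r h1
  obtain ⟨und, sgl, any, bp, c, h, hund, hbp, h2, h3⟩ : ∃ (und sgl any bp : ℕ) (c h : Bi),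
      Clean N und ∧ Clean N bp ∧ r.und = und ∧
        r.x = pick BR (ones N) (mask N) und sgl any bp c h :=
    ⟨_, _, _, _, _, _, clean_round_und N _ _, (clean_land_mask N I).land _, rfl, rfl⟩
  obtain ⟨x, y, hxy, hxu, hyu, hx, hy, -⟩ := pick_cases (BR := BR) (sgl := sgl) (any := any)
    c h hund hbp
  rw [h3, hxy, bt_lor, Bool.or_eq_true] at h1
  rw [h2, h3, hxy]
  refine ⟨h1.elim (hxu j p) (hyu j p), fun q hq t ht hbq hbt => ?_⟩
  rw [bt_lor, Bool.or_eq_true] at hbq hbt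
  rcases h1 with h1 | h1 <;> rcases hbq with hbq | hbq <;> rcases hbt with hbt | hbt
  · exact Or.inl (hx j p hp q hq h1 hbq)
  · exact Or.inl (hx j p hp q hq h1 hbq)
  · exact Or.inr (Or.inr (hx j p hp t ht h1 hbt))
  · exact Or.inr (Or.inl (hy j q hq t ht hbq hbt))
  · exact Or.inr (Or.inl (hx j q hq t ht hbq hbt))
  · exact Or.inr (Or.inr (hy j p hp t ht h1 hbt))
  · exact Or.inl (hy j p hp q hq h1 hbq)
  · exact Or.inl (hy j p hp q hq h1 hbq)

end round

end PG2

namespace PG2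

/-! ### The packed search -/

/-- Four packed numbers: flags, chosen points, excluded points, points to branch on. -/
structure Quad where
  V : ℕ
  I : ℕ
  O : ℕ
  X : ℕ

/-- Sums of the fields up to each field. -/
def prefixSums (N : ℕ) : ℕ → ℕ → ℕ → ℕ
  | 0, _, y => y
  | f + 1, s, y => cond (Nat.ble N s) y
      (prefixSums N f (Nat.mul 2 s) (Nat.add y (Nat.shiftLeft y (Nat.mul 104 s))))

/-- Move the bits of `X` in the mask `M` down by `s` places. -/
def moveDown (s M X : ℕ) : ℕ :=
  let t := Nat.land X M
  Nat.lor (Nat.xor X t) (Nat.shiftRight t s)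

/-- Remove the fields without flag. The distances over which the other fields have to be moved are
expected from bit `i` of the third number on. -/
def compress (N : ℕ) : ℕ → ℕ → ℕ → Quad → Option Quad
  | 0, _, _, q => some q
  | f + 1, i, s, q => cond (Nat.ble N s) (some q)
     (let sel := Nat.land (Nat.shiftRight q.O i) q.V
      let M := Nat.mul (pm 104) sel
      let sw := Nat.mul 104 s
      let st := Nat.xor q.V sel
      let sh := Nat.shiftRight sel sw
      cond (Nat.beq (Nat.lor (Nat.land st sh) (Nat.land sel (pm sw))) 0)
        (compress N f (Nat.succ i) (Nat.mul 2 s)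
          ⟨Nat.lor st sh, moveDown sw M q.I, moveDown sw M q.O, moveDown sw M q.X⟩) none)

/-- The fields of `I`, among the first `N` ones, at the flags `V`. -/
def extract : ℕ → ℕ → ℕ → ℕ → List ℕ → Option (List ℕ)
  | 0, _, _, _, _ => none
  | f + 1, N, V, I, acc => cond (Nat.beq V 0) (some acc)
      (cond (Nat.beq N 1) (some (Nat.land I b91 :: acc))
        (let h := Nat.div N 2
        let s := Nat.mul 104 h
        match extract f (Nat.sub N h) (Nat.shiftRight V s) (Nat.shiftRight I s) acc with
        | none => none
        | some a => extract f h (Nat.land V (pm s)) (Nat.land I (pm s)) a))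

/-- A number of states. -/
structure Batch where
  N : ℕ
  I : ℕ
  O : ℕ

/-- One round for all states of a batch: the batch of the states that result by branching, and the
list of the states in which all points are decided. If there are two points to branch on, then the
second one is chosen where the first one is excluded. -/
def proc (cap3 : Bool) (BR : ℕ) (b : Batch) : Option (Batch × List ℕ) :=
  let N := b.N
  let E := ones N
  let F := mask N
  let I := Nat.land b.I (Nat.mul (pm 95) E)
  let r := round cap3 BR E F I b.O
  let al := Nat.xor E r.dead
  let V := Nat.land al (nonzero E F r.und)
  let kd := prefixSums N 20 1 (Nat.xor E V)
  let c := Nat.sub N (Nat.land (Nat.shiftRight kd (Nat.mul 104 (Nat.sub N 1))) (pm 104))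
  let M := Nat.mul (pm 104) V
  match extract 40 N (Nat.xor al V) I [],
    compress N 20 91 1 ⟨V, Nat.land I M,
      Nat.land (Nat.lor (Nat.land r.O F)
        (Nat.land (Nat.shiftLeft kd 91) (Nat.mul (Nat.xor (pm 104) b91) E))) M, Nat.land r.x M⟩ with
  | some L, some q =>
    let E2 := ones c
    let sw := Nat.mul 104 c
    let F2 := mask c
    let I2 := Nat.land q.I (Nat.mul (pm 95) E2)
    let O2 := Nat.land q.O F2
    let X2 := Nat.land q.X F2
    let x := low E2 F2 X2
    let y := diff X2 x
    cond (Nat.beq q.V E2) (cond (Nat.beq (nonzero E2 F2 x) E2)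
      (some (⟨Nat.mul 2 c, Nat.lor (Nat.lor (bump E2 (nonzero E2 F2 y) I2) y)
          (Nat.shiftLeft (Nat.lor (bump E2 E2 I2) x) sw),
        Nat.lor (Nat.lor O2 x) (Nat.shiftLeft O2 sw)⟩, L)) none) none
  | _, _ => none

/-- The first `h` states of a batch. -/
def Batch.take (b : Batch) (h : ℕ) : Batch :=
  ⟨h, Nat.land b.I (pm (Nat.mul 104 h)), Nat.land b.O (pm (Nat.mul 104 h))⟩

/-- All but the first `h` states of a batch. -/
def Batch.drop (b : Batch) (h : ℕ) : Batch :=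
  ⟨Nat.sub b.N h, Nat.shiftRight b.I (Nat.mul 104 h), Nat.shiftRight b.O (Nat.mul 104 h)⟩

/-- The search: process the batches of a list, those with more than `lim` states in parts. -/
def search (cap3 : Bool) (BR lim : ℕ) : ℕ → List Batch → List ℕ → Option (List ℕ)
  | 0, _, _ => none
  | _ + 1, [], acc => some acc
  | f + 1, b :: st, acc => cond (Nat.beq b.N 0) (search cap3 BR lim f st acc)
     (cond (Nat.ble b.N lim)
       (match proc cap3 BR b with
        | none => none
        | some r => search cap3 BR lim f (r.1 :: st) (r.2 ++ acc))
       (search cap3 BR lim f (b.take (Nat.div b.N 2) :: b.drop (Nat.div b.N 2) :: st) acc))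

theorem bt_shiftRight (X s j p : ℕ) : bt (Nat.shiftRight X (Nat.mul 104 s)) j p = bt X (j + s) p := by
  change (X >>> (104 * s)).testBit _ = _
  rw [Nat.testBit_shiftRight, bt]
  congr 1; ring

theorem bt_shiftLeft (X s j p : ℕ) (hp : p < 104) :
    bt (Nat.shiftLeft X (Nat.mul 104 s)) j p = (decide (s ≤ j) && bt X (j - s) p) := by
  change (X <<< (104 * s)).testBit _ = _
  rw [Nat.testBit_shiftLeft, bt]
  by_cases h : s ≤ j
  · have h1 : 104 * j + p - 104 * s = 104 * (j - s) + p := by omega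
    have h2 : 104 * s ≤ 104 * j + p := by omega
    rw [h1]; simp [h, h2]
  · have h2 : ¬ 104 * s ≤ 104 * j + p := by omega
    simp [h, h2]

theorem bt_pm (k j : ℕ) {p : ℕ} (hp : p < 104) : bt (pm (Nat.mul 104 k)) j p = decide (j < k) := by
  change (pm (104 * k)).testBit (104 * j + p) = _
  rw [testBit_pm]
  by_cases h : j < k
  · simp [h]; omega
  · simp [h]; omega

theorem bt_full_flags {N V : ℕ} (hV : Flags N V) (j : ℕ) {p : ℕ} (hp : p < 104) :
    bt (Nat.mul (pm 104) V) j p = bt V j 0 := by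
  rw [bt_mul_flags (pm_lt le_rfl) hV j hp, testBit_pm]
  simp [hp]

theorem eq_zero_of_beq {X : ℕ} (h : Nat.beq X 0 = true) (j p : ℕ) : bt X j p = false := by
  rw [Nat.eq_of_beq_eq_true h]; exact bt_zero j p

/-- The bits of `X` lie in fields with a flag. -/
def Supp (V X : ℕ) : Prop := ∀ j, ∀ p < 104, bt X j p = true → bt V j 0 = true

/-- The flags are flags, and all other bits lie in fields with a flag. -/
structure Quad.Inv (N : ℕ) (q : Quad) : Prop where
  V : Flags N q.V
  I : Supp q.V q.I
  O : Supp q.V q.O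
  X : Supp q.V q.X

/-- Each field of `q` with a flag appears in `r`. -/
def Quad.Into (q r : Quad) : Prop := ∀ j, bt q.V j 0 = true → ∃ k, bt r.V k 0 = true ∧
  ∀ p < 104, bt r.I k p = bt q.I j p ∧ bt r.O k p = bt q.O j p ∧ bt r.X k p = bt q.X j p

/-! ### Compaction: moving the live states together -/

section stage

variable {N s V sel : ℕ}

theorem bt_moveDown (s M X j p : ℕ) : bt (moveDown (Nat.mul 104 s) M X) j p =
    ((bt X j p && !bt M j p) || (bt X (j + s) p && bt M (j + s) p)) := by
  rw [moveDown, bt_lor, bt_xor, bt_land, bt_shiftRight, bt_land]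
  cases bt X j p <;> cases bt M j p <;> rfl

/-- The two conditions `hc1` and `hc2` say that no moved field lands on a field that stays and that
none drops below field zero. They suffice for all contents to survive, wherever the selection comes
from. -/
theorem stage (hV : Flags N V) (hsel : ∀ j p, bt sel j p = true → bt V j p = true)
    (hc1 : ∀ j p, bt (Nat.land (Nat.xor V sel) (Nat.shiftRight sel (Nat.mul 104 s))) j p = false)
    (hc2 : ∀ j p, bt (Nat.land sel (pm (Nat.mul 104 s))) j p = false) :
    let V' := Nat.lor (Nat.xor V sel) (Nat.shiftRight sel (Nat.mul 104 s))
    Flags N V' ∧ (∀ X, Supp V X → Supp V' (moveDown (Nat.mul 104 s) (Nat.mul (pm 104) sel) X)) ∧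
    ∀ j, bt V j 0 = true → ∃ k, bt V' k 0 = true ∧ ∀ X, Supp V X → ∀ p < 104,
      bt (moveDown (Nat.mul 104 s) (Nat.mul (pm 104) sel) X) k p = bt X j p := by
  intro V'
  have hself : Flags N sel := fun j p hp h => hV j p hp (hsel j p h)
  have bV' : ∀ j p, bt V' j p = ((bt V j p ^^ bt sel j p) || bt sel (j + s) p) := by
    intro j p
    rw [bt_lor, bt_xor, bt_shiftRight]
  have hM := fun j p (hp : p < 104) => bt_full_flags hself j hp
  have hd : ∀ j p, (bt V j p ^^ bt sel j p) = true → bt sel (j + s) p = true → False := by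
    intro j p h1 h2
    have := hc1 j p
    rw [bt_land, bt_xor, bt_shiftRight, h1, h2] at this
    simp at this
  have hlow : ∀ j, bt sel j 0 = true → s ≤ j := by
    intro j h
    by_contra hcon
    have := hc2 j 0
    rw [bt_land, bt_pm s j (by norm_num), h] at this
    simp at this; omega
  refine ⟨fun j p hp h => ?_, fun X hX j p hp h => ?_, fun j hj => ?_⟩
  · rw [bV'] at h
    cases h1 : bt sel (j + s) p
    · rw [h1, Bool.or_false] at h
      refine hV j p hp ?_
      cases h2 : bt V j p
      · cases h3 : bt sel j p
        · simp [h2, h3] at h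
        · rw [hsel j p h3] at h2; simp at h2
      · rfl
    · have := hself (j + s) p hp h1
      omega
  · rw [bt_moveDown, hM j p hp, hM (j + s) p hp] at h
    rw [bV']
    rw [Bool.or_eq_true, Bool.and_eq_true, Bool.and_eq_true] at h
    rcases h with ⟨h1, h2⟩ | ⟨h1, h2⟩
    · rw [hX j p hp h1]
      simp only [Bool.not_eq_true'] at h2
      simp [h2]
    · simp [h2]
  · cases hs : bt sel j 0
    · refine ⟨j, ?_, fun X hX p hp => ?_⟩
      · rw [bV', hj, hs]; simp
      · rw [bt_moveDown, hM j p hp, hM (j + s) p hp, hs]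
        cases h2 : bt sel (j + s) 0
        · simp
        · exact (hd j 0 (by rw [hj, hs]; rfl) h2).elim
    · have hsj := hlow j hs
      have e : j - s + s = j := by omega
      refine ⟨j - s, ?_, fun X hX p hp => ?_⟩
      · rw [bV', e, hs, Bool.or_true]
      · rw [bt_moveDown, hM _ p hp, hM _ p hp, e, hs, Bool.and_true]
        cases h1 : bt X (j - s) p
        · simp
        · have h2 := hX _ p hp h1
          cases h3 : bt sel (j - s) 0
          · exact (hd (j - s) 0 (by rw [h2, h3]; rfl) (by rw [e, hs])).elim
          · simp

end stage

/-- The distances are consumed binary digit by binary digit, with one move by a power of two for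
each. They need not be correct for this statement: a collision ends in `none`, and whether the
result is really compact is tested in `proc`. -/
theorem compress_spec {N : ℕ} : ∀ (f i s : ℕ) (q r : Quad), q.Inv N → compress N f i s q = some r →
    r.Inv N ∧ q.Into r := by
  intro f
  induction f with
  | zero =>
    intro i s q r hq h
    obtain rfl := Option.some.inj h
    exact ⟨hq, fun j hj => ⟨j, hj, fun p _ => ⟨rfl, rfl, rfl⟩⟩⟩
  | succ f ih =>
    intro i s q r hq h
    rw [compress] at h
    cases hb : Nat.ble N s
    · rw [hb, cond_false] at h
      simp only at h
      set sel := Nat.land (Nat.shiftRight q.O i) q.V with hsel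
      cases hc : Nat.beq (Nat.lor (Nat.land (Nat.xor q.V sel) (Nat.shiftRight sel (Nat.mul 104 s)))
        (Nat.land sel (pm (Nat.mul 104 s)))) 0
      · rw [hc, cond_false] at h; simp at h
      · rw [hc, cond_true] at h
        have hz := eq_zero_of_beq hc
        simp only [bt_lor, Bool.or_eq_false_iff] at hz
        obtain ⟨h1, h2, h3⟩ := stage (s := s) hq.V
          (fun j p hjp => by rw [hsel, bt_land, Bool.and_eq_true] at hjp; exact hjp.2)
          (fun j p => (hz j p).1) (fun j p => (hz j p).2)
        obtain ⟨hr, hm⟩ := ih _ _ _ _ ⟨h1, h2 _ hq.I, h2 _ hq.O, h2 _ hq.X⟩ h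
        refine ⟨hr, fun j hj => ?_⟩
        obtain ⟨k, hk, hkX⟩ := h3 j hj
        obtain ⟨m, hm1, hm2⟩ := hm k hk
        refine ⟨m, hm1, fun p hp => ?_⟩
        obtain ⟨e1, e2, e3⟩ := hm2 p hp
        exact ⟨e1.trans (hkX _ hq.I p hp), e2.trans (hkX _ hq.O p hp),
          e3.trans (hkX _ hq.X p hp)⟩
    · rw [hb, cond_true] at h
      obtain rfl := Option.some.inj h
      exact ⟨hq, fun j hj => ⟨j, hj, fun p _ => ⟨rfl, rfl, rfl⟩⟩⟩

theorem extract_spec : ∀ (f N V I : ℕ) (acc L : List ℕ), extract f N V I acc = some L →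
    acc ⊆ L ∧ (Flags N V → ∀ j, bt V j 0 = true →
      Nat.land (Nat.shiftRight I (Nat.mul 104 j)) b91 ∈ L) := by
  intro f
  induction f with
  | zero => intro N V I acc L h; simp [extract] at h
  | succ f ih =>
    intro N V I acc L h
    rw [extract] at h
    cases hV : Nat.beq V 0
    · rw [hV, cond_false] at h
      cases hN : Nat.beq N 1
      · rw [hN, cond_false] at h
        simp only at h
        set k := Nat.div N 2 with hk
        cases he : extract f (Nat.sub N k) (Nat.shiftRight V (Nat.mul 104 k))
            (Nat.shiftRight I (Nat.mul 104 k)) acc with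
        | none => rw [he] at h; simp at h
        | some a =>
          rw [he] at h
          obtain ⟨h1, h2⟩ := ih _ _ _ _ _ he
          obtain ⟨h3, h4⟩ := ih _ _ _ _ _ h
          refine ⟨fun x hx => h3 (h1 hx), fun hF j hj => ?_⟩
          rcases lt_or_ge j k with hjk | hjk
          · have e : Nat.land (Nat.shiftRight (Nat.land I (pm (Nat.mul 104 k))) (Nat.mul 104 j)) b91 =
                Nat.land (Nat.shiftRight I (Nat.mul 104 j)) b91 := by
              refine Nat.eq_of_testBit_eq fun q => ?_
              change (((I &&& pm (104 * k)) >>> (104 * j)) &&& b91).testBit q =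
                ((I >>> (104 * j)) &&& b91).testBit q
              simp only [Nat.testBit_and, Nat.testBit_shiftRight, testBit_pm, testBit_b91]
              by_cases hq : q < 91
              · have : 104 * j + q < 104 * k := by omega
                simp [this]
              · simp [hq]
            rw [← e]
            refine h4 (fun i p hp hb => ?_) j ?_
            · rw [bt_land, bt_pm _ _ hp, Bool.and_eq_true, decide_eq_true_eq] at hb
              exact ⟨hb.2, (hF i p hp hb.1).2⟩
            · rw [bt_land, bt_pm _ _ (by norm_num), hj]
              simpa using hjk
          · have e : Nat.land (Nat.shiftRight (Nat.shiftRight I (Nat.mul 104 k))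
                (Nat.mul 104 (j - k))) b91 = Nat.land (Nat.shiftRight I (Nat.mul 104 j)) b91 := by
              change (I >>> (104 * k) >>> (104 * (j - k))) &&& b91 = (I >>> (104 * j)) &&& b91
              rw [← Nat.shiftRight_add]
              congr 2
              omega
            refine h3 ?_
            rw [← e]
            refine h2 (fun i p hp hb => ?_) (j - k) ?_
            · rw [bt_shiftRight] at hb
              obtain ⟨h5, h6⟩ := hF _ p hp hb
              refine ⟨?_, h6⟩
              change i < N - k
              omega
            · rw [bt_shiftRight, Nat.sub_add_cancel hjk, hj]
      · rw [hN, cond_true] at h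
        obtain rfl := Option.some.inj h
        refine ⟨List.subset_cons_self _ _, fun hF j hj => ?_⟩
        have h1 := (hF j 0 (by norm_num) hj).1
        have h2 := Nat.eq_of_beq_eq_true hN
        obtain rfl : j = 0 := by omega
        exact List.mem_cons_self
    · rw [hV, cond_true] at h
      obtain rfl := Option.some.inj h
      refine ⟨fun _ h => h, fun _ j hj => ?_⟩
      rw [Nat.eq_of_beq_eq_true hV, bt_zero] at hj
      simp at hj

theorem Fits.congr {s : Finset (Fin 91)} {I O j I' O' j' : ℕ} (h : Fits s I O j)
    (hI : ∀ p < 104, bt I' j' p = bt I j p) (hO : ∀ p < 91, bt O' j' p = bt O j p) :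
    Fits s I' O' j' := by
  have e1 : fld I' j' = fld I j := by
    ext p; rw [mem_fld, mem_fld, hI p (by omega)]
  have e2 : fld O' j' = fld O j := by
    ext p; rw [mem_fld, mem_fld, hO p p.2]
  refine ⟨e1 ▸ h.sub, e2 ▸ h.out, ?_⟩
  rw [e1, cap_eq, hI 91 (by norm_num), hI 92 (by norm_num), hI 93 (by norm_num),
    hI 94 (by norm_num), ← cap_eq]
  exact h.card

/-- The points given by the bits of a number. -/
def bits (n : ℕ) : Finset (Fin 91) := Finset.univ.filter fun p => n.testBit p.val = true

theorem mem_bits {n : ℕ} {p : Fin 91} : p ∈ bits n ↔ n.testBit p.val = true := by simp [bits]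

theorem Fits.add_point {s : Finset (Fin 91)} {I O j I' O' j' : ℕ} (h : Fits s I O j) {x : Fin 91}
    (hx : x ∈ s) (hxI : x ∉ fld I j)
    (hI : ∀ p : Fin 91, bt I' j' p.val = true ↔ bt I j p.val = true ∨ p = x)
    (hO : ∀ p ∈ fld O' j', p ∉ s) (hcap : 1 ≤ cap I j → cap I' j' + 1 = cap I j) :
    Fits s I' O' j' := by
  have e : fld I' j' = insert x (fld I j) := by
    ext p
    rw [mem_fld, hI, Finset.mem_insert, mem_fld, or_comm]
  have h1 : insert x (fld I j) ⊆ s := Finset.insert_subset hx h.sub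
  have h2 := Finset.card_le_card h1
  have h3 := Finset.card_insert_of_notMem hxI
  have h4 := h.card
  have h5 := hcap (by omega)
  exact ⟨e ▸ h1, hO, by rw [e]; omega⟩

/-- A state that fits `s` is not dead. If it is fully decided, then it equals `s` and is listed.
Otherwise it survives the compaction and is doubled: one copy chooses the first branching point, the
other one excludes it and chooses the second point, if there is one. -/
theorem proc_spec {cap3 : Bool} {BR : ℕ} {b b' : Batch} {L : List ℕ} {s : Finset (Fin 91)}
    (h : proc cap3 BR b = some (b', L)) (hs : SO s)
    (hcap : cap3 = true → ∀ l, (trc s l).card ≤ 3) {j : ℕ} (hj : j < b.N)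
    (hf : Fits s b.I b.O j) :
    (∃ k < b'.N, Fits s b'.I b'.O k) ∨ ∃ n ∈ L, bits n = s := by
  set N := b.N with hN
  set I := Nat.land b.I (Nat.mul (pm 95) (ones N)) with hI
  set r := round cap3 BR (ones N) (mask N) I b.O with hr
  set al := Nat.xor (ones N) r.dead with hal
  set V := Nat.land al (nonzero (ones N) (mask N) r.und) with hV
  set kd := prefixSums N 20 1 (Nat.xor (ones N) V) with hkd
  set c := Nat.sub N (Nat.land (Nat.shiftRight kd (Nat.mul 104 (Nat.sub N 1))) (pm 104)) with hc
  set M := Nat.mul (pm 104) V with hM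
  set q0 : Quad := ⟨V, Nat.land I M,
      Nat.land (Nat.lor (Nat.land r.O (mask N))
        (Nat.land (Nat.shiftLeft kd 91) (Nat.mul (Nat.xor (pm 104) b91) (ones N)))) M, Nat.land r.x M⟩ with hq0
  have hundF : Clean N r.und := by
    intro j p hp hb
    change bt (Nat.xor (mask N) (Nat.land (mask N) _)) j p = true at hb
    rw [bt_xor, bt_land] at hb
    cases hF : bt (mask N) j p
    · simp [hF] at hb
    · rw [bt_mask N j hp, Bool.and_eq_true] at hF
      simpa using hF
  have hVf : Flags N V := by
    intro j p hp hb
    rw [hV, bt_land, Bool.and_eq_true, bt_nonzero hundF j hp] at hb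
    exact ⟨hb.2.2.1, hb.2.1⟩
  have hMb := fun j p (hp : p < 104) => bt_full_flags hVf j hp
  have hsupp : ∀ X, Supp V (Nat.land X M) := by
    intro X j p hp hb
    rw [bt_land, hMb j p hp, Bool.and_eq_true] at hb
    exact hb.2
  have hinv : q0.Inv N := ⟨hVf, hsupp _, hsupp _, hsupp _⟩
  have hunf : proc cap3 BR b = match extract 40 N (Nat.xor al V) I [], compress N 20 91 1 q0 with
    | some L, some q =>
      let I2 := Nat.land q.I (Nat.mul (pm 95) (ones c))
      let O2 := Nat.land q.O (mask c)
      let X2 := Nat.land q.X (mask c)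
      let x := low (ones c) (mask c) X2
      let y := diff X2 x
      cond (Nat.beq q.V (ones c)) (cond (Nat.beq (nonzero (ones c) (mask c) x) (ones c))
        (some (⟨Nat.mul 2 c,
          Nat.lor (Nat.lor (bump (ones c) (nonzero (ones c) (mask c) y) I2) y)
            (Nat.shiftLeft (Nat.lor (bump (ones c) (ones c) I2) x) (Nat.mul 104 c)),
          Nat.lor (Nat.lor O2 x) (Nat.shiftLeft O2 (Nat.mul 104 c))⟩, L)) none) none
    | _, _ => none := rfl
  rw [hunf] at h
  have hIb : ∀ j, ∀ p < 104, bt I j p = (bt b.I j p && (decide (j < N) && decide (p < 95))) := by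
    intro j p hp
    rw [hI, bt_land, bt_mul_ones (pm_lt (by norm_num)) N j hp, testBit_pm]
  have hfI : Fits s I b.O j := by
    have e1 : fld I j = fld b.I j := by
      ext p; rw [mem_fld, mem_fld, hIb j p (by omega)]
      have : p.val < 95 := by omega
      simp [hj, this]
    refine ⟨e1 ▸ hf.sub, hf.out, ?_⟩
    have e2 : ∀ p, p < 95 → bt I j p = bt b.I j p := fun p hp => by
      rw [hIb j p (by omega)]; simp [hj, hp]
    rw [e1, cap_eq, e2 91 (by norm_num), e2 92 (by norm_num), e2 93 (by norm_num),
      e2 94 (by norm_num), ← cap_eq]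
    exact hf.card
  obtain ⟨hdead, hout, hund, htwo⟩ := round_spec BR hj hs hcap hfI
  rw [← hr] at hdead hout hund htwo
  have halj : bt al j 0 = true := by
    rw [hal, bt_xor, bt_ones N j (by norm_num), hdead]; simp [hj]
  cases hex : extract 40 N (Nat.xor al V) I [] with
  | none => rw [hex] at h; simp at h
  | some L' =>
  cases hco : compress N 20 91 1 q0 with
  | none => rw [hex, hco] at h; simp at h
  | some q =>
  rw [hex, hco] at h
  simp only at h
  cases hqV : Nat.beq q.V (ones c) with
  | false => rw [hqV] at h; simp at h
  | true =>
  rw [hqV, cond_true] at h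
  set X2 := Nat.land q.X (mask c) with hX2
  set x := low (ones c) (mask c) X2 with hx
  set y := diff X2 x with hy
  cases hqx : Nat.beq (nonzero (ones c) (mask c) x) (ones c) with
  | false => rw [hqx] at h; simp at h
  | true =>
  rw [hqx, cond_true, Option.some.injEq, Prod.mk.injEq] at h
  obtain ⟨rfl, rfl⟩ := h
  have hqx := Nat.eq_of_beq_eq_true hqx
  have hqV := Nat.eq_of_beq_eq_true hqV
  -- The flag tells whether undecided points are left.
  by_cases hVj : bt V j 0 = true
  · left
    obtain ⟨hqinv, hinto⟩ := compress_spec _ _ _ _ _ hinv hco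
    obtain ⟨k, hk, hkq⟩ := hinto j hVj
    rw [hqV, bt_ones c k (by norm_num)] at hk
    have hkc : k < c := by simpa using hk
    have hsc : ∀ {X}, Supp q.V X → ∀ j ≥ c, ∀ p < 104, bt X j p = false := by
      intro X hX j hj p hp
      by_contra hb
      have := hX j p hp (by simpa using hb)
      rw [hqV, bt_ones c j (by norm_num)] at this
      simp at this; omega
    have hMj : ∀ p < 104, bt M j p = true := fun p hp => by rw [hMb j p hp, hVj]
    have kI : ∀ p < 104, bt q.I k p = bt I j p := fun p hp => by
      rw [(hkq p hp).1, hq0, bt_land, hMj p hp, Bool.and_true]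
    -- The bits from 91 on carry the distances for the compaction; below them the field agrees with
    -- the excluded points.
    have kO : ∀ p < 91, bt q.O k p = bt r.O j p := fun p hp => by
      have hc : Nat.xor (pm 104) b91 < 2 ^ 104 := by decide +kernel
      rw [(hkq p (by omega)).2.1, hq0, bt_land, hMj p (by omega), Bool.and_true, bt_lor, bt_land,
        bt_land, bt_mask N j (by omega), bt_mul_ones hc N j (by omega)]
      have : (Nat.xor (pm 104) b91).testBit p = false := by
        change (pm 104 ^^^ b91).testBit p = false
        rw [Nat.testBit_xor, testBit_pm, testBit_b91]
        have : p < 104 := by omega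
        simp [hp, this]
      rw [this]
      simp [hj, hp]
    have kX : ∀ p < 104, bt q.X k p = bt r.x j p := fun p hp => by
      rw [(hkq p hp).2.2, hq0, bt_land, hMj p hp, Bool.and_true]
    set I2 := Nat.land q.I (Nat.mul (pm 95) (ones c)) with hI2
    set O2 := Nat.land q.O (mask c) with hO2
    have bI2 : ∀ k', ∀ p < 104, bt I2 k' p = (bt q.I k' p && (decide (k' < c) && decide (p < 95))) := by
      intro k' p hp
      rw [hI2, bt_land, bt_mul_ones (pm_lt (by norm_num)) c k' hp, testBit_pm]
    have bI2k : ∀ p < 104, bt I2 k p = bt I j p := by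
      intro p hp
      rw [bI2 k p hp, kI p hp, hIb j p hp]
      simp [hkc]
    have hI2c : ∀ k', ∀ p < 104, bt I2 k' p = true → k' < c ∧ p < 95 := fun k' p hp h => by
      rw [bI2 k' p hp] at h
      simp only [Bool.and_eq_true, decide_eq_true_eq] at h
      exact h.2
    have bO2 : ∀ k', ∀ p < 91, bt O2 k' p = (bt q.O k' p && decide (k' < c)) := by
      intro k' p hp
      rw [hO2, bt_land, bt_mask c k' (by omega)]
      simp [hp]
    have hX2c : Clean c X2 := clean_land_mask c q.X
    have hxX : ∀ {k p}, bt x k p = true → bt X2 k p = true := bt_of_low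
    have hxc : Clean c x := fun k p hp h => hX2c k p hp (hxX h)
    have hyc : Clean c y := hX2c.diff x
    have hclear : ∀ {X}, Clean c X → ∀ {k p}, c ≤ k → p < 104 → bt X k p = false := by
      intro X hX k p hk hp
      by_contra hb
      have := hX k p hp (by simpa using hb)
      omega
    have kX2 : ∀ p : Fin 91, bt X2 k p.val = bt r.x j p.val := fun p => by
      rw [hX2, bt_land, kX p.val (by omega), bt_mask c k (by omega)]
      simp [hkc]
    have hrx : ∀ {p : Fin 91}, bt r.x j p.val = true → p ∉ fld I j := by
      intro p hp hpI
      rw [mem_fld] at hpI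
      have h1 := (round_x (N := N) (cap3 := cap3) (BR := BR) (I := I) (O := b.O)
        (show p.val < 104 by omega) hp).1
      rw [← hr, hund p.val p.2, hpI] at h1
      simp at h1
    obtain ⟨a, ha⟩ : ∃ a : Fin 91, bt x k a.val = true := by
      have : bt (nonzero (ones c) (mask c) x) k 0 = true := by
        rw [hqx, bt_ones c k (by norm_num)]
        simp [hkc]
      rw [bt_nonzero hxc k (by norm_num)] at this
      obtain ⟨-, -, a, ha, hb⟩ := this
      exact ⟨⟨a, ha⟩, hb⟩
    have hau : ∀ {p : Fin 91}, bt x k p.val = true ↔ p = a := fun {p} =>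
      ⟨fun hp => Fin.ext (low_inj (by omega) (by omega) hp ha), fun hp => hp ▸ ha⟩
    have har : bt r.x j a.val = true := by rw [← kX2]; exact hxX ha
    have hyr : ∀ {p : Fin 91}, bt y k p.val = true → bt r.x j p.val = true ∧ p ≠ a := by
      intro p hp
      rw [hy, bt_diff, kX2, Bool.and_eq_true, Bool.not_eq_true', ← Bool.not_eq_true, hau] at hp
      exact hp
    have h91 : ∀ {X}, Clean c X → ∀ {k p}, 91 ≤ p → p < 104 → bt X k p = false := by
      intro X hX k p hk hp
      by_contra hb
      have := hX k p hp (by simpa using hb)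
      omega
    have hcapc : ∀ {X Y k k'}, (∀ p, 91 ≤ p → p < 104 → bt X k p = bt Y k' p) →
        cap X k = cap Y k' := by
      intro X Y k k' h
      rw [cap_eq, cap_eq, h 91 (by norm_num) (by norm_num), h 92 (by norm_num) (by norm_num),
        h 93 (by norm_num) (by norm_num), h 94 (by norm_num) (by norm_num)]
    have hcapI : cap I2 k = cap I j := hcapc fun p _ hp => bI2k p hp
    have hyF := flags_nonzero hyc
    set W := nonzero (ones c) (mask c) y with hW
    have hB1 := bump_spec hI2c hyF
    have hoF : Flags c (ones c) := fun k p hp hb => by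
      rw [bt_ones c k hp, Bool.and_eq_true, decide_eq_true_eq, decide_eq_true_eq] at hb
      exact hb
    have hB2 := bump_spec hI2c hoF
    set I' := Nat.lor (Nat.lor (bump (ones c) W I2) y)
      (Nat.shiftLeft (Nat.lor (bump (ones c) (ones c) I2) x) (Nat.mul 104 c)) with hI'
    set O' := Nat.lor (Nat.lor O2 x) (Nat.shiftLeft O2 (Nat.mul 104 c)) with hO'
    -- The copies with the first branching point chosen occupy the fields from `c` on, those with
    -- this point excluded the fields below.
    by_cases has : a ∈ s
    · have e0 : c + k - c = k := by omega
      have e1 : ∀ p < 104, bt I' (c + k) p = (bt (bump (ones c) (ones c) I2) k p || bt x k p) := by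
        intro p hp
        have : bt (bump (ones c) W I2) (c + k) p = false := by
          by_contra hb
          have := (hB1 (c + k)).2.2.2 p hp (by simpa using hb)
          omega
        rw [hI', bt_lor, bt_lor, this, hclear hyc (by omega) hp, bt_shiftLeft _ _ _ _ hp, bt_lor, e0]
        simp
      refine ⟨c + k, by change c + k < 2 * c; omega,
        hfI.add_point has (hrx har) (fun p => ?_) (fun p hp => ?_) fun h1 => ?_⟩
      · rw [e1 p.val (by omega), (hB2 k).1 p.val p.2, bI2k p.val (by omega), Bool.or_eq_true, hau]
      · rw [mem_fld, hO', bt_lor, bt_lor, bt_shiftLeft _ _ _ _ (by omega), bO2 _ p.val p.2, e0,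
          bO2 _ p.val p.2, kO p.val p.2, hclear hxc (by omega) (by omega)] at hp
        refine hout p (mem_fld.2 ?_)
        simpa [hkc] using hp
      · rw [hcapc (X := I') (Y := bump (ones c) (ones c) I2) (k' := k) fun p hp hp' => by
          rw [e1 p hp', h91 hxc hp hp', Bool.or_false]]
        rw [← hcapI] at h1 ⊢
        exact (hB2 k).2.1 (by rw [bt_ones c k (by norm_num)]; simp [hkc]) h1
    · have hck : ¬ c ≤ k := by omega
      have e1 : ∀ p < 104, bt I' k p = (bt (bump (ones c) W I2) k p || bt y k p) := by
        intro p hp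
        rw [hI', bt_lor, bt_lor, bt_shiftLeft _ _ _ _ hp]
        simp [hck]
      have hO : ∀ p ∈ fld O' k, p ∉ s := by
        intro p hp
        rw [mem_fld, hO', bt_lor, bt_lor, bt_shiftLeft _ _ _ _ (by omega), bO2 _ p.val p.2,
          kO p.val p.2, Bool.or_eq_true, Bool.or_eq_true, hau] at hp
        rcases hp with (hp | rfl) | hp
        · refine hout p (mem_fld.2 ?_)
          simpa [hkc] using hp
        · exact has
        · simp [hck] at hp
      have e2 : cap I' k = cap (bump (ones c) W I2) k := hcapc fun p hp hp' => by
        rw [e1 p hp', h91 hyc hp hp', Bool.or_false]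
      have hWk : bt W k 0 = true ↔ ∃ q < 91, bt y k q = true := by
        rw [hW, bt_nonzero hyc k (by norm_num)]
        simp [hkc]
      refine ⟨k, by change k < 2 * c; omega, ?_⟩
      -- The exclusion of the first branching point forces a second one into `s`, by the last clause
      -- of `round_spec`; only in this case the capacity drops.
      by_cases hyb : ∃ b : Fin 91, bt y k b.val = true
      · obtain ⟨b₂, hb⟩ := hyb
        obtain ⟨hbr, hba⟩ := hyr hb
        refine hfI.add_point (htwo a b₂ har hbr hba.symm has) (hrx hbr) (fun p => ?_) hO fun h1 => ?_
        · rw [e1 p.val (by omega), (hB1 k).1 p.val p.2, bI2k p.val (by omega), Bool.or_eq_true]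
          refine or_congr Iff.rfl ⟨fun hp => ?_, fun h => h ▸ hb⟩
          obtain ⟨hpr, hpa⟩ := hyr hp
          rcases (round_x (N := N) (cap3 := cap3) (BR := BR) (I := I) (O := b.O)
            (show a.val < 104 by omega) har).2 b₂.val (by omega) p.val (by omega) hbr hpr with h | h | h
          · exact (hba (Fin.ext h).symm).elim
          · exact (Fin.ext h).symm
          · exact (hpa (Fin.ext h).symm).elim
        · rw [e2]
          rw [← hcapI] at h1 ⊢
          exact (hB1 k).2.1 (hWk.2 ⟨b₂.val, b₂.2, hb⟩) h1
      · have hyn : ∀ p < 104, bt y k p = false := fun p hp => by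
          by_contra hcon
          rw [Bool.not_eq_false] at hcon
          exact hyb ⟨⟨p, (hyc k p hp hcon).2⟩, hcon⟩
        have e3 : fld I' k = fld I j := by
          ext p
          rw [mem_fld, mem_fld, e1 p.val (by omega), (hB1 k).1 p.val p.2, bI2k p.val (by omega),
            hyn p.val (by omega), Bool.or_false]
        refine ⟨e3 ▸ hfI.sub, hO, ?_⟩
        rw [e3, e2, (hB1 k).2.2.1, hcapI]
        · exact hfI.card
        · rw [← Bool.not_eq_true, hWk]
          rintro ⟨q, hq, hb⟩
          rw [hyn q (by omega)] at hb
          simp at hb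
  · right
    -- Without undecided points every point is chosen or excluded, so the chosen points are exactly
    -- `s`.
    have hnz : ∀ p < 91, bt r.und j p = false := by
      intro p hp
      by_contra hb
      refine hVj ?_
      rw [hV, bt_land, halj, Bool.true_and, bt_nonzero hundF j (by norm_num)]
      exact ⟨rfl, hj, p, hp, by simpa using hb⟩
    have hFl : Flags N (Nat.xor al V) := by
      intro i p hp hb
      rw [hV, bt_xor, bt_land] at hb
      have hb : bt al i p = true := by
        cases h1 : bt al i p
        · simp [h1] at hb
        · rfl
      rw [hal, bt_xor, bt_ones N i hp] at hb
      by_contra hcon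
      have h2 : (decide (i < N) && decide (p = 0)) = false := by
        by_contra h2
        rw [Bool.not_eq_false, Bool.and_eq_true, decide_eq_true_eq, decide_eq_true_eq] at h2
        exact hcon h2
      rw [h2, Bool.false_xor] at hb
      change bt (nonzero (ones N) (mask N) _) i p = true at hb
      rw [nonzero, bt_land, bt_ones N i hp, h2, Bool.and_false] at hb
      simp at hb
    have := (extract_spec _ _ _ _ _ _ hex).2 hFl j ?_
    · refine ⟨_, this, ?_⟩
      ext p
      have e1 : (Nat.land (Nat.shiftRight I (Nat.mul 104 j)) b91).testBit p.val = bt I j p.val := by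
        change ((I >>> (104 * j)) &&& b91).testBit p.val = _
        rw [Nat.testBit_and, Nat.testBit_shiftRight, testBit_b91, bt]
        simp
      rw [mem_bits, e1]
      refine ⟨fun h => hfI.sub (mem_fld.2 h), fun h => ?_⟩
      have h1 := hnz p.val p.2
      rw [hund p.val p.2] at h1
      cases h2 : bt I j p.val
      · cases h3 : bt r.O j p.val
        · simp [h2, h3] at h1
        · exact (hout p (mem_fld.2 h3) h).elim
      · rfl
    · rw [bt_xor, halj]
      simpa using hVj

theorem fits_take {s : Finset (Fin 91)} {b : Batch} {h j : ℕ} (hj : j < h) (hf : Fits s b.I b.O j) :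
    Fits s (b.take h).I (b.take h).O j :=
  hf.congr (fun p hp => by
      change bt (Nat.land b.I (pm (Nat.mul 104 h))) j p = _
      rw [bt_land, bt_pm h j hp]; simp [hj])
    (fun p hp => by
      change bt (Nat.land b.O (pm (Nat.mul 104 h))) j p = _
      rw [bt_land, bt_pm h j (by omega)]; simp [hj])

theorem fits_drop {s : Finset (Fin 91)} {b : Batch} {h j : ℕ} (hj : h ≤ j) (hf : Fits s b.I b.O j) :
    Fits s (b.drop h).I (b.drop h).O (j - h) :=
  hf.congr (fun p hp => by
      change bt (Nat.shiftRight b.I (Nat.mul 104 h)) (j - h) p = _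
      rw [bt_shiftRight, Nat.sub_add_cancel hj])
    (fun p hp => by
      change bt (Nat.shiftRight b.O (Nat.mul 104 h)) (j - h) p = _
      rw [bt_shiftRight, Nat.sub_add_cancel hj])

/-- Some state of the batch fits `s`. -/
def Batch.Has (b : Batch) (s : Finset (Fin 91)) : Prop := ∃ j < b.N, Fits s b.I b.O j

theorem Batch.Has.split {b : Batch} {s : Finset (Fin 91)} (hb : b.Has s) (h : ℕ) :
    (b.take h).Has s ∨ (b.drop h).Has s := by
  obtain ⟨j, hj, hf⟩ := hb
  rcases lt_or_ge j h with hjh | hjh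
  · exact Or.inl ⟨j, hjh, fits_take hjh hf⟩
  · refine Or.inr ⟨j - h, ?_, fits_drop hjh hf⟩
    change j - h < b.N - h
    omega

/-- The invariant is that `s` fits a state on the stack or has been found. Splitting a batch
preserves it trivially, a round by `proc_spec`. The fuel plays no role, since running out of it
yields `none`. -/
theorem search_spec {cap3 : Bool} {BR lim : ℕ} {s : Finset (Fin 91)} (hs : SO s)
    (hcap : cap3 = true → ∀ l, (trc s l).card ≤ 3) :
    ∀ (f : ℕ) (st : List Batch) (acc L : List ℕ), search cap3 BR lim f st acc = some L →
      ((∃ b ∈ st, b.Has s) ∨ ∃ n ∈ acc, bits n = s) → ∃ n ∈ L, bits n = s := by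
  intro f
  induction f with
  | zero => intro st acc L h; simp [search] at h
  | succ f ih =>
    intro st acc L h hst
    cases st with
    | nil =>
      obtain rfl := Option.some.inj h
      simpa using hst
    | cons b st =>
      rw [search] at h
      cases h0 : Nat.beq b.N 0
      · rw [h0, cond_false] at h
        cases h1 : Nat.ble b.N lim
        · rw [h1, cond_false] at h
          refine ih _ _ _ h ?_
          rcases hst with ⟨b', hb', hh⟩ | hacc
          · rcases List.mem_cons.1 hb' with rfl | hb'
            · rcases hh.split (Nat.div b'.N 2) with hh | hh
              · exact Or.inl ⟨_, List.mem_cons_self, hh⟩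
              · exact Or.inl ⟨_, List.mem_cons_of_mem _ List.mem_cons_self, hh⟩
            · exact Or.inl ⟨_, List.mem_cons_of_mem _ (List.mem_cons_of_mem _ hb'), hh⟩
          · exact Or.inr hacc
        · rw [h1, cond_true] at h
          cases hp : proc cap3 BR b with
          | none => rw [hp] at h; simp at h
          | some r =>
            rw [hp] at h
            refine ih _ _ _ h ?_
            rcases hst with ⟨b', hb', hh⟩ | ⟨n, hn, hns⟩
            · rcases List.mem_cons.1 hb' with rfl | hb'
              · obtain ⟨j, hj, hf⟩ := hh
                rcases proc_spec hp hs hcap hj hf with hh | ⟨n, hn, hns⟩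
                · exact Or.inl ⟨_, List.mem_cons_self, hh⟩
                · exact Or.inr ⟨n, List.mem_append_left _ hn, hns⟩
              · exact Or.inl ⟨_, List.mem_cons_of_mem _ hb', hh⟩
            · exact Or.inr ⟨n, List.mem_append_right _ hn, hns⟩
      · rw [h0, cond_true] at h
        refine ih _ _ _ h ?_
        rcases hst with ⟨b', hb', hh⟩ | hacc
        · rcases List.mem_cons.1 hb' with rfl | hb'
          · obtain ⟨j, hj, -⟩ := hh
            have := Nat.eq_of_beq_eq_true h0
            omega
          · exact Or.inl ⟨_, hb', hh⟩
        · exact Or.inr hacc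

end PG2

namespace PG2

/-! ### Classification by states -/

/-- Bit `k` of `n`. -/
def bitAt (n k : ℕ) : Bool := Nat.beq (Nat.land (Nat.shiftRight n k) 1) 1

theorem bitAt_eq (n k : ℕ) : bitAt n k = n.testBit k := by
  have h : Nat.land (Nat.shiftRight n k) 1 = n / 2 ^ k % 2 := by
    change n >>> k &&& 1 = _
    rw [Nat.and_one_is_mod, Nat.shiftRight_eq_div_pow]
  rw [bitAt, h, Nat.testBit_eq_decide_div_mod_eq]
  have : n / 2 ^ k % 2 < 2 := Nat.mod_lt _ (by norm_num)
  interval_cases n / 2 ^ k % 2 <;> rfl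

/-- The number of bits of `n` below `k`. -/
def pop (n : ℕ) : ℕ → ℕ
  | 0 => 0
  | k + 1 => cond (bitAt n k) (Nat.succ (pop n k)) (pop n k)

theorem pop_eq (n : ℕ) : ∀ k, pop n k = ((Finset.range k).filter fun p => n.testBit p = true).card
  | 0 => rfl
  | k + 1 => by
    rw [pop, bitAt_eq, Finset.range_add_one, Finset.filter_insert, pop_eq n k]
    cases n.testBit k
    · simp
    · rw [cond_true, if_pos rfl, Finset.card_insert_of_notMem (by simp)]

theorem card_bits (n : ℕ) : (bits n).card = pop n 91 := by
  rw [pop_eq, ← Finset.card_map Fin.valEmbedding]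
  congr 1
  ext p
  simp only [Finset.mem_map, mem_bits, Fin.valEmbedding_apply, Finset.mem_filter,
    Finset.mem_range]
  exact ⟨fun ⟨a, ha, h⟩ => h ▸ ⟨a.2, ha⟩, fun ⟨h, h1⟩ => ⟨⟨p, h⟩, h1, rfl⟩⟩

/-- The images under `f` of the bits of `n` below a bound. -/
def imgMask (f : ℕ → ℕ) (n : ℕ) : ℕ → ℕ
  | 0 => 0
  | k + 1 => cond (bitAt n k) (Nat.lor (imgMask f n k) (Nat.pow 2 (f k))) (imgMask f n k)

theorem testBit_lor_two_pow (n k q : ℕ) :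
    (Nat.lor n (Nat.pow 2 k)).testBit q = true ↔ n.testBit q = true ∨ q = k := by
  change (n ||| 2 ^ k).testBit q = true ↔ _
  rw [Nat.testBit_or, Nat.testBit_two_pow, Bool.or_eq_true, decide_eq_true_eq, eq_comm (a := k)]

theorem testBit_imgMask (f : ℕ → ℕ) (n q : ℕ) : ∀ k, (imgMask f n k).testBit q = true ↔
    ∃ p < k, n.testBit p = true ∧ f p = q
  | 0 => by simp [imgMask]
  | k + 1 => by
    have ih := testBit_imgMask f n q k
    rw [imgMask, bitAt_eq]
    cases h : n.testBit k
    · rw [cond_false, ih]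
      refine ⟨fun ⟨p, h1, h2⟩ => ⟨p, by omega, h2⟩, fun ⟨p, h1, h2⟩ => ⟨p, ?_, h2⟩⟩
      have : p ≠ k := by rintro rfl; rw [h] at h2; simp at h2
      omega
    · rw [cond_true, testBit_lor_two_pow, ih]
      constructor
      · rintro (⟨p, h1, h2⟩ | rfl)
        · exact ⟨p, by omega, h2⟩
        · exact ⟨k, by omega, h, rfl⟩
      · rintro ⟨p, h1, h2⟩
        by_cases hpk : p = k
        · exact Or.inr (hpk ▸ h2.2.symm)
        · exact Or.inl ⟨p, by omega, h2⟩

theorem bits_imgMask {f : ℕ → ℕ} {π : Equiv.Perm (Fin 91)} (h : ∀ p : Fin 91, (π p).val = f p)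
    (n : ℕ) : bits (imgMask f n 91) = (bits n).image π := by
  ext q
  rw [mem_bits, testBit_imgMask, Finset.mem_image]
  constructor
  · rintro ⟨p, hp, h1, h2⟩
    exact ⟨⟨p, hp⟩, mem_bits.2 h1, Fin.ext ((h _).trans h2)⟩
  · rintro ⟨p, h1, rfl⟩
    exact ⟨p, p.2, mem_bits.1 h1, (h p).symm⟩

/-- All bits of `m` are bits of `n`. -/
def subm (m n : ℕ) : Bool := Nat.beq (Nat.land m n) m

theorem bits_subset {m n : ℕ} (h : subm m n = true) : bits m ⊆ bits n := by
  intro p hp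
  rw [mem_bits] at hp ⊢
  have h1 : m &&& n = m := Nat.eq_of_beq_eq_true h
  rw [← h1, Nat.testBit_and, Bool.and_eq_true] at hp
  exact hp.2

/-- The collineation with the given number. -/
def Col.dec (n : ℕ) : Col :=
  let r := Nat.div n 2
  let x := Nat.div r 729
  let y := Nat.div x 729
  ⟨Nat.mod r 9, Nat.mod (Nat.div r 9) 9, Nat.mod (Nat.div r 81) 9, Nat.mod x 9,
    Nat.mod (Nat.div x 9) 9, Nat.mod (Nat.div x 81) 9, Nat.mod y 9, Nat.mod (Nat.div y 9) 9,
    Nat.mod (Nat.div y 81) 9, Nat.beq (Nat.mod n 2) 1⟩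

theorem Col.dec_valid (n : ℕ) : (Col.dec n).Valid := by
  have h : ∀ a, Nat.mod a 9 < 9 := fun a => Nat.mod_lt a (by norm_num)
  exact ⟨⟨h _, h _, h _⟩, ⟨h _, h _, h _⟩, h _, h _, h _⟩

/-- The determinant does not vanish. -/
def Col.reg (m : Col) : Bool := not (Nat.beq m.det 0)

theorem Col.det_ne {m : Col} (h : m.reg = true) : m.det ≠ 0 := by
  intro h0
  rw [Col.reg, h0] at h
  simp at h

namespace Model

variable {K : Type*} [Field K] (M : Model K)

theorem exists_perm {n : ℕ} (h : (Col.dec n).reg = true) :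
    ∃ π ∈ M.coll, ∀ p : Fin 91, (π p).val = (Col.dec n).img p :=
  M.exists_coll (Col.dec_valid n) (Col.det_ne h)

/-- Equivalence under collineations. -/
def Equi (s t : Finset (Fin 91)) : Prop := ∃ π ∈ M.coll, s.image π = t

variable {M}

theorem Equi.trans {s t u : Finset (Fin 91)} (h1 : M.Equi s t) (h2 : M.Equi t u) : M.Equi s u := by
  obtain ⟨π, hπ, rfl⟩ := h1
  obtain ⟨ρ, hρ, rfl⟩ := h2
  refine ⟨ρ * π, mul_mem hρ hπ, ?_⟩
  rw [Finset.image_image]; rfl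

theorem Equi.symm {s t : Finset (Fin 91)} (h : M.Equi s t) : M.Equi t s := by
  obtain ⟨π, hπ, rfl⟩ := h
  refine ⟨π⁻¹, inv_mem hπ, ?_⟩
  rw [Finset.image_image]
  ext p
  simp

theorem trc_image {s : Finset (Fin 91)} {π τ : Equiv.Perm (Fin 91)}
    (h : ∀ l p, inc (τ l) (π p) = inc l p) (l : Fin 91) :
    trc (s.image π) (τ l) = (trc s l).image π := by
  ext q
  simp only [mem_trc, Finset.mem_image]
  constructor
  · rintro ⟨⟨p, hp, rfl⟩, hl⟩
    exact ⟨p, ⟨hp, by rwa [h] at hl⟩, rfl⟩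
  · rintro ⟨p, ⟨hp, hl⟩, rfl⟩
    exact ⟨⟨p, hp, rfl⟩, by rwa [h]⟩

theorem Equi.card {s t : Finset (Fin 91)} (h : M.Equi s t) : t.card = s.card := by
  obtain ⟨π, -, rfl⟩ := h
  exact Finset.card_image_of_injective s π.injective

theorem Equi.cap {s t : Finset (Fin 91)} (h : M.Equi s t) {k : ℕ} (hs : ∀ l, (trc s l).card ≤ k)
    (l : Fin 91) : (trc t l).card ≤ k := by
  obtain ⟨π, hπ, rfl⟩ := h
  obtain ⟨τ, hτ⟩ := M.exists_linePerm hπ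
  obtain ⟨l, rfl⟩ := τ.surjective l
  rw [trc_image hτ, Finset.card_image_of_injective _ π.injective]
  exact hs l

theorem Equi.so {s t : Finset (Fin 91)} (h : M.Equi s t) (hs : SO s) : SO t := by
  obtain ⟨π, hπ, rfl⟩ := h
  obtain ⟨τ, hτ⟩ := M.exists_linePerm hπ
  refine ⟨hs.1.image π, fun q hq => ?_⟩
  obtain ⟨p, hp, rfl⟩ := Finset.mem_image.1 hq
  have key : ∀ l, trc (s.image π) (τ l) = {π p} ↔ trc s l = {p} := by
    intro l
    rw [trc_image hτ, ← Finset.image_singleton, (Finset.image_injective π.injective).eq_iff]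
  obtain ⟨l, hl, hu⟩ := hs.2 p hp
  refine ⟨τ l, (key l).2 hl, fun m hm => ?_⟩
  obtain ⟨m, rfl⟩ := τ.surjective m
  rw [hu m ((key m).1 hm)]

end Model

/-! ### States and certificates -/

section cover

variable {K : Type*} [Field K]

/-- Every semioval with at most `k` points (and at most three points on each line, if `cap3`) that
contains the points `I` and none of the points `O` is equivalent to one of a list. -/
def Cov (M : Model K) (R : List ℕ) (cap3 : Bool) (k : ℕ) (st : ℕ × ℕ) : Prop :=
  ∀ s, SO s → s.card ≤ k → (cap3 = true → ∀ l, (trc s l).card ≤ 3) → bits st.1 ⊆ s →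
    Disjoint (bits st.2) s → ∃ n ∈ R, M.Equi s (bits n)

variable {M : Model K} {R : List ℕ} {cap3 : Bool} {k : ℕ}

theorem Cov.mono {I O I' O' : ℕ} (h : Cov M R cap3 k (I, O)) (hI : bits I ⊆ bits I')
    (hO : bits O ⊆ bits O') : Cov M R cap3 k (I', O') :=
  fun s hs hk hc hi ho => h s hs hk hc (hI.trans hi) (ho.mono_left hO)

/-- The semioval is pulled back by the collineation: being a semioval, the size and the bound on
secants are invariant. Inclusions suffice in place of equalities, because more chosen and more
excluded points only strengthen the assumptions. -/
theorem Cov.transport {I O I' O' : ℕ} (h : Cov M R cap3 k (I, O)) {π : Equiv.Perm (Fin 91)}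
    (hπ : π ∈ M.coll) (hI : (bits I).image π ⊆ bits I') (hO : (bits O).image π ⊆ bits O') :
    Cov M R cap3 k (I', O') := by
  intro s hs hk hc hi ho
  have he : M.Equi s (s.image ⇑π⁻¹) := ⟨π⁻¹, inv_mem hπ, rfl⟩
  have h1 : bits I ⊆ s.image ⇑π⁻¹ := fun p hp =>
    Finset.mem_image.2 ⟨π p, hi (hI (Finset.mem_image_of_mem π hp)), by simp⟩
  have h2 : Disjoint (bits O) (s.image ⇑π⁻¹) := by
    rw [Finset.disjoint_left]
    intro p hp hps
    obtain ⟨q, hq, rfl⟩ := Finset.mem_image.1 hps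
    refine Finset.disjoint_left.1 ho (hO (Finset.mem_image_of_mem π hp)) ?_
    simpa using hq
  obtain ⟨n, hn, hns⟩ := h _ (he.so hs) (he.card.trans_le hk) (fun h3 => he.cap (hc h3)) h1 h2
  exact ⟨n, hn, he.trans hns⟩

theorem Cov.branch {I O : ℕ} (x : ℕ) (h1 : Cov M R cap3 k (Nat.lor I (Nat.pow 2 x), O))
    (h2 : Cov M R cap3 k (I, Nat.lor O (Nat.pow 2 x))) : Cov M R cap3 k (I, O) := by
  intro s hs hk hc hi ho
  by_cases hx : ∃ p : Fin 91, p.val = x ∧ p ∈ s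
  · obtain ⟨p, rfl, hp⟩ := hx
    refine h1 s hs hk hc (fun q hq => ?_) ho
    rcases (testBit_lor_two_pow _ _ _).1 (mem_bits.1 hq) with h | h
    · exact hi (mem_bits.2 h)
    · exact Fin.ext h ▸ hp
  · refine h2 s hs hk hc hi (Finset.disjoint_left.2 fun q hq hqs => ?_)
    rcases (testBit_lor_two_pow _ _ _).1 (mem_bits.1 hq) with h | h
    · exact Finset.disjoint_left.1 ho (mem_bits.2 h) hqs
    · exact hx ⟨q, h, hqs⟩

/-- The number with the given bits. -/
def ofBits : List ℕ → ℕ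
  | [] => 0
  | x :: xs => Nat.lor (ofBits xs) (Nat.pow 2 x)

theorem testBit_ofBits (q : ℕ) : ∀ xs, (ofBits xs).testBit q = true ↔ q ∈ xs
  | [] => by simp [ofBits]
  | x :: xs => by rw [ofBits, testBit_lor_two_pow, testBit_ofBits q xs, List.mem_cons, or_comm]

/-- The points of a line. -/
def lineMask (l : ℕ) : ℕ := ofBits ([0, 1, 3, 9, 27, 49, 56, 61, 77, 81].map fun d =>
  Nat.mod (Nat.add l d) 91)

theorem testBit_lineMask (l : Fin 91) (q : ℕ) : (lineMask l).testBit q = true ↔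
    ∃ h : q < 91, inc l ⟨q, h⟩ = true := by
  rw [lineMask, testBit_ofBits]
  constructor
  · intro h
    have hq : q < 91 := by
      obtain ⟨d, -, rfl⟩ := List.mem_map.1 h
      exact Nat.mod_lt _ (by norm_num)
    refine ⟨hq, (inc_iff_pointsOn _ _).2 ?_⟩
    simp only [List.map_cons, List.map_nil, List.mem_cons, List.not_mem_nil, or_false] at h
    simp only [pointsOn, List.map_cons, List.map_nil, List.mem_cons, List.not_mem_nil, or_false,
      Fin.ext_iff, Fin.val_add]
    exact h
  · rintro ⟨h, h1⟩
    have := (inc_iff_pointsOn _ _).1 h1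
    simp only [pointsOn, List.map_cons, List.map_nil, List.mem_cons, List.not_mem_nil, or_false,
      Fin.ext_iff, Fin.val_add] at this ⊢
    exact this

/-- The states that result from `(I, O)` if one of the given lines is the tangent at `p`. -/
def tangents (I O p : ℕ) : List ℕ → List (ℕ × ℕ) → List (ℕ × ℕ)
  | [], acc => acc
  | d :: ds, acc =>
    let t := lineMask (Nat.mod (Nat.add p d) 91)
    tangents I O p ds (cond (Nat.beq (Nat.land t I) (Nat.pow 2 p))
      ((I, Nat.lor O (Nat.xor t (Nat.pow 2 p))) :: acc) acc)

theorem mem_tangents {I O p : ℕ} : ∀ (ds : List ℕ) (acc : List (ℕ × ℕ)),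
    acc ⊆ tangents I O p ds acc ∧ ∀ d ∈ ds, Nat.land (lineMask (Nat.mod (Nat.add p d) 91)) I =
      Nat.pow 2 p → (I, Nat.lor O (Nat.xor (lineMask (Nat.mod (Nat.add p d) 91)) (Nat.pow 2 p))) ∈
        tangents I O p ds acc
  | [], acc => ⟨fun _ h => h, fun d hd => by simp at hd⟩
  | e :: ds, acc => by
    rw [tangents]
    refine ⟨fun x hx => ?_, fun d hd h => ?_⟩
    · refine (mem_tangents ds _).1 ?_
      cases Nat.beq (Nat.land (lineMask (Nat.mod (Nat.add p e) 91)) I) (Nat.pow 2 p)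
      · exact hx
      · exact List.mem_cons_of_mem _ hx
    · rcases List.mem_cons.1 hd with rfl | hd
      · rw [h, Nat.beq_refl]
        exact (mem_tangents ds _).1 List.mem_cons_self
      · exact (mem_tangents ds _).2 d hd h

/-- One of the ten lines through a chosen point is its tangent. It meets the chosen points in this
point only, which filters the candidates, and its nine other points can be excluded. -/
theorem Cov.tangent {I O : ℕ} (p : ℕ) (hp : bitAt I p = true) (hp91 : p < 91)
    (h : ∀ st ∈ tangents I O p [0, 90, 88, 82, 64, 42, 35, 30, 14, 10] [], Cov M R cap3 k st) :
    Cov M R cap3 k (I, O) := by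
  intro s hs hk hc hi ho
  rw [bitAt_eq] at hp
  set P : Fin 91 := ⟨p, hp91⟩ with hP
  have hPI : P ∈ bits I := mem_bits.2 hp
  obtain ⟨t, ht, -⟩ := hs.2 P (hi hPI)
  have hPt : inc t P = true := (mem_trc.1 (by rw [ht]; exact Finset.mem_singleton_self P :
    P ∈ trc s t)).2
  obtain ⟨d, hd, htd⟩ : ∃ d ∈ [0, 90, 88, 82, 64, 42, 35, 30, 14, 10],
      t.val = Nat.mod (Nat.add p d) 91 := by
    have := (inc_iff_linesOn _ _).1 hPt
    simp only [linesOn, List.map_cons, List.map_nil, List.mem_cons, List.not_mem_nil, or_false,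
      Fin.ext_iff, Fin.val_add] at this
    simp only [List.mem_cons, List.not_mem_nil, or_false, exists_eq_or_imp, exists_eq_left]
    exact this
  have ht1 : ∀ q, (lineMask t).testBit q = true → q ≠ p → ∀ h : q < 91, (⟨q, h⟩ : Fin 91) ∉ s := by
    intro q hq hqp h hqs
    obtain ⟨_, hq⟩ := (testBit_lineMask t q).1 hq
    have : (⟨q, h⟩ : Fin 91) ∈ trc s t := mem_trc.2 ⟨hqs, hq⟩
    rw [ht, Finset.mem_singleton] at this
    exact hqp (congrArg Fin.val this)
  have hmem := (mem_tangents (I := I) (O := O) (p := p) _ []).2 d hd ?_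
  · refine h _ hmem s hs hk hc hi (Finset.disjoint_left.2 fun q hq hqs => ?_)
    rw [mem_bits] at hq
    change (O ||| (lineMask _ ^^^ 2 ^ p)).testBit q = true at hq
    rw [Nat.testBit_or, Bool.or_eq_true, Nat.testBit_xor, ← htd] at hq
    rcases hq with hq | hq
    · exact Finset.disjoint_left.1 ho (mem_bits.2 hq) hqs
    · by_cases hqp : q.val = p
      · have h1 : (lineMask t).testBit q.val = true :=
          (testBit_lineMask t _).2 ⟨q.2, by rw [show (⟨q.val, q.2⟩ : Fin 91) = P from Fin.ext hqp]; exact hPt⟩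
        rw [h1, hqp] at hq
        simp at hq
      · rw [Nat.testBit_two_pow_of_ne (Ne.symm hqp), Bool.xor_false] at hq
        exact ht1 _ hq hqp q.2 hqs
  · refine Nat.eq_of_testBit_eq fun q => ?_
    change (lineMask _ &&& I).testBit q = (2 ^ p).testBit q
    rw [← htd, Nat.testBit_and]
    by_cases hqp : q = p
    · subst hqp
      rw [(testBit_lineMask t _).2 ⟨hp91, hPt⟩, hp]
      simp
    · rw [Nat.testBit_two_pow_of_ne (Ne.symm hqp)]
      by_contra hcon
      rw [Bool.not_eq_false, Bool.and_eq_true] at hcon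
      obtain ⟨h91, -⟩ := (testBit_lineMask t q).1 hcon.1
      exact ht1 q hcon.1 hqp h91 (hi (mem_bits.2 hcon.2))

/-- The batch of the given states. -/
def packStates (k : ℕ) : List (ℕ × ℕ) → Batch
  | [] => ⟨0, 0, 0⟩
  | st :: sts =>
    let b := packStates k sts
    ⟨Nat.succ b.N, Nat.lor (Nat.lor (Nat.land st.1 b91)
        (Nat.shiftLeft (Nat.land (Nat.sub (Nat.succ k) (pop st.1 91)) 15) 91)) (Nat.shiftLeft b.I 104),
      Nat.lor (Nat.land st.2 b91) (Nat.shiftLeft b.O 104)⟩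

/-- The numbers of further points are less than `16`. -/
def smallCaps (k : ℕ) : List (ℕ × ℕ) → Bool
  | [] => true
  | st :: sts => cond (Nat.ble (Nat.sub (Nat.succ k) (pop st.1 91)) 15) (smallCaps k sts) false

theorem bt_lor_shiftLeft {a : ℕ} (ha : a < 2 ^ 104) (X : ℕ) {p : ℕ} (hp : p < 104) :
    bt (Nat.lor a (Nat.shiftLeft X 104)) 0 p = a.testBit p ∧
      ∀ j, bt (Nat.lor a (Nat.shiftLeft X 104)) (j + 1) p = bt X j p := by
  have e : ∀ j, bt (Nat.shiftLeft X 104) j p = (decide (1 ≤ j) && bt X (j - 1) p) :=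
    fun j => bt_shiftLeft X 1 j p hp
  refine ⟨?_, fun j => ?_⟩
  · rw [bt_lor, e]
    simp [bt]
  · rw [bt_lor, e]
    have : bt a (j + 1) p = false := Nat.testBit_lt_two_pow (ha.trans_le
      (Nat.pow_le_pow_right (by norm_num) (by omega)))
    simp [this]

theorem fits_packStates : ∀ (sts : List (ℕ × ℕ)) (st : ℕ × ℕ), smallCaps k sts = true → st ∈ sts →
    ∀ s : Finset (Fin 91), s.card ≤ k → bits st.1 ⊆ s → Disjoint (bits st.2) s →
    (packStates k sts).Has s
  | [], st, _, hst => by simp at hst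
  | st' :: sts, st, hc, hst => by
    intro s hsk hi ho
    rw [smallCaps] at hc
    cases hcc : Nat.ble (Nat.sub (Nat.succ k) (pop st'.1 91)) 15 with
    | false => rw [hcc] at hc; simp at hc
    | true =>
    rw [hcc, cond_true] at hc
    have hcc : k + 1 - pop st'.1 91 ≤ 15 := Nat.le_of_ble_eq_true hcc
    set b := packStates k sts with hb
    set cp := k + 1 - pop st'.1 91 with hcp
    have h15 : Nat.land cp 15 = cp := by
      change cp &&& 15 = cp
      rw [show 15 = 2 ^ 4 - 1 from rfl, Nat.and_two_pow_sub_one_eq_mod]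
      exact Nat.mod_eq_of_lt (by omega)
    have hI1 : Nat.lor (Nat.land st'.1 b91) (Nat.shiftLeft cp 91) < 2 ^ 104 := by
      refine Nat.or_lt_two_pow ((Nat.and_le_right).trans_lt (b91_eq ▸ pm_lt (by norm_num))) ?_
      change cp <<< 91 < _
      rw [Nat.shiftLeft_eq]
      calc cp * 2 ^ 91 ≤ 15 * 2 ^ 91 := by gcongr
        _ < 2 ^ 104 := by norm_num
    have hO1 : Nat.land st'.2 b91 < 2 ^ 104 :=
      (Nat.and_le_right).trans_lt (b91_eq ▸ pm_lt (by norm_num))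
    have eb : packStates k (st' :: sts) = ⟨b.N + 1, Nat.lor (Nat.lor (Nat.land st'.1 b91)
        (Nat.shiftLeft cp 91)) (Nat.shiftLeft b.I 104),
        Nat.lor (Nat.land st'.2 b91) (Nat.shiftLeft b.O 104)⟩ := by
      rw [packStates, show Nat.sub (Nat.succ k) (pop st'.1 91) = cp from rfl, h15]
    rw [eb]
    have bI : ∀ p < 104, _ := fun p hp => bt_lor_shiftLeft hI1 b.I hp
    have bO : ∀ p < 104, _ := fun p hp => bt_lor_shiftLeft hO1 b.O hp
    rcases List.mem_cons.1 hst with rfl | hst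
    · refine ⟨0, Nat.succ_pos _, ?_⟩
      have hlt : ∀ p, p < 91 → (Nat.lor (Nat.land st.1 b91) (Nat.shiftLeft cp 91)).testBit p =
          st.1.testBit p := by
        intro p hp
        change ((st.1 &&& b91) ||| (cp <<< 91)).testBit p = _
        rw [Nat.testBit_or, Nat.testBit_and, testBit_b91, Nat.testBit_shiftLeft]
        have : ¬ 91 ≤ p := by omega
        simp [hp]
      have hge : ∀ i, (Nat.lor (Nat.land st.1 b91) (Nat.shiftLeft cp 91)).testBit (91 + i) =
          cp.testBit i := by
        intro i
        change ((st.1 &&& b91) ||| (cp <<< 91)).testBit (91 + i) = _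
        rw [Nat.testBit_or, Nat.testBit_and, testBit_b91, Nat.testBit_shiftLeft]
        simp
      have eI : fld (Nat.lor (Nat.lor (Nat.land st.1 b91) (Nat.shiftLeft cp 91))
          (Nat.shiftLeft b.I 104)) 0 = bits st.1 := by
        ext p
        rw [mem_fld, (bI p.val (by omega)).1, hlt _ p.2, mem_bits]
      refine ⟨?_, ?_, ?_⟩
      · rw [eI]; exact hi
      · intro p hp hps
        rw [mem_fld, (bO p.val (by omega)).1] at hp
        change (st.2 &&& b91).testBit p.val = true at hp
        rw [Nat.testBit_and, Bool.and_eq_true] at hp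
        exact Finset.disjoint_left.1 ho (mem_bits.2 hp.1) hps
      · rw [eI, card_bits, cap_eq, (bI 91 (by norm_num)).1, (bI 92 (by norm_num)).1,
          (bI 93 (by norm_num)).1, (bI 94 (by norm_num)).1]
        have h0 := hge 0
        have h1 := hge 1
        have h2 := hge 2
        have h3 := hge 3
        simp only [Nat.reduceAdd] at h0 h1 h2 h3
        rw [h0, h1, h2, h3]
        -- The capacity is at most 15 by `smallCaps`, so bits 91 to 94 hold it completely.
        have : bval (cp.testBit 0) (cp.testBit 1) (cp.testBit 2) (cp.testBit 3) = cp :=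
          (by decide : ∀ n ≤ 15, bval (n.testBit 0) (n.testBit 1) (n.testBit 2) (n.testBit 3) = n)
            cp hcc
        rw [this]
        omega
    · obtain ⟨j, hj, hf⟩ := fits_packStates sts st hc hst s hsk hi ho
      exact ⟨j + 1, Nat.succ_lt_succ hj, hf.congr (fun p hp => (bI p hp).2 j)
        (fun p hp => (bO p (by omega)).2 j)⟩

/-- The element of a list with the given number. -/
def nth : List ℕ → ℕ → ℕ
  | [], _ => 0
  | x :: xs, n => cond (Nat.beq n 0) x (nth xs (Nat.sub n 1))

theorem nth_mem : ∀ (xs : List ℕ) (n : ℕ), nth xs n ≠ 0 → nth xs n ∈ xs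
  | [], n => fun h => (h rfl).elim
  | x :: xs, n => fun h => by
    rw [nth] at h ⊢
    cases hn : Nat.beq n 0
    · rw [hn] at h
      exact List.mem_cons_of_mem _ (nth_mem xs _ h)
    · exact List.mem_cons_self

/-- Each of the numbers is mapped by a collineation to a number from the list `R`. The hints consist
of the number of the collineation and that of the element of the list. -/
def allHints (R : List ℕ) : List ℕ → List ℕ → Bool
  | [], _ => true
  | _ :: _, [] => false
  | n :: ns, h :: hs =>
    let m := Col.dec (Nat.shiftRight h 8)
    let r := nth R (Nat.land h 255)
    cond (not (Nat.beq r 0)) (cond m.reg (cond (Nat.beq (imgMask m.img n 91) r) (allHints R ns hs)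
      false) false) false

theorem cond_eq_true {a b : Bool} : cond a b false = true ↔ a = true ∧ b = true := by
  cases a <;> simp

/-- A hint is 256 times the number of a collineation plus a position in the list. A position out of
range yields 0, which the first test rejects. With no hints at all the test passes only if no
semioval was found. -/
theorem allHints_spec : ∀ (ns hs : List ℕ), allHints R ns hs = true →
    ∀ n ∈ ns, ∃ r ∈ R, M.Equi (bits n) (bits r)
  | [], _, _, n => fun hn => by simp at hn
  | _ :: _, [], h, _ => by simp [allHints] at h
  | n :: ns, h :: hs, hh, m => fun hm => by
    rw [allHints] at hh
    simp only [cond_eq_true] at hh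
    obtain ⟨h1, h2, h3, h4⟩ := hh
    rcases List.mem_cons.1 hm with rfl | hm
    · refine ⟨_, nth_mem R (Nat.land h 255) ?_, ?_⟩
      · intro h0
        rw [h0] at h1
        simp at h1
      · obtain ⟨π, hπ, he⟩ := M.exists_perm h2
        rw [← Nat.eq_of_beq_eq_true h3, bits_imgMask he]
        exact ⟨π, hπ, rfl⟩
    · exact allHints_spec ns hs h4 m hm

/-- Search from the given states, and check that the semiovals that are found are equivalent to
elements of `R`. -/
def run (R : List ℕ) (cap3 : Bool) (k BR lim : ℕ) (sts : List (ℕ × ℕ)) (hs : List ℕ) : Bool :=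
  cond (smallCaps k sts) (match search cap3 BR lim 1000000 [packStates k sts] [] with
    | some L => allHints R L hs
    | none => false) false

theorem cov_of_run {BR lim : ℕ} {sts : List (ℕ × ℕ)} {hs : List ℕ}
    (h : run R cap3 k BR lim sts hs = true) (st : ℕ × ℕ) (hst : st ∈ sts) : Cov M R cap3 k st := by
  rw [run, cond_eq_true] at h
  obtain ⟨h1, h2⟩ := h
  cases hL : search cap3 BR lim 1000000 [packStates k sts] [] with
  | none => rw [hL] at h2; simp at h2
  | some L =>
    rw [hL] at h2
    intro s hs hk hc hi ho
    obtain ⟨n, hn, rfl⟩ := search_spec hs hc _ _ _ _ hL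
      (Or.inl ⟨_, List.mem_cons_self, fits_packStates sts st h1 hst s hk hi ho⟩)
    exact allHints_spec L _ h2 n hn

/-- The element of a list with the given number. -/
def nthState : List (ℕ × ℕ) → ℕ → Option (ℕ × ℕ)
  | [], _ => none
  | x :: xs, n => cond (Nat.beq n 0) (some x) (nthState xs (Nat.sub n 1))

theorem nthState_mem : ∀ (xs : List (ℕ × ℕ)) (n : ℕ) (x), nthState xs n = some x → x ∈ xs
  | [], n, x => fun h => by simp [nthState] at h
  | y :: xs, n, x => fun h => by
    rw [nthState] at h
    cases hn : Nat.beq n 0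
    · rw [hn] at h
      exact List.mem_cons_of_mem _ (nthState_mem xs _ x h)
    · rw [hn] at h
      obtain rfl := Option.some.inj h
      exact List.mem_cons_self

/-- Steps that deal with a state: by a collineation from a known state, by a known state, by
branching on a point, by branching on the tangent at a point, or by a search. -/
inductive Step
  | use (i h : ℕ)
  | known (i : ℕ)
  | point (x : ℕ)
  | tangent (p : ℕ)
  | run (BR : ℕ) (hs : List ℕ)

/-- A list of steps deals with a list of states. -/
def check (R : List ℕ) (cap3 : Bool) (k : ℕ) (kn : List (ℕ × ℕ)) :
    List Step → List (ℕ × ℕ) → Bool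
  | [], [] => true
  | [], _ :: _ => false
  | _ :: _, [] => false
  | .use i h :: ss, st :: sts =>
    let m := Col.dec h
    match nthState kn i with
    | some z => cond m.reg (cond (subm (imgMask m.img z.1 91) st.1)
        (cond (subm (imgMask m.img z.2 91) st.2) (check R cap3 k kn ss sts) false) false) false
    | none => false
  | .known i :: ss, st :: sts =>
    match nthState kn i with
    | some z => cond (subm z.1 st.1) (cond (subm z.2 st.2) (check R cap3 k kn ss sts) false) false
    | none => false
  | .point x :: ss, st :: sts => check R cap3 k kn ss
      ((Nat.lor st.1 (Nat.pow 2 x), st.2) :: (st.1, Nat.lor st.2 (Nat.pow 2 x)) :: sts)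
  | .tangent p :: ss, st :: sts => cond (bitAt st.1 p) (cond (Nat.ble p 90) (check R cap3 k kn ss
      (tangents st.1 st.2 p [0, 90, 88, 82, 64, 42, 35, 30, 14, 10] [] ++ sts)) false) false
  | .run BR hs :: ss, st :: sts => cond (PG2.run R cap3 k BR 1000 [st] hs)
      (check R cap3 k kn ss sts) false

/-- The list of states is a stack, and each step deals with its head or replaces it by finitely many
states that exhaust it. The steps are an untrusted certificate. -/
theorem cov_of_check {kn : List (ℕ × ℕ)} (hkn : ∀ z ∈ kn, Cov M R cap3 k z) :
    ∀ (ss : List Step) (sts : List (ℕ × ℕ)), check R cap3 k kn ss sts = true →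
      ∀ st ∈ sts, Cov M R cap3 k st := by
  intro ss
  induction ss with
  | nil =>
    intro sts h
    cases sts with
    | nil => simp
    | cons => simp [check] at h
  | cons x ss ih =>
    intro sts h
    cases sts with
    | nil => simp
    | cons st sts =>
    cases x with
    | use i n =>
      rw [check] at h
      cases hi : nthState kn i with
      | none => rw [hi] at h; simp at h
      | some z =>
        rw [hi] at h
        simp only [cond_eq_true] at h
        obtain ⟨h1, h2, h3, h4⟩ := h
        refine List.forall_mem_cons.2 ⟨?_, ih _ h4⟩
        obtain ⟨π, hπ, he⟩ := M.exists_perm h1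
        have e1 := bits_subset h2
        have e2 := bits_subset h3
        rw [bits_imgMask he] at e1 e2
        exact (hkn z (nthState_mem _ _ _ hi)).transport hπ e1 e2
    | known i =>
      rw [check] at h
      cases hi : nthState kn i with
      | none => rw [hi] at h; simp at h
      | some z =>
        rw [hi] at h
        simp only [cond_eq_true] at h
        obtain ⟨h1, h2, h3⟩ := h
        exact List.forall_mem_cons.2 ⟨(hkn z (nthState_mem _ _ _ hi)).mono (bits_subset h1)
          (bits_subset h2), ih _ h3⟩
    | point x =>
      rw [check] at h
      have := ih _ h
      exact List.forall_mem_cons.2 ⟨Cov.branch x (this _ (by simp)) (this _ (by simp)),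
        fun z hz => this z (by simp [hz])⟩
    | tangent p =>
      rw [check] at h
      simp only [cond_eq_true] at h
      obtain ⟨h1, h2, h3⟩ := h
      have := ih _ h3
      exact List.forall_mem_cons.2 ⟨Cov.tangent p h1 (Nat.lt_succ_of_le (Nat.le_of_ble_eq_true h2))
        fun z hz => this z (List.mem_append_left _ hz),
        fun z hz => this z (List.mem_append_right _ hz)⟩
    | run BR hs =>
      rw [check, cond_eq_true] at h
      exact List.forall_mem_cons.2 ⟨cov_of_run h.1 st List.mem_cons_self, ih _ h.2⟩

end cover

end PG2

namespace PG2

/-! ### The list of semiovals -/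

/-- Semiovals with at most 16 points, one from each equivalence class. -/
def repT : List ℕ := [
  1242776406646660647230900226, 1243394667720999912228519938, 1242780760366459493097242658,
  1281503907145472693634203650, 1707307896068888164212670594, 2209955357781280908864651266,
  1407217988232594970571771970, 1243683027226788196062986306, 1242779293562075626389128226,
  1397518321261512296459415554, 1629633194655537368452366338, 1552262523290665628521791554,
  1649031486352148778269016082, 1861746721441724791609364514, 1861750780009182553619103778,
  1513575790821269240467718274, 1552265516546243352435163170, 1242775742575108857761140770,
  1436213355328644375738894338, 2026159673683128242988654594, 1252466047814585000087588866,
  1320751605502944867816575042, 1590947042983869444784193634, 1281461368791526768212202530,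
  1242785187875728344129507394, 1243380500630629953090653266, 1484579795952735972097011714,
  1252448569520103376701493282, 1242781351094657125516115970, 1397533300035725167505768450,
  1668336575878873719555358722, 1707329395731079717047771138, 1320161162139048746007175186,
  1552567762123283307058700322, 1242776406944019288639160354, 1291458619068113925202520098,
  1242785889137779325672626210, 1629670097371540356897722370, 1262421008511556299507368066,
  1320151717529984274277244994, 1242795296130626589875767330, 1561932980110467031262822402,
  1243082710508559964901015618, 1243106308218765596737949762, 1552322180051996118963191810,
  1590966467117148454741684226, 1397523043627986158488924210, 2171875079904880555093655586,
  1242776351599127360861999170, 1552263703868893272081436738, 1252768270050668683497646082,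
  2026159968831102068826590242, 1513598756437813242714227730, 1397537137228677717024051266,
  1397537284534804610658107394, 1397541878041944379407993922, 1397533604388953348993196034,
  1707007399022255856859217986, 1242794632043318774578848834, 1436204925166591667455930370,
  1552280250904431374643757122, 1552260826183471930848616450, 1668318894967413853271359490,
  1320453953456751592484120578, 1755361553691432103708721154, 1242776711454751842922233922,
  1590947633000483697504356386, 1281471994125104979203665986, 1416878216204466744408932418,
  1590946710665523286332538914, 1668323017517493116832391170, 1242775742855501852734410754,
  1359446602677788878459543554, 1397518625632771448051535874, 1252485518348464337339824130,
  1242775752079960489999749122, 1282068488036964728477126786, 1242776996951462812034334754,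
  1242776702082796348764178434, 1320156633442954809534646274, 1242775936551889151723307010,
  1243380870422430110682464274, 1281471551979778382749500610, 1474889574005112581214224386,
  1252447154030858099604099074, 1242823851672392381084339362, 1252451945562503090549301250,
  1281480332351788225033938978, 1900474775176267238654087170, 1716699825211694365978693634,
  1252447979512478452154761282, 1552262228710322861632421970, 1397519428354381258325246050,
  1242789947133258876774252546, 1320165884489653335787311106, 1281471422267053505576767490,
  1242788139073098401491197954, 1320151764367279618516879362, 1474894849508186893065912322,
  1242787032259442426171725890, 1262125048933839746463989986, 1397523583195252451244511234,
  2267949633750556295338991618, 1242790241709255524656152706, 1252448043936464747416817666,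
  1252447195237671002573209602, 1600622581323241456805151778, 1513579853149197853245177858,
  1320152916424040500720898050, 1243380500630629961672199282, 1474920278322370337426147330,
  1262118592576936212147802114, 1252763584568654581482913826, 1243087465156842763433101346,
  1417163375053597450513260610, 1243381985588952992740806658, 2209935296945006178718486530,
  1591550915598991887993208914, 1242832411105758457050695890, 1397523006880853874994372610,
  1242813715477049483840782370, 1242813521648841945184788482, 1861783840909242231234268194,
  1320152934870804314096963586, 1262118850843699244578148418, 1243389659434525260506996866,
  1242794932082104308554368002, 1552263565810893785632088066, 1242777015411701326700087426,
  1243691881661519919642202178, 1552263113572930372252542978, 1397518247483536255926165570,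
  1590965268380667584041256978, 1407196442433247660575105058, 1242780796971752789100277762,
  1552280905457591423609997314, 1242810293315541780765675522, 1242776664910058541699057698,
  1755360391843779293648789506, 1320151772870049321332531202, 1572265010689500157082337282,
  1358833266887411379781502978, 1862048809932144849925179394, 1910750054369691514465157250,
  1397523265286137019087839234]

end PG2

namespace PG2

/-! ### The searches -/

/-- States for the search. -/
def slice0 : List (ℕ × ℕ) := [
  (1237940039861981764959371266, 211796148080543793790332685),
  (1237940039861982039837245442, 289167400535950466222976877),
  (1238242271316885422253015042, 289167405444874893288861565),
  (1237940039861981765496209410, 289469646267285566741409661),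
  (1237940039861981769254305794, 598964100821596462270902141),
  (1237940039861981766033080322, 289479091000251323752771453)]

/-- States for the search. -/
def slice1 : List (ℕ × ℕ) := [
  (1237940039861981764959338498, 366536218021000708398256973)]

/-- States for the search. -/
def slice2 : List (ℕ × ℕ) := [
  (1237940039861981764959338562, 366536218021000707324510989)]

/-- States for the search. -/
def slice3 : List (ℕ × ℕ) := [
  (1237940039861981764959342594, 366536218021000707324511053),
  (1237940039861981766033080322, 366536218021000707324515149)]

/-- States for the search. -/
def slice4 : List (ℕ × ℕ) := [
  (1237940039285521012387482754, 57051798497763933922005773),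
  (1237940039285521012387497090, 57051872284740228760214285),
  (1237940039285521012388529282, 57051872293747428014971661),
  (1237940186859473602063893634, 57051872293747711485958925),
  (1547425049106866081112261762, 57052038314444374871923469),
  (1237940043897207030814867586, 521613706881413905172594525)]

/-- States for the search. -/
def slice5 : List (ℕ × ℕ) := [
  (1237940039285521287265387650, 57051872293747428018117389)]

/-- States for the search. -/
def slice6 : List (ℕ × ℕ) := [
  (1237940039285521012388003970, 57051245246263929493268285),
  (1237940039285521029567348866, 153765900967140600764441405)]

/-- States for the search. -/
def slice7 : List (ℕ × ℕ) := [
  (1237940039285523211410735234, 57051835397968033388176189),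
  (1257282852399355079182778498, 134423087853306533968094013)]

/-- States for the search. -/
def slice8 : List (ℕ × ℕ) := [
  (1237940039285521012388004994, 57051245102148741148975933),
  (1237940039429636200463859842, 57051245102148741417412413)]

/-- States for the search. -/
def slice9 : List (ℕ × ℕ) := [
  (1237940039285521046747218050, 57051835397970232427160381),
  (1237940629581331371109908610, 57051245102148878588453693)]

/-- States for the search. -/
def slice10 : List (ℕ × ℕ) := [
  (1237940629581331371093131394, 57051245102148895785100093),
  (1237940039285523211411783810, 57051835397968033387127613)]

/-- States for the search. -/
def slice11 : List (ℕ × ℕ) := [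
  (1237940039285521012656439426, 57051245102148741148976957),
  (1237940629581331388273000578, 57051245102148878605230909)]

/-- States for the search. -/
def slice12 : List (ℕ × ℕ) := [
  (1242775743140440281389731842, 81225597128489969107732301),
  (1237940039861981764959338498, 250778697708128205532467021),
  (1237940039861981764690903058, 250797587320433338060545869),
  (1237940039863107664597745666, 250797587617671499730050941)]

/-- States for the search. -/
def slice13 : List (ℕ × ℕ) := [
  (1237940039861982864202530818, 86061374193995432857079629),
  (1242775761587184355099279362, 81225597128489970181478221)]

/-- States for the search. -/
def slice14 : List (ℕ × ℕ) := [
  (1242775743140440282463469570, 81225597128489969107736397),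
  (1242775743140440281389727762, 81225615575234043891029837)]

/-- States for the search. -/
def slice15 : List (ℕ × ℕ) := [
  (1242775743140440281389727746, 81225615575234043891029853)]

/-- States for the search. -/
def slice16 : List (ℕ × ℕ) := [
  (1237940113072497307225686146, 168268108566765399815808845),
  (1237940039573751388539191426, 264982266513771702736947021)]

/-- States for the search. -/
def slice17 : List (ℕ × ℕ) := [
  (1237940039285522111899107474, 168268108566755504211134285)]

/-- States for the search. -/
def slice18 : List (ℕ × ℕ) := [
  (1237940039285521149826433154, 168268200944600956439398221),
  (1237940039285521287265386626, 264982266369656239783184205)]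

/-- States for the search. -/
def slice19 : List (ℕ × ℕ) := [
  (1237940039285522112167542914, 168268108566755504211134301),
  (1237940113072497307225702530, 168268108566765399815792461)]

/-- States for the search. -/
def slice20 : List (ℕ × ℕ) := [
  (1237940039285522111899107458, 168268108711996592462268253),
  (1237940039429637299974963330, 168268108567881404386412381)]

/-- States for the search. -/
def slice21 : List (ℕ × ℕ) := [
  (1237940113072497307225694338, 168268108566765399815784269),
  (1237940039286648011805950082, 168268108566755504479569757)]

/-- States for the search. -/
def slice22 : List (ℕ × ℕ) := [
  (1257282852399355079182778498, 168268200800485905806690125),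
  (1237940039429636337902289026, 168268200800485768363542349)]

/-- States for the search. -/
def slice23 : List (ℕ × ℕ) := [
  (1237940334433426191740305554, 4165794888390603366074189),
  (1237940039285523211410735234, 468393613992887210344845149),
  (1237940039285521012387545218, 487736427394953921034587997)]

/-- States for the search. -/
def slice24 : List (ℕ × ℕ) := [
  (1237940334433426192008740994, 4165794888390603366074205),
  (1392682544196193546749870210, 313651099857646370476658525)]

/-- States for the search. -/
def slice25 : List (ℕ × ℕ) := [
  (1237940039285522111899107458, 4166099259667841048514381),
  (1237940048508894148753883266, 4166090036295804193738573)]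

/-- States for the search. -/
def slice26 : List (ℕ × ℕ) := [
  (1237940334433426191740305538, 4165799644191810137753437),
  (1237940339045112210167693442, 4165795032505791710365533)]

/-- States for the search. -/
def slice27 : List (ℕ × ℕ) := [
  (1237940334577541379816161410, 4165794888390603634509661)]

/-- States for the search. -/
def slice28 : List (ℕ × ℕ) := [
  (1237940039285521012655915010, 676663470278488952372724621),
  (1237940039285521012387480578, 1083195099404349135948076029)]

/-- States for the search. -/
def slice29 : List (ℕ × ℕ) := [
  (1237940039285522111899107330, 623466306992362879802410957),
  (1237940039285521012655915010, 691166152895357731241953261),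
  (1392682544196193546749870082, 768840858912543231664445421),
  (1237940039285521012388003842, 923592808556190443148400621)]

set_option maxHeartbeats 0 in
theorem run_slices :
    run repT false 16 166992963367979818008226314 3000 slice0 [
      20676774175, 20376187679, 10324350239, 13564398623, 6095117340, 18013272348, 6457004572,
      18061436188, 4681894940, 16802869020, 7997953308, 16655679260, 4176817180, 6992398108,
      154302972697, 15378391171, 176321991449, 176342894105, 110225742873, 154280600345,
      154282070297, 154304838169, 46926610294, 57810915702, 144370856310, 6151692623,
      145924675210, 44495641206, 154282465049, 41336505462, 32085909622, 45025654390,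
      34547858038, 80866442122, 31274093942, 15139859791, 3989875587, 29645609846, 23657953910,
      6697378383, 9414613583, 88162303001, 88160080409, 33173929590, 137477712010, 44733775242,
      31280065654, 54005645174, 47218117238, 133144283786, 134032613494, 29638891126,
      11383878943, 9719576860, 11497464348, 13960525596, 49652445302, 110220913177, 176321250959,
      132240285327, 132240287375, 132239913359, 17044359967, 3473278236, 176334327065,
      110227988249, 176320879129, 33174676342, 23317923978, 27198591350, 33119803786,
      55069025674, 65967882378, 46927729782, 80503275382, 45843069302, 8689147167, 154296249369,
      19390530076, 44768113014, 61351179382, 141291199114, 56180938358, 11527738908, 45588513654,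
      68604139402, 45263413642, 144383546742, 56466846838, 68026476176, 67483027856, 66394099856,
      133214825846, 4167271452, 17741548060, 88188067097, 110201127937, 14470020892,
      176322386201, 159130563586, 119891766274, 110201127961, 88162307215] = true ∧
    run repT false 16 166992963367979813713260042 3000 slice1 [
      89709786452, 159456414277, 23130258030, 106564239156, 134145978222, 102992952165,
      116920943225, 168979730505, 97281888568, 194940746836, 29996477815, 63918374781,
      61462393474, 192080161893, 179461120328, 128017913397, 194895198553, 144511071598] = true ∧
    run repT false 16 166992963367979813713260042 3000 slice2 [
      138110165612, 172623770146, 98405048372, 81230560601, 190359497591, 102991104056,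
      193802285123, 54136277117, 88180962325, 141752070745, 96003425845, 156527525204,
      60171701623, 113371128888, 110635936568, 195696508706, 152745806199, 66121656411,
      71057099648, 49254174304, 173938830420, 181346753608, 192542255735, 25565093677,
      91664807733] = true ∧
    run repT false 16 166992963367979813713260042 3000 slice3 [
      100454883929, 56311196541, 97238008437, 186472436547, 42160468525, 183676095813,
      110206734357, 48981329248, 64617377132, 26941226848, 174937240183, 110810113141,
      40079391863, 179219082796, 110202967317, 171807849250, 162693768748, 110899449445,
      183875765109, 179196288812, 192542255991, 177136815173, 188648534105, 60005908781,
      154551940165, 154784083000, 156092594504, 45669510018, 34031686510, 119173763124,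
      123181387298, 173747218228, 132785182336, 88705066313, 116375256441] = true ∧
    run repT false 16 166985288585133615534484178 3000 slice4 [
      59837288073, 132240660111, 88162700175, 132240657295, 15397287819, 196010828169,
      176320871823, 13562571627, 3440277131, 62838550153, 10449352555, 132240675471, 89520983181,
      3410251403, 112695907209, 3639058539, 15367262091, 110201500815, 154282075535, 88161195151,
      66120889999, 132241780111] = true ∧
    run repT false 16 166985288585133615534484178 3000 slice5 [
      129830225033, 19271659403, 19226077323, 49067186690, 23172733186, 8417672299] = true ∧
    run repT false 16 166985288585138013580995266 3000 slice6 [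
      170055170891, 8383579722, 176676347766, 108404704574, 94305182528, 22813806410,
      117675646295, 39432645665, 53325224531, 117722083120, 4068704614, 78082883890,
      154952791675, 157859929662, 79420181115, 118194261560, 67755065920, 31035660864,
      68354028842, 62531078706, 23403144484, 89793717346, 95558483574, 27479754273, 163487859522,
      80833338937] = true ∧
    run repT false 16 166985288585138013580995266 3000 slice7 [
      9641726308, 87634240845, 112840740985, 42074980451, 191084691579, 88758004603,
      156013189497, 88976511242, 47230434612, 118492271908, 161298465846, 194014300208,
      22046949935, 31453086563, 35398993485, 125695355488, 63739952991, 50055092037,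
      115414259508, 171425030666, 6569650062, 172478812750, 47965904255, 46328662364] = true ∧
    run repT false 16 166985288585138013580995266 3000 slice8 [
      179338009401, 59715624737, 58233251955, 16647101997, 110206328204, 128212520790,
      110224987773, 170343252515, 53164733830, 137161057586, 123175721590, 120402485029,
      140626795062, 31862405668, 146434531701, 191850461508, 42731994995, 177940760388,
      163271355460, 67715026744, 180016120869, 91825453642, 158389223984, 113488162595,
      19172995622, 106841149740, 120771962683, 10668389165, 193622627698, 120008836223,
      12733536358, 131583258164, 63070181896, 47787247368, 38988391274, 161885194828,
      190417124416, 91104004152, 177935909462, 135261035910] = true ∧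
    run repT false 16 166985288585138013580995266 3000 slice9 [
      8396764209, 31427446352, 173566064695, 16471679281, 112105221995, 19309970241, 67866191685,
      182771178839, 183865087542, 41709740873, 29789358455, 19267755585, 97344227380,
      75115700618, 77199443990, 58280101748, 73178401076, 69563867767, 98860304694, 140694519851,
      161994426402, 160240379191, 88977476226, 102873399606, 91345739572, 159197894193,
      78831821657, 184439643509, 157408042373, 98000636435] = true ∧
    run repT false 16 166985288585138013580995266 3000 slice10 [
      63142810439, 52037254006, 14652651827, 51214170161, 7985325128, 24536213296, 113305441543,
      21298580567, 91906312816, 78980528449, 28678668352, 15235208825, 18344341061, 103574895706,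
      150569515887, 122603784225, 63436936300, 179704718864, 7875428144, 36526148972,
      37455199365, 40038685061, 70975750711, 29674490927, 149891246129, 66938409083, 95844459394,
      85448440881, 81715970108, 117570411047, 113365522224, 169011690001, 193896807753,
      22061514031, 98014891298] = true ∧
    run repT false 16 166985288585138013580995266 3000 slice11 [
      110264560911, 87705048416, 150760878405, 177092366626, 148287252287, 153293216872,
      118311757631, 45001767776, 108925909862, 190297515798, 22584625531, 103151140976,
      70459286578, 183357662554, 118360452916, 78224981593, 44229537910, 40465771369,
      164081848075, 154295885181, 116082508594, 68694059572, 125174841643, 16496390438,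
      111562661177, 2820051238, 132032756282] = true ∧
    run repT false 16 171828666069977582402579978 3000 slice12 [
      110179061591, 103740530480, 12030734678, 31852396873, 112210294114, 95062055712,
      175184844664, 76112256548, 185556933433, 111405199970, 178933248380, 38149240138,
      135469185592, 34602115929, 157141368674, 147813739593, 8047832711, 185894171744,
      110213177466, 125393021773, 184019543163, 138704241497, 176320680577, 170799518260,
      22040766246, 24297071140, 78163622762, 194296420953, 192068917092, 40491876971,
      133780671849, 88416081199, 18273084695] = true ∧
    run repT false 16 171828666069977582402579978 3000 slice13 [
      22042738692, 88180045061, 12230682119, 88704521587, 14325910131, 87056825666, 178311023931,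
      88390734383, 191036295218, 49212407861, 19186543219, 86843663669, 110384941677,
      151251071010, 43994254645, 13689611350, 166175834763, 65987485767, 131747936139,
      66120996888, 66121834880, 189317254694, 170573075238, 66038094698] = true ∧
    run repT false 16 171828666069977582402579978 3000 slice14 [
      56189187598, 153199887723, 162519229243, 6314422391, 54605677628, 159851802128,
      130177484654, 156826902634, 177137754217, 185538273099, 187782407520, 48836912672,
      53493951607, 89276070200, 43368839204, 91410916899, 154554137485, 58293763122, 91040511307,
      146953203836, 154332281176, 72282366498, 182914741115, 63674296377, 29173735498, 4889533734] = true ∧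
    run repT false 16 171828666069977582402579978 3000 slice15 [
      149042798881, 65197043586, 87186058114, 152692807460, 12755910177, 76563255585,
      171065155199, 97119396448, 132259948369, 162553858096, 121847709294, 90782507606,
      181990839908] = true ∧
    run repT false 16 171820991863596530278771346 3000 slice16 [
      132307840519, 122525033549, 89290255662, 56731712810, 113289814865, 111457826083,
      122460937356, 193471953220, 127363793273, 187232490084, 116020033030, 127299316007,
      69215432548, 5616251182, 172487306784, 121232078968, 15012910717, 107569299325,
      175101614935, 142080606779, 125675212323, 133830760737, 88977668194, 22686016823,
      197284799332, 190506122302, 20324831598, 68464997921, 128411308404, 28525112368,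
      99804784456, 94726497844] = true ∧
    run repT false 16 171820991863596530278771346 3000 slice17 [
      163525636102, 92234183735, 97016920634, 146453537581, 137559005533, 94044734990,
      124117888039, 143544228715, 181230670964, 44899230798, 14268986450, 80527423784,
      93840544649, 189403134010, 168874577693] = true ∧
    run repT false 16 171820991863596530278771346 3000 slice18 [
      89250831113, 129140753963, 75136589629, 69974081079, 56334441335, 156458738049,
      166658614580, 32323107149, 154415993681, 90596188455, 184982104424, 137983811625,
      34294479479, 24274961267, 142001964619, 66129842230, 154825990016, 67482851952,
      53096588396, 54847670861, 183413045868, 89202540581, 34304680976, 21458180163, 88271682129,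
      78992127777, 121608864575, 11374034245, 152956349741, 34755882529, 143975639085,
      130409834070] = true ∧
    run repT false 16 171820991863596530278771346 3000 slice19 [
      101730779745, 153457730887, 195380085799, 64935960703, 149477927801, 75928927342,
      44191844615, 43121853455, 47599928864, 142104867972, 40769090150, 58040324454, 35511932457,
      100244165757, 175501824090, 76080273721, 125858805614, 156496010529, 176812805945,
      106157811832, 143141311277, 113910713403, 180741749581, 165779359035, 12037496452,
      112280455812, 55848658545, 98054120777, 149932176261, 73550043942] = true ∧
    run repT false 16 171820991863596530278771346 3000 slice20 [
      171432016701, 155407407945, 161304813899, 90066835078, 19316917297, 36758969932,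
      123003418222, 75053603640, 56482901333, 67653814355, 66665214555, 51433456198,
      149401987449, 77504808805, 178699573833, 121330291809, 48035254328, 16850637154,
      63901209663, 116052712305, 184943273282, 141846860806, 38768273441, 47716915764,
      176521720914, 87933652287, 72174189857, 32174709063, 182302957115, 57039703664,
      90935921185, 169086554508, 11736254597, 142564126576, 79488571949, 187611717912,
      36743647038, 87203951905] = true ∧
    run repT false 16 171820991863596530278771346 3000 slice21 [
      15713521431, 157384804633, 96721371451, 40299867199, 169612802692, 146278910019,
      30576782917, 76814915409, 66554971762, 66666418000, 195873218913, 132784915299,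
      125626145158, 31845709839, 106699998476, 139973217094, 143350477347, 55595729788,
      3347383658, 132308952405, 101800000035, 165470346623, 91374185069, 182055722082,
      195061132386, 72541396769, 193103223874, 58327553859, 63499976249, 65432259907,
      92235856732, 36458696293, 62481492295, 110737456682, 119628188234, 165279303805,
      37577204268, 197148224024, 125714494306, 17492997462, 153749387596, 19467418417,
      44354280795, 61225575244, 61559569518, 67141720916, 195109999187, 174302206833,
      114957469478, 180407354429, 192003404154, 115563418989] = true ∧
    run repT false 16 171820991863596530278771346 3000 slice22 [
      61593581678, 40654830206, 26510661949, 48987718743, 159528896558, 96617648497,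
      159204117554, 26502204713, 3124664168, 183583906904, 59674498091, 144634738521,
      176112912941, 152067225652, 187458116675, 39479225925, 21554229614, 182140154217,
      2778894449, 82177486408, 71902682710, 74136515148, 112164384546, 117175436872, 52099390048,
      12129528901, 66676652843, 36338443328, 165123032106, 106674483517] = true ∧
    run repT false 16 171820991863596530278640338 3000 slice23 [
      150813620755, 99882464821, 141727298342, 18668834162, 45500428069, 60458948641,
      74570896673, 116506075524, 96703196760, 176864510747, 106711010574, 165901878859,
      124456876835, 197597640512, 90337873014, 176384163616, 40339447841, 96212778824,
      129486136945, 139053277473, 23128776488, 185497742431, 113341126790, 35354039654,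
      132913240611, 162029628455, 162376166179, 154280954927, 66378053988, 75174629243,
      167254533195, 67753640996, 148794830608] = true ∧
    run repT false 16 171820991863596530278640338 3000 slice24 [
      60466154041, 45442279271, 166483034430, 52059439659, 79656234570, 176570196340,
      182552674598, 49325413707, 106839170936, 120008776776, 151722624042, 55834471792,
      157738980642, 141649893664, 175152901938, 159288473122, 176321249548, 133115171113,
      137586047618, 146939789649, 180900592724, 30164879427, 21169037437, 77361360681,
      22912205962, 26677211168, 39734804235, 102539876196, 125263492998, 70106276153,
      28884439338, 46765384796, 67624415784, 85884761222, 85280572532, 14315073418, 133003567238,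
      103357294959, 153078798138, 177954575410, 110201364839, 95403432048] = true ∧
    run repT false 16 171820991863596530278640338 3000 slice25 [
      197776421230, 80816635177, 198252347713, 154537737583, 135280467070, 186395415305,
      155914355742, 119492543262, 166977281601, 186504028511, 25145025885, 163439926922,
      134756716414, 197387414892, 9091572048, 100698157585, 84799059282, 29213843791,
      85251411551, 88366034769, 99851942775, 182169323309, 182486882878, 184920613447,
      142652820538, 103863250558, 174209000287, 104755004222, 22041028207, 88369022289,
      44312003153, 66136876655, 149161709175, 105261980231, 177410859390, 132386618961,
      96411102821, 117953766721, 35480855678] = true ∧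
    run repT false 16 171820991863596530278640338 3000 slice26 [
      54675602952, 72430616686, 39828288366, 5347094560, 88161578547, 114394524765, 126306532158,
      42174014310, 14101606447, 154396648963, 30433701508, 121391394372, 8047717746, 71758018416,
      75461130290, 36743437932, 154316876591, 149239974725, 107597681247, 191029675066,
      103250832702, 49443690281, 162154928496, 125653726797, 49808528230, 29090923332,
      131573027199, 8361642272, 195934022718, 153991602308, 21414868871, 184345854065,
      176511752751] = true ∧
    run repT false 16 171820991863596530278640338 3000 slice27 [
      3046804755, 112377979925, 56563135763, 37477563411, 194998660463, 66901722180, 78598218298,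
      96212712277, 168976345441, 135081037381, 110472199463, 88978404195, 175108480853,
      107764336483, 176706771524, 111596750168, 71483653492, 122406200902, 190305992491,
      119053928316, 139059545354, 125868076092, 119442551132, 93415968034, 37743300972,
      23947749492, 162074520134, 66378069841, 132249693516, 132241510732, 155034902845,
      45164129813, 157417810728, 159204191350] = true ∧
    run repT true 16 166982927401329093317274114 3000 slice28 [
      49001134984, 26950395016, 87248802398, 45637783646, 76005260126, 139571433741,
      162674902802, 52786937694, 189561241114, 22859222152, 192896648978, 81638334600,
      64736863582, 88557571085, 188551089178, 32960667998, 24498164872, 89523051282, 43501067034,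
      197517636621, 24217461896, 45168615304, 88706026522, 64659194125, 61922153741, 90485396237,
      188587444242, 149431721822, 88704526098, 192370168333, 86874253662, 143655744538,
      51422723166, 79823270750, 68025333786, 23945408794, 78164130142, 71658472798, 84688874078,
      110202968845, 61251130760, 118534428434, 177138048274, 44899159176, 78766523917,
      45170568474, 142077247838, 110219765517, 79361718622, 153429114974, 66938068506,
      166280235026, 191022870034, 156735160082, 88000009822, 97108561946, 155915110426,
      155868739085, 69827098718, 78096206472, 67210527514, 185320024850, 170007038234,
      26533276510, 36608367454, 161646356498, 46257838874, 142537742174, 148761454686,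
      88160084493, 152322077534, 87992525918, 150789975390, 173277048589, 154298858509,
      25053560456, 24588472670, 123434642701, 88185068813, 181479545882, 34132063326,
      183686298130, 48613990925, 155913257234, 34037241480, 58769386846, 146050168158,
      30262861406, 23507163486, 144494025608, 45376135262, 140606734686, 79824762462,
      90204337933, 107066961165, 160257868314, 126106024730, 33346915166, 31859339144,
      63204459358, 88161946893, 139607834248, 170825123602, 23401545864, 46463780958,
      61659339802, 144253660254, 115269083418, 154197802590, 135169622622, 169801434642,
      88160454157, 161312193549, 107356513810, 112555550221, 119851488282, 162676396818,
      144236847496, 88163793165, 45441482632, 170302628109, 82056581214, 140607111006,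
      135290100062, 157233306130, 38773925726, 154291769357, 57769963102, 110200387085,
      99194345234, 180026621466, 32604194061, 61242198664, 112105473050, 177682260762,
      43399610462, 112541740045, 113080883730, 86126222349, 33879898206, 195923995666,
      87509727326, 35687997790, 117171885325, 148516422750, 111562780434, 104619483410,
      191841399570, 167049113626, 36136999693, 149431721566, 45083134046, 78120816520,
      85279400286, 169758431757, 110200375309, 110203714061, 43773910554, 69181534046,
      88161568013, 173277423629, 29341636109, 174630070285, 176864096274, 49445311582,
      163280039442, 91927527706, 141271018590, 173821992717, 34400065630, 27528440158,
      45985386778, 46257378184, 68113656670, 79840034398, 76593461517, 42735408776, 184194934029,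
      71676384350, 145542030942, 101635837709, 178216591629, 116057052186, 197015371026,
      108786389786, 158598685709, 154280229389] = true ∧
    run repT true 16 171818630679787610015050242 3000 slice29 [
      69814471262, 145449199124, 7153530206, 156186657562, 134715628813, 154718016274,
      43137463572, 36741445726, 109813022088, 37161614984, 68164420446, 144361361246,
      147027999880, 133535820045, 19104558174, 139083268114, 80531330952, 177137744776,
      72948684826, 55628746590, 3499316360, 39503196946, 46074857229, 51353677662, 3934166622,
      145297706002, 19988746334, 74701619038, 122471186014, 90018460946, 183351120397,
      125670931550, 36253599326, 67483058270, 166537293662, 134790709598, 111016920712,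
      89251321620, 186718651528, 47686983442, 124254589022, 112105964638, 57676797534,
      168843766290, 96757095518, 139988606228, 77968588638, 185369121374, 112822428766,
      190857688594, 31345901330, 119443554578, 40135632264, 155370980232, 114592872210,
      144249517448, 90203218706, 23129157256, 167259309406, 6475247122, 22586874206, 35553175134,
      192546769758, 76907057800, 124555302024, 188199926622, 3880617748, 57126132616,
      12166158866, 60326961758, 174430894686, 67481780872, 80381100126, 16785312392,
      100424419678, 67480807518, 156261769997, 171305195102, 139599676941, 37614082184,
      35626619742, 175801752456, 13498645598, 137364377101, 119616471688, 42897173268,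
      53671913608, 183806752094, 19006427016, 174924437640, 132859494750, 179864909448,
      46257303688, 63125760350, 80247664264, 144917780830, 164208992392, 28936826504,
      39862292498, 34173994120, 178029965330, 8393732702, 113204942354, 59284381576, 33248052574,
      111561615966, 188605961054, 181720592658, 10590888286, 61540402014, 126742766612,
      159909339016, 71247476754, 178778593928, 119039129950, 41641390942, 60847413010,
      31917588574, 97688074078, 169297691742, 117888254344, 38492256532, 156187273566,
      136390973576, 157958614878, 25655561242, 131555964766, 134146482708, 23946589210,
      20717030170, 56944569736, 44899073293, 160275647757, 46257070472, 85922060045, 92742615134,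
      106444850445, 101265206802, 124498103902, 129564074258, 125653255188, 154825725714,
      190468098578, 191495491422, 193471749982, 126438694750, 84038931038, 178497823252,
      104827819656, 80637223006, 123917081694, 34007314962, 114077502600, 186442464606,
      167624949896, 166209213210, 144361360990, 171305195358, 170994959966, 101208875277,
      140453290078, 102270793822, 26958120980, 10207385106, 20403573010, 198153223006,
      106406432904, 56530681618, 133466768909] = true := by
  refine ⟨?_, ?_, ?_, ?_, ?_, ?_, ?_, ?_, ?_, ?_, ?_, ?_, ?_, ?_, ?_, ?_, ?_, ?_, ?_, ?_, ?_, ?_, ?_, ?_, ?_, ?_, ?_, ?_, ?_, ?_⟩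
  all_goals decide +kernel

end PG2

namespace PG2

/-! ### Deduction from the searches -/

section

variable {K : Type*} [Field K] (M : Model K)

/-- States for the branches. -/
def subA1 : List (ℕ × ℕ) := [
  (1237940039861981764959371266, 211796148080543793790332685),
  (1237940039861982039837245442, 289167400535950466222976877),
  (1238242271316885422253015042, 289167405444874893288861565),
  (1237940039861981765496209410, 289469646267285566741409661),
  (1237940039861981766033080322, 289479091000251323752771453),
  (1237940039861981769254305794, 598964100821596462270902141)]

theorem cov_subA1 : ∀ st ∈ subA1, Cov M repT false 16 st :=
  cov_of_check (kn := slice0) (cov_of_run (run_slices.1))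
    [
      .known 0, .known 1, .known 2, .known 3, .known 5, .known 4]
    _ (by decide +kernel)

/-- A state with known tangents. -/
def rootA1 : ℕ × ℕ := (1237940039861981764959338498, 211796148080543793790332685)

/-- Each point that is branched on leads to an image of a state in `subA1`, which has one more
chosen point than the root. The excluded points accumulate, so that later states may assume the
orbits of the earlier ones to be avoided. When none of the listed points is chosen, the final
search, with an empty list of hints, finds no semioval. -/
theorem cov_rootA1 : ∀ st ∈ [rootA1], Cov M repT false 16 st :=
  cov_of_check (kn := subA1) (cov_subA1 M)
    [
      .point 5, .use 0 86119689, .point 6, .use 0 86097871, .point 14, .use 0 86157755,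
      .point 15, .use 0 86106566, .point 31, .use 0 86097924, .point 35, .use 0 86169358,
      .point 46, .use 0 86210170, .point 86, .use 0 86195639, .point 4, .use 1 86210170,
      .point 23, .use 1 86119689, .point 33, .use 1 86169358, .point 38, .use 1 86106566,
      .point 39, .use 1 86097871, .point 53, .use 1 86157755, .point 58, .use 1 86097924,
      .point 62, .use 1 86195639, .point 16, .use 2 86210170, .point 21, .use 2 86097924,
      .point 24, .use 2 86195639, .point 41, .use 2 86169358, .point 44, .use 2 86157755,
      .point 57, .use 2 86119689, .point 63, .use 2 86097871, .point 78, .use 2 86106566,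
      .point 22, .use 3 86097871, .point 29, .use 3 86106566, .point 34, .use 3 86097924,
      .point 73, .use 3 86119689, .point 17, .use 4 86097924, .point 30, .use 4 86106566,
      .point 36, .use 4 86097871, .point 88, .use 4 86119689, .point 32, .use 5 86097924,
      .point 45, .use 5 86097871, .run 166992963367979818008226314 []]
    _ (by decide +kernel)

/-- States for the branches. -/
def subA0 : List (ℕ × ℕ) := [
  (1237940039861981764959338498, 211796148080543793790332685)]

theorem cov_subA0 : ∀ st ∈ subA0, Cov M repT false 16 st :=
  cov_of_check (kn := [rootA1] ++ (slice0)) (List.forall_mem_append.2 ⟨cov_rootA1 M, (cov_of_run (run_slices.1))⟩)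
    [
      .known 0]
    _ (by decide +kernel)

/-- A state with known tangents. -/
def rootA0 : ℕ × ℕ := (1237940039861981764690903042, 211796148080543793790332685)

/-- All listed points are equivalent to the point `28`, which has been added in `subA0`. The
symmetry left after this choice is used once more in `cov_rootA1`. -/
theorem cov_rootA0 : ∀ st ∈ [rootA0], Cov M repT false 16 st :=
  cov_of_check (kn := subA0) (cov_subA0 M)
    [
      .point 4, .use 0 86137237, .point 5, .use 0 86180976, .point 6, .use 0 86192676, .point 12,
      .use 0 86096376, .point 14, .use 0 86109498, .point 15, .use 0 86141610, .point 16,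
      .use 0 86137236, .point 17, .use 0 86157666, .point 20, .use 0 86108040, .point 21,
      .use 0 86210154, .point 22, .use 0 86100822, .point 23, .use 0 86108041, .point 24,
      .use 0 86176602, .point 28, .use 0 86097871, .point 29, .use 0 86105179, .point 30,
      .use 0 86109499, .point 31, .use 0 86151834, .point 32, .use 0 86105178, .point 33,
      .use 0 86157667, .point 34, .use 0 86099346, .point 35, .use 0 86121163, .point 36,
      .use 0 86195592, .point 38, .use 0 86122620, .point 39, .use 0 86166432, .point 41,
      .use 0 86166433, .point 42, .use 0 86102244, .point 43, .use 0 86099347, .point 44,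
      .use 0 86204323, .point 45, .use 0 86103738, .point 46, .use 0 86210155, .point 50,
      .use 0 86102245, .point 51, .use 0 86094919, .point 53, .use 0 86195593, .point 57,
      .use 0 86141611, .point 58, .use 0 86204322, .point 62, .use 0 86176603, .point 63,
      .use 0 86169348, .point 64, .use 0 86097870, .point 65, .use 0 86096377, .point 67,
      .use 0 86094918, .point 69, .use 0 86100823, .point 70, .use 0 86151835, .point 73,
      .use 0 86103739, .point 74, .use 0 86122621, .point 78, .use 0 86180977, .point 84,
      .use 0 86192677, .point 86, .use 0 86169349, .point 88, .use 0 86121162,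
      .run 166992963367979818008226314 []]
    _ (by decide +kernel)

/-- States for the branches. -/
def subB0 : List (ℕ × ℕ) := [
  (1237940039861981764959338498, 366536218021000707324510989)]

/-- Branching on a few points without use of symmetry merely distributes one large search over
several smaller ones. The same is done for the types D, E, F and G. -/
theorem cov_subB0 : ∀ st ∈ subB0, Cov M repT false 16 st :=
  cov_of_check (kn := slice1 ++ slice2 ++ slice3) (List.forall_mem_append.2 ⟨List.forall_mem_append.2 ⟨cov_of_run (run_slices.2.1), cov_of_run (run_slices.2.2.1)⟩, cov_of_run (run_slices.2.2.2.1)⟩)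
    [
      .point 6, .known 1, .point 12, .known 2, .point 30, .known 3, .known 0]
    _ (by decide +kernel)

/-- A state with known tangents. -/
def rootB0 : ℕ × ℕ := (1237940039861981764690903042, 366536218021000707324510989)

theorem cov_rootB0 : ∀ st ∈ [rootB0], Cov M repT false 16 st :=
  cov_of_check (kn := subB0) (cov_subB0 M)
    [
      .point 15, .use 0 86109485, .point 16, .use 0 86109484, .point 20, .use 0 86121181,
      .point 23, .use 0 86121180, .point 28, .use 0 86106566, .point 36, .use 0 86096381,
      .point 44, .use 0 86119724, .point 50, .use 0 86106567, .point 51, .use 0 86094919,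
      .point 53, .use 0 86119725, .point 58, .use 0 86096380, .point 67, .use 0 86094918,
      .run 166992963367979813713260042 []]
    _ (by decide +kernel)

/-- States for the branches. -/
def subC1 : List (ℕ × ℕ) := [
  (1237940039285521012387482754, 57051798497763933922005773),
  (1237940039285521012387497090, 57051872284740228760214285),
  (1237940039285521012388529282, 57051872293747428014971661),
  (1237940039285521287265387650, 57051872293747428018117389),
  (1237940186859473602063893634, 57051872293747711485958925),
  (1547425049106866081112261762, 57052038314444374871923469)]

theorem cov_subC1 : ∀ st ∈ subC1, Cov M repT false 16 st :=
  cov_of_check (kn := slice4 ++ slice5) (List.forall_mem_append.2 ⟨cov_of_run (run_slices.2.2.2.2.1), cov_of_run (run_slices.2.2.2.2.2.1)⟩)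
    [
      .known 0, .known 1, .known 2, .known 6, .known 3, .known 4]
    _ (by decide +kernel)

/-- A state with known tangents. -/
def rootC1 : ℕ × ℕ := (1237940039285521012387480706, 57051798497763933922005773)

theorem cov_rootC1 : ∀ st ∈ [rootC1], Cov M repT false 16 st :=
  cov_of_check (kn := subC1) (cov_subC1 M)
    [
      .point 11, .use 0 86106566, .point 66, .use 0 86096395, .point 14, .use 1 86106566,
      .point 53, .use 1 86096395, .point 20, .use 2 86106566, .point 21, .use 2 86096395,
      .point 33, .use 3 86096395, .point 38, .use 3 86106566, .point 64, .use 4 86096395,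
      .point 67, .use 4 86106566, .point 63, .use 5 86096395, .point 88, .use 5 86106566,
      .run 166985288585133615534484178 []]
    _ (by decide +kernel)

/-- States for the branches. -/
def subC0 : List (ℕ × ℕ) := [
  (1237940039285521012387480706, 57051798497763933922005773),
  (1237940043897207030814867586, 521613706881413905172594525)]

theorem cov_subC0 : ∀ st ∈ subC0, Cov M repT false 16 st :=
  cov_of_check (kn := [rootC1] ++ (slice4 ++ slice5)) (List.forall_mem_append.2 ⟨cov_rootC1 M, (List.forall_mem_append.2 ⟨cov_of_run (run_slices.2.2.2.2.1), cov_of_run (run_slices.2.2.2.2.2.1)⟩)⟩)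
    [
      .known 0, .known 6]
    _ (by decide +kernel)

/-- A state with known tangents. -/
def rootC0 : ℕ × ℕ := (1237940039285521012387479682, 57051798497763933922005773)

/-- Here the further points fall under two representatives; the second state of `subC0` is used only
after the points of the first kind have been excluded. -/
theorem cov_rootC0 : ∀ st ∈ [rootC0], Cov M repT false 16 st :=
  cov_of_check (kn := subC0) (cov_subC0 M)
    [
      .point 4, .use 0 86157677, .point 6, .use 0 86191281, .point 10, .use 0 86096395,
      .point 11, .use 0 86102299, .point 13, .use 0 86100823, .point 14, .use 0 86169344,
      .point 15, .use 0 86204348, .point 17, .use 0 86109592, .point 19, .use 0 86105251,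
      .point 22, .use 0 86100804, .point 23, .use 0 86192721, .point 24, .use 0 86173671,
      .point 29, .use 0 86105196, .point 34, .use 0 86099400, .point 37, .use 0 86099347,
      .point 41, .use 0 86176659, .point 46, .use 0 86153357, .point 50, .use 0 86102226,
      .point 53, .use 0 86156224, .point 58, .use 0 86164988, .point 63, .use 0 86141615,
      .point 64, .use 0 86097834, .point 65, .use 0 86096412, .point 66, .use 0 86097871,
      .point 67, .use 0 86095008, .point 70, .use 0 86121200, .point 71, .use 0 86094919,
      .point 73, .use 0 86103792, .point 74, .use 0 86175204, .point 78, .use 0 86135747,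
      .point 87, .use 0 86103775, .point 88, .use 0 86134332, .point 5, .use 1 86103792,
      .point 16, .use 1 86100823, .point 20, .use 1 86099347, .point 21, .use 1 86097834,
      .point 30, .use 1 86105251, .point 31, .use 1 86102299, .point 33, .use 1 86097871,
      .point 35, .use 1 86099400, .point 36, .use 1 86096412, .point 38, .use 1 86105196,
      .point 39, .use 1 86094919, .point 44, .use 1 86102226, .point 57, .use 1 86103775,
      .point 62, .use 1 86100804, .point 84, .use 1 86095008, .point 86, .use 1 86096395,
      .run 166985288585133615534484178 []]
    _ (by decide +kernel)

/-- States for the branches. -/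
def subD0 : List (ℕ × ℕ) := [
  (1237940039285521012388003970, 57051245102148741148975933),
  (1237940629581331371093131394, 57051245102148878588453693),
  (1237940039285523211410735234, 57051835397968033387127613),
  (1237940039285521046747218050, 57051835397970232427160381),
  (1257282852399355079182778498, 134423087853306533968094013),
  (1237940039285521029567348866, 153765900967140600764441405)]

theorem cov_subD0 : ∀ st ∈ subD0, Cov M repT false 16 st :=
  cov_of_check (kn := slice6 ++ slice7 ++ slice8 ++ slice9 ++ slice10 ++ slice11) (List.forall_mem_append.2 ⟨List.forall_mem_append.2 ⟨List.forall_mem_append.2 ⟨List.forall_mem_append.2 ⟨List.forall_mem_append.2 ⟨cov_of_run (run_slices.2.2.2.2.2.2.1), cov_of_run (run_slices.2.2.2.2.2.2.2.1)⟩, cov_of_run (run_slices.2.2.2.2.2.2.2.2.1)⟩, cov_of_run (run_slices.2.2.2.2.2.2.2.2.2.1)⟩, cov_of_run (run_slices.2.2.2.2.2.2.2.2.2.2.1)⟩, cov_of_run (run_slices.2.2.2.2.2.2.2.2.2.2.2.1)⟩)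
    [
      .point 10, .known 4, .point 28, .known 10, .point 57, .known 5, .known 0, .point 24,
      .known 7, .point 34, .known 11, .known 8, .point 20, .known 9, .known 2, .known 6,
      .known 3, .known 1]
    _ (by decide +kernel)

/-- A state with known tangents. -/
def rootD0 : ℕ × ℕ := (1237940039285521012387479682, 57051245102148741148975933)

theorem cov_rootD0 : ∀ st ∈ [rootD0], Cov M repT false 16 st :=
  cov_of_check (kn := subD0) (cov_subD0 M)
    [
      .point 19, .use 0 86106566, .point 37, .use 0 86097871, .point 43, .use 1 86097871,
      .point 69, .use 1 86106566, .point 24, .use 2 86097871, .point 41, .use 2 86106566,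
      .point 35, .use 3 86106566, .point 86, .use 3 86097871, .point 20, .use 4 86097871,
      .point 84, .use 4 86106566, .point 34, .use 5 86106566, .point 73, .use 5 86097871,
      .run 166985288585138013580995266 []]
    _ (by decide +kernel)

/-- States for the branches. -/
def subE0 : List (ℕ × ℕ) := [
  (1242775743140440281389727746, 81225597128489969107732301),
  (1237940039861982864202530818, 86061374193995432857079629),
  (1237940039861981764959338498, 250778697708128205532467021),
  (1237940039861981764690903058, 250797587320433338060545869),
  (1237940039863107664597745666, 250797587617671499730050941)]

theorem cov_subE0 : ∀ st ∈ subE0, Cov M repT false 16 st :=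
  cov_of_check (kn := slice12 ++ slice13 ++ slice14 ++ slice15) (List.forall_mem_append.2 ⟨List.forall_mem_append.2 ⟨List.forall_mem_append.2 ⟨cov_of_run (run_slices.2.2.2.2.2.2.2.2.2.2.2.2.1), cov_of_run (run_slices.2.2.2.2.2.2.2.2.2.2.2.2.2.1)⟩, cov_of_run (run_slices.2.2.2.2.2.2.2.2.2.2.2.2.2.2.1)⟩, cov_of_run (run_slices.2.2.2.2.2.2.2.2.2.2.2.2.2.2.2.1)⟩)
    [
      .point 12, .known 0, .point 30, .known 6, .point 64, .known 5, .point 4, .known 7,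
      .known 8, .known 4, .known 1, .known 2, .known 3]
    _ (by decide +kernel)

/-- A state with known tangents. -/
def rootE0 : ℕ × ℕ := (1237940039861981764690903042, 81225597128489969107732301)

theorem cov_rootE0 : ∀ st ∈ [rootE0], Cov M repT false 16 st :=
  cov_of_check (kn := subE0) (cov_subE0 M)
    [
      .point 11, .use 0 86102244, .point 15, .use 0 87103673, .point 18, .use 0 86096395,
      .point 33, .use 0 87112365, .point 38, .use 0 87103592, .point 46, .use 0 87141524,
      .point 66, .use 0 86132821, .point 82, .use 0 86106566, .point 30, .use 1 87103592,
      .point 37, .use 1 86102244, .point 40, .use 1 86106566, .point 44, .use 1 87112365,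
      .point 70, .use 1 87141524, .point 78, .use 1 87103673, .point 83, .use 1 86096395,
      .point 87, .use 1 86132821, .point 12, .use 2 86096395, .point 28, .use 2 86106566,
      .point 36, .use 2 87103673, .point 41, .use 2 87103592, .point 42, .use 2 86102244,
      .point 51, .use 2 86132821, .point 57, .use 2 87141524, .point 74, .use 2 87112365,
      .point 4, .use 3 86106566, .point 5, .use 3 87112365, .point 14, .use 3 87141524,
      .point 31, .use 3 86102244, .point 35, .use 3 86132821, .point 39, .use 3 87103592,
      .point 53, .use 3 87103673, .point 58, .use 3 86096395, .point 50, .use 4 86102244,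
      .point 65, .use 4 86096395, .run 171828666069977582402579978 []]
    _ (by decide +kernel)

/-- States for the branches. -/
def subF0 : List (ℕ × ℕ) := [
  (1237940039285522111899107458, 168268108566755504211134285),
  (1237940113072497307225686146, 168268108566765399815784269),
  (1237940039285521149826433154, 168268200800485768363542349),
  (1257282852399355079182778498, 168268200800485905806690125),
  (1237940039285521287265386626, 264982266369656239783184205),
  (1237940039573751388539191426, 264982266513771702736947021)]

theorem cov_subF0 : ∀ st ∈ subF0, Cov M repT false 16 st :=
  cov_of_check (kn := slice16 ++ slice17 ++ slice18 ++ slice19 ++ slice20 ++ slice21 ++ slice22) (List.forall_mem_append.2 ⟨List.forall_mem_append.2 ⟨List.forall_mem_append.2 ⟨List.forall_mem_append.2 ⟨List.forall_mem_append.2 ⟨List.forall_mem_append.2 ⟨cov_of_run (run_slices.2.2.2.2.2.2.2.2.2.2.2.2.2.2.2.2.1), cov_of_run (run_slices.2.2.2.2.2.2.2.2.2.2.2.2.2.2.2.2.2.1)⟩, cov_of_run (run_slices.2.2.2.2.2.2.2.2.2.2.2.2.2.2.2.2.2.2.1)⟩, cov_of_run (run_slices.2.2.2.2.2.2.2.2.2.2.2.2.2.2.2.2.2.2.2.1)⟩,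 cov_of_run (run_slices.2.2.2.2.2.2.2.2.2.2.2.2.2.2.2.2.2.2.2.2.1)⟩, cov_of_run (run_slices.2.2.2.2.2.2.2.2.2.2.2.2.2.2.2.2.2.2.2.2.2.1)⟩, cov_of_run (run_slices.2.2.2.2.2.2.2.2.2.2.2.2.2.2.2.2.2.2.2.2.2.2.1)⟩)
    [
      .point 4, .known 2, .point 28, .known 5, .point 50, .known 10, .point 57, .known 8,
      .known 7, .point 13, .known 9, .point 14, .known 6, .known 0, .point 57, .known 12,
      .known 3, .known 11, .known 4, .known 1]
    _ (by decide +kernel)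

/-- A state with known tangents. -/
def rootF0 : ℕ × ℕ := (1237940039285521012387479682, 168268108566755504211134285)

theorem cov_rootF0 : ∀ st ∈ [rootF0], Cov M repT false 16 st :=
  cov_of_check (kn := subF0) (cov_subF0 M)
    [
      .point 40, .use 0 86106566, .point 43, .use 0 86119693, .point 64, .use 1 86119693,
      .point 66, .use 1 86106566, .point 22, .use 2 86119693, .point 37, .use 2 86106566,
      .point 84, .use 3 86106566, .point 86, .use 3 86119693, .point 38, .use 4 86106566,
      .point 57, .use 4 86119693, .point 46, .use 5 86119693, .point 58, .use 5 86106566,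
      .run 171820991863596530278771346 []]
    _ (by decide +kernel)

/-- States for the branches. -/
def subG0 : List (ℕ × ℕ) := [
  (1237940334433426191740305538, 4165794888390603366074189),
  (1237940039285522111899107458, 4166090036295804193738573),
  (1392682544196193546749870210, 313651099857646370476658525),
  (1237940039285523211410735234, 468393613992887210344845149),
  (1237940039285521012387545218, 487736427394953921034587997)]

theorem cov_subG0 : ∀ st ∈ subG0, Cov M repT false 16 st :=
  cov_of_check (kn := slice23 ++ slice24 ++ slice25 ++ slice26 ++ slice27) (List.forall_mem_append.2 ⟨List.forall_mem_append.2 ⟨List.forall_mem_append.2 ⟨List.forall_mem_append.2 ⟨cov_of_run (run_slices.2.2.2.2.2.2.2.2.2.2.2.2.2.2.2.2.2.2.2.2.2.2.2.1), cov_of_run (run_slices.2.2.2.2.2.2.2.2.2.2.2.2.2.2.2.2.2.2.2.2.2.2.2.2.1)⟩, cov_of_run (run_slices.2.2.2.2.2.2.2.2.2.2.2.2.2.2.2.2.2.2.2.2.2.2.2.2.2.1)⟩, cov_of_run (run_slices.2.2.2.2.2.2.2.2.2.2.2.2.2.2.2.2.2.2.2.2.2.2.2.2.2.2.1)⟩,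 cov_of_run (run_slices.2.2.2.2.2.2.2.2.2.2.2.2.2.2.2.2.2.2.2.2.2.2.2.2.2.2.2.1)⟩)
    [
      .point 4, .known 0, .point 28, .known 3, .point 57, .known 9, .point 62, .known 8,
      .known 7, .point 63, .known 6, .known 5, .known 4, .known 1, .known 2]
    _ (by decide +kernel)

/-- A state with known tangents. -/
def rootG0 : ℕ × ℕ := (1237940039285521012387479682, 4165794888390603366074189)

theorem cov_rootG0 : ∀ st ∈ [rootG0], Cov M repT false 16 st :=
  cov_of_check (kn := subG0) (cov_subG0 M)
    [
      .point 11, .use 0 86583931, .point 32, .use 0 86103792, .point 34, .use 0 86677287,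
      .point 68, .use 0 86106566, .point 4, .use 1 86677287, .point 40, .use 1 86106566,
      .point 42, .use 1 86103792, .point 88, .use 1 86583931, .point 46, .use 2 86677287,
      .point 50, .use 2 86103792, .point 63, .use 2 86583931, .point 87, .use 2 86106566,
      .point 36, .use 3 86583931, .point 41, .use 3 86106566, .point 58, .use 3 86103792,
      .point 84, .use 3 86677287, .point 16, .use 4 86103792, .point 31, .use 4 86583931,
      .run 171820991863596530278640338 []]
    _ (by decide +kernel)

/-- States for the branches. -/
def subH0 : List (ℕ × ℕ) := [
  (1237940039285521012655915010, 676663470278488952372724621),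
  (1237940039285521012387480578, 1083195099404349135948076029)]

theorem cov_subH0 : ∀ st ∈ subH0, Cov M repT true 16 st :=
  cov_of_check (kn := slice28) (cov_of_run (run_slices.2.2.2.2.2.2.2.2.2.2.2.2.2.2.2.2.2.2.2.2.2.2.2.2.2.2.2.2.1))
    [
      .known 0, .known 1]
    _ (by decide +kernel)

/-- A state with known tangents. -/
def rootH0 : ℕ × ℕ := (1237940039285521012387479554, 676663470278488952372724621)

theorem cov_rootH0 : ∀ st ∈ [rootH0], Cov M repT true 16 st :=
  cov_of_check (kn := subH0) (cov_subH0 M)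
    [
      .point 4, .use 0 86176656, .point 5, .use 0 86198570, .point 6, .use 0 86106587, .point 12,
      .use 0 86096395, .point 14, .use 0 86109498, .point 15, .use 0 86141610, .point 16,
      .use 0 86176657, .point 17, .use 0 86157666, .point 20, .use 0 86121181, .point 21,
      .use 0 86106586, .point 22, .use 0 86100822, .point 23, .use 0 86121180, .point 24,
      .use 0 86099426, .point 28, .use 0 86097871, .point 29, .use 0 86105250, .point 30,
      .use 0 86109499, .point 31, .use 0 86204395, .point 32, .use 0 86105251, .point 33,
      .use 0 86157667, .point 34, .use 0 86099346, .point 35, .use 0 86099427, .point 36,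
      .use 0 86096381, .point 38, .use 0 86159156, .point 39, .use 0 86192713, .point 41,
      .use 0 86192712, .point 42, .use 0 86102299, .point 43, .use 0 86099347, .point 44,
      .use 0 86119724, .point 45, .use 0 86103775, .point 46, .use 0 86094938, .point 50,
      .use 0 86102298, .point 51, .use 0 86094919, .point 53, .use 0 86119725, .point 57,
      .use 0 86141611, .point 58, .use 0 86096380, .point 62, .use 0 86100869, .point 63,
      .use 0 86169348, .point 64, .use 0 86097870, .point 65, .use 0 86096394, .point 67,
      .use 0 86094918, .point 69, .use 0 86100823, .point 70, .use 0 86204394, .point 73,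
      .use 0 86103774, .point 74, .use 0 86198571, .point 78, .use 0 86185433, .point 84,
      .use 0 86094939, .point 86, .use 0 86169349, .point 88, .use 0 86103752, .point 10,
      .use 1 86121180, .point 11, .use 1 86176656, .point 13, .use 1 86100822, .point 19,
      .use 1 86204394, .point 37, .use 1 86099346, .point 66, .use 1 86097870, .point 71,
      .use 1 86094918, .point 87, .use 1 86192712, .run 166982927401329093317274114 []]
    _ (by decide +kernel)

/-- States for the branches. -/
def subI0 : List (ℕ × ℕ) := [
  (1237940039285522111899107330, 623466306992362879802410957),
  (1237940039285521012655915010, 691166152895357731241953261),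
  (1392682544196193546749870082, 768840858912543231664445421),
  (1237940039285521012388003842, 923592808556190443148400621)]

theorem cov_subI0 : ∀ st ∈ subI0, Cov M repT true 16 st :=
  cov_of_check (kn := slice29) (cov_of_run (run_slices.2.2.2.2.2.2.2.2.2.2.2.2.2.2.2.2.2.2.2.2.2.2.2.2.2.2.2.2.2))
    [
      .known 0, .known 1, .known 2, .known 3]
    _ (by decide +kernel)

/-- A state with known tangents. -/
def rootI0 : ℕ × ℕ := (1237940039285521012387479554, 623466306992362879802410957)

theorem cov_rootI0 : ∀ st ∈ [rootI0], Cov M repT true 16 st :=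
  cov_of_check (kn := subI0) (cov_subI0 M)
    [
      .point 5, .use 0 86096704, .point 15, .use 0 86106911, .point 16, .use 0 86106910,
      .point 17, .use 0 86239244, .point 24, .use 0 86096705, .point 39, .use 0 86239245,
      .point 40, .use 0 86106566, .point 46, .use 0 86239278, .point 52, .use 0 86096394,
      .point 83, .use 0 86096395, .point 84, .use 0 86239279, .point 85, .use 0 86106567,
      .point 12, .use 1 86096395, .point 14, .use 1 86239279, .point 28, .use 1 86106566,
      .point 30, .use 1 86239278, .point 44, .use 1 86106911, .point 50, .use 1 86106567,
      .point 53, .use 1 86106910, .point 62, .use 1 86239245, .point 65, .use 1 86096394,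
      .point 70, .use 1 86096705, .point 78, .use 1 86239244, .point 86, .use 1 86096704,
      .point 22, .use 2 86239279, .point 32, .use 2 86239278, .point 37, .use 2 86096395,
      .point 43, .use 2 86106911, .point 73, .use 2 86106910, .point 87, .use 2 86096394,
      .point 13, .use 3 86096395, .point 19, .use 3 86096394, .point 33, .use 3 86239279,
      .point 38, .use 3 86106910, .point 41, .use 3 86239278, .point 74, .use 3 86106911,
      .run 171818630679787610015050242 []]
    _ (by decide +kernel)

/-- The points of a line. -/
def lineZ : List ℕ := [89, 90, 1, 7, 25, 47, 54, 59, 75, 79]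

/-- A state with known tangents. -/
def twoA : ℕ × ℕ := (1237940039861981764690903042, 3853454617716960503268109)

/-- With the tangents at `1` and `90` fixed, there are nine lines each for the tangents at `47` and
`59`. The 81 pairs reduce to three by collineations. -/
theorem cov_twoA : ∀ st ∈ [twoA], Cov M repT false 16 st :=
  cov_of_check (kn := [rootA0, rootB0, rootE0]) (List.forall_mem_cons.2 ⟨cov_rootA0 M _ (List.mem_singleton_self _), List.forall_mem_cons.2 ⟨cov_rootB0 M _ (List.mem_singleton_self _), cov_rootE0 M⟩⟩)
    [
      .tangent 47, .tangent 59, .use 1 86845824, .use 2 86094937, .use 2 86800644,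
      .use 1 86102244, .use 2 86096376, .use 2 86831227, .use 2 86816628, .use 2 86676714,
      .use 1 86133414, .tangent 59, .use 2 86668021, .use 2 86638824, .use 2 86103738,
      .use 1 86204322, .use 2 86239260, .use 2 86100859, .use 1 86147306, .use 1 86682546,
      .use 2 86476914, .tangent 59, .use 2 86831209, .use 2 86996034, .use 1 86160002,
      .use 1 86103738, .use 2 86239261, .use 1 86993118, .use 2 86100822, .use 2 86105178,
      .use 2 86978520, .tangent 59, .use 1 86141610, .use 1 86109498, .use 1 86100822,
      .use 0 86094918, .use 1 86094918, .use 1 86169348, .use 1 86157666, .use 1 86099346,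
      .use 1 86097870, .tangent 59, .use 2 86096394, .use 1 86106908, .use 2 86783166,
      .use 1 86121162, .use 1 86240718, .use 2 86239279, .use 2 87140376, .use 2 86239278,
      .use 2 86096395, .tangent 59, .use 2 86783203, .use 2 86345713, .use 1 86786082,
      .use 1 86192676, .use 2 86742325, .use 1 86160286, .use 2 86103775, .use 2 86105179,
      .use 2 86462353, .tangent 59, .use 2 86094919, .use 1 86344236, .use 2 86345695,
      .use 1 86096376, .use 1 86106766, .use 2 87036841, .use 2 86345694, .use 2 86676715,
      .use 2 86094918, .tangent 59, .use 1 86133840, .use 2 86094936, .use 2 86462335,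
      .use 1 86176602, .use 2 86096377, .use 2 86996071, .use 2 87111253, .use 2 86476932,
      .use 1 86535270, .tangent 59, .use 2 86816646, .use 2 86345712, .use 2 86099346,
      .use 1 86105178, .use 2 87102451, .use 2 86099347, .use 1 87096618, .use 1 86146738,
      .use 2 87102450]
    _ (by decide +kernel)

/-- A state with known tangents. -/
def oneA : ℕ × ℕ := (1237940039861981764690903042, 2568969745144640335512073)

/-- The tangents at `1` and `90` meet outside the common line of the four points, and the elations
with this line as axis are transitive on the points outside it. So one choice of the second tangent
suffices. The same holds for the other types. -/
theorem cov_oneA : ∀ st ∈ [oneA], Cov M repT false 16 st :=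
  cov_of_check (kn := [twoA]) (cov_twoA M)
    [
      .tangent 90, .use 0 86331114, .use 0 86685408, .use 0 87039702, .use 0 86567310,
      .use 0 86803506, .use 0 86449212, .use 0 86213016, .use 0 86921604, .use 0 86094918]
    _ (by decide +kernel)

/-- A state with known tangents. -/
def noneA : ℕ × ℕ := (1237940039861981764690903042, 0)

theorem cov_noneA : ∀ st ∈ [noneA], Cov M repT false 16 st :=
  cov_of_check (kn := [oneA]) (cov_oneA M)
    [
      .tangent 1, .use 0 86107052, .use 0 86106890, .use 0 86107376, .use 0 86107862,
      .use 0 86107700, .use 0 86107538, .use 0 86107214, .use 0 86106566, .use 0 86106728]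
    _ (by decide +kernel)

/-- A state with known tangents. -/
def twoC : ℕ × ℕ := (1237940039285521012387479682, 3853454617716960503268109)

/-- As for `cov_twoA`, with the tangents at `7` and `47`; here the 81 pairs reduce to four. -/
theorem cov_twoC : ∀ st ∈ [twoC], Cov M repT false 16 st :=
  cov_of_check (kn := [rootC0, rootD0, rootF0, rootG0]) (List.forall_mem_cons.2 ⟨cov_rootC0 M _ (List.mem_singleton_self _), List.forall_mem_cons.2 ⟨cov_rootD0 M _ (List.mem_singleton_self _), List.forall_mem_cons.2 ⟨cov_rootF0 M _ (List.mem_singleton_self _), cov_rootG0 M⟩⟩⟩)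
    [
      .tangent 7, .tangent 47, .use 2 86531925, .use 1 86158973, .use 2 86159061,
      .use 1 86105251, .use 3 86103792, .use 1 86781771, .use 3 86094919, .use 2 87018615,
      .use 2 86099347, .tangent 47, .use 2 86784526, .use 2 86100804, .use 1 86991674,
      .use 1 86099347, .use 3 86096395, .use 2 86159062, .use 3 86100804, .use 2 86850689,
      .use 1 86193388, .tangent 47, .use 1 86844335, .use 2 86490365, .use 3 86097834,
      .use 1 86094919, .use 2 86097834, .use 3 86103775, .use 1 86176752, .use 2 86172179,
      .use 2 86678097, .tangent 47, .use 1 86096412, .use 1 86103792, .use 1 86105196,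
      .use 0 86094919, .use 1 86102226, .use 1 86099400, .use 1 86097834, .use 1 86095008,
      .use 1 86100804, .tangent 47, .use 2 86132811, .use 2 87151292, .use 3 86100823,
      .use 1 86096395, .use 1 86109829, .use 3 86102226, .use 2 86094919, .use 1 86527965,
      .use 2 86882421, .tangent 47, .use 3 86105196, .use 1 86678252, .use 1 86193531,
      .use 1 86100823, .use 2 87154647, .use 2 86105196, .use 2 86233756, .use 3 86102299,
      .use 2 86145945, .tangent 47, .use 1 86177145, .use 3 86096412, .use 2 86784345,
      .use 1 86097871, .use 1 86242196, .use 2 86346760, .use 2 86119690, .use 2 86096412,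
      .use 3 86099347, .tangent 47, .use 2 86097871, .use 3 86105251, .use 2 86239784,
      .use 1 86102299, .use 2 86106566, .use 2 87024592, .use 1 86351530, .use 1 86122172,
      .use 3 86095008, .tangent 47, .use 3 86097871, .use 2 86145938, .use 2 86100823,
      .use 1 86103775, .use 2 86360456, .use 1 86205482, .use 2 86677550, .use 3 86099400,
      .use 1 87098141]
    _ (by decide +kernel)

/-- A state with known tangents. -/
def oneC : ℕ × ℕ := (1237940039285521012387479682, 2568969745144640335512073)

theorem cov_oneC : ∀ st ∈ [oneC], Cov M repT false 16 st :=
  cov_of_check (kn := [twoC]) (cov_twoC M)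
    [
      .tangent 90, .use 0 86331115, .use 0 86685409, .use 0 87039703, .use 0 86567311,
      .use 0 86803507, .use 0 86449213, .use 0 86213017, .use 0 86921605, .use 0 86094919]
    _ (by decide +kernel)

/-- A state with known tangents. -/
def noneC : ℕ × ℕ := (1237940039285521012387479682, 0)

theorem cov_noneC : ∀ st ∈ [noneC], Cov M repT false 16 st :=
  cov_of_check (kn := [oneC]) (cov_oneC M)
    [
      .tangent 1, .use 0 86107052, .use 0 86106890, .use 0 86107376, .use 0 86107862,
      .use 0 86107700, .use 0 86107538, .use 0 86107214, .use 0 86106566, .use 0 86106728]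
    _ (by decide +kernel)

/-- A state with known tangents. -/
def twoH : ℕ × ℕ := (1237940039285521012387479554, 623465716696552520548352909)

/-- Only one of the three chosen points still lacks its tangent, and the nine possibilities reduce
to two. -/
theorem cov_twoH : ∀ st ∈ [twoH], Cov M repT true 16 st :=
  cov_of_check (kn := [rootH0, rootI0]) (List.forall_mem_cons.2 ⟨cov_rootH0 M _ (List.mem_singleton_self _), cov_rootI0 M⟩)
    [
      .tangent 47, .use 1 86097870, .use 1 86676786, .use 1 86100822, .use 0 86094918,
      .use 1 86239278, .use 1 86783202, .use 1 86094918, .use 1 86530950, .use 1 86099346]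
    _ (by decide +kernel)

/-- A state with known tangents. -/
def oneH : ℕ × ℕ := (1237940039285521012387479554, 622181231823980200380596873)

theorem cov_oneH : ∀ st ∈ [oneH], Cov M repT true 16 st :=
  cov_of_check (kn := [twoH]) (cov_twoH M)
    [
      .tangent 90, .use 0 86331114, .use 0 86685408, .use 0 87039702, .use 0 86567310,
      .use 0 86803506, .use 0 86449212, .use 0 86213016, .use 0 86921604, .use 0 86094918]
    _ (by decide +kernel)

/-- A state with known tangents. -/
def noneH : ℕ × ℕ := (1237940039285521012387479554, 619612262078835560045084800)

theorem cov_noneH : ∀ st ∈ [noneH], Cov M repT true 16 st :=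
  cov_of_check (kn := [oneH]) (cov_oneH M)
    [
      .tangent 1, .use 0 86107052, .use 0 86106890, .use 0 86107376, .use 0 86107862,
      .use 0 86107700, .use 0 86107538, .use 0 86107214, .use 0 86106566, .use 0 86106728]
    _ (by decide +kernel)

/-- The 210 quadruples on a line fall under two types: 30 are images of {1, 47, 59, 90}, the
harmonic ones, and 180 are images of {1, 7, 47, 90}. -/
theorem cov_four : ∀ st ∈ (List.sublistsLen 4 lineZ).map (fun L => (ofBits L, 0)),
    Cov M repT false 16 st :=
  cov_of_check (kn := [noneA, noneC])
    (List.forall_mem_cons.2 ⟨cov_noneA M _ (List.mem_singleton_self _), cov_noneC M⟩)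
    [
      .use 1 86178027, .use 1 86191148, .use 1 86147409, .use 1 86188286, .use 1 86148866,
      .use 1 86122676, .use 1 86125592, .use 0 86201390, .use 1 86148867, .use 1 86186775,
      .use 1 86199950, .use 0 86199932, .use 1 86173652, .use 1 86160530, .use 1 86160531,
      .use 1 86189691, .use 0 86150360, .use 1 86189690, .use 1 86178026, .use 1 86186774,
      .use 1 86188233, .use 1 86173706, .use 1 86128508, .use 1 86186828, .use 0 86173688,
      .use 1 86163446, .use 1 86135744, .use 1 86150324, .use 1 86127050, .use 1 86164905,
      .use 1 86111012, .use 0 86147444, .use 1 86163447, .use 1 86160584, .use 1 86179485,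
      .use 1 86126995, .use 1 86188231, .use 1 86129910, .use 0 86126994, .use 0 86110956,
      .use 1 86108040, .use 1 86108041, .use 1 86188230, .use 1 86178024, .use 1 86178025,
      .use 1 86147407, .use 1 86191146, .use 1 86161987, .use 1 86164903, .use 1 86182398,
      .use 1 86179483, .use 1 86166361, .use 1 86147406, .use 1 86122620, .use 0 86112414,
      .use 1 86148864, .use 0 86125536, .use 1 86125537, .use 1 86173650, .use 1 86134285,
      .use 1 86125536, .use 1 86138658, .use 1 86148865, .use 1 86143032, .use 1 86113873,
      .use 1 86195520, .use 0 86134284, .use 1 86160528, .use 1 86135742, .use 1 86112415,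
      .use 0 86172230, .use 1 86172248, .use 1 86185370, .use 1 86175110, .use 1 86191149,
      .use 1 86119707, .use 1 86119706, .use 0 86145986, .use 1 86146004, .use 1 86121164,
      .use 1 86192606, .use 1 86159072, .use 1 86109554, .use 1 86185317, .use 0 86106620,
      .use 1 86192660, .use 1 86185316, .use 1 86106638, .use 1 86106585, .use 1 86173653,
      .use 1 86176622, .use 1 86135745, .use 1 86175164, .use 1 86132828, .use 1 86172195,
      .use 1 86176569, .use 1 86124134, .use 0 86159108, .use 1 86121165, .use 1 86176568,
      .use 1 86159073, .use 1 86164904, .use 0 86198474, .use 1 86172194, .use 1 86159126,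
      .use 1 86099292, .use 1 86191147, .use 1 86156154, .use 1 86173651, .use 1 86153239,
      .use 1 86096377, .use 1 86109499, .use 1 86109498, .use 0 86094918, .use 1 86094918,
      .use 0 86100750, .use 1 86099293, .use 1 86121163, .use 1 86164902, .use 1 86169276,
      .use 1 86192605, .use 1 86134284, .use 1 86096376, .use 0 86097834, .use 1 86094919,
      .use 1 86135743, .use 1 86143088, .use 1 86207187, .use 1 86194065, .use 1 86175111,
      .use 1 86147408, .use 0 86186810, .use 1 86138714, .use 1 86207186, .use 0 86160566,
      .use 1 86135798, .use 0 86191184, .use 1 86161989, .use 1 86201354, .use 1 86194064,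
      .use 1 86191202, .use 1 86161988, .use 1 86108096, .use 1 86112470, .use 1 86205729,
      .use 1 86179484, .use 1 86137256, .use 1 86188232, .use 0 86188268, .use 1 86208644,
      .use 1 86189744, .use 1 86162042, .use 1 86199897, .use 1 86134287, .use 1 86199896,
      .use 1 86202813, .use 1 86140172, .use 1 86150325, .use 1 86201355, .use 0 86189726,
      .use 1 86202812, .use 1 86186772, .use 1 86201352, .use 1 86151780, .use 0 86173650,
      .use 1 86151781, .use 1 86199895, .use 1 86186773, .use 1 86205727, .use 1 86122621,
      .use 1 86116788, .use 1 86201353, .use 1 86161986, .use 0 86124078, .use 1 86199894,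
      .use 1 86112414, .use 1 86138659, .use 1 86208642, .use 1 86140117, .use 1 86175109,
      .use 0 86113872, .use 1 86160529, .use 1 86204270, .use 1 86119760, .use 1 86198439,
      .use 1 86208645, .use 1 86198438, .use 0 86185352, .use 1 86121218, .use 1 86145951,
      .use 1 86106584, .use 1 86134340, .use 1 86192607, .use 1 86204271, .use 1 86205728,
      .use 1 86141630, .use 0 86132864, .use 0 86119742, .use 1 86145950, .use 1 86198492,
      .use 1 86132829, .use 1 86134286, .use 1 86132882, .use 1 86103666, .use 0 86099292,
      .use 1 86121162, .use 1 86175108, .use 1 86204269, .use 1 86100751, .use 1 86204268]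
    _ (by decide +kernel)

/-- The group of a line is transitive on its triples, so one triple suffices. The line is a secant
with exactly three points, hence its other seven points are excluded. -/
theorem cov_three : ∀ st ∈ (List.sublistsLen 3 lineZ).map
    (fun L => (ofBits L, Nat.xor (ofBits lineZ) (ofBits L))), Cov M repT true 16 st :=
  cov_of_check (kn := [noneH]) (cov_noneH M)
    [
      .use 0 86151818, .use 0 86167856, .use 0 86116826, .use 0 86148866, .use 0 86147408,
      .use 0 86182436, .use 0 86162024, .use 0 86108078, .use 0 86138696, .use 0 86173688,
      .use 0 86153276, .use 0 86179520, .use 0 86178062, .use 0 86154734, .use 0 86166398,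
      .use 0 86201390, .use 0 86143070, .use 0 86199932, .use 0 86140154, .use 0 86160530,
      .use 0 86129948, .use 0 86135744, .use 0 86163482, .use 0 86150360, .use 0 86112452,
      .use 0 86128490, .use 0 86147444, .use 0 86137238, .use 0 86135780, .use 0 86110994,
      .use 0 86202848, .use 0 86150324, .use 0 86122658, .use 0 86207222, .use 0 86127032,
      .use 0 86150322, .use 0 86191146, .use 0 86126994, .use 0 86173650, .use 0 86153238,
      .use 0 86179482, .use 0 86189688, .use 0 86110956, .use 0 86108040, .use 0 86178024,
      .use 0 86166360, .use 0 86147406, .use 0 86124078, .use 0 86164902, .use 0 86112414,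
      .use 0 86138658, .use 0 86134284, .use 0 86125536, .use 0 86137200, .use 0 86113872,
      .use 0 86160528, .use 0 86169314, .use 0 86096414, .use 0 86172230, .use 0 86103704,
      .use 0 86102246, .use 0 86109536, .use 0 86145986, .use 0 86099330, .use 0 86106584,
      .use 0 86141612, .use 0 86159072, .use 0 86204306, .use 0 86198474, .use 0 86106620,
      .use 0 86094956, .use 0 86119742, .use 0 86159108, .use 0 86176604, .use 0 86132828,
      .use 0 86121200, .use 0 86100788, .use 0 86192604, .use 0 86099292, .use 0 86121162,
      .use 0 86176566, .use 0 86094918, .use 0 86100750, .use 0 86097834, .use 0 86191184,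
      .use 0 86148902, .use 0 86188268, .use 0 86194064, .use 0 86118284, .use 0 86180978,
      .use 0 86144528, .use 0 86160566, .use 0 86186810, .use 0 86194100, .use 0 86208680,
      .use 0 86170772, .use 0 86161988, .use 0 86113910, .use 0 86210138, .use 0 86195558,
      .use 0 86125574, .use 0 86183894, .use 0 86131406, .use 0 86134286, .use 0 86189726,
      .use 0 86186772, .use 0 86151780, .use 0 86202810, .use 0 86199894, .use 0 86205726,
      .use 0 86163444, .use 0 86140116, .use 0 86157650, .use 0 86145950, .use 0 86105162,
      .use 0 86185352, .use 0 86132864, .use 0 86192642, .use 0 86097872, .use 0 86204268]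
    _ (by decide +kernel)

/-- A state with three points and two tangents. -/
def frame3 : ℕ × ℕ := (1242775742563838791597948930, 3853454617716960503268109)

/-- With at most ten points the search finds a single semioval, the first one of `repT`. -/
theorem cov_frame3 : ∀ st ∈ [frame3], Cov M repT false 10 st :=
  cov_of_check (kn := []) (by simp) [.run 791251439823640607787624994 [
      45715288064]]
    _ (by decide +kernel)

/-- A state with two points and two tangents. -/
def frame2 : ℕ × ℕ := (1237940039285380274899124226, 3853454617716960503268109)

/-- The 64 points off the triangle formed by the two tangents and the chord form one orbit of the
diagonal group of that triangle. No semioval with at most ten points avoids all of them. -/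
theorem cov_frame2 : ∀ st ∈ [frame2], Cov M repT false 10 st :=
  cov_of_check (kn := [frame3]) (cov_frame3 M)
    [
      .point 4, .use 0 344452508, .point 5, .use 0 430545956, .point 6, .use 0 602759072,
      .point 10, .use 0 172200010, .point 11, .use 0 86172180, .point 12, .use 0 516600020,
      .point 13, .use 0 258385310, .point 14, .use 0 688773794, .point 15, .use 0 344413150,
      .point 16, .use 0 602732836, .point 17, .use 0 602745960, .point 18, .use 0 86119690,
      .point 19, .use 0 516626276, .point 20, .use 0 430480348, .point 21, .use 0 344439380,
      .point 22, .use 0 86159068, .point 23, .use 0 688760668, .point 24, .use 0 688786910,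
      .point 28, .use 0 258306576, .point 29, .use 0 172239382, .point 30, .use 0 430493462,
      .point 31, .use 0 688813150, .point 32, .use 0 86198428, .point 33, .use 0 688839392,
      .point 34, .use 0 172291874, .point 35, .use 0 602680354, .point 36, .use 0 688800036,
      .point 37, .use 0 516652516, .point 38, .use 0 602667224, .point 39, .use 0 344426262,
      .point 40, .use 0 516613148, .point 41, .use 0 430519700, .point 42, .use 0 258293460,
      .point 43, .use 0 86145944, .point 44, .use 0 344465626, .point 45, .use 0 172252502,
      .point 46, .use 0 430532832, .point 50, .use 0 516586908, .point 51, .use 0 516639388,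
      .point 52, .use 0 516665644, .point 53, .use 0 602706586, .point 57, .use 0 602693474,
      .point 58, .use 0 430559070, .point 62, .use 0 430506586, .point 63, .use 0 430572190,
      .point 64, .use 0 516573780, .point 65, .use 0 258359060, .point 66, .use 0 86132820,
      .point 67, .use 0 258319696, .point 68, .use 0 172226256, .point 69, .use 0 172278754,
      .point 70, .use 0 602719710, .point 71, .use 0 172213130, .point 72, .use 0 172265628,
      .point 73, .use 0 86185304, .point 74, .use 0 344386904, .point 78, .use 0 688826284,
      .point 82, .use 0 86106566, .point 83, .use 0 258345946, .point 84, .use 0 688852518,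
      .point 85, .use 0 258372194, .point 86, .use 0 344478756, .point 87, .use 0 258332830,
      .point 88, .use 0 344400022, .run 791251439823640607787624994 []]
    _ (by decide +kernel)

/-- A state with two points. -/
def pair : ℕ × ℕ := (1237940039285380274899124226, 0)

/-- The 81 pairs of tangents at the two points are all equivalent. -/
theorem cov_pair : ∀ st ∈ [pair], Cov M repT false 10 st :=
  cov_of_check (kn := [frame2]) (cov_frame2 M)
    [
      .tangent 90, .tangent 1, .use 0 516993844, .use 0 86343086, .use 0 431360004,
      .use 0 689325882, .use 0 603336936, .use 0 259028446, .use 0 345372018, .use 0 86342762,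
      .use 0 172331552, .tangent 1, .use 0 688997998, .use 0 603402872, .use 0 517138684,
      .use 0 86777090, .use 0 259278262, .use 0 344519254, .use 0 173080484, .use 0 430900246,
      .use 0 430901060, .tangent 1, .use 0 602799100, .use 0 344808098, .use 0 87091538,
      .use 0 259173766, .use 0 172765076, .use 0 430717192, .use 0 517244140, .use 0 689495506,
      .use 0 689496794, .tangent 1, .use 0 430612856, .use 0 689181226, .use 0 173185300,
      .use 0 517453772, .use 0 86671954, .use 0 602904716, .use 0 258963494, .use 0 345121730,
      .use 0 345122386, .tangent 1, .use 0 86841894, .use 0 258425646, .use 0 689430206,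
      .use 0 603651532, .use 0 345266390, .use 0 172620408, .use 0 431044744, .use 0 258424674,
      .use 0 516810948, .tangent 1, .use 0 172935816, .use 0 516705492, .use 0 345056278,
      .use 0 431464808, .use 0 689639998, .use 0 86527446, .use 0 603231788, .use 0 516705006,
      .use 0 258530142, .tangent 1, .use 0 258713678, .use 0 172436368, .use 0 603547368,
      .use 0 344951634, .use 0 431150532, .use 0 517308932, .use 0 689745306, .use 0 172436206,
      .use 0 86237950, .tangent 1, .use 0 344623910, .use 0 431216308, .use 0 258858998,
      .use 0 172869892, .use 0 517559228, .use 0 688892702, .use 0 86986402, .use 0 603087134,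
      .use 0 603088264, .tangent 1, .use 0 688774924, .use 0 602733650, .use 0 516613804,
      .use 0 86160356, .use 0 258385966, .use 0 344388034, .use 0 172280042, .use 0 344452508,
      .use 0 430507400]
    _ (by decide +kernel)

/-- Two points can be moved to any two points; the final search rules out that `0` is the only
point. -/
theorem cov_single : ∀ st ∈ [(1, 0)], Cov M repT false 10 st :=
  cov_of_check (kn := [pair]) (cov_pair M)
    [
      .point 1, .use 0 610174134, .point 2, .use 0 53498484, .point 3, .use 0 683460504,
      .point 4, .use 0 10799424, .point 5, .use 0 75149784, .point 6, .use 0 66043116, .point 7,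
      .use 0 6626718, .point 8, .use 0 82314324, .point 9, .use 0 330622398, .point 10,
      .use 0 32201442, .point 11, .use 0 73916298, .point 12, .use 0 79650666, .point 13,
      .use 0 23002956, .point 14, .use 0 15772698, .point 15, .use 0 85463658, .point 16,
      .use 0 53892180, .point 17, .use 0 14066874, .point 18, .use 0 21506976, .point 19,
      .use 0 26506584, .point 20, .use 0 62329518, .point 21, .use 0 34156710, .point 22,
      .use 0 54954972, .point 23, .use 0 37135278, .point 24, .use 0 42948450, .point 25,
      .use 0 7873326, .point 26, .use 0 66016872, .point 27, .use 0 141415956, .point 28,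
      .use 0 21454506, .point 29, .use 0 60413832, .point 30, .use 0 18646470, .point 31,
      .use 0 64980216, .point 32, .use 0 80149212, .point 33, .use 0 76461948, .point 34,
      .use 0 45074088, .point 35, .use 0 23960826, .point 36, .use 0 24695676, .point 37,
      .use 0 40822596, .point 38, .use 0 37883250, .point 39, .use 0 17255574, .point 40,
      .use 0 49640580, .point 41, .use 0 44260614, .point 42, .use 0 63917316, .point 43,
      .use 0 30653064, .point 44, .use 0 53078598, .point 45, .use 0 70898184, .point 46,
      .use 0 82419300, .point 47, .use 0 2270142, .point 48, .use 0 84558222, .point 49,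
      .use 0 227562048, .point 50, .use 0 85804902, .point 51, .use 0 68706936, .point 52,
      .use 0 16625700, .point 53, .use 0 84650076, .point 54, .use 0 3438018, .point 55,
      .use 0 63654858, .point 56, .use 0 735555006, .point 57, .use 0 74795526, .point 58,
      .use 0 27884376, .point 59, .use 0 1207242, .point 60, .use 0 27398844, .point 61,
      .use 0 391219956, .point 62, .use 0 16363152, .point 63, .use 0 33093810, .point 64,
      .use 0 32030910, .point 65, .use 0 50637870, .point 66, .use 0 42344820, .point 67,
      .use 0 40323996, .point 68, .use 0 83797182, .point 69, .use 0 31401036, .point 70,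
      .use 0 46281330, .point 71, .use 0 10878174, .point 72, .use 0 51595848, .point 73,
      .use 0 59036004, .point 74, .use 0 63707346, .point 75, .use 0 9251154, .point 76,
      .use 0 42869718, .point 77, .use 0 511260174, .point 78, .use 0 64074834, .point 79,
      .use 0 5747526, .point 80, .use 0 27871254, .point 81, .use 0 588929454, .point 82,
      .use 0 43276428, .point 83, .use 0 13751928, .point 84, .use 0 57225060, .point 85,
      .use 0 78023520, .point 86, .use 0 72105426, .point 87, .use 0 69835392, .point 88,
      .use 0 27464454, .point 89, .use 0 4999554, .point 90, .use 0 4960188,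
      .run 2475880078570760549798248447 []]
    _ (by decide +kernel)

end

end PG2

namespace PG2

/-! ### The classification -/

theorem join_inc (p q : Fin 91) (h : p ≠ q) : inc (join p q) p = true ∧ inc (join p q) q = true := by
  revert p q
  decide +kernel

theorem inc_add (l p t : Fin 91) : inc (l + t) (p + t) = inc l p := by
  rw [Bool.eq_iff_iff, inc_iff, inc_iff, Fin.val_add, Fin.val_add]
  have : ((p.val + t.val) % 91 + 91 - (l.val + t.val) % 91) % 91 = (p.val + 91 - l.val) % 91 := by
    omega
  rw [this]

/-- A semioval with at most two points on each line has at most ten points. -/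
theorem SO.card_le {s : Finset (Fin 91)} (hs : SO s) (h2 : ∀ l, (trc s l).card ≤ 2) :
    s.card ≤ 10 := by
  obtain ⟨p, hp⟩ := hs.1
  obtain ⟨t, ht, -⟩ := hs.2 p hp
  have hpt : inc t p = true :=
    (mem_trc.1 (by rw [ht]; exact Finset.mem_singleton_self p : p ∈ trc s t)).2
  have hmem : ∀ q ∈ s.erase p, join p q ∈ (linesOn p).toFinset.erase t := by
    intro q hq
    obtain ⟨hqp, hq⟩ := Finset.mem_erase.1 hq
    obtain ⟨h1, h3⟩ := join_inc p q hqp.symm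
    refine Finset.mem_erase.2 ⟨fun h => hqp ?_, List.mem_toFinset.2 ((inc_iff_linesOn _ _).1 h1)⟩
    have : q ∈ trc s t := mem_trc.2 ⟨hq, h ▸ h3⟩
    rw [ht] at this
    exact Finset.mem_singleton.1 this
  have hinj : Set.InjOn (join p) (s.erase p : Finset (Fin 91)) := by
    intro q hq r hr h
    obtain ⟨hqp, hq⟩ := Finset.mem_erase.1 hq
    obtain ⟨hrp, hr⟩ := Finset.mem_erase.1 hr
    by_contra hqr
    obtain ⟨h1, h3⟩ := join_inc p q hqp.symm
    obtain ⟨-, h4⟩ := join_inc p r hrp.symm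
    have h5 : ({p, q, r} : Finset (Fin 91)) ⊆ trc s (join p q) := by
      intro x hx
      simp only [Finset.mem_insert, Finset.mem_singleton] at hx
      rcases hx with rfl | rfl | rfl
      · exact mem_trc.2 ⟨hp, h1⟩
      · exact mem_trc.2 ⟨hq, h3⟩
      · exact mem_trc.2 ⟨hr, h ▸ h4⟩
    have h6 := (Finset.card_le_card h5).trans (h2 _)
    rw [Finset.card_eq_three.2 ⟨p, q, r, hqp.symm, hrp.symm, hqr, rfl⟩] at h6
    omega
  have h1 := Finset.card_le_card_of_injOn _ hmem hinj
  rw [Finset.card_erase_of_mem hp, Finset.card_erase_of_mem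
    (List.mem_toFinset.2 ((inc_iff_linesOn _ _).1 hpt)),
    List.toFinset_card_of_nodup (linesOn_nodup p)] at h1
  simp only [linesOn, List.length_map, List.length_cons, List.length_nil] at h1
  omega

theorem mem_lineZ (q : Fin 91) : q.val ∈ lineZ ↔ inc 89 q = true := by
  revert q
  decide +kernel

theorem mem_bits_ofBits {L : List ℕ} {q : Fin 91} : q ∈ bits (ofBits L) ↔ q.val ∈ L := by
  rw [mem_bits, testBit_ofBits]

/-- The numbers of the points of a subset of the line `89`. -/
theorem exists_sublist {T : Finset (Fin 91)} (hT : ∀ q ∈ T, inc 89 q = true) :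
    ∃ L ∈ List.sublistsLen T.card lineZ, bits (ofBits L) = T := by
  set V := T.map Fin.valEmbedding with hV
  refine ⟨lineZ.filter (· ∈ V), List.mem_sublistsLen.2 ⟨List.filter_sublist, ?_⟩, ?_⟩
  · rw [← List.toFinset_card_of_nodup ((by decide : lineZ.Nodup).filter _),
      ← Finset.card_map Fin.valEmbedding, ← hV]
    congr 1
    ext q
    simp only [List.mem_toFinset, List.mem_filter, decide_eq_true_eq, and_iff_right_iff_imp]
    rw [hV, Finset.mem_map]
    rintro ⟨a, ha, rfl⟩
    exact (mem_lineZ a).2 (hT a ha)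
  · ext q
    simp only [mem_bits_ofBits, List.mem_filter, decide_eq_true_eq, mem_lineZ]
    rw [hV, show q.val = Fin.valEmbedding q from rfl, Finset.mem_map']
    exact ⟨fun h => h.2, fun h => ⟨hT q h, h⟩⟩

theorem bits_zero : bits 0 = ∅ := by ext; simp [mem_bits]

section

variable {K : Type*} [Field K] (M : Model K)

/-- The number in the proof encodes the matrix of the Singer cycle, which adds 1 to the number of
each point; its powers are the other translations. -/
theorem exists_shift (t : Fin 91) : ∃ π ∈ M.coll, ∀ p, π p = p + t := by
  obtain ⟨π, hπ, h⟩ := M.exists_perm (n := 49483152) (by decide +kernel)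
  have h1 : ∀ p : Fin 91, π p = p + 1 := fun p => Fin.ext ((h p).trans
    ((by decide +kernel : ∀ p : Fin 91, (Col.dec 49483152).img p = (p + 1).val) p))
  refine ⟨π ^ t.val, pow_mem hπ _, fun p => ?_⟩
  have h2 : ∀ n : ℕ, ∀ p, ((π ^ n) p).val = (p.val + n) % 91 := by
    intro n
    induction n with
    | zero => intro p; simp; omega
    | succ n ih =>
      intro p
      rw [pow_succ, Equiv.Perm.mul_apply, ih, h1, Fin.val_add]
      change ((p.val + 1) % 91 + n) % 91 = _
      omega
  exact Fin.ext (h2 _ _)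

variable {M}

theorem exists_equi_trc {s : Finset (Fin 91)} (l : Fin 91) :
    ∃ s', M.Equi s s' ∧ (trc s' 89).card = (trc s l).card := by
  obtain ⟨π, hπ, h⟩ := exists_shift M (89 - l)
  refine ⟨_, ⟨π, hπ, rfl⟩, ?_⟩
  have := Model.trc_image (s := s) (π := π) (τ := Equiv.addRight (89 - l)) (fun l p => by
    rw [h]; exact inc_add _ _ _) l
  rw [show Equiv.addRight (89 - l) l = 89 from add_sub_cancel l 89] at this
  rw [this, Finset.card_image_of_injective _ π.injective]

/-- The cases are a longest secant with at most two, exactly three, or at least four points. In the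
first case the size is at most ten and a point is moved to `0`; in the others the secant is moved to
the line `89`. -/
theorem exists_rep {s : Finset (Fin 91)} (hs : SO s) (hk : s.card ≤ 16) :
    ∃ n ∈ repT, M.Equi s (bits n) := by
  by_cases h3 : ∀ l, (trc s l).card ≤ 3
  · by_cases h2 : ∀ l, (trc s l).card ≤ 2
    · obtain ⟨p, hp⟩ := hs.1
      obtain ⟨π, hπ, h⟩ := exists_shift M (-p)
      have he : M.Equi s (s.image π) := ⟨π, hπ, rfl⟩
      obtain ⟨n, hn, hns⟩ := cov_single M _ (List.mem_singleton_self _) _ (he.so hs)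
        (he.card.trans_le (hs.card_le h2)) (by simp) (fun q hq => by
          have : q = 0 := by
            revert q
            decide +kernel
          rw [this]
          refine Finset.mem_image.2 ⟨p, hp, ?_⟩
          rw [h, add_neg_cancel]) (by rw [bits_zero]; exact Finset.disjoint_empty_left _)
      exact ⟨n, hn, he.trans hns⟩
    · push Not at h2
      obtain ⟨l, hl⟩ := h2
      obtain ⟨s', he, hc⟩ := exists_equi_trc (M := M) (s := s) l
      have hc3 : (trc s' 89).card = 3 := by have := h3 l; omega
      obtain ⟨L, hL, hLs⟩ := exists_sublist (T := trc s' 89) fun q hq => (mem_trc.1 hq).2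
      rw [hc3] at hL
      -- The three points are the whole trace of the line `89`, so its other points are outside the
      -- semioval, as the state requires.
      obtain ⟨n, hn, hns⟩ := cov_three M _ (List.mem_map_of_mem hL) s' (he.so hs)
        (he.card.trans_le hk) (fun _ => he.cap h3) (by rw [hLs]; exact Finset.filter_subset _ _) (by
          rw [Finset.disjoint_left]
          intro q hq hqs
          rw [mem_bits] at hq
          change (ofBits lineZ ^^^ ofBits L).testBit q.val = true at hq
          rw [Nat.testBit_xor] at hq
          cases hb : (ofBits lineZ).testBit q.val
          · rw [hb, Bool.false_xor] at hq
            have h1 := mem_bits.2 hq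
            rw [hLs] at h1
            rw [← Bool.not_eq_true, testBit_ofBits, mem_lineZ] at hb
            exact hb (mem_trc.1 h1).2
          · rw [testBit_ofBits, mem_lineZ] at hb
            have h1 : q ∈ bits (ofBits L) := by rw [hLs]; exact mem_trc.2 ⟨hqs, hb⟩
            rw [mem_bits] at h1
            rw [h1, (testBit_ofBits _ _).2 ((mem_lineZ q).2 hb)] at hq
            simp at hq)
      exact ⟨n, hn, he.trans hns⟩
  · push Not at h3
    obtain ⟨l, hl⟩ := h3
    obtain ⟨s', he, hc⟩ := exists_equi_trc (M := M) (s := s) l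
    obtain ⟨T, hT, hT4⟩ := Finset.exists_subset_card_eq (show 4 ≤ (trc s' 89).card by omega)
    obtain ⟨L, hL, hLs⟩ := exists_sublist (T := T) fun q hq => (mem_trc.1 (hT hq)).2
    rw [hT4] at hL
    obtain ⟨n, hn, hns⟩ := cov_four M _ (List.mem_map_of_mem hL) s' (he.so hs)
      (he.card.trans_le hk) (by simp) (by rw [hLs]; exact hT.trans (Finset.filter_subset _ _))
      (by rw [bits_zero]; exact Finset.disjoint_empty_left _)
    exact ⟨n, hn, he.trans hns⟩

end

end PG2

namespace PG2

/-! ### Sets of points and sets of numbers -/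

namespace Model

variable {K : Type*} [Field K] (M : Model K)

/-- The set of the points with the given numbers. -/
def set (s : Finset (Fin 91)) : Set (Point K) := M.ptE '' s

/-- The stabilizer of a set of numbers. -/
def stab (s : Finset (Fin 91)) : Subgroup (Equiv.Perm (Fin 91)) where
  carrier := {π | π ∈ M.coll ∧ s.image π = s}
  one_mem' := ⟨one_mem _, by simp⟩
  mul_mem' := by
    rintro π ρ ⟨h1, h2⟩ ⟨h3, h4⟩
    refine ⟨mul_mem h1 h3, ?_⟩
    rw [Equiv.Perm.coe_mul, ← Finset.image_image, h4, h2]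
  inv_mem' := by
    rintro π ⟨h1, h2⟩
    refine ⟨inv_mem h1, ?_⟩
    conv_lhs => rw [← h2]
    rw [Finset.image_image]
    ext; simp

variable {M}

theorem mem_set {s : Finset (Fin 91)} {p : Fin 91} : M.ptE p ∈ M.set s ↔ p ∈ s := by
  simp [set]

variable (M)

theorem exists_set (S : Set (Point K)) : ∃ s, M.set s = S := by
  classical
  refine ⟨Finset.univ.filter fun p => M.ptE p ∈ S, ?_⟩
  ext x
  obtain ⟨p, rfl⟩ := M.ptE.surjective x
  rw [mem_set]
  simp

theorem set_injective : Function.Injective M.set := fun s t h => by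
  ext p
  rw [← mem_set (M := M), h, mem_set]

theorem ncard_set (s : Finset (Fin 91)) : (M.set s).ncard = s.card := by
  rw [set, Set.ncard_image_of_injective _ M.ptE.injective, Set.ncard_coe_finset]

theorem trace_set (s : Finset (Fin 91)) (l : Fin 91) :
    trace (M.set s) (M.lnE l) = M.set (trc s l) := by
  ext x
  obtain ⟨p, rfl⟩ := M.ptE.surjective x
  rw [mem_set, mem_trc, ← M.mem_ln, ← mem_set (M := M)]
  rfl

theorem set_singleton (p : Fin 91) : M.set {p} = {M.ptE p} := by simp [set]

theorem isSemioval_set (s : Finset (Fin 91)) : IsSemioval (M.set s) ↔ SO s := by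
  refine and_congr (by simp [set]) ?_
  constructor
  · intro h p hp
    obtain ⟨l, hl, hu⟩ := h _ (mem_set.2 hp)
    obtain ⟨l, rfl⟩ := M.lnE.surjective l
    have key : ∀ m, trace (M.set s) (M.lnE m) = {M.ptE p} ↔ trc s m = {p} := fun m => by
      rw [trace_set, ← set_singleton, M.set_injective.eq_iff]
    exact ⟨l, (key l).1 hl, fun m hm => M.lnE.injective (hu _ ((key m).2 hm))⟩
  · intro h x hx
    obtain ⟨p, rfl⟩ := M.ptE.surjective x
    obtain ⟨l, hl, hu⟩ := h p (mem_set.1 hx)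
    have key : ∀ m, trace (M.set s) (M.lnE m) = {M.ptE p} ↔ trc s m = {p} := fun m => by
      rw [trace_set, ← set_singleton, M.set_injective.eq_iff]
    refine ⟨M.lnE l, (key l).2 hl, fun m hm => ?_⟩
    obtain ⟨m, rfl⟩ := M.lnE.surjective m
    rw [hu m ((key m).1 hm)]

theorem secantCount_set (s : Finset (Fin 91)) (i : ℕ) :
    secantCount (M.set s) i = (Finset.univ.filter fun l => (trc s l).card = i).card := by
  rw [secantCount, ← Set.ncard_coe_finset, ← Set.ncard_image_of_injective _ M.lnE.injective]
  congr 1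
  ext x
  obtain ⟨l, rfl⟩ := M.lnE.surjective x
  simp [trace_set, ncard_set]

theorem perm_set (π : Equiv.Perm (Fin 91)) (s : Finset (Fin 91)) :
    (M.ptE.permCongrHom π : Equiv.Perm (Point K)) '' M.set s = M.set (s.image π) := by
  ext x
  obtain ⟨p, rfl⟩ := M.ptE.surjective x
  rw [mem_set, Finset.mem_image]
  constructor
  · rintro ⟨y, hy, h⟩
    obtain ⟨q, rfl⟩ := M.ptE.surjective y
    refine ⟨q, mem_set.1 hy, M.ptE.injective ?_⟩
    rw [← h]
    simp [Equiv.permCongrHom]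
  · rintro ⟨q, hq, rfl⟩
    exact ⟨_, mem_set.2 hq, by simp [Equiv.permCongrHom]⟩

theorem mem_orbit_set (s t : Finset (Fin 91)) :
    M.set t ∈ MulAction.orbit (PGammaL K) (M.set s) ↔ M.Equi s t := by
  constructor
  · rintro ⟨⟨γ, hγ⟩, h⟩
    obtain ⟨π, rfl⟩ := M.ptE.permCongrHom.surjective γ
    refine ⟨π, hγ, M.set_injective ?_⟩
    rw [← perm_set]
    exact h
  · rintro ⟨π, hπ, rfl⟩
    refine ⟨⟨_, hπ⟩, ?_⟩
    rw [← perm_set]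
    rfl

/-- The stabilizer of a set of points. -/
theorem nonempty_stab (s : Finset (Fin 91)) :
    Nonempty (MulAction.stabilizer (PGammaL K) (M.set s) ≃* M.stab s) := by
  have key : ∀ {π} (hπ : π ∈ M.coll), (⟨_, hπ⟩ : PGammaL K) ∈
      MulAction.stabilizer (PGammaL K) (M.set s) ↔ s.image π = s := by
    intro π hπ
    rw [MulAction.mem_stabilizer_iff, ← M.set_injective.eq_iff, ← perm_set]
    rfl
  let f : M.stab s →* MulAction.stabilizer (PGammaL K) (M.set s) :=
    { toFun := fun π => ⟨⟨_, π.2.1⟩, (key π.2.1).2 π.2.2⟩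
      map_one' := by ext; simp
      map_mul' := fun π ρ => by ext; simp }
  refine ⟨(MulEquiv.ofBijective f ⟨fun π ρ h => ?_, fun γ => ?_⟩).symm⟩
  · have h1 := congrArg (fun g => (g.1.1 : Equiv.Perm (Point K))) h
    exact Subtype.ext (M.ptE.permCongrHom.injective h1)
  · obtain ⟨⟨γ, hγ⟩, h⟩ := γ
    obtain ⟨π, rfl⟩ := M.ptE.permCongrHom.surjective γ
    exact ⟨⟨π, hγ, (key hγ).1 h⟩, rfl⟩

/-- The number of classes of semiovals with an invariant property is the number of elements of a
list of representatives with the property. -/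
theorem numClasses_eq {α : Type*} {R : List α} (f : α → ℕ)
    (hR : ∀ s, SO s → s.card ≤ 16 → ∃ x ∈ R, M.Equi s (bits (f x)))
    (hR1 : ∀ x ∈ R, SO (bits (f x))) (hR2 : R.Nodup)
    (hR3 : ∀ x ∈ R, ∀ y ∈ R, M.Equi (bits (f x)) (bits (f y)) → x = y) (Q : Set (Point K) → Prop)
    (hQ : ∀ s, Q (M.set s) → s.card ≤ 16) (hQ2 : ∀ s t, M.Equi s t → Q (M.set s) → Q (M.set t))
    (c : α → Bool) (hc : ∀ x ∈ R, Q (M.set (bits (f x))) ↔ c x = true) :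
    numClasses K Q = R.countP c := by
  classical
  have h1 : {O : Set (Set (Point K)) | ∃ S : Set (Point K), IsSemioval S ∧ Q S ∧
      O = MulAction.orbit (PGammaL K) S} =
      (fun x => MulAction.orbit (PGammaL K) (M.set (bits (f x)))) '' {x | x ∈ R.filter c} := by
    ext O
    constructor
    · rintro ⟨S, hS, hSQ, rfl⟩
      obtain ⟨s, rfl⟩ := M.exists_set S
      obtain ⟨x, hx, hxs⟩ := hR s ((M.isSemioval_set s).1 hS) (hQ s hSQ)
      exact ⟨x, List.mem_filter.2 ⟨hx, (hc x hx).1 (hQ2 _ _ hxs hSQ)⟩,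
        MulAction.orbit_eq_iff.2 ((M.mem_orbit_set _ _).2 hxs)⟩
    · rintro ⟨x, hx, rfl⟩
      obtain ⟨hx, hcx⟩ := List.mem_filter.1 hx
      exact ⟨_, (M.isSemioval_set _).2 (hR1 x hx), (hc x hx).2 hcx, rfl⟩
  rw [numClasses, h1, Set.InjOn.ncard_image, List.countP_eq_length_filter,
    ← List.toFinset_card_of_nodup (hR2.filter c), ← Set.ncard_coe_finset]
  · congr 1
    ext x
    simp
  · intro x hx y hy h
    refine hR3 x (List.mem_filter.1 hx).1 y (List.mem_filter.1 hy).1 ?_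
    have h : MulAction.orbit (PGammaL K) (M.set (bits (f x))) =
      MulAction.orbit (PGammaL K) (M.set (bits (f y))) := h
    rw [← mem_orbit_set, h]
    exact MulAction.mem_orbit_self _

end Model

end PG2

namespace PG2

/-! ### Invariants of sets of numbers -/

/-- Bit `k` of `n`, as a number. -/
def bitN (n k : ℕ) : ℕ := Nat.land (Nat.shiftRight n k) 1

theorem bitN_eq (n k : ℕ) : bitN n k = (n.testBit k).toNat := by
  have h : bitN n k = n / 2 ^ k % 2 := by
    change n >>> k &&& 1 = _
    rw [Nat.and_one_is_mod, Nat.shiftRight_eq_div_pow]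
  rw [h, Nat.testBit_eq_decide_div_mod_eq]
  have : n / 2 ^ k % 2 < 2 := Nat.mod_lt _ (by norm_num)
  interval_cases n / 2 ^ k % 2 <;> rfl

theorem bt_field_zero (X p : ℕ) : bt X 0 p = X.testBit p := by rw [bt]; congr 1; omega

theorem fld_zero (n : ℕ) : fld n 0 = bits n := by
  ext p
  rw [mem_fld, bt_field_zero, mem_bits]

/-- The number of points of `n` on the line `l`. -/
def lineCount (n l : ℕ) : ℕ :=
  let c := cnt (ones 1) n dl
  Nat.add (bitN c.a l) (Nat.mul 2 (Nat.add (bitN c.b l) (Nat.mul 2 (Nat.add (bitN c.c l)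
    (Nat.mul 2 (bitN c.d l))))))

theorem lineCount_eq (n : ℕ) (l : Fin 91) : lineCount n l = (trc (bits n) l).card := by
  have h := bt_cnt (N := 1) (j := 0) (by norm_num) l.2 n good_dl (by decide)
  rw [← fld_zero, card_trc_fld, ← h]
  simp only [lineCount, bitN_eq, bt_field_zero, bval]
  change _ + 2 * (_ + 2 * (_ + 2 * _)) = _
  omega

/-- Through each of the bits of `n` below `k` there is just one line with one point. -/
def soCheck (n : ℕ) : ℕ → Bool
  | 0 => true
  | k + 1 => cond (cond (bitAt n k) (Nat.beq ([0, 90, 88, 82, 64, 42, 35, 30, 14, 10].countP fun d =>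
      Nat.beq (lineCount n (Nat.mod (Nat.add k d) 91)) 1) 1) true) (soCheck n k) false

theorem cond_false_eq {a b : Bool} : cond a b false = true ↔ a = true ∧ b = true := by
  cases a <;> simp

theorem cond_true_eq {a b : Bool} : cond a b true = true ↔ (a = true → b = true) := by
  cases a <;> simp

theorem soCheck_spec {n : ℕ} : ∀ {k : ℕ}, soCheck n k = true → ∀ p < k, n.testBit p = true →
    ([0, 90, 88, 82, 64, 42, 35, 30, 14, 10].countP fun d =>
      Nat.beq (lineCount n (Nat.mod (Nat.add p d) 91)) 1) = 1
  | 0, _, p, hp, _ => by omega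
  | k + 1, h, p, hp, hb => by
    rw [soCheck, cond_false_eq, cond_true_eq] at h
    by_cases hpk : p = k
    · subst hpk
      exact Nat.eq_of_beq_eq_true (h.1 (by rw [bitAt_eq, hb]))
    · exact soCheck_spec h.2 p (by omega) hb

theorem countP_linesOn (g : ℕ → Bool) (p : Fin 91) : (linesOn p).countP (fun l : Fin 91 => g l) =
    [0, 90, 88, 82, 64, 42, 35, 30, 14, 10].countP fun d => g (Nat.mod (Nat.add p d) 91) := by
  have h : [0, 90, 88, 82, 64, 42, 35, 30, 14, 10] =
      ([0, 90, 88, 82, 64, 42, 35, 30, 14, 10] : List (Fin 91)).map Fin.val := rfl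
  rw [linesOn, h, List.countP_map, List.countP_map]
  rfl

theorem so_of_soCheck {n : ℕ} (h0 : (bits n).Nonempty) (h : soCheck n 91 = true) : SO (bits n) := by
  refine ⟨h0, fun p hp => ?_⟩
  have h1 := soCheck_spec h p p.2 (mem_bits.1 hp)
  have h2 : (Finset.univ.filter fun l : Fin 91 => l ∈ linesOn p ∧
      Nat.beq (lineCount n l) 1 = true).card = 1 := by
    rw [card_filter_list (linesOn_nodup p) fun l => Nat.beq (lineCount n l) 1,
      countP_linesOn fun l => Nat.beq (lineCount n l) 1]
    exact h1
  obtain ⟨l, hl⟩ := Finset.card_eq_one.1 h2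
  have key : ∀ m, trc (bits n) m = {p} ↔ m ∈ ({l} : Finset (Fin 91)) := by
    intro m
    rw [← hl, Finset.mem_filter, ← inc_iff_linesOn]
    constructor
    · intro hm
      have : p ∈ trc (bits n) m := by rw [hm]; exact Finset.mem_singleton_self p
      refine ⟨Finset.mem_univ m, (mem_trc.1 this).2, ?_⟩
      rw [lineCount_eq, hm]
      rfl
    · rintro ⟨-, hm, h3⟩
      have h3 := Nat.eq_of_beq_eq_true h3
      rw [lineCount_eq] at h3
      exact trc_eq_singleton hp hm h3
  exact ⟨l, (key l).2 (Finset.mem_singleton_self l), fun m hm => Finset.mem_singleton.1 ((key m).1 hm)⟩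

/-- The numbers of lines with `0`, …, `8` points of `n`. -/
def secants (n : ℕ) : List ℕ :=
  (List.range 9).map fun i => (List.range 91).countP fun l => Nat.beq (lineCount n l) i

theorem card_filter_range (f : ℕ → Bool) (k : ℕ) :
    (Finset.univ.filter fun l : Fin k => f l = true).card = (List.range k).countP f := by
  rw [← Finset.card_map Fin.valEmbedding, List.countP_eq_length_filter,
    ← List.toFinset_card_of_nodup (List.nodup_range.filter f)]
  congr 1
  ext l
  simp only [Finset.mem_map, Finset.mem_filter, Finset.mem_univ, true_and, Fin.valEmbedding_apply,
    List.mem_toFinset, List.mem_filter, List.mem_range]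
  exact ⟨fun ⟨a, ha, h⟩ => h ▸ ⟨a.2, ha⟩, fun ⟨h, h1⟩ => ⟨⟨l, h⟩, h1, rfl⟩⟩

theorem Model.secantCounts_bits {K : Type*} [Field K] (M : Model K) (n : ℕ) :
    secantCounts (M.set (bits n)) = secants n := by
  refine List.map_congr_left fun i _ => ?_
  rw [M.secantCount_set, ← card_filter_range]
  congr 1
  ext l
  simp only [Finset.mem_filter, Finset.mem_univ, true_and, ← lineCount_eq]
  exact ⟨fun h => by rw [h]; exact Nat.beq_refl i, Nat.eq_of_beq_eq_true⟩

/-- The permutation `f` maps the bits of `X` to the bits of `Y`. -/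
def Corr (f : Equiv.Perm (Fin 91)) (X Y : ℕ) : Prop := ∀ p : Fin 91, Y.testBit (f p) = X.testBit p

theorem Corr.land {f : Equiv.Perm (Fin 91)} {X Y X' Y' : ℕ} (h : Corr f X Y) (h' : Corr f X' Y') :
    Corr f (Nat.land X X') (Nat.land Y Y') := by
  intro p
  change (Y &&& Y').testBit _ = (X &&& X').testBit _
  rw [Nat.testBit_and, Nat.testBit_and, h, h']

theorem corr_iff {f : Equiv.Perm (Fin 91)} {m n : ℕ} : Corr f m n ↔ (bits m).image f = bits n := by
  constructor
  · intro h
    ext q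
    obtain ⟨p, rfl⟩ := f.surjective q
    rw [mem_bits, h, Finset.mem_image, ← mem_bits]
    simp
  · intro h p
    rw [Bool.eq_iff_iff, ← mem_bits, ← mem_bits, ← h]
    simp

/-- The digits of a count. -/
def Bi.toList (c : Bi) : List ℕ := [c.a, c.b, c.c, c.d]

theorem bval_inj : ∀ a b c d a' b' c' d', bval a b c d = bval a' b' c' d' →
    a = a' ∧ b = b' ∧ c = c' ∧ d = d' := by decide

/-- Equal counts have equal binary digits, so each digit of a count is itself a set that the
permutation respects. -/
theorem corr_cnt {f : Equiv.Perm (Fin 91)} {ds : List ℕ} (hds : Good ds) (hl : ds.length < 15)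
    {X Y : ℕ} (h : ∀ p : Fin 91, num Y 0 (f p) ds = num X 0 p ds) :
    Corr f (cnt (ones 1) X ds).a (cnt (ones 1) Y ds).a ∧
      Corr f (cnt (ones 1) X ds).b (cnt (ones 1) Y ds).b ∧
      Corr f (cnt (ones 1) X ds).c (cnt (ones 1) Y ds).c ∧
      Corr f (cnt (ones 1) X ds).d (cnt (ones 1) Y ds).d := by
  have key := fun p : Fin 91 => by
    have h1 := bt_cnt (N := 1) (j := 0) (by norm_num) p.2 X hds hl
    have h2 := bt_cnt (N := 1) (j := 0) (by norm_num) (f p).2 Y hds hl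
    rw [h, ← h1] at h2
    simp only [bt_field_zero] at h2
    exact bval_inj _ _ _ _ _ _ _ _ h2
  exact ⟨fun p => (key p).1, fun p => (key p).2.1, fun p => (key p).2.2.1, fun p => (key p).2.2.2⟩

/-- Sets of points that are derived from `n`. -/
def pointMasks (n : ℕ) : List ℕ :=
  let c := cnt (ones 1) n dl
  n :: ([c.a, c.b, c.c, c.d, Nat.land c.a c.b].flatMap fun X => (cnt (ones 1) X dp).toList)

/-- The masks arise from the point set by counting along lines and then along pencils, so only
incidence enters and any collineation respects them. -/
theorem corr_pointMasks {π τ : Equiv.Perm (Fin 91)} (h : ∀ l p, inc (τ l) (π p) = inc l p) {m n : ℕ}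
    (hmn : Corr π m n) : List.Forall₂ (Corr π) (pointMasks m) (pointMasks n) := by
  obtain ⟨ha, hb, hc, hd⟩ := corr_cnt (f := τ) (X := m) (Y := n) good_dl (by decide) fun l => by
    rw [← card_points, ← card_points]
    refine (Finset.card_equiv π fun p => ?_).symm
    simp only [Finset.mem_filter, Finset.mem_univ, true_and, bt_field_zero, h, hmn p]
  have key : ∀ {X Y : ℕ}, Corr τ X Y → List.Forall₂ (Corr π) (cnt (ones 1) X dp).toList
      (cnt (ones 1) Y dp).toList := by
    intro X Y hXY
    obtain ⟨ha, hb, hc, hd⟩ := corr_cnt (f := π) (X := X) (Y := Y) good_dp (by decide) fun p => by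
      rw [← card_lines, ← card_lines]
      refine (Finset.card_equiv τ fun l => ?_).symm
      simp only [Finset.mem_filter, Finset.mem_univ, true_and, bt_field_zero, h, hXY l]
    exact .cons ha (.cons hb (.cons hc (.cons hd .nil)))
  refine .cons hmn ?_
  have app : ∀ {A B C D : List ℕ}, List.Forall₂ (Corr π) A B → List.Forall₂ (Corr π) C D →
      List.Forall₂ (Corr π) (A ++ C) (B ++ D) := fun h1 h2 => List.rel_append h1 h2
  simp only [List.flatMap_cons, List.flatMap_nil]
  exact app (key ha) (app (key hb) (app (key hc) (app (key hd) (app (key (ha.land hb)) .nil))))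

/-- A color of the point `p`. -/
def color (ms : List ℕ) (p : ℕ) : ℕ := ms.foldl (fun a m => Nat.add (Nat.mul 2 a) (bitN m p)) 1

theorem color_eq {π : Equiv.Perm (Fin 91)} {A B : List ℕ} (h : List.Forall₂ (Corr π) A B)
    (p : Fin 91) : color B (π p) = color A p := by
  have key : ∀ a, B.foldl (fun a m => Nat.add (Nat.mul 2 a) (bitN m (π p))) a =
      A.foldl (fun a m => Nat.add (Nat.mul 2 a) (bitN m p)) a := by
    induction h with
    | nil => exact fun _ => rfl
    | cons h1 _ ih =>
      intro a
      rw [List.foldl_cons, List.foldl_cons, ih, bitN_eq, bitN_eq, h1 p]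
  exact key 1

/-- A number that depends only on the colors of the points below `k`. -/
def colorSum (ms : List ℕ) : ℕ → ℕ
  | 0 => 0
  | k + 1 => Nat.add (colorSum ms k) (Nat.pow (color ms k) 3)

theorem colorSum_eq (ms : List ℕ) : ∀ k, colorSum ms k = ∑ p ∈ Finset.range k, color ms p ^ 3
  | 0 => rfl
  | k + 1 => by
    rw [Finset.sum_range_succ, ← colorSum_eq ms k]
    rfl

/-- An invariant of `n`. -/
def key (n : ℕ) : ℕ := Nat.mod (colorSum (pointMasks n) 91) 10007

/-- A collineation permutes the points and preserves their colors, while the key depends only on the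
sum of the cubes of the colors over all points. -/
theorem Model.Equi.key_eq {K : Type*} [Field K] {M : Model K} {m n : ℕ}
    (h : M.Equi (bits m) (bits n)) : key n = key m := by
  obtain ⟨π, hπ, h⟩ := h
  obtain ⟨τ, hτ⟩ := M.exists_linePerm hπ
  have hc := corr_pointMasks hτ (corr_iff.2 h)
  rw [key, key, colorSum_eq, colorSum_eq, ← Fin.sum_univ_eq_sum_range fun p => color _ p ^ 3,
    ← Fin.sum_univ_eq_sum_range fun p => color _ p ^ 3, ← Equiv.sum_comp π]
  simp only [color_eq hc]

end PG2

namespace PG2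

/-! ### Collineations between two sets of numbers -/

/-- A point that is not fixed by the Frobenius collineation. -/
def fV : Fin 91 := ⟨nrm 28, by decide +kernel⟩

/-- The line `l` contains the point `p`. -/
def incN (l p : ℕ) : Bool :=
  Nat.beq (Nat.land (Nat.shiftRight diffMask (Nat.mod (Nat.sub (Nat.add p 91) l) 91)) 1) 1

/-- The line through two different points. -/
def joinN (p q : ℕ) : ℕ :=
  Nat.mod (Nat.sub (Nat.add p 91) (Nat.land (Nat.shiftRight startT
    (Nat.mul 7 (Nat.mod (Nat.sub (Nat.add q 91) p) 91))) 127)) 91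

theorem joinN_val (p q : Fin 91) : joinN p q = join p q := rfl

/-- The bits of `n` below `k`. -/
def elems (n : ℕ) : ℕ → List ℕ
  | 0 => []
  | k + 1 => cond (bitAt n k) (k :: elems n k) (elems n k)

theorem mem_elems {n p : ℕ} : ∀ {k : ℕ}, p ∈ elems n k ↔ p < k ∧ n.testBit p = true
  | 0 => by simp [elems]
  | k + 1 => by
    have ih : p ∈ elems n k ↔ p < k ∧ n.testBit p = true := mem_elems
    rw [elems, bitAt_eq]
    cases h : n.testBit k
    · rw [cond_false, ih]
      refine and_congr_left fun hp => ?_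
      have : p ≠ k := by rintro rfl; rw [h] at hp; simp at hp
      omega
    · rw [cond_true, List.mem_cons, ih]
      constructor
      · rintro (rfl | ⟨h1, h2⟩)
        · exact ⟨by omega, h⟩
        · exact ⟨by omega, h2⟩
      · rintro ⟨h1, h2⟩
        by_cases hpk : p = k
        · exact Or.inl hpk
        · exact Or.inr ⟨by omega, h2⟩

/-- The pairs `p`, `q` and `x`, `y` span lines with the same number of points of `m` and `n`. -/
def sameLine (m n p q x y : ℕ) : Bool := Nat.beq (lineCount n (joinN p q)) (lineCount m (joinN x y))

/-- The point `q` has the same color for `n` as the point `p` for `m`. -/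
def sameColor (m n p q : ℕ) : Bool := Nat.beq (color (pointMasks n) q) (color (pointMasks m) p)

/-- The possible images of `fX`, `fY` and `fU` under a collineation from `m` to `n`. -/
def triples (m n : ℕ) : List (ℕ × ℕ × ℕ) :=
  let L := elems n 91
  (L.filter (sameColor m n fX)).flatMap fun p =>
    (L.filter fun q => sameColor m n fY q && (!Nat.beq q p && sameLine m n p q fX fY)).flatMap
      fun q => (L.filter fun r => sameColor m n fU r && (!Nat.beq r p &&
        (!Nat.beq (joinN p r) (joinN p q) && (sameLine m n p r fX fU &&
          sameLine m n q r fY fU)))).map fun r => (p, q, r)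

/-- The first tangent in a list of lines through `p`. -/
def tanLine (n p : ℕ) : List ℕ → ℕ
  | [] => 0
  | d :: ds => cond (Nat.beq (lineCount n (Nat.mod (Nat.add p d) 91)) 1) (Nat.mod (Nat.add p d) 91)
      (tanLine n p ds)

/-- The intersection of two lines. -/
def meetN (l m : ℕ) : ℕ :=
  Nat.mod (Nat.add m (Nat.land (Nat.shiftRight startT
    (Nat.mul 7 (Nat.mod (Nat.sub (Nat.add m 91) l) 91))) 127)) 91

/-- The number of the tangent of `n` at `p`. -/
def tanN (n p : ℕ) : ℕ := tanLine n p [0, 90, 88, 82, 64, 42, 35, 30, 14, 10]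

/-- The value of `f` at `n`, to be computed after `n`. -/
def force {α : Type} (n : ℕ) (f : ℕ → α) : α := Nat.rec (f 0) (fun k _ => f (Nat.succ k)) n

theorem force_eq {α : Type} (n : ℕ) (f : ℕ → α) : force n f = f n := by cases n <;> rfl

/-- The determinant of three vectors. -/
def det3 (p q r : ℕ) : ℕ :=
  Col.det ⟨vx p, vx q, vx r, vy p, vy q, vy r, vz p, vz q, vz r, false⟩

/-- The collineation that maps the standard frame to the points with vectors `p`, `q`, `t`, `r`. -/
def frame (p q t r : ℕ) (s : Bool) : Col :=
  -- Cramer's rule: these are the coefficients of `r` in terms of `p`, `q`, `t`, up to a common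
  -- factor. Scaling the columns with them sends the unit point to `r`; `frameOk` tests the outcome.
  force (det3 r q t) fun a => force (det3 p r t) fun b => force (det3 p q r) fun c =>
    force (fm a (vx p)) fun x₁ => force (fm b (vx q)) fun x₂ => force (fm c (vx t)) fun x₃ =>
    force (fm a (vy p)) fun y₁ => force (fm b (vy q)) fun y₂ => force (fm c (vy t)) fun y₃ =>
    force (fm a (vz p)) fun z₁ => force (fm b (vz q)) fun z₂ => force (fm c (vz t)) fun z₃ =>
    ⟨x₁, x₂, x₃, y₁, y₂, y₃, z₁, z₂, z₃, s⟩

/-- The intersection of the tangents of `n` at `p` and `q`. -/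
def pole (n p q : ℕ) : ℕ := meetN (tanN n p) (tanN n q)

/-- The collineation that maps `fX`, `fY`, `fU` to `p`, `q`, `r`, and `fZ` to the intersection of the
tangents at `p` and `q`. -/
def frameAt (n : ℕ) (t : ℕ × ℕ × ℕ) (s : Bool) : Col :=
  force (pv t.1) fun p => force (pv t.2.1) fun q => force (pv (pole n t.1 t.2.1)) fun u =>
    force (pv t.2.2) fun r => frame p q u r s

/-- The point `z` lies on a tangent at `p`. -/
def onTangent (n p z : ℕ) : Bool :=
  let l := tanN n p
  Nat.ble (Nat.succ l) 91 && (Nat.beq (lineCount n l) 1 && (incN l p && incN l z))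

/-- The collineation `frameAt` has the properties that were claimed. -/
def frameOk (n : ℕ) (t : ℕ × ℕ × ℕ) : Bool :=
  let D := frameAt n t false
  D.reg && (Nat.beq (D.img fX) t.1 && (Nat.beq (D.img fY) t.2.1 && (Nat.beq (D.img fU) t.2.2 &&
    (Nat.beq (D.img fZ) (pole n t.1 t.2.1) && (onTangent n t.1 (pole n t.1 t.2.1) &&
      onTangent n t.2.1 (pole n t.1 t.2.1))))))

/-- The collineation maps the bits of `m` to bits of `n`. -/
def Col.maps (D : Col) (m n : ℕ) : Bool := (elems m 91).all fun p => bitAt n (D.img p)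

theorem Col.maps_iff {D : Col} {m n : ℕ} : D.maps m n = true ↔
    ∀ p < 91, m.testBit p = true → n.testBit (D.img p) = true := by
  simp only [Col.maps, List.all_eq_true, mem_elems, bitAt_eq, and_imp]

/-- The images of the points of the standard frame and of one more point, as a number. -/
def Col.code (D : Col) : ℕ := Nat.add (D.img fV) (Nat.mul 91 (Nat.add (D.img fU) (Nat.mul 91
  (Nat.add (D.img fY) (Nat.mul 91 (D.img fX))))))

/-- The two collineations given by a frame, with descending codes. -/
def frames (n : ℕ) (t : ℕ × ℕ × ℕ) : List Col :=
  let D := frameAt n t false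
  let D' := frameAt n t true
  cond (Nat.ble (D.img fV) (D'.img fV)) [D', D] [D, D']

theorem mem_frames {n : ℕ} {t : ℕ × ℕ × ℕ} {D : Col} :
    D ∈ frames n t ↔ ∃ s, D = frameAt n t s := by
  rw [frames]
  cases Nat.ble _ _ <;> simp [or_comm]

/-- The collineations from `m` to `n`. -/
def isos (m n : ℕ) : List Col := ((triples m n).flatMap (frames n)).filter fun D => D.maps m n

theorem Col.det_lt {D : Col} (h : D.Valid) : D.det < 9 := by
  obtain ⟨⟨ha, hb, hc⟩, ⟨hd, he, hf⟩, hg, hh, hi⟩ := h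
  have key : ∀ {a b c d : ℕ}, a < 9 → b < 9 → c < 9 → d < 9 → Col.minor a b c d < 9 :=
    fun h1 h2 h3 h4 => Model.fa_lt (Model.fm_lt h1 h2) (Model.fm_lt (by norm_num) (Model.fm_lt h3 h4))
  exact Model.fa_lt (Model.fa_lt (Model.fm_lt ha (key he hi hf hh)) (Model.fm_lt hb (key hf hg hd hi)))
    (Model.fm_lt hc (key hd hh he hg))

theorem frame_valid (p q t r : ℕ) (s : Bool) : (frame p q t r s).Valid := by
  simp only [frame, force_eq]
  have key : ∀ p q r, det3 p q r < 9 := fun p q r => Col.det_lt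
    ⟨⟨vx_lt _, vx_lt _, vx_lt _⟩, ⟨vy_lt _, vy_lt _, vy_lt _⟩, vz_lt _, vz_lt _, vz_lt _⟩
  have hx : ∀ {a : ℕ}, a < 9 → ∀ v, fm a (vx v) < 9 := fun h v => Model.fm_lt h (vx_lt v)
  have hy : ∀ {a : ℕ}, a < 9 → ∀ v, fm a (vy v) < 9 := fun h v => Model.fm_lt h (vy_lt v)
  have hz : ∀ {a : ℕ}, a < 9 → ∀ v, fm a (vz v) < 9 := fun h v => Model.fm_lt h (vz_lt v)
  exact ⟨⟨hx (key _ _ _) _, hx (key _ _ _) _, hx (key _ _ _) _⟩,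
    ⟨hy (key _ _ _) _, hy (key _ _ _) _, hy (key _ _ _) _⟩,
    hz (key _ _ _) _, hz (key _ _ _) _, hz (key _ _ _) _⟩

theorem frameAt_valid (n : ℕ) (t : ℕ × ℕ × ℕ) (s : Bool) : (frameAt n t s).Valid := by
  simp only [frameAt, force_eq]
  exact frame_valid _ _ _ _ _

theorem frob_coords : ∀ p < 91, vx (pv (Col.frob.img p)) = fr (vx (pv p)) ∧
    vy (pv (Col.frob.img p)) = fr (vy (pv p)) ∧ vz (pv (Col.frob.img p)) = fr (vz (pv p)) := by
  decide +kernel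

theorem frameAt_eq (n : ℕ) (t : ℕ × ℕ × ℕ) (s : Bool) :
    frameAt n t s = { frameAt n t false with s := s } := by
  simp only [frameAt, frame, force_eq]

/-- The two collineations with the same matrix differ by the Frobenius collineation, applied first.
This matches the second alternative of `rigid`. -/
theorem frameAt_true (n : ℕ) (t : ℕ × ℕ × ℕ) {p : ℕ} (hp : p < 91) :
    (frameAt n t true).img p = (frameAt n t false).img (Col.frob.img p) := by
  obtain ⟨h1, h2, h3⟩ := frob_coords p hp
  have h' : (frameAt n t false).s = false := by rw [frameAt_eq]
  rw [frameAt_eq n t true]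
  simp only [Col.img, h']
  change nrm ((frameAt n t false).app _ _ _) =
    nrm ((frameAt n t false).app (vx (pv (Col.frob.img p))) (vy (pv (Col.frob.img p)))
      (vz (pv (Col.frob.img p))))
  rw [h1, h2, h3]

theorem join_map {π τ : Equiv.Perm (Fin 91)} (h : ∀ l p, inc (τ l) (π p) = inc l p) {p q : Fin 91}
    (hpq : p ≠ q) : join (π p) (π q) = τ (join p q) := by
  obtain ⟨h1, h2⟩ := join_inc p q hpq
  exact join_eq (by rw [h, h1]) (by rw [h, h2]) (π.injective.ne hpq)

theorem lineCount_map {π τ : Equiv.Perm (Fin 91)} (h : ∀ l p, inc (τ l) (π p) = inc l p) {m n : ℕ}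
    (hmn : (bits m).image π = bits n) (l : Fin 91) : lineCount n (τ l) = lineCount m l := by
  rw [lineCount_eq, lineCount_eq, ← hmn, Model.trc_image h,
    Finset.card_image_of_injective _ π.injective]

theorem onTangent_spec {n : ℕ} {p z : Fin 91} (hp : p ∈ bits n) (h : onTangent n p z = true) :
    ∃ l, trc (bits n) l = {p} ∧ inc l z = true := by
  simp only [onTangent, Bool.and_eq_true] at h
  obtain ⟨h0, h1, h2, h3⟩ := h
  have hl : tanN n p < 91 := Nat.le_of_ble_eq_true h0
  have h1 := Nat.eq_of_beq_eq_true h1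
  rw [lineCount_eq n ⟨_, hl⟩] at h1
  exact ⟨⟨_, hl⟩, trc_eq_singleton hp h2 h1, h3⟩

namespace Model

variable {K : Type*} [Field K] {M : Model K}

/-- The filters compare only colors, secant lengths, distinctness and collinearity. All of these are
preserved by collineations, so no image of the frame is discarded. -/
theorem mem_triples {m n : ℕ} {π : Equiv.Perm (Fin 91)} (hπ : π ∈ M.coll)
    (h : (bits m).image π = bits n) (hX : fX ∈ bits m) (hY : fY ∈ bits m) (hU : fU ∈ bits m) :
    ((π fX : ℕ), (π fY : ℕ), (π fU : ℕ)) ∈ triples m n := by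
  obtain ⟨τ, hτ⟩ := M.exists_linePerm hπ
  have hel : ∀ p ∈ bits m, (π p : ℕ) ∈ elems n 91 := fun p hp =>
    mem_elems.2 ⟨(π p).2, mem_bits.1 (h ▸ Finset.mem_image_of_mem π hp)⟩
  have hcol : ∀ p : Fin 91, sameColor m n p (π p) = true := fun p => by
    rw [sameColor, color_eq (corr_pointMasks hτ (corr_iff.2 h))]
    exact Nat.beq_refl _
  have hline : ∀ p q : Fin 91, p ≠ q → sameLine m n (π p) (π q) p q = true := fun p q hpq => by
    rw [sameLine, joinN_val, joinN_val, join_map hτ hpq, lineCount_map hτ h]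
    exact Nat.beq_refl _
  have hne : ∀ p q : Fin 91, p ≠ q → (!Nat.beq (π p) (π q)) = true := fun p q hpq => by
    rw [Bool.not_eq_true', ← Bool.not_eq_true]
    intro hb
    exact hpq (π.injective (Fin.ext (Nat.eq_of_beq_eq_true hb)))
  have hXY : fX ≠ fY := by decide +kernel
  have hXU : fX ≠ fU := by decide +kernel
  have hYU : fY ≠ fU := by decide +kernel
  have hj : (!Nat.beq (joinN (π fX) (π fU)) (joinN (π fX) (π fY))) = true := by
    rw [Bool.not_eq_true', ← Bool.not_eq_true, joinN_val, joinN_val, join_map hτ hXU,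
      join_map hτ hXY]
    intro hb
    have := τ.injective (Fin.ext (Nat.eq_of_beq_eq_true hb))
    revert this
    decide +kernel
  simp only [triples, List.mem_flatMap, List.mem_filter, List.mem_map, Bool.and_eq_true]
  exact ⟨_, ⟨hel _ hX, hcol _⟩, _, ⟨hel _ hY, hcol _, hne _ _ hXY.symm, hline _ _ hXY⟩, _,
    ⟨hel _ hU, hcol _, hne _ _ hXU.symm, hj, hline _ _ hXU, hline _ _ hYU⟩, rfl⟩

/-- All collineations from `m` to `n` are found. -/
theorem exists_isos {m n : ℕ} (hs : SO (bits m)) (hX : fX ∈ bits m) (hY : fY ∈ bits m)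
    (hU : fU ∈ bits m) (hZ : onTangent m fX fZ = true ∧ onTangent m fY fZ = true)
    (hok : (triples m n).all (frameOk n) = true) {π : Equiv.Perm (Fin 91)} (hπ : π ∈ M.coll)
    (h : (bits m).image π = bits n) : ∃ D ∈ isos m n, ∀ p : Fin 91, (π p).val = D.img p := by
  have ht := mem_triples hπ h hX hY hU
  set t := ((π fX : ℕ), (π fY : ℕ), (π fU : ℕ)) with htdef
  have hf := List.all_eq_true.1 hok _ ht
  simp only [frameOk, Bool.and_eq_true] at hf
  obtain ⟨hreg, h1, h2, h3, h4, h5, h6⟩ := hf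
  obtain ⟨ρ, hρ, hρD⟩ := M.exists_coll (frameAt_valid _ _ _) (Col.det_ne hreg)
  obtain ⟨τ, hτ⟩ := M.exists_linePerm hπ
  have hsn : SO (bits n) := Equi.so (M := M) ⟨π, hπ, h⟩ hs
  have hmem : ∀ p ∈ bits m, π p ∈ bits n := fun p hp => h ▸ Finset.mem_image_of_mem π hp
  -- The point Z is the intersection of the tangents at X and Y. Tangents go to tangents, and the
  -- tangents at two different points are different, so both images are the one point in which the
  -- image tangents meet.
  have hz : ρ fZ = π fZ := by
    have e : ((ρ fZ : Fin 91) : ℕ) = pole n t.1 t.2.1 := (hρD fZ).trans (Nat.eq_of_beq_eq_true h4)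
    rw [← e] at h5 h6
    obtain ⟨l, hl, hlz⟩ := onTangent_spec (hmem _ hX) h5
    obtain ⟨k, hk, hkz⟩ := onTangent_spec (hmem _ hY) h6
    obtain ⟨l', hl', hlz'⟩ := onTangent_spec hX hZ.1
    obtain ⟨k', hk', hkz'⟩ := onTangent_spec hY hZ.2
    have el : l = τ l' := (hsn.2 _ (hmem _ hX)).unique hl (by
      rw [← h, trc_image hτ, hl', Finset.image_singleton])
    have ek : k = τ k' := (hsn.2 _ (hmem _ hY)).unique hk (by
      rw [← h, trc_image hτ, hk', Finset.image_singleton])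
    by_contra hne
    have hlk : l = k := line_unique hne hlz (by rw [el, hτ]; exact hlz') hkz
      (by rw [ek, hτ]; exact hkz')
    rw [hlk, hk, Finset.singleton_inj] at hl
    have := π.injective hl
    revert this
    decide +kernel
  have hfix : ∀ p : Fin 91, ρ p = π p → (ρ⁻¹ * π) p = p := fun p hp => by
    rw [Equiv.Perm.mul_apply, Equiv.Perm.inv_eq_iff_eq]; exact hp.symm
  have hval : ∀ p : Fin 91, Nat.beq ((frameAt n t false).img p) (π p) = true → ρ p = π p := fun p hp =>
    Fin.ext ((hρD p).trans (Nat.eq_of_beq_eq_true hp))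
  -- The two collineations agree on the frame, so they are equal up to the Frobenius collineation.
  have key : ∃ s, ∀ p : Fin 91, (π p).val = (frameAt n t s).img p := by
    rcases M.rigid (mul_mem (inv_mem hρ) hπ) (hfix _ (hval _ h1)) (hfix _ (hval _ h2)) (hfix _ hz)
      (hfix _ (hval _ h3)) with hid | hfr
    · refine ⟨false, fun p => ?_⟩
      have := hid p
      rw [Equiv.Perm.mul_apply, Equiv.Perm.inv_eq_iff_eq] at this
      rw [this]
      exact hρD p
    · refine ⟨true, fun p => ?_⟩
      have h7 : π p = ρ ((ρ⁻¹ * π) p) := by simp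
      rw [h7, frameAt_true n t p.2, ← hfr p]
      exact hρD _
  obtain ⟨s, hs⟩ := key
  refine ⟨frameAt n t s, List.mem_filter.2 ⟨List.mem_flatMap.2 ⟨t, ht, mem_frames.2 ⟨s, rfl⟩⟩, ?_⟩, hs⟩
  refine Col.maps_iff.2 fun p hp hb => ?_
  rw [← hs ⟨p, hp⟩]
  exact mem_bits.1 (hmem _ (mem_bits.2 hb))

/-- The collineations that are found do exist. -/
theorem exists_stab {n : ℕ} (hok : (triples n n).all (frameOk n) = true) {D : Col}
    (hD : D ∈ isos n n) : ∃ π ∈ M.stab (bits n), ∀ p : Fin 91, (π p).val = D.img p := by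
  obtain ⟨hD, hm⟩ := List.mem_filter.1 hD
  obtain ⟨t, ht, hD⟩ := List.mem_flatMap.1 hD
  have hf := List.all_eq_true.1 hok _ ht
  simp only [frameOk, Bool.and_eq_true] at hf
  have hdet : D.Valid ∧ D.det ≠ 0 := by
    obtain ⟨s, rfl⟩ := mem_frames.1 hD
    exact ⟨frameAt_valid _ _ _, by rw [frameAt_eq]; exact Col.det_ne hf.1⟩
  obtain ⟨π, hπ, h⟩ := M.exists_coll hdet.1 hdet.2
  refine ⟨π, ⟨hπ, Finset.eq_of_subset_of_card_le (fun q hq => ?_) ?_⟩, h⟩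
  · obtain ⟨p, hp, rfl⟩ := Finset.mem_image.1 hq
    rw [mem_bits, h]
    exact Col.maps_iff.1 hm p p.2 (mem_bits.1 hp)
  · rw [Finset.card_image_of_injective _ π.injective]

end Model

end PG2

namespace PG2

/-! ### Stabilizers -/

/-- The codes are descending and less than `a`. -/
def ordered : ℕ → List Col → Bool
  | _, [] => true
  | a, D :: L => cond (Nat.ble (Nat.succ D.code) a) (ordered D.code L) false

theorem ordered_spec : ∀ {a : ℕ} {L : List Col}, ordered a L = true →
    (∀ D ∈ L, D.code < a) ∧ (L.map Col.code).Nodup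
  | _, [], _ => ⟨by simp, List.nodup_nil⟩
  | a, D :: L, h => by
    rw [ordered, cond_false_eq] at h
    obtain ⟨h1, h2⟩ := ordered_spec h.2
    have h3 : D.code < a := Nat.le_of_ble_eq_true h.1
    refine ⟨fun E hE => ?_, List.nodup_cons.2 ⟨fun hD => ?_, h2⟩⟩
    · rcases List.mem_cons.1 hE with rfl | hE
      · exact h3
      · exact (h1 E hE).trans h3
    · obtain ⟨E, hE, h4⟩ := List.mem_map.1 hD
      exact absurd (h1 E hE) (by omega)

/-- The standard frame and one more point. -/
def fives : List (Fin 91) := [fX, fY, fZ, fU, fV]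

namespace Model

variable {K : Type*} [Field K] {M : Model K}

/-- After the frame only the Frobenius collineation is left, and it moves the fifth point. -/
theorem eq_of_fives {π ρ : Equiv.Perm (Fin 91)} (hπ : π ∈ M.coll) (hρ : ρ ∈ M.coll)
    (h : ∀ p ∈ fives, π p = ρ p) : π = ρ := by
  have hfix : ∀ p ∈ fives, (ρ⁻¹ * π) p = p := fun p hp => by
    rw [Equiv.Perm.mul_apply, Equiv.Perm.inv_eq_iff_eq, h p hp]
  simp only [fives, List.mem_cons, List.not_mem_nil, or_false, forall_eq_or_imp, forall_eq] at hfix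
  obtain ⟨h1, h2, h3, h4, h5⟩ := hfix
  rcases M.rigid (mul_mem (inv_mem hρ) hπ) h1 h2 h3 h4 with hid | hfr
  · exact (inv_mul_eq_one.1 (Equiv.ext hid)).symm
  · have hV : ¬ (fV : ℕ) = Col.frob.img fV := by decide +kernel
    exact absurd ((congrArg Fin.val h5).symm.trans (hfr fV)) hV

/-- Stabilizer elements are matched with the listed collineations through the images of X, Y, U and
V, read as digits to base 91. That the list has no repetition is checked by descending codes; the
start value 68574961 used later is 91^4. -/
theorem card_stab {n k : ℕ} (hs : SO (bits n)) (hX : fX ∈ bits n) (hY : fY ∈ bits n)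
    (hU : fU ∈ bits n) (hZ : onTangent n fX fZ = true ∧ onTangent n fY fZ = true)
    (hok : (triples n n).all (frameOk n) = true) {a : ℕ} (ho : ordered a (isos n n) = true)
    (hk : (isos n n).length = k) : Nat.card (M.stab (bits n)) = k := by
  let f : M.stab (bits n) → ℕ := fun π =>
    π.1 fV + 91 * (π.1 fU + 91 * (π.1 fY + 91 * (π.1 fX : ℕ)))
  have hf : ∀ (π : M.stab (bits n)) (D : Col), (∀ p : Fin 91, (π.1 p).val = D.img p) →
      f π = D.code := fun π D h => by
    simp only [f, h]
    rfl
  -- Both elements act like listed collineations; equal codes give the same entry of the list.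
  have hinj : Function.Injective f := by
    intro π ρ h
    obtain ⟨D, hD, hπ⟩ := exists_isos hs hX hY hU hZ hok π.2.1 π.2.2
    obtain ⟨E, hE, hρ⟩ := exists_isos hs hX hY hU hZ hok ρ.2.1 ρ.2.2
    rw [hf π D hπ, hf ρ E hρ] at h
    have := List.inj_on_of_nodup_map (ordered_spec ho).2 hD hE h
    subst this
    exact Subtype.ext (Equiv.ext fun p => Fin.ext ((hπ p).trans (hρ p).symm))
  have hrange : Set.range f = ((isos n n).map Col.code).toFinset := by
    ext c
    simp only [Set.mem_range, List.coe_toFinset, Set.mem_ofPred_eq, List.mem_map]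
    constructor
    · rintro ⟨π, rfl⟩
      obtain ⟨D, hD, hπ⟩ := exists_isos hs hX hY hU hZ hok π.2.1 π.2.2
      exact ⟨D, hD, (hf π D hπ).symm⟩
    · rintro ⟨D, hD, rfl⟩
      obtain ⟨π, hπ, h⟩ := exists_stab (M := M) hok hD
      exact ⟨⟨π, hπ⟩, hf ⟨π, hπ⟩ D h⟩
  rw [← Nat.card_range_of_injective hinj, Nat.card_coe_set_eq, hrange, Set.ncard_coe_finset,
    List.toFinset_card_of_nodup (ordered_spec ho).2, List.length_map, hk]

end Model

/-- The collineations with numbers `f g` stabilize `n`, and `f` is an injective homomorphism. -/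
def homCheck {G : Type} [Group G] [Fintype G] [DecidableEq G] (n : ℕ) (f : G → ℕ) : Bool :=
  decide (∀ g, ((Col.dec (f g)).reg && ((Col.dec (f g)).maps n n && (decide (g = 1) ||
    !(fives.all fun p => Nat.beq ((Col.dec (f g)).img p) p)))) = true) &&
  decide (∀ g h, (fives.all fun p => Nat.beq ((Col.dec (f (g * h))).img p)
    ((Col.dec (f g)).img ((Col.dec (f h)).img p))) = true)

/-- An injective homomorphism between finite groups of equal order is an isomorphism. Products need
to be compared on five points only, because these determine a collineation. -/
theorem Model.nonempty_mulEquiv {K : Type*} [Field K] (M : Model K) {G : Type} [Group G] [Fintype G]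
    [DecidableEq G] {n : ℕ} {f : G → ℕ} (h : homCheck n f = true)
    (hc : Nat.card (M.stab (bits n)) = Nat.card G) : Nonempty (M.stab (bits n) ≃* G) := by
  simp only [homCheck, Bool.and_eq_true, decide_eq_true_eq, Bool.or_eq_true, Bool.not_eq_true',
    ← Bool.not_eq_true] at h
  obtain ⟨h1, h2⟩ := h
  choose φ hφ hφf using fun g => M.exists_perm (h1 g).1
  have hst : ∀ g, φ g ∈ M.stab (bits n) := by
    refine fun g => ⟨hφ g, Finset.eq_of_subset_of_card_le (fun q hq => ?_) ?_⟩
    · obtain ⟨p, hp, rfl⟩ := Finset.mem_image.1 hq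
      rw [mem_bits, hφf]
      exact Col.maps_iff.1 (h1 g).2.1 p p.2 (mem_bits.1 hp)
    · rw [Finset.card_image_of_injective _ (φ g).injective]
  have hmul : ∀ g k, φ (g * k) = φ g * φ k := fun g k => by
    refine eq_of_fives (hφ _) (mul_mem (hφ g) (hφ k)) fun p hp => Fin.ext ?_
    rw [hφf, Equiv.Perm.mul_apply, hφf, hφf]
    exact Nat.eq_of_beq_eq_true (List.all_eq_true.1 (h2 g k) p hp)
  let F : G →* M.stab (bits n) := MonoidHom.mk' (fun g => ⟨φ g, hst g⟩) fun g k =>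
    Subtype.ext (hmul g k)
  have hF : Function.Injective F := by
    refine (injective_iff_map_eq_one F).2 fun g hg => ?_
    rcases (h1 g).2.2 with h3 | h3
    · exact h3
    · refine absurd (List.all_eq_true.2 fun p _ => ?_) h3
      have h4 : φ g = 1 := congrArg Subtype.val hg
      rw [← hφf, h4]
      exact Nat.beq_refl _
  have : Finite (M.stab (bits n)) := Subtype.finite
  exact ⟨(MulEquiv.ofBijective F (hF.bijective_of_nat_card_le hc.le)).symm⟩

/-! ### The representatives -/

/-- Claims about a semioval: the invariant `key`, ten times the order of the stabilizer, plus one for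
some groups, the number of the row in `secantTable`, and numbers of collineations. -/
structure Info where
  key : ℕ
  ty : ℕ
  row : ℕ
  gens : List ℕ

/-- Claims about the semiovals of the list `repT`. -/
def infoT : List Info := [
  ⟨4954, 14400, 0, []⟩, ⟨5987, 1920, 1, []⟩, ⟨414, 160, 2, []⟩, ⟨771, 20, 3, []⟩, ⟨4995, 41, 3,
  [86106566, 258930855, 516572389, 86609118]⟩, ⟨7151, 20, 3, []⟩, ⟨9728, 10, 5, []⟩, ⟨9358, 10, 5,
  []⟩, ⟨7766, 20, 5, []⟩, ⟨2331, 20, 5, []⟩, ⟨515, 20, 5, []⟩, ⟨5809, 20, 5, []⟩, ⟨8432, 20, 5,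
  []⟩, ⟨7884, 30, 4, []⟩, ⟨3461, 10, 5, []⟩, ⟨1328, 10, 5, []⟩, ⟨1231, 20, 6, []⟩, ⟨9154, 20, 5,
  []⟩, ⟨1497, 20, 4, []⟩, ⟨9863, 10, 5, []⟩, ⟨2608, 61, 4, [86106566, 86106566, 549814175,
  172189837, 86106566, 324173648, 341340890, 568149273, 86106566]⟩, ⟨535, 10, 5, []⟩, ⟨5943, 30,
  6, []⟩, ⟨9651, 20, 5, []⟩, ⟨3074, 20, 5, []⟩, ⟨9173, 20, 5, []⟩, ⟨603, 60, 4, [86106566,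
  250528705, 651026250, 579561639, 352888720, 546998721]⟩, ⟨2902, 120, 5, [86106566, 332387324,
  333556638, 88484566, 742598260, 741389574, 16818237, 89983401, 199781341, 197191943, 176904987,
  14268199]⟩, ⟨5165, 81, 5, [86106566, 172226256, 86119690, 172265628, 172200047, 86172235,
  172213149, 86132929]⟩, ⟨3378, 60, 6, [86106566, 35539841, 233273884, 172189837, 35868876,
  147637911]⟩, ⟨4895, 61, 6, [86106566, 86106566, 318083804, 86099364, 86106566, 546733390,
  332939356, 570173718, 86106566]⟩, ⟨2902, 240, 5, []⟩, ⟨3073, 20, 13, []⟩, ⟨455, 10, 13, []⟩,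
  ⟨551, 10, 10, []⟩, ⟨7146, 10, 10, []⟩, ⟨7140, 20, 10, []⟩, ⟨6313, 10, 8, []⟩, ⟨7472, 20, 13,
  []⟩, ⟨2862, 10, 9, []⟩, ⟨5530, 10, 8, []⟩, ⟨4331, 10, 9, []⟩, ⟨4120, 10, 9, []⟩, ⟨5681, 10, 9,
  []⟩, ⟨7642, 10, 8, []⟩, ⟨8254, 10, 10, []⟩, ⟨4562, 10, 8, []⟩, ⟨7630, 41, 15, [86106566,
  172189836, 86102299, 172226257]⟩, ⟨9749, 10, 10, []⟩, ⟨6199, 10, 9, []⟩, ⟨6898, 10, 10, []⟩,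
  ⟨2152, 20, 8, []⟩, ⟨6809, 10, 13, []⟩, ⟨5351, 10, 8, []⟩, ⟨885, 10, 9, []⟩, ⟨3855, 10, 9, []⟩,
  ⟨2455, 10, 9, []⟩, ⟨6923, 10, 10, []⟩, ⟨7495, 10, 9, []⟩, ⟨1736, 10, 9, []⟩, ⟨9002, 10, 8, []⟩,
  ⟨915, 10, 9, []⟩, ⟨5933, 10, 9, []⟩, ⟨4103, 10, 9, []⟩, ⟨3421, 10, 9, []⟩, ⟨8543, 10, 8, []⟩,
  ⟨8880, 10, 8, []⟩, ⟨1973, 10, 9, []⟩, ⟨346, 10, 9, []⟩, ⟨3229, 10, 11, []⟩, ⟨731, 20, 9, []⟩,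
  ⟨2806, 10, 9, []⟩, ⟨5180, 10, 9, []⟩, ⟨1829, 10, 9, []⟩, ⟨1801, 10, 9, []⟩, ⟨926, 10, 9, []⟩,
  ⟨5317, 10, 9, []⟩, ⟨8840, 10, 9, []⟩, ⟨809, 20, 8, []⟩, ⟨9617, 40, 8, [86106566, 361189680,
  172191366, 361211446]⟩, ⟨512, 10, 8, []⟩, ⟨8227, 10, 10, []⟩, ⟨4325, 10, 8, []⟩, ⟨6222, 10, 8,
  []⟩, ⟨473, 10, 8, []⟩, ⟨8215, 10, 8, []⟩, ⟨3209, 10, 9, []⟩, ⟨2980, 10, 9, []⟩, ⟨3348, 20, 9,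
  []⟩, ⟨4309, 10, 9, []⟩, ⟨6415, 10, 8, []⟩, ⟨9020, 20, 8, []⟩, ⟨4823, 10, 8, []⟩, ⟨7540, 10, 8,
  []⟩, ⟨542, 10, 7, []⟩, ⟨7020, 10, 8, []⟩, ⟨9742, 10, 9, []⟩, ⟨3051, 10, 8, []⟩, ⟨6097, 10, 9,
  []⟩, ⟨9164, 10, 8, []⟩, ⟨8304, 10, 9, []⟩, ⟨4461, 10, 8, []⟩, ⟨6610, 10, 9, []⟩, ⟨8699, 80, 9,
  [86106566, 73255523, 650417060, 357092501, 649923704, 356875447, 86640926, 73127043]⟩, ⟨8045,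
  10, 8, []⟩, ⟨2753, 20, 9, []⟩, ⟨799, 10, 8, []⟩, ⟨9115, 20, 9, []⟩, ⟨9046, 10, 9, []⟩, ⟨4618,
  10, 8, []⟩, ⟨4532, 10, 12, []⟩, ⟨6024, 10, 8, []⟩, ⟨191, 10, 9, []⟩, ⟨5246, 10, 9, []⟩, ⟨2076,
  10, 8, []⟩, ⟨9519, 10, 8, []⟩, ⟨2787, 10, 9, []⟩, ⟨5752, 10, 8, []⟩, ⟨7219, 10, 9, []⟩, ⟨2421,
  10, 9, []⟩, ⟨9941, 20, 9, []⟩, ⟨1848, 10, 9, []⟩, ⟨9744, 20, 8, []⟩, ⟨5779, 20, 12, []⟩, ⟨2145,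
  20, 9, []⟩, ⟨8967, 10, 9, []⟩, ⟨9221, 10, 8, []⟩, ⟨7575, 10, 9, []⟩, ⟨7069, 81, 11, [86106566,
  517211046, 87002286, 516567124, 258287743, 172200225, 517609275, 87118429]⟩, ⟨288, 20, 8, []⟩,
  ⟨3514, 20, 9, []⟩, ⟨4180, 480, 8, []⟩, ⟨516, 10, 9, []⟩, ⟨6644, 20, 11, []⟩, ⟨7255, 10, 9, []⟩,
  ⟨2572, 41, 8, [86106566, 258287743, 258290623, 86119690]⟩, ⟨5828, 20, 7, []⟩, ⟨9535, 20, 8, []⟩,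
  ⟨9722, 20, 9, []⟩, ⟨4092, 20, 8, []⟩, ⟨3635, 20, 9, []⟩, ⟨3587, 320, 14, []⟩, ⟨7412, 60, 8,
  [86106566, 181885519, 173251406, 86106567, 181885518, 173251407]⟩, ⟨4652, 2560, 16, []⟩, ⟨957,
  1920, 14, []⟩]

/-- The representatives with their claims. -/
def reps : List (ℕ × Info) := repT.zip infoT

/-- The claimed size and numbers of secants. -/
def Info.secs (x : Info) : ℕ × List ℕ × ℕ := secantTable.getD x.row (0, [], 0)

/-- The structure of the stabilizer of `n` is as claimed. -/
def groupCheck (n : ℕ) (x : Info) : Bool :=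
  cond (Nat.beq x.ty 40) (homCheck n fun g : Z 4 => nth x.gens (ZMod.val (n := 4) g.toAdd)) <|
  cond (Nat.beq x.ty 41) (homCheck n fun g : Z 2 × Z 2 =>
    nth x.gens (Nat.add (Nat.mul 2 (ZMod.val (n := 2) g.1.toAdd)) (ZMod.val (n := 2) g.2.toAdd))) <|
  cond (Nat.beq x.ty 60) (homCheck n fun g : Z 6 => nth x.gens (ZMod.val (n := 6) g.toAdd)) <|
  cond (Nat.beq x.ty 61) (homCheck n fun g : Equiv.Perm (Fin 3) =>
    nth x.gens (Nat.add (Nat.mul 3 (g 0).val) (g 1).val)) <|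
  cond (Nat.beq x.ty 80) (homCheck n fun g : Z 2 × Z 4 =>
    nth x.gens (Nat.add (Nat.mul 4 (ZMod.val (n := 2) g.1.toAdd)) (ZMod.val (n := 4) g.2.toAdd))) <|
  cond (Nat.beq x.ty 81) (homCheck n fun g : DihedralGroup 4 => match g with
    | .r i => nth x.gens (ZMod.val (n := 4) i)
    | .sr i => nth x.gens (Nat.add 4 (ZMod.val (n := 4) i))) <|
  cond (Nat.beq x.ty 120) (homCheck n fun g : QuaternionGroup 3 => match g with
    | .a i => nth x.gens (ZMod.val (n := 6) i)
    | .xa i => nth x.gens (Nat.add 6 (ZMod.val (n := 6) i))) true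

/-- All claims about `n` except those about the structure of the stabilizer. -/
def repCheck (n : ℕ) (x : Info) : Bool :=
  bitAt n fX && (bitAt n fY && (bitAt n fU && (onTangent n fX fZ && (onTangent n fY fZ &&
    (soCheck n 91 && (Nat.beq (key n) x.key && (Nat.beq (pop n 91) x.secs.1 &&
      (secants n == x.secs.2.1 && ((triples n n).all (frameOk n) &&
        (ordered 68574961 (isos n n) && Nat.beq (isos n n).length (Nat.div x.ty 10)))))))))))

/-- Two representatives have different invariants, are the same, or there is no collineation. -/
def sepCheck (x y : ℕ × Info) : Bool :=
  !Nat.beq x.2.key y.2.key || (Nat.beq x.1 y.1 || ((triples x.1 y.1).all (frameOk y.1) &&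
    (isos x.1 y.1).isEmpty))

end PG2

namespace PG2

/-! ### Verification of the representatives -/

theorem all_of_take {α : Type*} {L : List α} {f : α → Bool} (k : ℕ) (h1 : (L.take k).all f = true)
    (h2 : (L.drop k).all f = true) : L.all f = true := by
  rw [← List.take_append_drop k L, List.all_append, h1, h2]
  rfl

set_option maxHeartbeats 0 in
-- The first representative has the stabilizer of order 1440 and forms a block of its own; the
-- others are checked in blocks. The key does not separate all classes, for instance 2902 occurs
-- twice; there the complete list of collineations is found to be empty.
theorem reps_check : (reps.all fun x => repCheck x.1 x.2) = true ∧
    (reps.all fun x => groupCheck x.1 x.2) = true ∧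
    (reps.all fun x => reps.all fun y => sepCheck x y) = true := by
  refine ⟨all_of_take 1 ?_ (all_of_take 24 ?_ (all_of_take 24 ?_ (all_of_take 24 ?_
    (all_of_take 24 ?_ (all_of_take 24 ?_ ?_))))), ?_, ?_⟩
  all_goals decide +kernel

end PG2

namespace PG2

/-! ### The classification -/

theorem reps_map_fst : reps.map Prod.fst = repT := by decide +kernel

theorem reps_secs : ∀ x ∈ reps, x.2.secs ∈ secantTable := by decide +kernel

theorem reps_nodup : (reps.map Prod.fst).Nodup := by decide +kernel

namespace Model

variable {K : Type*} [Field K] {M : Model K}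

theorem exists_reps {s : Finset (Fin 91)} (hs : SO s) (hk : s.card ≤ 16) :
    ∃ x ∈ reps, M.Equi s (bits x.1) := by
  obtain ⟨n, hn, h⟩ := exists_rep (M := M) hs hk
  rw [← reps_map_fst] at hn
  obtain ⟨x, hx, rfl⟩ := List.mem_map.1 hn
  exact ⟨x, hx, h⟩

theorem rep_frame {x : ℕ × Info} (hx : x ∈ reps) : SO (bits x.1) ∧ fX ∈ bits x.1 ∧ fY ∈ bits x.1 ∧
    fU ∈ bits x.1 ∧ onTangent x.1 fX fZ = true ∧ onTangent x.1 fY fZ = true := by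
  have h := List.all_eq_true.1 reps_check.1 x hx
  simp only [repCheck, Bool.and_eq_true, bitAt_eq, ← mem_bits] at h
  exact ⟨so_of_soCheck ⟨_, h.1⟩ h.2.2.2.2.2.1, h.1, h.2.1, h.2.2.1, h.2.2.2.1, h.2.2.2.2.1⟩

theorem rep_spec {x : ℕ × Info} (hx : x ∈ reps) : key x.1 = x.2.key ∧
    (bits x.1).card = x.2.secs.1 ∧ secantCounts (M.set (bits x.1)) = x.2.secs.2.1 ∧
    Nat.card (M.stab (bits x.1)) = x.2.ty / 10 := by
  obtain ⟨hs, hX, hY, hU, hZ⟩ := rep_frame hx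
  have h := List.all_eq_true.1 reps_check.1 x hx
  simp only [repCheck, Bool.and_eq_true, beq_iff_eq] at h
  obtain ⟨-, -, -, -, -, -, h1, h2, h3, h4, h5, h6⟩ := h
  exact ⟨Nat.eq_of_beq_eq_true h1, (card_bits _).trans (Nat.eq_of_beq_eq_true h2),
    (M.secantCounts_bits _).trans h3, card_stab hs hX hY hU hZ h4 h5 (Nat.eq_of_beq_eq_true h6)⟩

/-- Equivalent representatives have equal keys, and for equal keys of different entries
`exists_isos` would produce a collineation from an empty list. -/
theorem eq_of_equi {x y : ℕ × Info} (hx : x ∈ reps) (hy : y ∈ reps)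
    (h : M.Equi (bits x.1) (bits y.1)) : x = y := by
  obtain ⟨hs, hX, hY, hU, hZ⟩ := rep_frame hx
  have hk : Nat.beq x.2.key y.2.key = true := by
    rw [← (rep_spec (M := M) hx).1, ← (rep_spec (M := M) hy).1, h.key_eq]
    exact Nat.beq_refl _
  have h1 := List.all_eq_true.1 (List.all_eq_true.1 reps_check.2.2 x hx) y hy
  rw [sepCheck, hk] at h1
  simp only [Bool.not_true, Bool.false_or, Bool.or_eq_true, Bool.and_eq_true] at h1
  rcases h1 with h1 | ⟨h1, h2⟩
  · exact List.inj_on_of_nodup_map reps_nodup hx hy (Nat.eq_of_beq_eq_true h1)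
  · obtain ⟨π, hπ, h⟩ := h
    obtain ⟨D, hD, -⟩ := exists_isos hs hX hY hU hZ h1 hπ h
    rw [List.isEmpty_iff.1 h2] at hD
    simp at hD

theorem Equi.secantCounts_eq {s t : Finset (Fin 91)} (h : M.Equi s t) :
    secantCounts (M.set t) = secantCounts (M.set s) := by
  obtain ⟨π, hπ, rfl⟩ := h
  obtain ⟨τ, hτ⟩ := M.exists_linePerm hπ
  refine List.map_congr_left fun i _ => ?_
  rw [secantCount_set, secantCount_set]
  refine (Finset.card_equiv τ fun l => ?_).symm
  simp only [Finset.mem_filter, Finset.mem_univ, true_and, trc_image hτ,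
    Finset.card_image_of_injective _ π.injective]

theorem Equi.nonempty_stabilizer {s t : Finset (Fin 91)} (h : M.Equi s t) :
    Nonempty (MulAction.stabilizer (PGammaL K) (M.set s) ≃*
      MulAction.stabilizer (PGammaL K) (M.set t)) :=
  ⟨MulAction.stabilizerEquivStabilizerOfOrbitRel
    (MulAction.orbitRel_apply.2 ((M.mem_orbit_set t s).2 h.symm))⟩

/-- The number of classes with an invariant property. -/
theorem numClasses_reps {k : ℕ} (hk : k ≤ 16) (Q : Set (Point K) → Prop)
    (hQ : ∀ s t, M.Equi s t → Q (M.set s) → Q (M.set t)) (c : Info → Bool)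
    (hc : ∀ x ∈ reps, x.2.secs.1 = k → (Q (M.set (bits x.1)) ↔ c x.2 = true)) :
    numClasses K (fun S => S.ncard = k ∧ Q S) =
      reps.countP fun x => Nat.beq x.2.secs.1 k && c x.2 := by
  refine numClasses_eq (M := M) Prod.fst (fun s => exists_reps) (fun x hx => (rep_frame hx).1)
    (List.Nodup.of_map _ reps_nodup) (fun x hx y hy => eq_of_equi hx hy) _ (fun s hs => ?_)
    (fun s t h hs => ?_) _ fun x hx => ?_
  · rw [← M.ncard_set, hs.1]
    exact hk
  · exact ⟨by rw [M.ncard_set, h.card, ← M.ncard_set, hs.1], hQ s t h hs.2⟩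
  · rw [M.ncard_set, (rep_spec (M := M) hx).2.1, Bool.and_eq_true]
    constructor
    · rintro ⟨h1, h2⟩
      exact ⟨by rw [h1]; exact Nat.beq_refl k, (hc x hx h1).1 h2⟩
    · rintro ⟨h1, h2⟩
      have h1 := Nat.eq_of_beq_eq_true h1
      exact ⟨h1, (hc x hx h1).2 h2⟩

theorem numOfSize_eq (M : Model K) {k : ℕ} (hk : k ≤ 16) :
    numOfSize K k = reps.countP fun x => Nat.beq x.2.secs.1 k && true := by
  rw [← numClasses_reps (M := M) hk (fun _ => True) (fun _ _ _ h => h) (fun _ => true)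
    fun _ _ _ => by simp]
  simp only [numOfSize, and_true]

theorem numWithSecants_eq (M : Model K) {k : ℕ} (hk : k ≤ 16) (d : List ℕ) :
    numWithSecants K k d = reps.countP fun x => Nat.beq x.2.secs.1 k && x.2.secs.2.1 == d :=
  numClasses_reps (M := M) hk (fun S => secantCounts S = d)
    (fun s t h hs => h.secantCounts_eq.trans hs) (fun x => x.secs.2.1 == d) fun x hx _ => by
      rw [(rep_spec (M := M) hx).2.2.1, beq_iff_eq]

theorem numWithStabilizerOrder_eq (M : Model K) {k : ℕ} (hk : k ≤ 16) (n : ℕ) :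
    numWithStabilizerOrder K k n =
      reps.countP fun x => Nat.beq x.2.secs.1 k && Nat.beq (x.2.ty / 10) n :=
  numClasses_reps (M := M) hk (fun S => Nat.card (MulAction.stabilizer (PGammaL K) S) = n)
    (fun s t h hs => by
      obtain ⟨e⟩ := h.nonempty_stabilizer
      rw [← hs, Nat.card_congr e.toEquiv]) (fun x => Nat.beq (x.ty / 10) n) fun x hx _ => by
    obtain ⟨e⟩ := M.nonempty_stab (bits x.1)
    rw [Nat.card_congr e.toEquiv, (rep_spec (M := M) hx).2.2.2, Nat.beq_eq]

theorem numWithStabilizer_eq (M : Model K) {k : ℕ} (hk : k ≤ 16) {G : Type} [Group G] {ty : ℕ}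
    (h : ∀ x ∈ reps, Nonempty (M.stab (bits x.1) ≃* G) ↔ x.2.ty = ty) :
    numWithStabilizer K k G = reps.countP fun x => Nat.beq x.2.secs.1 k && Nat.beq x.2.ty ty :=
  numClasses_reps (M := M) hk
    (fun S => Nonempty (MulAction.stabilizer (PGammaL K) S ≃* G))
    (fun s t h ⟨f⟩ => by
      obtain ⟨e⟩ := h.nonempty_stabilizer
      exact ⟨e.symm.trans f⟩) (fun x => Nat.beq x.ty ty) fun x hx _ => by
    obtain ⟨e⟩ := M.nonempty_stab (bits x.1)
    rw [Nat.beq_eq, ← h x hx]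
    exact ⟨fun ⟨f⟩ => ⟨e.symm.trans f⟩, fun ⟨f⟩ => ⟨e.trans f⟩⟩

/-! ### The structure of the stabilizers -/

/-- Types with the same order. -/
theorem _root_.PG2.reps_ty : ∀ x ∈ reps, (x.2.ty / 10 = 1 → x.2.ty = 10) ∧
    (x.2.ty / 10 = 2 → x.2.ty = 20) ∧ (x.2.ty / 10 = 3 → x.2.ty = 30) ∧
    (x.2.ty / 10 = 4 → x.2.ty = 40 ∨ x.2.ty = 41) ∧ (x.2.ty / 10 = 6 → x.2.ty = 60 ∨ x.2.ty = 61) ∧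
    (x.2.ty / 10 = 8 → x.2.ty = 80 ∨ x.2.ty = 81) ∧ (x.2.ty / 10 = 12 → x.2.ty = 120) := by
  decide +kernel

theorem mul_self_of_mulEquiv {G H : Type*} [Group G] [Group H] (e : G ≃* H)
    (h : ∀ a : G, a * a = 1) (b : H) : b * b = 1 := by
  rw [← e.apply_symm_apply b, ← map_mul, h, map_one]

theorem mul_comm_of_mulEquiv {G H : Type*} [CommGroup G] [Group H] (e : G ≃* H) (b c : H) :
    b * c = c * b := by
  rw [← e.apply_symm_apply b, ← e.apply_symm_apply c, ← map_mul, mul_comm, map_mul]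

/-- The type divided by ten is the order. By `reps_ty` this settles the type for the orders 1, 2, 3
and 12; for 4, 6 and 8 two types remain and must be told apart. -/
theorem ty_div {x : ℕ × Info} (hx : x ∈ reps) {G : Type} [Group G] {n : ℕ} (hn : Nat.card G = n)
    (h : Nonempty (M.stab (bits x.1) ≃* G)) : x.2.ty / 10 = n := by
  obtain ⟨e⟩ := h
  rw [← hn, ← Nat.card_congr e.toEquiv, (rep_spec (M := M) hx).2.2.2]

theorem card_stab_rep {x : ℕ × Info} (hx : x ∈ reps) {n : ℕ} (h : x.2.ty / 10 = n) {G : Type}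
    (hn : Nat.card G = n) : Nat.card (M.stab (bits x.1)) = Nat.card G := by
  rw [(rep_spec (M := M) hx).2.2.2, h, hn]

theorem card_Z (n : ℕ) : Nat.card (Z n) = n := Nat.card_zmod n

theorem stab_one {x : ℕ × Info} (hx : x ∈ reps) (h : x.2.ty = 10) : Nonempty (M.stab (bits x.1) ≃* Z 1) := by
  have h1 := card_stab_rep (M := M) hx (n := 1) (by rw [h]) (card_Z 1)
  rw [card_Z, Nat.card_eq_one_iff_unique] at h1
  have := h1.1
  have h2 := Nat.card_eq_one_iff_unique.1 (card_Z 1)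
  have := h2.1
  exact ⟨⟨⟨fun _ => 1, fun _ => 1, fun _ => Subsingleton.elim _ _, fun _ => Subsingleton.elim _ _⟩,
    fun _ _ => Subsingleton.elim _ _⟩⟩

theorem stab_prime {x : ℕ × Info} (hx : x ∈ reps) {p : ℕ} [Fact p.Prime] (h : x.2.ty = 10 * p) :
    Nonempty (M.stab (bits x.1) ≃* Z p) :=
  ⟨mulEquivOfPrimeCardEq ((card_stab_rep (M := M) hx (n := p) (by omega) (card_Z p)).trans
    (card_Z p)) (card_Z p)⟩

theorem group_check {x : ℕ × Info} (hx : x ∈ reps) : groupCheck x.1 x.2 = true := List.all_eq_true.1 reps_check.2.1 x hx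

theorem stab_four {x : ℕ × Info} (hx : x ∈ reps) (h : x.2.ty = 40) : Nonempty (M.stab (bits x.1) ≃* Z 4) := by
  have h1 := group_check hx
  rw [groupCheck, h] at h1
  exact M.nonempty_mulEquiv (G := Z 4) h1 (card_stab_rep hx (n := 4) (by rw [h]) (card_Z 4))

theorem stab_two_two {x : ℕ × Info} (hx : x ∈ reps) (h : x.2.ty = 41) : Nonempty (M.stab (bits x.1) ≃* Z 2 × Z 2) := by
  have h1 := group_check hx
  rw [groupCheck, h] at h1
  exact M.nonempty_mulEquiv (G := Z 2 × Z 2) h1 (card_stab_rep hx (n := 4) (by rw [h])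
    (by rw [Nat.card_prod, card_Z]))

theorem stab_six {x : ℕ × Info} (hx : x ∈ reps) (h : x.2.ty = 60) : Nonempty (M.stab (bits x.1) ≃* Z 6) := by
  have h1 := group_check hx
  rw [groupCheck, h] at h1
  exact M.nonempty_mulEquiv (G := Z 6) h1 (card_stab_rep hx (n := 6) (by rw [h]) (card_Z 6))

theorem stab_perm {x : ℕ × Info} (hx : x ∈ reps) (h : x.2.ty = 61) : Nonempty (M.stab (bits x.1) ≃* Equiv.Perm (Fin 3)) := by
  have h1 := group_check hx
  rw [groupCheck, h] at h1
  exact M.nonempty_mulEquiv (G := Equiv.Perm (Fin 3)) h1 (card_stab_rep hx (n := 6) (by rw [h])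
    (by rw [Nat.card_perm, Nat.card_fin]; rfl))

theorem stab_two_four {x : ℕ × Info} (hx : x ∈ reps) (h : x.2.ty = 80) : Nonempty (M.stab (bits x.1) ≃* Z 2 × Z 4) := by
  have h1 := group_check hx
  rw [groupCheck, h] at h1
  exact M.nonempty_mulEquiv (G := Z 2 × Z 4) h1 (card_stab_rep hx (n := 8) (by rw [h])
    (by rw [Nat.card_prod, card_Z, card_Z]))

theorem stab_dihedral {x : ℕ × Info} (hx : x ∈ reps) (h : x.2.ty = 81) : Nonempty (M.stab (bits x.1) ≃* DihedralGroup 4) := by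
  have h1 := group_check hx
  rw [groupCheck, h] at h1
  exact M.nonempty_mulEquiv (G := DihedralGroup 4) h1 (card_stab_rep hx (n := 8) (by rw [h])
    DihedralGroup.nat_card)

theorem stab_quaternion {x : ℕ × Info} (hx : x ∈ reps) (h : x.2.ty = 120) : Nonempty (M.stab (bits x.1) ≃* QuaternionGroup 3) := by
  have h1 := group_check hx
  rw [groupCheck, h] at h1
  exact M.nonempty_mulEquiv (G := QuaternionGroup 3) h1 (card_stab_rep hx (n := 12) (by rw [h])
    (by rw [Nat.card_eq_fintype_card, QuaternionGroup.card]))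

theorem stab_iff_one : ∀ x ∈ reps, Nonempty (M.stab (bits x.1) ≃* Z 1) ↔ x.2.ty = 10 :=
  fun x hx => ⟨fun h => (reps_ty x hx).1 (ty_div hx (card_Z 1) h), stab_one hx⟩

theorem stab_iff_two : ∀ x ∈ reps, Nonempty (M.stab (bits x.1) ≃* Z 2) ↔ x.2.ty = 20 :=
  fun x hx => ⟨fun h => (reps_ty x hx).2.1 (ty_div hx (card_Z 2) h), stab_prime (p := 2) hx⟩

theorem stab_iff_three : ∀ x ∈ reps, Nonempty (M.stab (bits x.1) ≃* Z 3) ↔ x.2.ty = 30 :=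
  fun x hx => ⟨fun h => (reps_ty x hx).2.2.1 (ty_div hx (card_Z 3) h), stab_prime (p := 3) hx⟩

/-- Of the two types of order four only the other one has all squares trivial. -/
theorem stab_iff_four : ∀ x ∈ reps, Nonempty (M.stab (bits x.1) ≃* Z 4) ↔ x.2.ty = 40 := by
  refine fun x hx => ⟨fun h => ?_, stab_four hx⟩
  refine ((reps_ty x hx).2.2.2.1 (ty_div hx (card_Z 4) h)).resolve_right fun h1 => ?_
  obtain ⟨e⟩ := h
  obtain ⟨f⟩ := stab_two_two (M := M) hx h1
  have h2 : ∀ a : Z 2 × Z 2, a * a = 1 := by decide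
  have h3 : ¬ ∀ a : Z 4, a * a = 1 := by decide
  exact h3 (mul_self_of_mulEquiv (f.symm.trans e) h2)

theorem stab_iff_two_two : ∀ x ∈ reps, Nonempty (M.stab (bits x.1) ≃* Z 2 × Z 2) ↔ x.2.ty = 41 := by
  refine fun x hx => ⟨fun h => ?_, stab_two_two hx⟩
  refine ((reps_ty x hx).2.2.2.1 (ty_div hx (by rw [Nat.card_prod, card_Z]) h)).resolve_left
    fun h1 => ?_
  obtain ⟨e⟩ := h
  obtain ⟨f⟩ := stab_four (M := M) hx h1
  have h2 : ∀ a : Z 2 × Z 2, a * a = 1 := by decide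
  have h3 : ¬ ∀ a : Z 4, a * a = 1 := by decide
  exact h3 (mul_self_of_mulEquiv (e.symm.trans f) h2)

/-- For the orders six and eight the two types that occur are distinguished by commutativity. -/
theorem stab_iff_six : ∀ x ∈ reps, Nonempty (M.stab (bits x.1) ≃* Z 6) ↔ x.2.ty = 60 := by
  refine fun x hx => ⟨fun h => ?_, stab_six hx⟩
  refine ((reps_ty x hx).2.2.2.2.1 (ty_div hx (card_Z 6) h)).resolve_right fun h1 => ?_
  obtain ⟨e⟩ := h
  obtain ⟨f⟩ := stab_perm (M := M) hx h1
  have h3 : ¬ ∀ a b : Equiv.Perm (Fin 3), a * b = b * a := by decide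
  exact h3 (mul_comm_of_mulEquiv (e.symm.trans f))

theorem stab_iff_perm : ∀ x ∈ reps, Nonempty (M.stab (bits x.1) ≃* Equiv.Perm (Fin 3)) ↔
    x.2.ty = 61 := by
  refine fun x hx => ⟨fun h => ?_, stab_perm hx⟩
  refine ((reps_ty x hx).2.2.2.2.1 (ty_div hx (by rw [Nat.card_perm, Nat.card_fin]; rfl)
    h)).resolve_left fun h1 => ?_
  obtain ⟨e⟩ := h
  obtain ⟨f⟩ := stab_six (M := M) hx h1
  have h3 : ¬ ∀ a b : Equiv.Perm (Fin 3), a * b = b * a := by decide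
  exact h3 (mul_comm_of_mulEquiv (f.symm.trans e))

theorem stab_iff_two_four : ∀ x ∈ reps, Nonempty (M.stab (bits x.1) ≃* Z 2 × Z 4) ↔ x.2.ty = 80 := by
  refine fun x hx => ⟨fun h => ?_, stab_two_four hx⟩
  refine ((reps_ty x hx).2.2.2.2.2.1 (ty_div hx (by rw [Nat.card_prod, card_Z, card_Z])
    h)).resolve_right fun h1 => ?_
  obtain ⟨e⟩ := h
  obtain ⟨f⟩ := stab_dihedral (M := M) hx h1
  have h3 : ¬ ∀ a b : DihedralGroup 4, a * b = b * a := by decide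
  exact h3 (mul_comm_of_mulEquiv (e.symm.trans f))

theorem stab_iff_dihedral : ∀ x ∈ reps, Nonempty (M.stab (bits x.1) ≃* DihedralGroup 4) ↔
    x.2.ty = 81 := by
  refine fun x hx => ⟨fun h => ?_, stab_dihedral hx⟩
  refine ((reps_ty x hx).2.2.2.2.2.1 (ty_div hx DihedralGroup.nat_card h)).resolve_left fun h1 => ?_
  obtain ⟨e⟩ := h
  obtain ⟨f⟩ := stab_two_four (M := M) hx h1
  have h3 : ¬ ∀ a b : DihedralGroup 4, a * b = b * a := by decide
  exact h3 (mul_comm_of_mulEquiv (f.symm.trans e))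

theorem stab_iff_quaternion : ∀ x ∈ reps, Nonempty (M.stab (bits x.1) ≃* QuaternionGroup 3) ↔
    x.2.ty = 120 :=
  fun x hx => ⟨fun h => (reps_ty x hx).2.2.2.2.2.2 (ty_div hx
    (by rw [Nat.card_eq_fintype_card, QuaternionGroup.card]) h), stab_quaternion hx⟩

theorem exists_reps_set (M : Model K) {S : Set (Point K)} (hS : IsSemioval S) (hk : S.ncard ≤ 16) :
    ∃ x ∈ reps, S.ncard = x.2.secs.1 ∧ secantCounts S = x.2.secs.2.1 := by
  obtain ⟨s, rfl⟩ := M.exists_set S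
  rw [ncard_set] at hk ⊢
  obtain ⟨x, hx, h⟩ := exists_reps (M := M) ((M.isSemioval_set s).1 hS) hk
  have h1 := rep_spec (M := M) hx
  exact ⟨x, hx, h.card.symm.trans h1.2.1, h.secantCounts_eq.symm.trans h1.2.2.1⟩

/-- The first secant number is positive for every representative, so there is a line without points
of the semioval. -/
theorem not_isBlockingSemioval (M : Model K) {S : Set (Point K)} (hk : S.ncard ≤ 16) :
    ¬ IsBlockingSemioval S := by
  rintro ⟨hS, hb⟩
  obtain ⟨x, hx, -, h⟩ := M.exists_reps_set hS hk
  have h1 : x.2.secs.2.1.headD 0 ≠ 0 :=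
    (by decide +kernel : ∀ x ∈ reps, x.2.secs.2.1.headD 0 ≠ 0) x hx
  rw [← h] at h1
  have h2 : secantCount S 0 ≠ 0 := h1
  obtain ⟨ℓ, hℓ⟩ := Set.nonempty_of_ncard_ne_zero h2
  obtain ⟨p, hp, hpS⟩ := (hb ℓ).1
  have : Finite (Point K) := Finite.of_equiv _ M.ptE
  have h3 : trace S ℓ = ∅ := (Set.ncard_eq_zero (Set.toFinite _)).1 hℓ
  exact (Set.eq_empty_iff_forall_notMem.1 h3 p) ⟨hpS, hp⟩

end Model

end PG2

theorem mainTheorem2 {K : Type*} [Field K] (hK : Nat.card K = 9) :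
    -- the numbers of inequivalent semiovals of size at most 16
    ((∀ S : Set (PG2.Point K), PG2.IsSemioval S → S.ncard ≤ 16 →
        S.ncard ∈ ({10, 12, 13, 14, 15, 16} : Set ℕ)) ∧
      PG2.numOfSize K 10 = 1 ∧ PG2.numOfSize K 12 = 1 ∧ PG2.numOfSize K 13 = 1 ∧
      PG2.numOfSize K 14 = 3 ∧ PG2.numOfSize K 15 = 26 ∧ PG2.numOfSize K 16 = 113) ∧
    -- none of them is a blocking semioval
    (∀ S : Set (PG2.Point K), S.ncard ≤ 16 → ¬ PG2.IsBlockingSemioval S) ∧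
    -- the intersection numbers with lines
    ((∀ S : Set (PG2.Point K), PG2.IsSemioval S → S.ncard ≤ 16 →
        ∃ n, (S.ncard, PG2.secantCounts S, n) ∈ PG2.secantTable) ∧
      ∀ k d n, (k, d, n) ∈ PG2.secantTable → PG2.numWithSecants K k d = n) ∧
    -- the stabilizers: size 10, 12, 13
    (PG2.numWithStabilizerOrder K 10 1440 = 1 ∧
      PG2.numWithStabilizerOrder K 12 192 = 1 ∧
      PG2.numWithStabilizerOrder K 13 16 = 1) ∧
    -- the stabilizers: size 14
    (PG2.numWithStabilizer K 14 (PG2.Z 2) = 2 ∧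
      PG2.numWithStabilizer K 14 (PG2.Z 2 × PG2.Z 2) = 1) ∧
    -- the stabilizers: size 15
    (PG2.numWithStabilizer K 15 (PG2.Z 1) = 6 ∧
      PG2.numWithStabilizer K 15 (PG2.Z 2) = 11 ∧
      PG2.numWithStabilizer K 15 (PG2.Z 3) = 2 ∧
      PG2.numWithStabilizer K 15 (PG2.Z 6) = 2 ∧
      PG2.numWithStabilizer K 15 (Equiv.Perm (Fin 3)) = 2 ∧
      PG2.numWithStabilizer K 15 (DihedralGroup 4) = 1 ∧
      PG2.numWithStabilizer K 15 (QuaternionGroup 3) = 1 ∧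
      PG2.numWithStabilizerOrder K 15 24 = 1) ∧
    -- the stabilizers: size 16
    (PG2.numWithStabilizer K 16 (PG2.Z 1) = 81 ∧
      PG2.numWithStabilizer K 16 (PG2.Z 2) = 22 ∧
      PG2.numWithStabilizer K 16 (PG2.Z 2 × PG2.Z 2) = 2 ∧
      PG2.numWithStabilizer K 16 (PG2.Z 4) = 1 ∧
      PG2.numWithStabilizer K 16 (PG2.Z 6) = 1 ∧
      PG2.numWithStabilizer K 16 (PG2.Z 2 × PG2.Z 4) = 1 ∧
      PG2.numWithStabilizer K 16 (DihedralGroup 4) = 1 ∧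
      PG2.numWithStabilizerOrder K 16 32 = 1 ∧
      PG2.numWithStabilizerOrder K 16 48 = 1 ∧
      PG2.numWithStabilizerOrder K 16 192 = 1 ∧
      PG2.numWithStabilizerOrder K 16 256 = 1) := by
  obtain ⟨M⟩ := PG2.exists_model hK
  refine ⟨⟨fun S hS hk => ?_, ?_, ?_, ?_, ?_, ?_, ?_⟩, fun S hk => M.not_isBlockingSemioval hk,
    ⟨fun S hS hk => ?_, fun k d n h => ?_⟩, ⟨?_, ?_, ?_⟩, ⟨?_, ?_⟩,
    ⟨?_, ?_, ?_, ?_, ?_, ?_, ?_, ?_⟩, ?_, ?_, ?_, ?_, ?_, ?_, ?_, ?_, ?_, ?_, ?_⟩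
  · obtain ⟨x, hx, h, -⟩ := M.exists_reps_set hS hk
    have h1 : x.2.secs.1 ∈ [10, 12, 13, 14, 15, 16] :=
      (by decide +kernel : ∀ x ∈ PG2.reps, x.2.secs.1 ∈ [10, 12, 13, 14, 15, 16]) x hx
    rw [h]
    simpa using h1
  iterate 6 exact (M.numOfSize_eq (by norm_num)).trans (by decide +kernel)
  · obtain ⟨x, hx, h1, h2⟩ := M.exists_reps_set hS hk
    exact ⟨x.2.secs.2.2, by rw [h1, h2]; exact PG2.reps_secs x hx⟩
  -- All rows of the table are compared at once with the counts over the representatives.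
  · have h1 : ∀ r ∈ PG2.secantTable, r.1 ≤ 16 ∧ (PG2.reps.countP fun x =>
        Nat.beq x.2.secs.1 r.1 && x.2.secs.2.1 == r.2.1) = r.2.2 := by decide +kernel
    exact (M.numWithSecants_eq (h1 _ h).1 d).trans (h1 _ h).2
  iterate 3 exact (M.numWithStabilizerOrder_eq (by norm_num) _).trans (by decide +kernel)
  · exact (M.numWithStabilizer_eq (by norm_num) PG2.Model.stab_iff_two).trans (by decide +kernel)
  · exact (M.numWithStabilizer_eq (by norm_num) PG2.Model.stab_iff_two_two).trans (by decide +kernel)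
  · exact (M.numWithStabilizer_eq (by norm_num) PG2.Model.stab_iff_one).trans (by decide +kernel)
  · exact (M.numWithStabilizer_eq (by norm_num) PG2.Model.stab_iff_two).trans (by decide +kernel)
  · exact (M.numWithStabilizer_eq (by norm_num) PG2.Model.stab_iff_three).trans (by decide +kernel)
  · exact (M.numWithStabilizer_eq (by norm_num) PG2.Model.stab_iff_six).trans (by decide +kernel)
  · exact (M.numWithStabilizer_eq (by norm_num) PG2.Model.stab_iff_perm).trans (by decide +kernel)
  · exact (M.numWithStabilizer_eq (by norm_num) PG2.Model.stab_iff_dihedral).trans (by decide +kernel)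
  · exact (M.numWithStabilizer_eq (by norm_num) PG2.Model.stab_iff_quaternion).trans (by decide +kernel)
  · exact (M.numWithStabilizerOrder_eq (by norm_num) _).trans (by decide +kernel)
  · exact (M.numWithStabilizer_eq (by norm_num) PG2.Model.stab_iff_one).trans (by decide +kernel)
  · exact (M.numWithStabilizer_eq (by norm_num) PG2.Model.stab_iff_two).trans (by decide +kernel)
  · exact (M.numWithStabilizer_eq (by norm_num) PG2.Model.stab_iff_two_two).trans (by decide +kernel)
  · exact (M.numWithStabilizer_eq (by norm_num) PG2.Model.stab_iff_four).trans (by decide +kernel)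
  · exact (M.numWithStabilizer_eq (by norm_num) PG2.Model.stab_iff_six).trans (by decide +kernel)
  · exact (M.numWithStabilizer_eq (by norm_num) PG2.Model.stab_iff_two_four).trans (by decide +kernel)
  · exact (M.numWithStabilizer_eq (by norm_num) PG2.Model.stab_iff_dihedral).trans (by decide +kernel)
  iterate 4 exact (M.numWithStabilizerOrder_eq (by norm_num) _).trans (by decide +kernel)
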